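/- **Setting.** Let $Y$ be a smooth manifold (Hausdorff, $\sigma$-compact, without boundary) of dimension $n-1\ge 0$, write points of $\mathbb R\times Y$ as $(x,y)$ and let $X=\{x\ge 0\}$. Let $W\subset\mathbb R\times Y$ be open, let $\rho,\rho_1\in C^\infty(W;\mathbb R)$, and suppose that $$K=\{p\in W:\ x\ge 0,\ \rho\ge 0,\ \rho_1\ge 0\}$$ is compact. This is the closure of $\Omega_1\setminus\Omega$, with $\Omega_1=\{x\ge0,\rho_1\ge0\}$ and $\Omega=\{x\ge 0,\rho\le 0\}$ in $W$. Put $\partial_{\rm int}\Omega=K\cap\{\rho=0\}$ and $\partial_{\rm int}\Omega_1=K\cap\{\rho_1=0\}$. Assume that these two sets are disjoint, that $d\rho\ne0$ on the first and $d\rho_1\neq 0$ on the second, and that both are transversal to $\partial X$ (that is, $d_y\rho\ne0$, resp. $d_y\rho_1\neq0$, at their points with $x=0$). So $\rho$ is a defining function of $\partial_{\rm int}\Omega$ as a boundary of $\Omega_1\setminus\Omega$, positive on the rest of that region. Let $g$ be a smooth Riemannian metric on $W$ (smooth across $x=0$), let $\mathrm d^{\mathrm s}$ be its symmetric gradient on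 one-forms, $(\mathrm d^{\mathrm s}u)_{ab}=\frac12(\partial_au_b+\partial_bu_a)-\Gamma^c_{ab}u_c$, and for $\digamma\in\mathbb R$ let $\mathrm d^{\mathrm s}_\digamma=e^{-\digamma/x}\,\mathrm d^{\mathrm s}\,e^{\digamma/x}$. **Spaces.** Scattering components are components in the frame $\frac{dx}{x^2},\frac{dy_1}{x},\dots,\frac{dy_{n-1}}{x}$ and its tensor products, where $y_1,\dots,y_{n-1}$ are local coordinates of $Y$. For $r\in\mathbb R$, $H^{0,r}_{\rm sc}(\Omega_1\setminus\Omega)$ is the space of complex sections of $\mathrm{Sym}^2\,{}^{\rm sc}T^*X$ over $\Omega_1\setminus\Omega$ whose scattering components lie in $x^rL^2(x^{-n-1}\,dx\,dy)$. The norm of $H^{1,r}_{\rm sc}(\Omega_1\setminus\Omega)$ on complex one-forms is the $x^rL^2(x^{-n-1}\,dx\,dy)$ norm of the scattering components together with their first derivatives along $x^2\partial_x, x\partial_{y_1},\dots,x\partial_{y_{n-1}}$. The norms are computed in any finite family of charts of $Y$ with compact subsets of their domains which cover the projection of $K$ to $Y$. The space $\dot H^{1,r}_{\rm sc}(\Omega_1\setminus\Omega)$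 of one-forms vanishing at $\partial_{\rm int}\Omega_1$ (but not necessarily at $\partial_{\rm int}\Omega$) is the closure, in the norm of $H^{1,r}_{\rm sc}(\Omega_1\setminus\Omega)$, of the smooth one-forms on $\mathbb R\times Y$ which vanish near $\partial_{\rm int}\Omega_1$ and near $K\cap\{x=0\}$. **Lemma.** Suppose that $\partial_x\rho>0$ at every point of $\partial_{\rm int}\Omega$, with $\partial_x$ taken in the product $\mathbb R\times Y$. This condition does not depend on the choice of $\rho$: every $f\in C^\infty(W;\mathbb R)$ which vanishes on $\partial_{\rm int}\Omega$ with $df\ne0$ there and is positive on $K\setminus\partial_{\rm int}\Omega$ also satisfies $\partial_xf>0$ on $\partial_{\rm int}\Omega$. Moreover, there is $\digamma_0>0$ such that for all $\digamma\ge\digamma_0$ and all $r\in\mathbb R$ the operator $\mathrm d^{\mathrm s}_\digamma$ extends from smooth forms to a continuous linear map $$\mathrm d^{\mathrm s}_\digamma:\dot H^{1,r}_{\rm sc}(\Omega_1\setminus\Omega)\to H^{0,r}_{\rm sc}(\Omega_1\setminus\Omega),$$ this map is injective, and it has a continuous linear left inverse $$P_{\Omega_1\setminus\Omega}:H^{0,r}_{\rm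 sc}(\Omega_1\setminus\Omega)\to\dot H^{1,r}_{\rm sc}(\Omega_1\setminus\Omega).$$ -/

import Mathlib

open Set Filter Topology MeasureTheory
open scoped Manifold ContDiff ENNReal

noncomputable section

namespace ScGrad

/-- The model space `ℝᵈ` of the cross-section `Y`; the ambient dimension is `n = d + 1`. -/
abbrev E (d : ℕ) : Type := EuclideanSpace ℝ (Fin d)

/-- The model with corners of the (boundaryless) ambient manifold `ℝ × Y`, whose points are written
`p = (x, y)`. The manifold with boundary is `X = {x ≥ 0}`. -/
abbrev IZ (d : ℕ) : ModelWithCorners ℝ (ℝ × E d) (ModelProd ℝ (E d)) :=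
  𝓘(ℝ, ℝ).prod (𝓡 d)

section Geometry

variable {d : ℕ} {Y : Type*} [TopologicalSpace Y] [ChartedSpace (E d) Y]

/-- `∂ₓ f` at `p = (x, y)`, the derivative in `x` with `y` fixed (so relative to the product
decomposition). -/
def dx (f : ℝ × Y → ℝ) (p : ℝ × Y) : ℝ := deriv (fun t => f (t, p.2)) p.1

/-- The differential `d_y f` at `p = (x, y)`, with `x` fixed. -/
def dy (f : ℝ × Y → ℝ) (p : ℝ × Y) : TangentSpace (𝓡 d) p.2 →L[ℝ] ℝ :=
  mfderiv (𝓡 d) 𝓘(ℝ, ℝ) (fun y => f (p.1, y)) p.2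

variable (d Y) in
/-- The region `Ω₁ ∖ Ω` in a neighbourhood `W` of it in `ℝ × Y`.
In `W`, `Ω₁` is `{x ≥ 0, rho₁ ≥ 0}`, `Ω` is `{x ≥ 0, rho ≤ 0}`, the internal boundary of `Ω` is
`{rho = 0}` and that of `Ω₁` is `{rho₁ = 0}`. The closure `{x ≥ 0, rho ≥ 0, rho₁ ≥ 0}` of `Ω₁ ∖ Ω`
is compact; it is a manifold with corners, the corners being the transversal intersections of the
two (disjoint) internal boundary hypersurfaces with `∂X = {x = 0}`. -/
structure Region where
  W : Set (ℝ × Y)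
  isOpen_W : IsOpen W
  rho : ℝ × Y → ℝ
  rho₁ : ℝ × Y → ℝ
  smooth_rho : ContMDiffOn (IZ d) 𝓘(ℝ, ℝ) ∞ rho W
  smooth_rho₁ : ContMDiffOn (IZ d) 𝓘(ℝ, ℝ) ∞ rho₁ W
  isCompact : IsCompact {p | p ∈ W ∧ 0 ≤ p.1 ∧ 0 ≤ rho p ∧ 0 ≤ rho₁ p}
  disjoint : ∀ p ∈ {p | p ∈ W ∧ 0 ≤ p.1 ∧ 0 ≤ rho p ∧ 0 ≤ rho₁ p}, ¬ (rho p = 0 ∧ rho₁ p = 0)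
  regular : ∀ p ∈ {p | p ∈ W ∧ 0 ≤ p.1 ∧ 0 ≤ rho p ∧ 0 ≤ rho₁ p}, rho p = 0 →
    mfderiv (IZ d) 𝓘(ℝ, ℝ) rho p ≠ 0 ∧ (p.1 = 0 → dy (d := d) rho p ≠ 0)
  regular₁ : ∀ p ∈ {p | p ∈ W ∧ 0 ≤ p.1 ∧ 0 ≤ rho p ∧ 0 ≤ rho₁ p}, rho₁ p = 0 →
    mfderiv (IZ d) 𝓘(ℝ, ℝ) rho₁ p ≠ 0 ∧ (p.1 = 0 → dy (d := d) rho₁ p ≠ 0)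

namespace Region

variable (R : Region d Y)

/-- The compact closure of `Ω₁ ∖ Ω`. -/
def K : Set (ℝ × Y) := {p | p ∈ R.W ∧ 0 ≤ p.1 ∧ 0 ≤ R.rho p ∧ 0 ≤ R.rho₁ p}

/-- The interior of `Ω₁ ∖ Ω`. -/
def D : Set (ℝ × Y) := {p | p ∈ R.W ∧ 0 < p.1 ∧ 0 < R.rho p ∧ 0 < R.rho₁ p}

/-- The internal boundary `∂_int Ω`, as a boundary hypersurface of `Ω₁ ∖ Ω`. -/
def bdryInt : Set (ℝ × Y) := {p | p ∈ R.K ∧ R.rho p = 0}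

/-- The internal boundary `∂_int Ω₁`. -/
def bdryInt₁ : Set (ℝ × Y) := {p | p ∈ R.K ∧ R.rho₁ p = 0}

/-- `f` is a defining function of `∂_int Ω` as a boundary hypersurface of `Ω₁ ∖ Ω`: it is smooth,
vanishes exactly there, with non-zero differential, and is positive on the rest of `Ω₁ ∖ Ω`. -/
def IsDefiningFunction (f : ℝ × Y → ℝ) : Prop :=
  ContMDiffOn (IZ d) 𝓘(ℝ, ℝ) ∞ f R.W ∧
    (∀ p ∈ R.bdryInt, f p = 0 ∧ mfderiv (IZ d) 𝓘(ℝ, ℝ) f p ≠ 0) ∧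
    ∀ p ∈ R.K, p ∉ R.bdryInt → 0 < f p

end Region

variable [IsManifold (𝓡 d) ∞ Y]

/-- A smooth Riemannian metric on the open set `W ⊆ ℝ × Y`; it is smooth up to and across
`{x = 0}`, i.e. a standard metric, not a scattering metric. -/
structure MetricOn (d : ℕ) {Y : Type*} [TopologicalSpace Y] [ChartedSpace (E d) Y]
    [IsManifold (𝓡 d) ∞ Y] (W : Set (ℝ × Y)) where
  inner : ∀ p : ℝ × Y, TangentSpace (IZ d) p →L[ℝ] TangentSpace (IZ d) p →L[ℝ] ℝ
  symm : ∀ p ∈ W, ∀ v w, inner p v w = inner p w v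
  pos : ∀ p ∈ W, ∀ v, v ≠ 0 → 0 < inner p v v
  smooth : ContMDiffOn (IZ d) ((IZ d).prod 𝓘(ℝ, (ℝ × E d) →L[ℝ] (ℝ × E d) →L[ℝ] ℝ)) ∞
    (fun p => Bundle.TotalSpace.mk' ((ℝ × E d) →L[ℝ] (ℝ × E d) →L[ℝ] ℝ)
      (E := fun p : ℝ × Y => TangentSpace (IZ d) p →L[ℝ] TangentSpace (IZ d) p →L[ℝ] ℝ)
      p (inner p)) W

/-- Complex one-forms on `ℝ × Y` (pointwise sections, no regularity). -/
abbrev OneForm (d : ℕ) (Y : Type*) [TopologicalSpace Y] [ChartedSpace (E d) Y] : Type _ :=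
  ∀ p : ℝ × Y, TangentSpace (IZ d) p →L[ℝ] ℂ

/-- Complex two-tensors on `ℝ × Y` (pointwise sections, no regularity). -/
abbrev TwoTensor (d : ℕ) (Y : Type*) [TopologicalSpace Y] [ChartedSpace (E d) Y] : Type _ :=
  ∀ p : ℝ × Y, TangentSpace (IZ d) p →L[ℝ] TangentSpace (IZ d) p →L[ℝ] ℂ

/-- Smooth complex one-forms on `ℝ × Y`. -/
def OneForm.Smooth (u : OneForm d Y) : Prop :=
  ContMDiff (IZ d) ((IZ d).prod 𝓘(ℝ, (ℝ × E d) →L[ℝ] ℂ)) ∞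
    (fun p => Bundle.TotalSpace.mk' ((ℝ × E d) →L[ℝ] ℂ)
      (E := fun p : ℝ × Y => TangentSpace (IZ d) p →L[ℝ] ℂ) p (u p))

end Geometry

section Coordinates

variable {d : ℕ} {Y : Type*} [TopologicalSpace Y] [ChartedSpace (E d) Y]

/-- The coordinate directions of `ℝ × ℝᵈ`: index `0` is `∂ₓ`, index `i + 1` is `∂_{y_i}`. -/
def coordVec {d : ℕ} : Fin (d + 1) → ℝ × E d :=
  Fin.cons (1, 0) (fun i => (0, EuclideanSpace.single i 1))

/-- The factors turning `∂ₓ, ∂_{y_i}` into the scattering frame `x² ∂ₓ, x ∂_{y_i}`, which is dual to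
the frame `dx / x², dy_i / x` of the scattering cotangent bundle. -/
def scFactor {d : ℕ} (x : ℝ) : Fin (d + 1) → ℝ := Fin.cons (x ^ 2) (fun _ => x)

/-- Partial derivative in the coordinate direction `a`. -/
def pd {d : ℕ} {F : Type*} [NormedAddCommGroup F] [NormedSpace ℝ F]
    (a : Fin (d + 1)) (f : ℝ × E d → F) (q : ℝ × E d) : F :=
  fderiv ℝ f q (coordVec a)

/-- The parametrization `(x, w) ↦ (x, e⁻¹ w)` of a part of `ℝ × Y` given by a chart `e` of `Y`. -/
def param (e : OpenPartialHomeomorph Y (E d)) (q : ℝ × E d) : ℝ × Y := (q.1, e.symm q.2)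

/-- The coordinate vector field `∂_a` of the coordinates `(x, e)`, at the point `param e q`. -/
def frame (e : OpenPartialHomeomorph Y (E d)) (q : ℝ × E d) (a : Fin (d + 1)) :
    TangentSpace (IZ d) (param e q) :=
  mfderiv 𝓘(ℝ, ℝ × E d) (IZ d) (param e) q (coordVec a : ℝ × E d)

/-- Coordinate components `u_a = u(∂_a)` of a one-form. -/
def comp₁ (e : OpenPartialHomeomorph Y (E d)) (u : OneForm d Y) (a : Fin (d + 1))
    (q : ℝ × E d) : ℂ :=
  u (param e q) (frame e q a)

/-- Coordinate components `T_ab = T(∂_a, ∂_b)` of a two-tensor. -/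
def comp₂ (e : OpenPartialHomeomorph Y (E d)) (T : TwoTensor d Y) (a b : Fin (d + 1))
    (q : ℝ × E d) : ℂ :=
  T (param e q) (frame e q a) (frame e q b)

/-- Components of a one-form in the scattering frame. -/
def scComp₁ (e : OpenPartialHomeomorph Y (E d)) (u : OneForm d Y) (a : Fin (d + 1))
    (q : ℝ × E d) : ℂ :=
  scFactor q.1 a * comp₁ e u a q

section Metric

variable [IsManifold (𝓡 d) ∞ Y] {W : Set (ℝ × Y)} (g : MetricOn d W)
  (e : OpenPartialHomeomorph Y (E d))

/-- The matrix `g_ab` of the metric in the coordinates `(x, e)`. -/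
def gMat (q : ℝ × E d) : Matrix (Fin (d + 1)) (Fin (d + 1)) ℝ :=
  fun a b => g.inner (param e q) (frame e q a) (frame e q b)

/-- The Christoffel symbols `Γ^c_ab` of the Levi-Civita connection of `g`. -/
def christoffel (c a b : Fin (d + 1)) (q : ℝ × E d) : ℝ :=
  (1 / 2) * ∑ k, (gMat g e q)⁻¹ c k *
    (pd a (fun q' => gMat g e q' b k) q + pd b (fun q' => gMat g e q' a k) q
      - pd k (fun q' => gMat g e q' a b) q)

/-- The symmetric gradient `(dˢ v)_ab = (∂_a v_b + ∂_b v_a) / 2 - Γ^c_ab v_c` of `g`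
on one-forms given by their coordinate components. -/
def symGrad (v : Fin (d + 1) → ℝ × E d → ℂ) (a b : Fin (d + 1)) (q : ℝ × E d) : ℂ :=
  (1 / 2) * (pd a (v b) q + pd b (v a) q) - ∑ c, (christoffel g e c a b q : ℂ) * v c q

/-- The conjugated symmetric gradient `e^{-F/x} dˢ e^{F/x}`, in coordinate components. -/
def symGradConj (F : ℝ) (v : Fin (d + 1) → ℝ × E d → ℂ) (a b : Fin (d + 1))
    (q : ℝ × E d) : ℂ :=
  (Real.exp (-F / q.1) : ℂ) * symGrad g e (fun c q' => (Real.exp (F / q'.1) : ℂ) * v c q') a b q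

end Metric

end Coordinates

section Spaces

variable {d : ℕ} {Y : Type*} [TopologicalSpace Y] [ChartedSpace (E d) Y]
  [IsManifold (𝓡 d) ∞ Y]

/-- Finitely many smooth charts `e j` of `Y` with compact sets `C j` in their domains which cover the
projection of `Ω₁ ∖ Ω` to `Y`. It serves to write down the norms below; different choices give the
same spaces with equivalent norms. -/
structure Cover (R : Region d Y) where
  N : ℕ
  e : Fin N → OpenPartialHomeomorph Y (E d)
  e_mem : ∀ j, e j ∈ IsManifold.maximalAtlas (𝓡 d) ∞ Y
  C : Fin N → Set Y
  isCompact_C : ∀ j, IsCompact (C j)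
  C_subset : ∀ j, C j ⊆ (e j).source
  covers : ∀ p ∈ R.K, ∃ j, p.2 ∈ C j

variable {R : Region d Y} (A : Cover R) (r : ℝ)

namespace Cover

/-- The part of `Ω₁ ∖ Ω` over `C j`, in coordinates. -/
def piece (j : Fin A.N) : Set (ℝ × E d) :=
  {q | q.2 ∈ (A.e j).target ∧ (A.e j).symm q.2 ∈ A.C j ∧ param (A.e j) q ∈ R.D}

/-- The scattering density `x^{-n-1} dx dy`, `n = d + 1`, on a coordinate piece, together with
the weight `x^{-2r}`. -/
def mu (j : Fin A.N) : Measure (ℝ × E d) :=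
  (volume.restrict (A.piece j)).withDensity
    fun q => ENNReal.ofReal (q.1 ^ (-(d + 2 : ℝ) - 2 * r))

/-- The ambient Hilbert space: families, indexed by the coordinate pieces, of functions with
components indexed by `κ` which lie in `x^r L²` with respect to the scattering density. -/
abbrev L2 (κ : Type) [Fintype κ] : Type :=
  PiLp 2 fun j : Fin A.N => Lp (EuclideanSpace ℂ κ) 2 (A.mu r j)

/-- `f` is (almost everywhere) the family of functions `T j`. -/
def Represents {κ : Type} [Fintype κ] (f : A.L2 r κ) (T : Fin A.N → κ → ℝ × E d → ℂ) : Prop :=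
  ∀ j, ∀ᵐ q ∂(A.mu r j), ∀ k, (f j : ℝ × E d → EuclideanSpace ℂ κ) q k = T j k q

/-- The scattering components of a two-tensor, in the coordinates of each piece. -/
def repr₂ (T : TwoTensor d Y) (j : Fin A.N) (k : Fin (d + 1) × Fin (d + 1)) (q : ℝ × E d) : ℂ :=
  scFactor q.1 k.1 * scFactor q.1 k.2 * comp₂ (A.e j) T k.1 k.2 q

/-- The space `H_sc^{0,r}(Ω₁ ∖ Ω)` of sections of `Sym² scT*X`: the symmetric two-tensors whose
scattering components lie in `x^r L²` with respect to the scattering density. -/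
def H0 : Submodule ℂ (A.L2 r (Fin (d + 1) × Fin (d + 1))) where
  carrier := {f | ∃ T : TwoTensor d Y, (∀ p v w, T p v w = T p w v) ∧ A.Represents r f (A.repr₂ T)}
  zero_mem' := by
    refine ⟨fun _ => 0, fun p v w => by simp, fun j => ?_⟩
    have h := Lp.coeFn_zero (EuclideanSpace ℂ (Fin (d + 1) × Fin (d + 1))) 2 (A.mu r j)
    filter_upwards [h] with q hq k
    have h0 : ((0 : A.L2 r (Fin (d + 1) × Fin (d + 1))) j) = 0 := rfl
    rw [h0, hq]
    simp [repr₂, comp₂]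
  add_mem' := by
    rintro f f' ⟨T, hT, h⟩ ⟨T', hT', h'⟩
    refine ⟨fun p => T p + T' p, fun p v w => by simp [hT p v w, hT' p v w], fun j => ?_⟩
    filter_upwards [h j, h' j, Lp.coeFn_add (f j) (f' j)] with q h1 h2 h3 k
    have h0 : (f + f') j = f j + f' j := rfl
    rw [h0, h3]
    simp only [Pi.add_apply, PiLp.add_apply, h1, h2, repr₂, comp₂, add_apply]
    ring
  smul_mem' := by
    rintro c f ⟨T, hT, h⟩
    refine ⟨fun p => c • T p, fun p v w => by simp [hT p v w], fun j => ?_⟩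
    filter_upwards [h j, Lp.coeFn_smul c (f j)] with q h1 h3 k
    have h0 : (c • f) j = c • f j := rfl
    rw [h0, h3]
    simp only [Pi.smul_apply, PiLp.smul_apply, h1, repr₂, comp₂, smul_apply,
      smul_eq_mul]
    ring

/-- Index set of the first order jet of a one-form: `inl a` stands for the component `u_a` in the
scattering frame, `inr (b, a)` for its derivative along the `b`-th scattering vector field
(`x² ∂ₓ` or `x ∂_{y_i}`). -/
abbrev JetIdx (d : ℕ) : Type := Fin (d + 1) ⊕ Fin (d + 1) × Fin (d + 1)

/-- The scattering first order jet of a one-form. -/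
def jet (u : OneForm d Y) (j : Fin A.N) (k : JetIdx d) (q : ℝ × E d) : ℂ :=
  match k with
  | .inl a => scComp₁ (A.e j) u a q
  | .inr (b, a) => scFactor q.1 b * pd b (scComp₁ (A.e j) u a) q

end Cover

variable (R) in
/-- Smooth one-forms on `Ω₁ ∖ Ω`, smooth up to `∂_int Ω` (where there is no condition), and vanishing
near `∂_int Ω₁` and near `∂X = {x = 0}`. -/
def TestForm (u : OneForm d Y) : Prop :=
  u.Smooth ∧ ∀ p ∈ R.K, p.1 = 0 ∨ p ∈ R.bdryInt₁ → ∀ᶠ p' in 𝓝 p, u p' = 0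

namespace Cover

/-- The space of one-forms of class `H_sc^{1,r}(Ω₁ ∖ Ω)` vanishing at `∂_int Ω₁` (but not
necessarily at `∂_int Ω`), i.e. the closure, in the norm of `H_sc^{1,r}(Ω₁ ∖ Ω)`, of the smooth forms
vanishing near `∂_int Ω₁` and near `∂X`. The norm of `H_sc^{1,r}` is the `x^r L²` norm (with
respect to the scattering density) of the scattering first order jet; an element of the closure is
recorded together with its weak first derivatives. -/
def HDot1 : Submodule ℂ (A.L2 r (JetIdx d)) :=
  (Submodule.span ℂ {f | ∃ u : OneForm d Y, TestForm R u ∧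
    A.Represents r f (A.jet u)}).topologicalClosure

/-- `S` is the conjugated symmetric gradient `e^{-F/x} dˢ e^{F/x}` of `g`, as a bounded operator
on `HDot1`: it is given by the classical formula on smooth forms, which are dense. -/
def IsSymGradConj (g : MetricOn d R.W) (F : ℝ) (S : A.HDot1 r →L[ℂ] A.H0 r) : Prop :=
  ∀ (u : OneForm d Y) (f : A.HDot1 r), TestForm R u → A.Represents r f.1 (A.jet u) →
    A.Represents r (S f).1 fun j k q =>
      scFactor q.1 k.1 * scFactor q.1 k.2 *
        symGradConj g (A.e j) F (fun a => comp₁ (A.e j) u a) k.1 k.2 q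

end Cover

end Spaces

end ScGrad

end

/-! The theorem rests on one a priori estimate: for F large, the H^{1,r} norm of u is at most a
constant times the H^{0,r} norm of d^s_F u, for smooth u vanishing near ∂_int Ω₁ and near x = 0. A
bound from below passes to the closure of such forms. The extended operator is therefore injective
with closed range, and the orthogonal projection onto the range followed by the inverse is a left
inverse (`exists_leftInverse`).

Order zero. Conjugation subtracts (F/x²) times the symmetric product of dx and u from d^s u. If V is
a vector field whose derivatives are harmless, the diagonal value of d^s_F u at (V, V) is V(u(V)) -
F α u(V) plus terms of order zero, with α = dx(V)/x². So a = u(V) satisfies a transport equation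
along V with growth rate Fα. If α ≥ c > 0 and V points into the region at ∂_int Ω, the integral of
V|a|² is nonpositive, since its only boundary term has a sign and u vanishes near the other
boundaries. This gives cF‖a‖ ≤ ‖error‖ (`Inward.energy`). Enough such V to span the tangent space
yield F²‖u‖² ≤ N(‖u‖² + ‖d^s_F u‖²) with N independent of F, and ‖u‖² is absorbed once F ≥ N + 1. At
points of ∂_int Ω with x > 0 the condition ∂_xρ > 0 is what provides spanning fields that point
inward and increase x. At corners x = 0 it is not needed for this: d_yρ ≠ 0 suffices, because x²∂_x
is tangent to the boundary to leading order.

Order one. Korn's inequality without boundary condition at ∂_int Ω bounds all first derivatives by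
the symmetric gradient. On the whole space it is an integration by parts (`korn_frame`). On a
half-space the form is extended by a higher order reflection built from pullbacks of one-forms,
which commutes with the symmetric gradient (`kornOn_halfSpace`).

Both steps are local and take place in `Adapted` coordinates. Near x = 0 the map (s, Θ) ↦ (1/s, Θ/s)
turns Euclidean into scattering geometry with uniform bounds, and once ρ has been straightened to a
linear function of y the region becomes a half-space, which this map preserves. Away from x = 0 one
uses (ρ, y) as coordinates. The weight x^{-r} is replaced by (1/x + M)^r with M ≥ |r|, whose
logarithmic scattering derivative is at most 1; so N, and hence the threshold for F, does not depend
on r.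

Globally, local estimates are patched by compactness. A neighbourhood used in one chart leaves the
chosen compact set of that chart, so its contribution is moved to other charts; this needs the
tensorial character of d^s_F, which follows from the Koszul formula (`chr_trans`,
`bilinGrad_trans`).

For the first assertion, a defining function f is nonnegative where x ≥ 0 and ρ > 0 near ∂_int Ω, so
df is nonnegative on the open cone dx > 0, dρ > 0. A nonzero linear functional with this property is
strictly positive on the cone, and ∂_x lies in it up to the boundary. -/

noncomputable section

set_option maxSynthPendingDepth 3
set_option linter.unusedSectionVars false

namespace ScGrad

section

/-! ### Korn's inequality on the whole space -/

section Korn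

variable {H : Type*} [NormedAddCommGroup H] [NormedSpace ℝ H] [FiniteDimensional ℝ H]

/-- The symmetric part of a bilinear form. -/
def symPart (A : H →L[ℝ] H →L[ℝ] ℂ) : H →L[ℝ] H →L[ℝ] ℂ := (1 / 2 : ℝ) • (A + A.flip)

theorem symPart_apply (A : H →L[ℝ] H →L[ℝ] ℂ) (w w' : H) :
    symPart A w w' = (1 / 2) * (A w w' + A w' w) := by
  simp [symPart]
  ring

/-- Reduces operator norms of bilinear forms to finitely many components, for which Korn's
inequality is an explicit computation. -/
theorem exists_frame_norm_le (H : Type*) [NormedAddCommGroup H] [NormedSpace ℝ H]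
    [FiniteDimensional ℝ H] :
    ∃ (n : ℕ) (b : Fin n → H) (C : ℝ), 0 ≤ C ∧
      ∀ A : H →L[ℝ] H →L[ℝ] ℂ, ‖A‖ ^ 2 ≤ C * ∑ a, ∑ c, ‖A (b a) (b c)‖ ^ 2 := by
  let b := Module.finBasis ℝ H
  obtain ⟨C₁, hC₁, h₁⟩ := b.exists_opNorm_le (F := ℂ)
  obtain ⟨C₂, hC₂, h₂⟩ := b.exists_opNorm_le (F := H →L[ℝ] ℂ)
  refine ⟨_, b, (C₂ * C₁) ^ 2, by positivity, fun A => ?_⟩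
  set S := ∑ a, ∑ c, ‖A (b a) (b c)‖ ^ 2 with hS
  have hS0 : 0 ≤ S := by positivity
  have h : ∀ a c, ‖A (b a) (b c)‖ ≤ √S := fun a c => by
    refine Real.le_sqrt_of_sq_le ?_
    refine le_trans ?_ (Finset.single_le_sum (f := fun a => ∑ c, ‖A (b a) (b c)‖ ^ 2)
      (fun i _ => by positivity) (Finset.mem_univ a))
    exact Finset.single_le_sum (f := fun c => ‖A (b a) (b c)‖ ^ 2)
      (fun i _ => by positivity) (Finset.mem_univ c)
  have h3 : ‖A‖ ≤ C₂ * (C₁ * √S) :=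
    h₂ (by positivity) fun a => h₁ (by positivity) fun c => h a c
  calc ‖A‖ ^ 2 ≤ (C₂ * (C₁ * √S)) ^ 2 := by gcongr
    _ = (C₂ * C₁) ^ 2 * (√S) ^ 2 := by ring
    _ = _ := by rw [Real.sq_sqrt hS0]

variable [MeasurableSpace H] [BorelSpace H] (μ : Measure H) [μ.IsAddHaarMeasure]

/-- Both sides equal minus the integral of a mixed second derivative of `f` times `g`, and mixed
derivatives commute. Compact support of `g` alone excludes boundary terms. -/
theorem integral_fderiv_mul_fderiv_swap {f g : H → ℂ} (hf : ContDiff ℝ 2 f) (hg : ContDiff ℝ 2 g)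
    (hgc : HasCompactSupport g) (a b : H) :
    ∫ z, fderiv ℝ f z a * fderiv ℝ g z b ∂μ = ∫ z, fderiv ℝ f z b * fderiv ℝ g z a ∂μ := by
  have hf1 : ∀ a, ContDiff ℝ 1 fun z => fderiv ℝ f z a := fun a =>
    (hf.fderiv_right (m := 1) (by norm_num)).clm_apply contDiff_const
  have hg1 : ∀ a, ContDiff ℝ 1 fun z => fderiv ℝ g z a := fun a =>
    (hg.fderiv_right (m := 1) (by norm_num)).clm_apply contDiff_const
  have hgc1 : ∀ a, HasCompactSupport fun z => fderiv ℝ g z a := fun a =>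
    hgc.fderiv_apply (𝕜 := ℝ) a
  have key : ∀ a b, ∫ z, fderiv ℝ f z a * fderiv ℝ g z b ∂μ
      = - ∫ z, fderiv ℝ (fun z => fderiv ℝ f z a) z b * g z ∂μ := by
    intro a b
    apply integral_mul_fderiv_eq_neg_fderiv_mul_of_integrable
    · refine Continuous.integrable_of_hasCompactSupport ?_ hgc.mul_left
      exact (((hf1 a).continuous_fderiv (by norm_num)).clm_apply continuous_const).mul hg.continuous
    · exact Continuous.integrable_of_hasCompactSupport
        ((hf1 a).continuous.mul (hg1 b).continuous) (hgc1 b).mul_left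
    · exact Continuous.integrable_of_hasCompactSupport
        ((hf1 a).continuous.mul hg.continuous) hgc.mul_left
    · exact fun x _ => ((hf1 a).differentiable (by norm_num)) x
    · exact fun x _ => (hg.differentiable (by norm_num)) x
  rw [key a b, key b a]
  congr 2
  ext z
  have hd : DifferentiableAt ℝ (fderiv ℝ f) z :=
    (hf.fderiv_right (m := 1) (by norm_num)).differentiable (by norm_num) z
  have e : ∀ a b, fderiv ℝ (fun z => fderiv ℝ f z a) z b = fderiv ℝ (fderiv ℝ f) z b a := by
    intro a b
    rw [fderiv_clm_apply hd (differentiableAt_const a)]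
    simp
  have hs := (hf.contDiffAt (x := z)).isSymmSndFDerivAt (by simp)
  rw [e, e, hs.eq]

theorem sum_norm_symPart_sq {n : ℕ} (P : Fin n → Fin n → ℂ) :
    ∑ a, ∑ c, ‖(1 / 2 : ℂ) * (P a c + P c a)‖ ^ 2
      = (1 / 2) * ∑ a, ∑ c, ‖P a c‖ ^ 2 + (1 / 2) * ∑ a, ∑ c, (P a c * star (P c a)).re := by
  have h : ∀ a c, ‖(1 / 2 : ℂ) * (P a c + P c a)‖ ^ 2
      = (1 / 4) * ‖P a c‖ ^ 2 + (1 / 4) * ‖P c a‖ ^ 2 + (1 / 2) * (P a c * star (P c a)).re := by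
    intro a c
    simp only [← Complex.normSq_eq_norm_sq, Complex.normSq_apply, Complex.star_def, Complex.mul_re,
      Complex.mul_im, Complex.conj_re, Complex.conj_im, Complex.add_re, Complex.add_im]
    norm_num
    ring
  simp only [h, Finset.sum_add_distrib, ← Finset.mul_sum]
  rw [Finset.sum_comm (f := fun a c => ‖P c a‖ ^ 2)]
  ring

/-- The square of the symmetric part is half the full square plus half the cross terms `P a c * star
(P c a)`. Integrated and summed, the cross terms become the square of the trace, so they are
nonnegative and can be dropped. The family `b` need not be a basis. -/
theorem korn_frame {n : ℕ} (b : Fin n → H) {v : H → H →L[ℝ] ℂ} (hv : ContDiff ℝ 2 v)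
    (hc : HasCompactSupport v) :
    ∫ z, ∑ a, ∑ c, ‖fderiv ℝ v z (b a) (b c)‖ ^ 2 ∂μ
      ≤ 2 * ∫ z, ∑ a, ∑ c, ‖symPart (fderiv ℝ v z) (b a) (b c)‖ ^ 2 ∂μ := by
  set P : Fin n → Fin n → H → ℂ := fun a c z => fderiv ℝ v z (b a) (b c) with hP
  have hu : ∀ c, ContDiff ℝ 2 fun z => v z (b c) := fun c => hv.clm_apply contDiff_const
  have huc : ∀ c, HasCompactSupport fun z => v z (b c) := fun c =>
    hc.comp_left (g := fun L : H →L[ℝ] ℂ => L (b c)) (by simp)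
  have hPu : ∀ a c z, P a c z = fderiv ℝ (fun z => v z (b c)) z (b a) := by
    intro a c z
    rw [fderiv_clm_apply (hv.differentiable (by norm_num) z) (differentiableAt_const _)]
    simp [hP]
  have hPcont : ∀ a c, Continuous (P a c) := fun a c =>
    ((hv.continuous_fderiv (by norm_num)).clm_apply continuous_const).clm_apply continuous_const
  have hPc : ∀ a c, HasCompactSupport (P a c) := fun a c => by
    refine (hc.fderiv (𝕜 := ℝ)).comp_left (g := fun L : H →L[ℝ] H →L[ℝ] ℂ => L (b a) (b c)) (by simp)
  have hint : ∀ a c, Integrable (fun z => ‖P a c z‖ ^ 2) μ := fun a c => by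
    refine Continuous.integrable_of_hasCompactSupport ((hPcont a c).norm.pow 2) ?_
    exact (hPc a c).comp_left (g := fun w : ℂ => ‖w‖ ^ 2) (by simp)
  have hint2 : ∀ a c a' c', Integrable (fun z => P a c z * star (P a' c' z)) μ :=
    fun a c a' c' => Continuous.integrable_of_hasCompactSupport
      ((hPcont a c).mul (continuous_star.comp (hPcont a' c'))) (hPc a c).mul_right
  -- Exchanging the two derivatives turns an off-diagonal product into a product of diagonal
  -- entries, which sum to the squared modulus of a divergence.
  have hswap : ∀ a c, ∫ z, P a c z * star (P c a z) ∂μ = ∫ z, P c c z * star (P a a z) ∂μ := by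
    intro a c
    have hconj : ContDiff ℝ 2 fun z => star (v z (b a)) :=
      (Complex.conjCLE.contDiff).comp (hu a)
    have hcc : HasCompactSupport fun z => star (v z (b a)) :=
      (huc a).comp_left (g := star) (by simp)
    have h := integral_fderiv_mul_fderiv_swap μ (hu c) hconj hcc (b a) (b c)
    have e : ∀ k z, fderiv ℝ (fun z => star (v z (b a))) z (b k) = star (P k a z) := by
      intro k z
      rw [hPu]
      have h1 : HasFDerivAt (fun z => star (v z (b a)))
          ((Complex.conjCLE : ℂ →L[ℝ] ℂ).comp (fderiv ℝ (fun z => v z (b a)) z)) z :=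
        (Complex.conjCLE : ℂ →L[ℝ] ℂ).hasFDerivAt.comp z
          ((hu a).differentiable (by norm_num) z).hasFDerivAt
      rw [h1.fderiv]
      simp
    simpa only [e, ← hPu] using h
  have hre : ∀ a c, Integrable (fun z => (P a c z * star (P c a z)).re) μ := fun a c =>
    (hint2 a c c a).re
  have hdiv : 0 ≤ ∫ z, ∑ a, ∑ c, (P a c z * star (P c a z)).re ∂μ := by
    have e1 : ∫ z, ∑ a, ∑ c, (P a c z * star (P c a z)).re ∂μ
        = ∑ a, ∑ c, (∫ z, P c c z * star (P a a z) ∂μ).re := by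
      rw [integral_finsetSum _ fun a _ => integrable_finsetSum _ fun c _ => hre a c]
      refine Finset.sum_congr rfl fun a _ => ?_
      rw [integral_finsetSum _ fun c _ => hre a c]
      refine Finset.sum_congr rfl fun c _ => ?_
      rw [← hswap]
      exact integral_re (hint2 a c c a)
    have e2 : ∑ a, ∑ c, (∫ z, P c c z * star (P a a z) ∂μ).re
        = ∫ z, ‖∑ a, P a a z‖ ^ 2 ∂μ := by
      have : ∀ a c, (∫ z, P c c z * star (P a a z) ∂μ).re = ∫ z, (P c c z * star (P a a z)).re ∂μ :=
        fun a c => (integral_re (hint2 c c a a)).symm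
      have hre2 : ∀ a c, Integrable (fun z => (P c c z * star (P a a z)).re) μ := fun a c =>
        (hint2 c c a a).re
      have this' : ∀ a, ∑ c, (∫ z, P c c z * star (P a a z) ∂μ).re
          = ∫ z, ∑ c, (P c c z * star (P a a z)).re ∂μ := fun a => by
        rw [integral_finsetSum _ fun c _ => hre2 a c]
        exact Finset.sum_congr rfl fun c _ => this a c
      rw [Finset.sum_congr rfl fun a _ => this' a,
        ← integral_finsetSum _ fun a _ => integrable_finsetSum _ fun c _ => hre2 a c]
      congr 1
      ext z
      have h3 : ((∑ c, P c c z) * star (∑ a, P a a z)).re = ‖∑ a, P a a z‖ ^ 2 := by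
        rw [Complex.star_def, Complex.mul_conj, Complex.normSq_eq_norm_sq]
        norm_cast
      rw [← h3, star_sum, Finset.mul_sum]
      simp only [Finset.sum_mul, Complex.re_sum]
    rw [e1, e2]
    exact integral_nonneg fun z => by positivity
  have hsum : ∀ z, ∑ a, ∑ c, ‖symPart (fderiv ℝ v z) (b a) (b c)‖ ^ 2
      = (1 / 2) * ∑ a, ∑ c, ‖P a c z‖ ^ 2
        + (1 / 2) * ∑ a, ∑ c, (P a c z * star (P c a z)).re := by
    intro z
    simp only [symPart_apply]
    exact sum_norm_symPart_sq fun a c => P a c z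
  simp only [hsum]
  rw [integral_add, integral_const_mul, integral_const_mul]
  · linarith
  · exact (integrable_finsetSum _ fun a _ => integrable_finsetSum _ fun c _ => hint a c).const_mul _
  · exact (integrable_finsetSum _ fun a _ => integrable_finsetSum _ fun c _ => hre a c).const_mul _

theorem continuous_symPart : Continuous (symPart (H := H)) := by
  have : Continuous fun A : H →L[ℝ] H →L[ℝ] ℂ => A.flip :=
    (ContinuousLinearMap.flipₗᵢ ℝ H H ℂ).continuous
  exact (continuous_id.add this).const_smul (1 / 2 : ℝ)

theorem symPart_zero : symPart (0 : H →L[ℝ] H →L[ℝ] ℂ) = 0 := by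
  ext w w'; simp [symPart_apply]

theorem lintegral_enorm_sq_eq {G F : Type*} [TopologicalSpace G] [MeasurableSpace G] [BorelSpace G]
    [NormedAddCommGroup F] (μ : Measure G) [IsFiniteMeasureOnCompacts μ] {f : G → F}
    (hf : Continuous f) (hc : HasCompactSupport f) :
    ∫⁻ z, ‖f z‖ₑ ^ 2 ∂μ = ENNReal.ofReal (∫ z, ‖f z‖ ^ 2 ∂μ) := by
  rw [ofReal_integral_eq_lintegral_ofReal]
  · refine lintegral_congr fun z => ?_
    rw [← ofReal_norm, ENNReal.ofReal_pow (norm_nonneg _)]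
  · exact Continuous.integrable_of_hasCompactSupport (hf.norm.pow 2)
      (hc.comp_left (g := fun w : F => ‖w‖ ^ 2) (by simp))
  · exact Eventually.of_forall fun z => by positivity

theorem integrable_norm_sq {G F : Type*} [TopologicalSpace G] [MeasurableSpace G]
    [OpensMeasurableSpace G] [NormedAddCommGroup F] (μ : Measure G) [IsFiniteMeasureOnCompacts μ]
    {f : G → F} (hf : Continuous f) (hc : HasCompactSupport f) :
    Integrable (fun z => ‖f z‖ ^ 2) μ :=
  Continuous.integrable_of_hasCompactSupport (hf.norm.pow 2)
    (hc.comp_left (g := fun w : F => ‖w‖ ^ 2) (by simp))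

theorem integrable_norm_apply_sq (A : H → H →L[ℝ] H →L[ℝ] ℂ) (hA : Continuous A)
    (hc : HasCompactSupport A) (a c : H) : Integrable (fun z => ‖A z a c‖ ^ 2) μ := by
  refine integrable_norm_sq μ ((hA.clm_apply continuous_const).clm_apply continuous_const) ?_
  exact hc.comp_left (g := fun L : H →L[ℝ] H →L[ℝ] ℂ => L a c) (by simp)

theorem sum_norm_apply_sq_le {n : ℕ} (b : Fin n → H) (A : H →L[ℝ] H →L[ℝ] ℂ) :
    ∑ a, ∑ c, ‖A (b a) (b c)‖ ^ 2 ≤ (∑ a, ∑ c, (‖b a‖ * ‖b c‖) ^ 2) * ‖A‖ ^ 2 := by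
  simp only [Finset.sum_mul]
  refine Finset.sum_le_sum fun a _ => Finset.sum_le_sum fun c _ => ?_
  rw [← mul_pow]
  refine pow_le_pow_left₀ (norm_nonneg _) ?_ 2
  refine (A.le_opNorm₂ _ _).trans (le_of_eq ?_)
  ring

/-- Korn's first inequality, for covector fields with compact support. -/
theorem exists_korn :
    ∃ C : NNReal, ∀ v : H → H →L[ℝ] ℂ, ContDiff ℝ 2 v → HasCompactSupport v →
      ∫⁻ z, ‖fderiv ℝ v z‖ₑ ^ 2 ∂μ ≤ C * ∫⁻ z, ‖symPart (fderiv ℝ v z)‖ₑ ^ 2 ∂μ := by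
  obtain ⟨n, b, C, hC, hb⟩ := exists_frame_norm_le H
  obtain ⟨B, hB0, hB⟩ : ∃ B : ℝ, 0 ≤ B ∧ ∀ A : H →L[ℝ] H →L[ℝ] ℂ,
      ∑ a, ∑ c, ‖A (b a) (b c)‖ ^ 2 ≤ B * ‖A‖ ^ 2 :=
    ⟨_, by positivity, sum_norm_apply_sq_le b⟩
  refine ⟨Real.toNNReal (C * (2 * B)), fun v hv hc => ?_⟩
  have hcont : Continuous (fderiv ℝ v) := hv.continuous_fderiv (by norm_num)
  have hcs : HasCompactSupport (fderiv ℝ v) := hc.fderiv (𝕜 := ℝ)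
  have hcs' : HasCompactSupport fun z => symPart (fderiv ℝ v z) :=
    HasCompactSupport.comp_left (g := symPart) hcs symPart_zero
  have hcont' : Continuous fun z => symPart (fderiv ℝ v z) := continuous_symPart.comp hcont
  rw [lintegral_enorm_sq_eq μ hcont hcs, lintegral_enorm_sq_eq μ hcont' hcs',
    ← ENNReal.ofReal_coe_nnreal, ← ENNReal.ofReal_mul (by positivity),
    Real.coe_toNNReal _ (by positivity)]
  refine ENNReal.ofReal_le_ofReal ?_
  have hint := integrable_norm_apply_sq μ _ hcont hcs
  have hint' := integrable_norm_apply_sq μ _ hcont' hcs'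
  have h1 : ∫ z, ‖fderiv ℝ v z‖ ^ 2 ∂μ
      ≤ C * ∫ z, ∑ a, ∑ c, ‖fderiv ℝ v z (b a) (b c)‖ ^ 2 ∂μ := by
    rw [← integral_const_mul]
    exact integral_mono (integrable_norm_sq μ hcont hcs)
      ((integrable_finsetSum _ fun a _ => integrable_finsetSum _ fun c _ =>
        hint (b a) (b c)).const_mul _) fun z => hb _
  have h2 : ∫ z, ∑ a, ∑ c, ‖symPart (fderiv ℝ v z) (b a) (b c)‖ ^ 2 ∂μ
      ≤ B * ∫ z, ‖symPart (fderiv ℝ v z)‖ ^ 2 ∂μ := by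
    rw [← integral_const_mul]
    exact integral_mono
      (integrable_finsetSum _ fun a _ => integrable_finsetSum _ fun c _ => hint' (b a) (b c))
      ((integrable_norm_sq μ hcont' hcs').const_mul _) fun z => hB _
  have h3 := korn_frame μ b hv hc
  calc _ ≤ C * (2 * (B * ∫ z, ‖symPart (fderiv ℝ v z)‖ ^ 2 ∂μ)) :=
        h1.trans (mul_le_mul_of_nonneg_left (h3.trans (by linarith)) hC)
    _ = _ := by ring

end Korn

end

section

/-! ### Extension of one-forms across a hyperplane by reflection -/

section Glue

variable {H F : Type*} [NormedAddCommGroup H] [NormedSpace ℝ H] [NormedAddCommGroup F]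
  [NormedSpace ℝ F] (l : H →L[ℝ] ℝ)

/-- The restriction of `h` to the open half-space `{l < 0}`, extended by zero. -/
def cutNeg (h : H → F) (z : H) : F := if 0 ≤ l z then 0 else h z

theorem continuous_cutNeg {h : H → F} (hc : Continuous h) (h0 : ∀ z, l z = 0 → h z = 0) :
    Continuous (cutNeg l h) :=
  Continuous.if_le continuous_const hc continuous_const l.continuous fun z hz => (h0 z hz.symm).symm

/-- Only the hyperplane needs an argument: there `h` is o(|y - z|), and the cut function is
dominated by `h`. -/
theorem hasFDerivAt_cutNeg {h : H → F} (hd : Differentiable ℝ h) (h0 : ∀ z, l z = 0 → h z = 0)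
    (h1 : ∀ z, l z = 0 → fderiv ℝ h z = 0) (z : H) :
    HasFDerivAt (cutNeg l h) (cutNeg l (fderiv ℝ h) z) z := by
  rcases lt_trichotomy (l z) 0 with hz | hz | hz
  · have e : cutNeg l h =ᶠ[𝓝 z] h := by
      filter_upwards [l.continuous.continuousAt.eventually_lt continuousAt_const hz] with y hy
      simp [cutNeg, not_le.2 hy]
    rw [cutNeg, if_neg (not_le.2 hz)]
    exact (hd z).hasFDerivAt.congr_of_eventuallyEq e
  · have h2 := (hd z).hasFDerivAt
    rw [h1 z hz] at h2
    rw [cutNeg, if_pos hz.ge]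
    rw [hasFDerivAt_iff_isLittleO] at h2 ⊢
    refine (Asymptotics.IsBigO.of_bound 1 (Eventually.of_forall fun y => ?_)).trans_isLittleO h2
    simp only [h0 z hz, zero_apply, sub_zero, one_mul, cutNeg]
    split_ifs <;> simp
  · have e : cutNeg l h =ᶠ[𝓝 z] fun _ => 0 := by
      filter_upwards [continuousAt_const.eventually_lt l.continuous.continuousAt hz] with y hy
      simp [cutNeg, hy.le]
    rw [cutNeg, if_pos hz.le]
    exact (hasFDerivAt_const (0 : F) z).congr_of_eventuallyEq e

theorem contDiff_two_cutNeg {h : H → F} (hd : ContDiff ℝ 2 h) (h0 : ∀ z, l z = 0 → h z = 0)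
    (h1 : ∀ z, l z = 0 → fderiv ℝ h z = 0) (h2 : ∀ z, l z = 0 → fderiv ℝ (fderiv ℝ h) z = 0) :
    ContDiff ℝ 2 (cutNeg l h) := by
  have hd1 : ContDiff ℝ 1 (fderiv ℝ h) := hd.fderiv_right (by norm_num)
  have H1 := hasFDerivAt_cutNeg l (hd.differentiable (by norm_num)) h0 h1
  have H2 := hasFDerivAt_cutNeg l (hd1.differentiable (by norm_num)) h1 h2
  have e1 : fderiv ℝ (cutNeg l h) = cutNeg l (fderiv ℝ h) := funext fun z => (H1 z).fderiv
  have e2 : fderiv ℝ (cutNeg l (fderiv ℝ h)) = cutNeg l (fderiv ℝ (fderiv ℝ h)) :=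
    funext fun z => (H2 z).fderiv
  rw [show (2 : WithTop ℕ∞) = 1 + 1 by norm_num, contDiff_succ_iff_fderiv]
  refine ⟨fun z => (H1 z).differentiableAt, by simp, ?_⟩
  rw [e1, contDiff_one_iff_fderiv]
  refine ⟨fun z => (H2 z).differentiableAt, ?_⟩
  rw [e2]
  exact continuous_cutNeg l (hd1.continuous_fderiv (by norm_num)) h2

end Glue

section HalfSpace

variable {H : Type*} [NormedAddCommGroup H] [NormedSpace ℝ H] [FiniteDimensional ℝ H]
  [MeasurableSpace H] [BorelSpace H] (μ : Measure H) [μ.IsAddHaarMeasure]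

theorem exists_lintegral_comp_le (R : H →L[ℝ] H) (hR : Function.Injective R) :
    ∃ C : NNReal, ∀ (g : H → ℝ≥0∞) (s t : Set H), MeasurableSet s → MapsTo R s t →
      ∫⁻ z in s, g (R z) ∂μ ≤ C * ∫⁻ z in t, g z ∂μ := by
  have hdet : R.det ≠ 0 := fun h0 => by
    have := LinearMap.bot_lt_ker_of_det_eq_zero (f := (R : H →ₗ[ℝ] H)) h0
    rw [LinearMap.ker_eq_bot.2 hR] at this
    exact lt_irrefl _ this
  have hpos : 0 < |R.det| := abs_pos.2 hdet
  refine ⟨Real.toNNReal |R.det|⁻¹, fun g s t hs hst => ?_⟩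
  have h := lintegral_image_eq_lintegral_abs_det_fderiv_mul μ hs
    (fun x _ => R.hasFDerivAt.hasFDerivWithinAt) hR.injOn g
  rw [lintegral_const_mul' _ _ ENNReal.ofReal_ne_top] at h
  have h2 : ∫⁻ z in R '' s, g z ∂μ ≤ ∫⁻ z in t, g z ∂μ := lintegral_mono_set hst.image_subset
  rw [h] at h2
  calc ∫⁻ z in s, g (R z) ∂μ
      = ENNReal.ofReal |R.det|⁻¹ * (ENNReal.ofReal |R.det| * ∫⁻ z in s, g (R z) ∂μ) := by
        rw [← mul_assoc, ← ENNReal.ofReal_mul (by positivity), inv_mul_cancel₀ hpos.ne']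
        simp
    _ ≤ _ := mul_le_mul_right h2 _

/-- The linear map which fixes the hyperplane `l = 0` and sends `n` to `(1 + β) n`. -/
def stretch (l : H →L[ℝ] ℝ) (n : H) (β : ℝ) : H →L[ℝ] H :=
  ContinuousLinearMap.id ℝ H + β • l.smulRight n

theorem stretch_apply (l : H →L[ℝ] ℝ) (n : H) (β : ℝ) (w : H) :
    stretch l n β w = w + (β * l w) • n := by
  simp [stretch, smul_smul]

/-- Pullback of covectors by `stretch`. -/
def stretchPull (l : H →L[ℝ] ℝ) (n : H) (β : ℝ) : (H →L[ℝ] ℂ) →L[ℝ] (H →L[ℝ] ℂ) :=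
  (ContinuousLinearMap.compL ℝ H H ℂ).flip (stretch l n β)

theorem stretchPull_apply (l : H →L[ℝ] ℝ) (n : H) (β : ℝ) (A : H →L[ℝ] ℂ) (w : H) :
    stretchPull l n β A w = A (stretch l n β w) := rfl

/-- The dilation parameters of the reflection of order three. -/
def reflParam : Fin 4 → ℝ := ![-2, -3, -4, -5]

/-- The coefficients of the reflection of order three. -/
def reflCoef : Fin 4 → ℝ := ![10, -20, 15, -4]

/-- The extension by reflection of a covector field to `{l < 0}`. -/
def reflField (l : H →L[ℝ] ℝ) (n : H) (v : H → H →L[ℝ] ℂ) (z : H) : H →L[ℝ] ℂ :=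
  ∑ i, reflCoef i • stretchPull l n (reflParam i) (v (stretch l n (reflParam i) z))

variable {l : H →L[ℝ] ℝ} {n : H} {v : H → H →L[ℝ] ℂ}

theorem contDiff_reflField {k : ℕ∞ω} (hv : ContDiff ℝ k v) : ContDiff ℝ k (reflField l n v) := by
  unfold reflField
  refine ContDiff.sum fun i _ => ContDiff.const_smul _ ?_
  exact (stretchPull l n _).contDiff.comp (hv.comp (stretch l n _).contDiff)

/-- Each term is the pullback of a one-form under a linear map, so differentiation only inserts the
same map into the new slot; no derivative of the map appears. -/
theorem fderiv_reflField (hv : ContDiff ℝ 2 v) (z w w' : H) :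
    fderiv ℝ (reflField l n v) z w w' = ∑ i, reflCoef i *
      fderiv ℝ v (stretch l n (reflParam i) z) (stretch l n (reflParam i) w)
        (stretch l n (reflParam i) w') := by
  have h : ∀ i, HasFDerivAt
      (fun z => reflCoef i • stretchPull l n (reflParam i) (v (stretch l n (reflParam i) z)))
      (reflCoef i • (stretchPull l n (reflParam i)).comp
        ((fderiv ℝ v (stretch l n (reflParam i) z)).comp (stretch l n (reflParam i)))) z := fun i =>
    (((stretchPull l n (reflParam i)).hasFDerivAt).comp z
      (((hv.differentiable (by norm_num)) _).hasFDerivAt.comp z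
        (stretch l n (reflParam i)).hasFDerivAt)).fun_const_smul _
  have h2 : HasFDerivAt (reflField l n v) _ z := HasFDerivAt.fun_sum fun i _ => h i
  rw [h2.fderiv]
  simp [stretchPull_apply]

theorem fderiv_fderiv_reflField (hv : ContDiff ℝ 3 v) (z w w' w'' : H) :
    fderiv ℝ (fderiv ℝ (reflField l n v)) z w w' w'' = ∑ i, reflCoef i *
      fderiv ℝ (fderiv ℝ v) (stretch l n (reflParam i) z) (stretch l n (reflParam i) w)
        (stretch l n (reflParam i) w') (stretch l n (reflParam i) w'') := by
  have hv2 : ContDiff ℝ 2 v := hv.of_le (by norm_num)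
  have hr : ContDiff ℝ 3 (reflField l n v) := contDiff_reflField hv
  have hr1 : DifferentiableAt ℝ (fderiv ℝ (reflField l n v)) z :=
    (hr.fderiv_right (m := 1) (by norm_num)).differentiable (by norm_num) z
  have hv1 : Differentiable ℝ (fderiv ℝ v) :=
    (hv.fderiv_right (m := 1) (by norm_num)).differentiable (by norm_num)
  have e : fderiv ℝ (fderiv ℝ (reflField l n v)) z w w' w''
      = fderiv ℝ (fun z => fderiv ℝ (reflField l n v) z w' w'') z w := by
    have h3 : HasFDerivAt (fun z => fderiv ℝ (reflField l n v) z w' w'')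
        ((ContinuousLinearMap.apply ℝ ℂ w'').comp ((ContinuousLinearMap.apply ℝ _ w').comp
          (fderiv ℝ (fderiv ℝ (reflField l n v)) z))) z :=
      (ContinuousLinearMap.apply ℝ ℂ w'').hasFDerivAt.comp z
        ((ContinuousLinearMap.apply ℝ (H →L[ℝ] ℂ) w').hasFDerivAt.comp z hr1.hasFDerivAt)
    rw [h3.fderiv]
    rfl
  have h : ∀ i, HasFDerivAt (fun z => (reflCoef i : ℂ) *
      fderiv ℝ v (stretch l n (reflParam i) z) (stretch l n (reflParam i) w')
        (stretch l n (reflParam i) w''))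
      ((reflCoef i : ℂ) • ((ContinuousLinearMap.apply ℝ ℂ (stretch l n (reflParam i) w'')).comp
        ((ContinuousLinearMap.apply ℝ _ (stretch l n (reflParam i) w')).comp
        ((fderiv ℝ (fderiv ℝ v) (stretch l n (reflParam i) z)).comp
          (stretch l n (reflParam i)))))) z := fun i =>
    (((ContinuousLinearMap.apply ℝ ℂ _).hasFDerivAt).comp z
      (((ContinuousLinearMap.apply ℝ (H →L[ℝ] ℂ) _).hasFDerivAt).comp z
      ((hv1 _).hasFDerivAt.comp z (stretch l n (reflParam i)).hasFDerivAt))).const_mul _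
  rw [e]
  simp only [fderiv_reflField hv2]
  rw [(HasFDerivAt.fun_sum fun i _ => h i).fderiv]
  simp

theorem fderiv_fderiv_sub {f g : H → H →L[ℝ] ℂ} (hf : ContDiff ℝ 2 f) (hg : ContDiff ℝ 2 g)
    (z : H) : fderiv ℝ (f - g) z = fderiv ℝ f z - fderiv ℝ g z ∧
      fderiv ℝ (fderiv ℝ (f - g)) z
        = fderiv ℝ (fderiv ℝ f) z - fderiv ℝ (fderiv ℝ g) z := by
  have h1 : ∀ z, fderiv ℝ (f - g) z = fderiv ℝ f z - fderiv ℝ g z := fun z =>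
    fderiv_sub (hf.differentiable (by norm_num) z) (hg.differentiable (by norm_num) z)
  refine ⟨h1 z, ?_⟩
  have e : fderiv ℝ (f - g) = fderiv ℝ f - fderiv ℝ g := funext h1
  rw [e]
  exact fderiv_sub ((hf.fderiv_right (m := 1) (by norm_num)).differentiable (by norm_num) z)
    ((hg.fderiv_right (m := 1) (by norm_num)).differentiable (by norm_num) z)

/-- The covector field equal to `v` on `{0 ≤ l}` and to its reflection on `{l < 0}`. -/
def reflExt (l : H →L[ℝ] ℝ) (n : H) (v : H → H →L[ℝ] ℂ) : H → H →L[ℝ] ℂ :=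
  v + cutNeg l (reflField l n v - v)

/-- With λ = 1 + `reflParam` running through -1, -2, -3, -4, the coefficients solve ∑ c λ^k = 1 for
k = 0, 1, 2, 3. Up to two powers of λ come from normal derivatives, and one more from the pullback
of the normal component of the covector. This is why matching to second order takes four
reflections. -/
theorem fderiv_reflField_sub_eq (hv : ContDiff ℝ 3 v) {z : H} (hz : l z = 0) :
    (reflField l n v - v) z = 0 ∧ fderiv ℝ (reflField l n v - v) z = 0 ∧
      fderiv ℝ (fderiv ℝ (reflField l n v - v)) z = 0 := by
  have hv2 : ContDiff ℝ 2 v := hv.of_le (by norm_num)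
  have hr : ContDiff ℝ 2 (reflField l n v) := contDiff_reflField hv2
  have hs : ∀ β, stretch l n β z = z := fun β => by simp [stretch_apply, hz]
  obtain ⟨e1, e2⟩ := fderiv_fderiv_sub hr hv2 z
  refine ⟨?_, ?_, ?_⟩
  · ext w
    simp only [Pi.sub_apply, reflField, Fin.sum_univ_four, sub_apply, add_apply, smul_apply,
      stretchPull_apply, hs, reflCoef, reflParam, stretch_apply, map_add, map_smul, zero_apply,
      Matrix.cons_val, Complex.real_smul]
    push_cast
    ring
  · rw [e1]
    ext w w'
    simp only [sub_apply, fderiv_reflField hv2, hs, Fin.sum_univ_four, reflCoef, reflParam,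
      stretch_apply, map_add, map_smul, zero_apply, add_apply, smul_apply,
      Matrix.cons_val, Complex.real_smul]
    push_cast
    ring
  · rw [e2]
    ext w w' w''
    simp only [sub_apply, fderiv_fderiv_reflField hv, hs, Fin.sum_univ_four, reflCoef, reflParam,
      stretch_apply, map_add, map_smul, zero_apply, add_apply, smul_apply,
      Matrix.cons_val, Complex.real_smul]
    push_cast
    ring

theorem contDiff_reflExt (hv : ContDiff ℝ 3 v) : ContDiff ℝ 2 (reflExt l n v) := by
  have hv2 : ContDiff ℝ 2 v := hv.of_le (by norm_num)
  exact hv2.add (contDiff_two_cutNeg l ((contDiff_reflField hv2).sub hv2)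
    (fun z hz => (fderiv_reflField_sub_eq hv hz).1)
    (fun z hz => (fderiv_reflField_sub_eq hv hz).2.1)
    (fun z hz => (fderiv_reflField_sub_eq hv hz).2.2))

theorem fderiv_reflExt (hv : ContDiff ℝ 3 v) (z : H) : fderiv ℝ (reflExt l n v) z
    = if 0 ≤ l z then fderiv ℝ v z else fderiv ℝ (reflField l n v) z := by
  have hv2 : ContDiff ℝ 2 v := hv.of_le (by norm_num)
  have hr : ContDiff ℝ 2 (reflField l n v) := contDiff_reflField hv2
  have hd : HasFDerivAt (reflExt l n v)
      (fderiv ℝ v z + cutNeg l (fderiv ℝ (reflField l n v - v)) z) z := (hv2.differentiable (by norm_num) z).hasFDerivAt.add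
    (hasFDerivAt_cutNeg l (((contDiff_reflField hv2).sub hv2).differentiable (by norm_num))
      (fun z hz => (fderiv_reflField_sub_eq hv hz).1)
      (fun z hz => (fderiv_reflField_sub_eq hv hz).2.1) z)
  rw [hd.fderiv, cutNeg]
  split_ifs
  · simp
  · rw [(fderiv_fderiv_sub hr hv2 z).1]
    abel

end HalfSpace

end

section

/-! ### Korn's inequality on a half-space -/

section HalfSpaceKorn

variable {H : Type*} [NormedAddCommGroup H] [NormedSpace ℝ H] [FiniteDimensional ℝ H]
  [MeasurableSpace H] [BorelSpace H] (μ : Measure H) [μ.IsAddHaarMeasure]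

theorem enorm_sq_eq_ofReal {F : Type*} [SeminormedAddCommGroup F] (x : F) :
    ‖x‖ₑ ^ 2 = ENNReal.ofReal (‖x‖ ^ 2) := by
  rw [← ofReal_norm, ENNReal.ofReal_pow (norm_nonneg _)]

variable {l : H →L[ℝ] ℝ} {n : H} {v : H → H →L[ℝ] ℂ}

theorem stretch_injective (hn : l n = 1) {β : ℝ} (hβ : 1 + β ≠ 0) :
    Function.Injective (stretch l n β) := by
  rw [injective_iff_map_eq_zero]
  intro w hw
  rw [stretch_apply] at hw
  have h := congrArg l hw
  simp only [map_add, map_smul, hn, smul_eq_mul, map_zero, mul_one] at h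
  have h0 : l w = 0 := by
    have : (1 + β) * l w = 0 := by linarith
    exact (mul_eq_zero.1 this).resolve_left hβ
  simpa [h0] using hw

theorem one_add_reflParam_neg (i : Fin 4) : 1 + reflParam i < 0 := by
  fin_cases i <;> norm_num [reflParam]

theorem hasCompactSupport_reflField (hn : l n = 1) (hc : HasCompactSupport v) :
    HasCompactSupport (reflField l n v) := by
  have h : ∀ i, HasCompactSupport fun z =>
      reflCoef i • stretchPull l n (reflParam i) (v (stretch l n (reflParam i) z)) := by
    intro i
    have hcl : IsClosedEmbedding (stretch l n (reflParam i)) :=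
      LinearMap.isClosedEmbedding_of_injective (f := (stretch l n (reflParam i) : H →ₗ[ℝ] H))
        (LinearMap.ker_eq_bot.2 (stretch_injective hn (one_add_reflParam_neg i).ne))
    have h1 := hc.comp_isClosedEmbedding hcl
    exact HasCompactSupport.comp_left
      (g := fun A : H →L[ℝ] ℂ => reflCoef i • stretchPull l n (reflParam i) A) h1 (by simp)
  have e : reflField l n v = fun z =>
      (reflCoef 0 • stretchPull l n (reflParam 0) (v (stretch l n (reflParam 0) z))
      + reflCoef 1 • stretchPull l n (reflParam 1) (v (stretch l n (reflParam 1) z)))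
      + reflCoef 2 • stretchPull l n (reflParam 2) (v (stretch l n (reflParam 2) z))
      + reflCoef 3 • stretchPull l n (reflParam 3) (v (stretch l n (reflParam 3) z)) := by
    ext1 z
    exact Fin.sum_univ_four _
  rw [e]
  exact (((h 0).add (h 1)).add (h 2)).add (h 3)

theorem hasCompactSupport_reflExt (hn : l n = 1) (hc : HasCompactSupport v) :
    HasCompactSupport (reflExt l n v) := by
  refine hc.add (HasCompactSupport.mono (f := reflField l n v - v) ?_ ?_)
  · exact (hasCompactSupport_reflField hn hc).sub hc
  · intro z hz h0
    refine hz ?_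
    simp only [cutNeg, h0, ite_self]

/-- The reason for reflecting by pullback of covectors rather than component by component: the
symmetric part of the reflected derivative involves only symmetric parts of the original one. -/
theorem symPart_fderiv_reflField (hv : ContDiff ℝ 2 v) (z w w' : H) :
    symPart (fderiv ℝ (reflField l n v) z) w w' = ∑ i, reflCoef i *
      symPart (fderiv ℝ v (stretch l n (reflParam i) z)) (stretch l n (reflParam i) w)
        (stretch l n (reflParam i) w') := by
  simp only [symPart_apply, fderiv_reflField hv, ← Finset.sum_add_distrib, Finset.mul_sum]
  exact Finset.sum_congr rfl fun i _ => by ring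

theorem norm_symPart_fderiv_reflField_le (hv : ContDiff ℝ 2 v) (z : H) :
    ‖symPart (fderiv ℝ (reflField l n v) z)‖ ^ 2 ≤ ∑ i,
      (4 * (|reflCoef i| * ‖stretch l n (reflParam i)‖ ^ 2) ^ 2) *
        ‖symPart (fderiv ℝ v (stretch l n (reflParam i) z))‖ ^ 2 := by
  have h1 : ‖symPart (fderiv ℝ (reflField l n v) z)‖ ≤ ∑ i,
      (|reflCoef i| * ‖stretch l n (reflParam i)‖ ^ 2) *
        ‖symPart (fderiv ℝ v (stretch l n (reflParam i) z))‖ := by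
    refine ContinuousLinearMap.opNorm_le_bound₂ _ (by positivity) fun w w' => ?_
    rw [symPart_fderiv_reflField hv, Finset.sum_mul, Finset.sum_mul]
    refine (norm_sum_le _ _).trans (Finset.sum_le_sum fun i _ => ?_)
    rw [norm_mul, Complex.norm_real, Real.norm_eq_abs]
    have h2 := (symPart (fderiv ℝ v (stretch l n (reflParam i) z))).le_opNorm₂
      (stretch l n (reflParam i) w) (stretch l n (reflParam i) w')
    have h3 := (stretch l n (reflParam i)).le_opNorm w
    have h4 := (stretch l n (reflParam i)).le_opNorm w'
    calc _ ≤ |reflCoef i| * (‖symPart (fderiv ℝ v (stretch l n (reflParam i) z))‖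
          * (‖stretch l n (reflParam i)‖ * ‖w‖) * (‖stretch l n (reflParam i)‖ * ‖w'‖)) := by
          refine mul_le_mul_of_nonneg_left (h2.trans ?_) (abs_nonneg _)
          gcongr
      _ = _ := by ring
  calc _ ≤ (∑ i, (|reflCoef i| * ‖stretch l n (reflParam i)‖ ^ 2) *
        ‖symPart (fderiv ℝ v (stretch l n (reflParam i) z))‖) ^ 2 :=
        pow_le_pow_left₀ (norm_nonneg _) h1 2
    _ ≤ _ := sq_sum_le_card_mul_sum_sq
    _ = _ := by
        rw [Finset.mul_sum]
        refine Finset.sum_congr rfl fun i _ => ?_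
        simp
        ring

theorem measure_ker_eq_zero (hn : l n = 1) : μ {z | l z = 0} = 0 := by
  refine Measure.addHaar_submodule μ (LinearMap.ker (l : H →ₗ[ℝ] ℝ)) fun h => ?_
  have : n ∈ LinearMap.ker (l : H →ₗ[ℝ] ℝ) := by rw [h]; trivial
  have h2 : l n = 0 := this
  rw [hn] at h2
  exact one_ne_zero h2

/-- Korn's inequality holds on `T`, without boundary conditions, for compactly supported fields. -/
def KornOn (T : Set H) : Prop :=
  ∃ C : NNReal, ∀ v : H → H →L[ℝ] ℂ, ContDiff ℝ 3 v → HasCompactSupport v →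
    ∫⁻ z in T, ‖fderiv ℝ v z‖ₑ ^ 2 ∂μ ≤ C * ∫⁻ z in T, ‖symPart (fderiv ℝ v z)‖ₑ ^ 2 ∂μ

theorem kornOn_univ : KornOn μ (univ : Set H) := by
  obtain ⟨C, hC⟩ := exists_korn (H := H) μ
  refine ⟨C, fun v hv hc => ?_⟩
  simpa using hC v (hv.of_le (by norm_num)) hc

theorem exists_lintegral_symPart_reflField_le (hn : l n = 1) :
    ∃ C : NNReal, ∀ v : H → H →L[ℝ] ℂ, ContDiff ℝ 2 v →
      ∫⁻ z in {z | l z < 0}, ‖symPart (fderiv ℝ (reflField l n v) z)‖ₑ ^ 2 ∂μ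
        ≤ C * ∫⁻ z in {z | 0 < l z}, ‖symPart (fderiv ℝ v z)‖ₑ ^ 2 ∂μ := by
  choose C hC using fun i : Fin 4 => exists_lintegral_comp_le μ (stretch l n (reflParam i))
    (stretch_injective hn (one_add_reflParam_neg i).ne)
  set k : Fin 4 → ℝ := fun i => 4 * (|reflCoef i| * ‖stretch l n (reflParam i)‖ ^ 2) ^ 2 with hk
  have hk0 : ∀ i, 0 ≤ k i := fun i => by simp only [hk]; positivity
  refine ⟨∑ i, Real.toNNReal (k i) * C i, fun v hv => ?_⟩
  have hm : MeasurableSet {z : H | l z < 0} :=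
    (isOpen_lt l.continuous continuous_const).measurableSet
  have hcont : Continuous fun z => symPart (fderiv ℝ v z) :=
    continuous_symPart.comp (hv.continuous_fderiv (by norm_num))
  calc ∫⁻ z in {z | l z < 0}, ‖symPart (fderiv ℝ (reflField l n v) z)‖ₑ ^ 2 ∂μ
      ≤ ∫⁻ z in {z | l z < 0}, ∑ i, ENNReal.ofReal (k i) *
          ‖symPart (fderiv ℝ v (stretch l n (reflParam i) z))‖ₑ ^ 2 ∂μ := by
        refine lintegral_mono fun z => ?_
        simp only [enorm_sq_eq_ofReal]
        refine (ENNReal.ofReal_le_ofReal (norm_symPart_fderiv_reflField_le hv z)).trans ?_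
        rw [ENNReal.ofReal_sum_of_nonneg fun i _ => mul_nonneg (hk0 i) (by positivity)]
        exact Finset.sum_le_sum fun i _ => (ENNReal.ofReal_mul (hk0 i)).le
    _ = ∑ i, ENNReal.ofReal (k i) * ∫⁻ z in {z | l z < 0},
          ‖symPart (fderiv ℝ v (stretch l n (reflParam i) z))‖ₑ ^ 2 ∂μ := by
        have hmeas : ∀ i, Measurable fun z =>
            ‖symPart (fderiv ℝ v (stretch l n (reflParam i) z))‖ₑ ^ 2 := fun i =>
          ((hcont.comp (stretch l n (reflParam i)).continuous).enorm.measurable).pow_const 2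
        rw [lintegral_finsetSum _ fun i _ => (hmeas i).const_mul _]
        exact Finset.sum_congr rfl fun i _ => lintegral_const_mul _ (hmeas i)
    _ ≤ ∑ i, ENNReal.ofReal (k i) * (C i * ∫⁻ z in {z | 0 < l z},
          ‖symPart (fderiv ℝ v z)‖ₑ ^ 2 ∂μ) := by
        refine Finset.sum_le_sum fun i _ => mul_le_mul_right ?_ _
        refine hC i (fun z => ‖symPart (fderiv ℝ v z)‖ₑ ^ 2) _ _ hm fun z (hz : l z < 0) => ?_
        -- The map multiplies `l` by the negative number 1 + `reflParam i`, so it sends the lower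
        -- half-space into the upper one.
        have e : l (stretch l n (reflParam i) z) = (1 + reflParam i) * l z := by
          simp [stretch_apply, hn]
          ring
        rw [mem_ofPred_eq, e]
        exact mul_pos_of_neg_of_neg (one_add_reflParam_neg i) hz
    _ = _ := by
        simp only [← mul_assoc, ← Finset.sum_mul]
        congr 1

/-- Apply the inequality on the whole space to the reflected extension. Its symmetric gradient on
the lower half-space is controlled by that on the upper one, and the hyperplane is a null set. -/
theorem kornOn_halfSpace (hn : l n = 1) : KornOn μ {z | 0 < l z} := by
  obtain ⟨C, hC⟩ := exists_korn (H := H) μ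
  obtain ⟨C', hC'⟩ := exists_lintegral_symPart_reflField_le μ hn
  refine ⟨C * (1 + C'), fun v hv hc => ?_⟩
  have hm : MeasurableSet {z : H | 0 < l z} :=
    (isOpen_lt continuous_const l.continuous).measurableSet
  have h1 := hC (reflExt l n v) (contDiff_reflExt hv) (hasCompactSupport_reflExt hn hc)
  have h2 : ∫⁻ z in {z | 0 < l z}, ‖fderiv ℝ v z‖ₑ ^ 2 ∂μ
      ≤ ∫⁻ z, ‖fderiv ℝ (reflExt l n v) z‖ₑ ^ 2 ∂μ := by
    rw [setLIntegral_congr_fun (g := fun z => ‖fderiv ℝ (reflExt l n v) z‖ₑ ^ 2) hm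
      fun z (hz : 0 < l z) => by simp only [fderiv_reflExt hv, if_pos hz.le]]
    exact setLIntegral_le_lintegral _ _
  refine h2.trans (h1.trans ?_)
  rw [← lintegral_add_compl _ hm]
  have e1 : ∫⁻ z in {z | 0 < l z}, ‖symPart (fderiv ℝ (reflExt l n v) z)‖ₑ ^ 2 ∂μ
      = ∫⁻ z in {z | 0 < l z}, ‖symPart (fderiv ℝ v z)‖ₑ ^ 2 ∂μ :=
    setLIntegral_congr_fun hm fun z (hz : 0 < l z) => by
      simp only [fderiv_reflExt hv, if_pos hz.le]
  have e2 : ∫⁻ z in {z | 0 < l z}ᶜ, ‖symPart (fderiv ℝ (reflExt l n v) z)‖ₑ ^ 2 ∂μ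
      = ∫⁻ z in {z | l z < 0}, ‖symPart (fderiv ℝ (reflField l n v) z)‖ₑ ^ 2 ∂μ := by
    have hae : ({z | 0 < l z}ᶜ : Set H) =ᵐ[μ] {z | l z < 0} := by
      have h0 : ∀ᵐ z ∂μ, l z ≠ 0 := by
        rw [ae_iff]
        simpa using measure_ker_eq_zero μ hn
      filter_upwards [h0] with z hz
      refine propext ⟨fun h => lt_of_le_of_ne (not_lt.1 h) hz, fun h => not_lt.2 (le_of_lt h)⟩
    rw [setLIntegral_congr hae]
    refine setLIntegral_congr_fun (isOpen_lt l.continuous continuous_const).measurableSet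
      fun z (hz : l z < 0) => ?_
    simp only [fderiv_reflExt hv, if_neg (not_le.2 hz)]
  rw [e1, e2]
  calc _ ≤ (C : ℝ≥0∞) * (∫⁻ z in {z | 0 < l z}, ‖symPart (fderiv ℝ v z)‖ₑ ^ 2 ∂μ
        + C' * ∫⁻ z in {z | 0 < l z}, ‖symPart (fderiv ℝ v z)‖ₑ ^ 2 ∂μ) := by
        gcongr
        exact hC' v (hv.of_le (by norm_num))
    _ = _ := by push_cast; ring

end HalfSpaceKorn

/-! ### Energy estimate for transport along inward pointing fields -/

section Energy

variable {H : Type*} [NormedAddCommGroup H] [NormedSpace ℝ H] [FiniteDimensional ℝ H]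
  [MeasurableSpace H] [BorelSpace H] (μ : Measure H) [μ.IsAddHaarMeasure]

/-- The constant vector field `V` points into `T` along its boundary. -/
def Inward (T : Set H) (V : H) : Prop :=
  ∀ G : H → ℝ, ContDiff ℝ 1 G → HasCompactSupport G → (∀ z, 0 ≤ G z) →
    ∫ z in T, fderiv ℝ G z V ∂μ ≤ 0

theorem integral_mul_fderiv_eq_neg {f G : H → ℝ} (hf : ContDiff ℝ 1 f) (hG : ContDiff ℝ 1 G)
    (hc : HasCompactSupport G) (V : H) :
    ∫ z, f z * fderiv ℝ G z V ∂μ = - ∫ z, fderiv ℝ f z V * G z ∂μ := by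
  apply integral_mul_fderiv_eq_neg_fderiv_mul_of_integrable
  · exact Continuous.integrable_of_hasCompactSupport
      (((hf.continuous_fderiv (by norm_num)).clm_apply continuous_const).mul hG.continuous)
      hc.mul_left
  · exact Continuous.integrable_of_hasCompactSupport
      (hf.continuous.mul ((hG.continuous_fderiv (by norm_num)).clm_apply continuous_const))
      (hc.fderiv_apply (𝕜 := ℝ) V).mul_left
  · exact Continuous.integrable_of_hasCompactSupport (hf.continuous.mul hG.continuous) hc.mul_left
  · exact fun x _ => hf.differentiable (by norm_num) x
  · exact fun x _ => hG.differentiable (by norm_num) x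

theorem inward_univ (V : H) : Inward μ univ V := by
  intro G hG hc _
  have h := integral_mul_fderiv_eq_neg μ (f := fun _ => 1) contDiff_const hG hc V
  simp only [one_mul, fderiv_fun_const, Pi.zero_apply, zero_apply, zero_mul, integral_zero,
    neg_zero] at h
  simpa using h.le

/-- The indicator of the half-space is approximated by the nondecreasing smooth functions
`smoothTransition (k * l z)`. Integration by parts moves the derivative onto them, where it is
nonnegative because `l V` is; then let k tend to infinity by dominated convergence. -/
theorem inward_halfSpace {l : H →L[ℝ] ℝ} {V : H} (hV : 0 ≤ l V) : Inward μ {z | 0 < l z} V := by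
  intro G hG hc hG0
  have hm : MeasurableSet {z : H | 0 < l z} :=
    (isOpen_lt continuous_const l.continuous).measurableSet
  set θ : ℕ → H → ℝ := fun k z => Real.smoothTransition (k * l z) with hθ
  have hθs : ∀ k, ContDiff ℝ 1 (θ k) := fun k =>
    Real.smoothTransition.contDiff.comp (contDiff_const.mul l.contDiff)
  have hint : Integrable (fun z => fderiv ℝ G z V) μ :=
    Continuous.integrable_of_hasCompactSupport
      ((hG.continuous_fderiv (by norm_num)).clm_apply continuous_const)
      (hc.fderiv_apply (𝕜 := ℝ) V)
  have hle : ∀ k, ∫ z, θ k z * fderiv ℝ G z V ∂μ ≤ 0 := by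
    intro k
    rw [integral_mul_fderiv_eq_neg μ (hθs k) hG hc V, neg_nonpos]
    refine integral_nonneg fun z => mul_nonneg ?_ (hG0 z)
    have hd : HasDerivAt Real.smoothTransition (deriv Real.smoothTransition (k * l z)) (k * l z) :=
      ((Real.smoothTransition.contDiff (n := 1)).differentiable (by norm_num) _).hasDerivAt
    have h1 : HasFDerivAt (θ k) (deriv Real.smoothTransition (k * l z) • ((k : ℝ) • l)) z :=
      HasDerivAt.comp_hasFDerivAt (f := fun y => (k : ℝ) * l y) z hd (l.hasFDerivAt.const_mul (k : ℝ))
    rw [h1.fderiv]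
    simp only [smul_apply, smul_eq_mul]
    exact mul_nonneg Real.smoothTransition.monotone.deriv_nonneg
      (mul_nonneg (Nat.cast_nonneg _) hV)
  have hlim : Tendsto (fun k => ∫ z, θ k z * fderiv ℝ G z V ∂μ) atTop
      (𝓝 (∫ z, {z | 0 < l z}.indicator (fun z => fderiv ℝ G z V) z ∂μ)) := by
    refine tendsto_integral_of_dominated_convergence (fun z => ‖fderiv ℝ G z V‖) ?_ hint.norm ?_ ?_
    · exact fun k => ((hθs k).continuous.mul ((hG.continuous_fderiv (by norm_num)).clm_apply
        continuous_const)).aestronglyMeasurable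
    · refine fun k => Eventually.of_forall fun z => ?_
      rw [norm_mul, Real.norm_eq_abs, abs_of_nonneg (Real.smoothTransition.nonneg _)]
      exact mul_le_of_le_one_left (norm_nonneg _) (Real.smoothTransition.le_one _)
    · refine Eventually.of_forall fun z => ?_
      by_cases hz : 0 < l z
      · rw [indicator_of_mem (show z ∈ {z | 0 < l z} from hz)]
        refine tendsto_const_nhds.congr' ?_
        have h2 : Tendsto (fun k : ℕ => (k : ℝ) * l z) atTop atTop :=
          tendsto_natCast_atTop_atTop.atTop_mul_const hz
        filter_upwards [h2.eventually_ge_atTop 1] with k hk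
        simp only [hθ, Real.smoothTransition.one_of_one_le hk, one_mul]
      · rw [indicator_of_notMem (show z ∉ {z | 0 < l z} from hz)]
        refine tendsto_const_nhds.congr fun k => ?_
        simp only [hθ]
        rw [Real.smoothTransition.zero_of_nonpos
          (mul_nonpos_of_nonneg_of_nonpos (Nat.cast_nonneg _) (not_lt.1 hz)), zero_mul]
  rw [← integral_indicator hm]
  exact le_of_tendsto' hlim hle

/-- The energy estimate for transport along an inward pointing constant vector field. -/
theorem Inward.energy {T : Set H} {V : H} (hV : Inward μ T V) (hT : MeasurableSet T) {a : H → ℂ}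
    (ha : ContDiff ℝ 1 a) (hc : HasCompactSupport a) {κ : ℝ} (hκ : 0 < κ) {B : H → ℝ}
    (hB : ∀ z ∈ T, κ * ‖a z‖ ^ 2 ≤ inner ℝ (a z) (fderiv ℝ a z V) + ‖a z‖ * B z) :
    ENNReal.ofReal (κ ^ 2) * ∫⁻ z in T, ‖a z‖ₑ ^ 2 ∂μ ≤ ∫⁻ z in T, ENNReal.ofReal (B z ^ 2) ∂μ := by
  have hG := hV (fun z => ‖a z‖ ^ 2) (ha.norm_sq ℝ) (hc.comp_left (g := fun w : ℂ => ‖w‖ ^ 2)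
    (by simp)) fun z => by positivity
  have e : ∀ z, fderiv ℝ (fun z => ‖a z‖ ^ 2) z V = 2 * inner ℝ (a z) (fderiv ℝ a z V) := by
    intro z
    rw [((ha.differentiable (by norm_num) z).hasFDerivAt.norm_sq).fderiv]
    simp only [smul_apply, ContinuousLinearMap.comp_apply, innerSL_apply_apply, nsmul_eq_mul,
      Nat.cast_ofNat]
  simp only [e] at hG
  have hi1 : Integrable (fun z => ‖a z‖ ^ 2) μ := integrable_norm_sq μ ha.continuous hc
  have hcd : Continuous fun z => fderiv ℝ a z V :=
    (ha.continuous_fderiv (by norm_num)).clm_apply continuous_const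
  have hi2 : Integrable (fun z => 2 * inner ℝ (a z) (fderiv ℝ a z V)) μ := by
    refine Continuous.integrable_of_hasCompactSupport
      (continuous_const.mul (ha.continuous.inner hcd)) ?_
    refine (HasCompactSupport.mono (f := a) hc fun z hz h0 => hz ?_)
    simp only [h0, inner_zero_left, mul_zero]
  -- The integral of V|a|² over `T` is nonpositive, so subtracting κ times it only increases the
  -- right-hand side.
  have h1 : κ ^ 2 * ∫ z in T, ‖a z‖ ^ 2 ∂μ
      ≤ ∫ z in T, (κ ^ 2 * ‖a z‖ ^ 2 - κ * (2 * inner ℝ (a z) (fderiv ℝ a z V))) ∂μ := by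
    rw [integral_sub (hi1.const_mul _).integrableOn (hi2.const_mul _).integrableOn,
      integral_const_mul, integral_const_mul]
    nlinarith
  have h2 : ENNReal.ofReal (κ ^ 2) * ∫⁻ z in T, ‖a z‖ₑ ^ 2 ∂μ
      = ENNReal.ofReal (κ ^ 2 * ∫ z in T, ‖a z‖ ^ 2 ∂μ) := by
    rw [ENNReal.ofReal_mul (by positivity),
      ofReal_integral_eq_lintegral_ofReal hi1.integrableOn (Eventually.of_forall fun z => by positivity)]
    simp only [enorm_sq_eq_ofReal]
  rw [h2]
  refine (ENNReal.ofReal_le_ofReal h1).trans ?_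
  have h3 : ENNReal.ofReal (∫ z in T,
      (κ ^ 2 * ‖a z‖ ^ 2 - κ * (2 * inner ℝ (a z) (fderiv ℝ a z V))) ∂μ)
      ≤ ∫⁻ z in T, ENNReal.ofReal
        (κ ^ 2 * ‖a z‖ ^ 2 - κ * (2 * inner ℝ (a z) (fderiv ℝ a z V))) ∂μ := by
    have hi3 : Integrable (fun z => κ ^ 2 * ‖a z‖ ^ 2
      - κ * (2 * inner ℝ (a z) (fderiv ℝ a z V))) (μ.restrict T) :=
      ((hi1.const_mul _).sub (hi2.const_mul _)).integrableOn
    rw [integral_eq_lintegral_pos_part_sub_lintegral_neg_part hi3]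
    refine (ENNReal.ofReal_le_ofReal (sub_le_self _ ENNReal.toReal_nonneg)).trans ?_
    exact ENNReal.ofReal_toReal_le
  refine h3.trans ?_
  refine setLIntegral_mono' hT fun z hz => ENNReal.ofReal_le_ofReal ?_
  -- By `hB` the integrand is at most -κ²|a|² + 2κ|a|B, which is at most B² since (κ|a| - B)² ≥ 0.
  have h4 := hB z hz
  have h5 := sq_nonneg (κ * ‖a z‖ - B z)
  nlinarith [mul_le_mul_of_nonneg_left h4 hκ.le]

end Energy

end

section

/-! ### Scattering frames and changes of variables with bounded geometry -/

section Scaling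

/-- The coordinate space `ℝ × ℝᵈ`. -/
abbrev HE (d : ℕ) : Type := ℝ × E d

instance isAddHaarMeasure_volume (d : ℕ) : (volume : Measure (HE d)).IsAddHaarMeasure :=
  inferInstanceAs ((volume : Measure ℝ).prod (volume : Measure (E d))).IsAddHaarMeasure

variable {d : ℕ}

/-- The change from the coordinate frame to the scattering frame at distance `x`. -/
def sig (x : ℝ) : HE d →L[ℝ] HE d :=
  (x ^ 2 • ContinuousLinearMap.fst ℝ ℝ (E d)).prod (x • ContinuousLinearMap.snd ℝ ℝ (E d))

theorem sig_apply (x : ℝ) (w : HE d) : sig x w = (x ^ 2 * w.1, x • w.2) := rfl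

theorem sig_inv_sig {x : ℝ} (hx : x ≠ 0) (w : HE d) : sig x⁻¹ (sig x w) = w := by
  ext1
  · simp only [sig_apply]; field_simp
  · simp only [sig_apply, smul_smul, inv_mul_cancel₀ hx, one_smul]

theorem sig_sig_inv {x : ℝ} (hx : x ≠ 0) (w : HE d) : sig x (sig x⁻¹ w) = w := by
  simpa using sig_inv_sig (inv_ne_zero hx) w

theorem norm_sig_le {x X : ℝ} (hx : 0 < x) (hX : x ≤ X) (w : HE d) :
    ‖sig x w‖ ≤ x * (1 + X) * ‖w‖ := by
  have h1 := norm_fst_le w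
  have h2 := norm_snd_le w
  have h0 := norm_nonneg w
  rw [sig_apply, Prod.norm_def, max_le_iff]
  constructor
  · rw [norm_mul, Real.norm_eq_abs, abs_of_pos (by positivity)]
    calc x ^ 2 * ‖w.1‖ ≤ x ^ 2 * ‖w‖ := by gcongr
      _ = x * x * ‖w‖ := by ring
      _ ≤ _ := by gcongr; linarith
  · rw [norm_smul, Real.norm_eq_abs, abs_of_pos hx]
    calc x * ‖w.2‖ ≤ x * 1 * ‖w‖ := by rw [mul_one]; gcongr
      _ ≤ _ := by gcongr; linarith

theorem norm_sig_inv_le {x X : ℝ} (hx : 0 < x) (hX : x ≤ X) (w : HE d) :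
    ‖sig x⁻¹ w‖ ≤ (1 + X) / x ^ 2 * ‖w‖ := by
  have h1 := norm_fst_le w
  have h2 := norm_snd_le w
  have h0 := norm_nonneg w
  rw [sig_apply, Prod.norm_def, max_le_iff]
  constructor
  · rw [norm_mul, Real.norm_eq_abs, abs_of_pos (by positivity)]
    calc (x⁻¹) ^ 2 * ‖w.1‖ ≤ (x⁻¹) ^ 2 * ‖w‖ := by gcongr
      _ = 1 / x ^ 2 * ‖w‖ := by field_simp
      _ ≤ _ := by gcongr; linarith
  · rw [norm_smul, Real.norm_eq_abs, abs_of_pos (by positivity)]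
    calc x⁻¹ * ‖w.2‖ ≤ x⁻¹ * ‖w‖ := by gcongr
      _ = x / x ^ 2 * ‖w‖ := by field_simp
      _ ≤ _ := by gcongr; linarith

/-- The norm of a covector in the scattering frame. -/
def scN₁ (x : ℝ) (η : HE d →L[ℝ] ℂ) : ℝ := ‖η.comp (sig x)‖

/-- The norm of a bilinear form in the scattering frame. -/
def scN₂ (x : ℝ) (f : HE d →L[ℝ] HE d →L[ℝ] ℂ) : ℝ := ‖f.bilinearComp (sig x) (sig x)‖

theorem scN₁_nonneg (x : ℝ) (η : HE d →L[ℝ] ℂ) : 0 ≤ scN₁ x η := norm_nonneg _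

theorem scN₂_nonneg (x : ℝ) (f : HE d →L[ℝ] HE d →L[ℝ] ℂ) : 0 ≤ scN₂ x f :=
  norm_nonneg (f.bilinearComp (sig x) (sig x))

theorem norm_le_scN₁ {x : ℝ} (hx : x ≠ 0) (η : HE d →L[ℝ] ℂ) (h : HE d) :
    ‖η h‖ ≤ scN₁ x η * ‖sig x⁻¹ h‖ := by
  have := (η.comp (sig x)).le_opNorm (sig x⁻¹ h)
  rwa [ContinuousLinearMap.comp_apply, sig_sig_inv hx] at this

theorem norm_le_scN₂ {x : ℝ} (hx : x ≠ 0) (f : HE d →L[ℝ] HE d →L[ℝ] ℂ) (h h' : HE d) :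
    ‖f h h'‖ ≤ scN₂ x f * ‖sig x⁻¹ h‖ * ‖sig x⁻¹ h'‖ := by
  have := (f.bilinearComp (sig x) (sig x)).le_opNorm₂ (sig x⁻¹ h) (sig x⁻¹ h')
  rwa [ContinuousLinearMap.bilinearComp_apply, sig_sig_inv hx, sig_sig_inv hx] at this

/-- Scattering vectors are O(x) in coordinates, so a bounded bilinear map sends two of them to
something O(x²), which compensates the factor x⁻² lost by `sig x⁻¹`. Hence a connection smooth
across x = 0 is of order zero in scattering frames. -/
theorem norm_sig_inv_bilin_le {x X G : ℝ} (hx : 0 < x) (hX : x ≤ X)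
    {Γ : HE d →L[ℝ] HE d →L[ℝ] HE d} (hG : ‖Γ‖ ≤ G) (h h' : HE d) :
    ‖sig x⁻¹ (Γ h h')‖ ≤ G * (1 + X) ^ 3 * ‖sig x⁻¹ h‖ * ‖sig x⁻¹ h'‖ := by
  have h1 := norm_sig_inv_le hx hX (Γ h h')
  have h2 := Γ.le_opNorm₂ h h'
  have h3 := norm_sig_le hx hX (sig x⁻¹ h)
  have h4 := norm_sig_le hx hX (sig x⁻¹ h')
  rw [sig_sig_inv hx.ne'] at h3 h4
  have hX0 : 0 < X := hx.trans_le hX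
  have hG0 : 0 ≤ G := (norm_nonneg Γ).trans hG
  calc _ ≤ (1 + X) / x ^ 2 * (G * (x * (1 + X) * ‖sig x⁻¹ h‖) * (x * (1 + X) * ‖sig x⁻¹ h'‖)) := by
        refine h1.trans (mul_le_mul_of_nonneg_left (h2.trans ?_) (by positivity))
        gcongr
    _ = _ := by field_simp

theorem det_sig (x : ℝ) : (sig x : HE d →L[ℝ] HE d).det = x ^ (d + 2) := by
  have e : ((sig x : HE d →L[ℝ] HE d) : HE d →ₗ[ℝ] HE d)
      = LinearMap.prodMap (x ^ 2 • LinearMap.id) (x • LinearMap.id) := rfl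
  rw [ContinuousLinearMap.det, e, LinearMap.det_prodMap, LinearMap.det_smul, LinearMap.det_smul]
  simp
  ring

theorem exists_abs_det_le (H : Type*) [NormedAddCommGroup H] [NormedSpace ℝ H]
    [FiniteDimensional ℝ H] (C : ℝ) :
    ∃ K : ℝ, 0 < K ∧ ∀ P : H →L[ℝ] H, ‖P‖ ≤ C → |P.det| ≤ K := by
  obtain ⟨K, hK⟩ := (isCompact_closedBall (0 : H →L[ℝ] H) C).exists_bound_of_continuousOn
    (f := fun P => P.det) ContinuousLinearMap.continuous_det.continuousOn
  refine ⟨max K 1, by positivity, fun P hP => (hK P ?_).trans (le_max_left _ _)⟩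
  simpa using hP

/-- The determinant is continuous, hence bounded on bounded sets of operators. The second hypothesis
puts the inverse into such a set as well, which bounds the determinant from below. -/
theorem exists_abs_det_bounds (H : Type*) [NormedAddCommGroup H] [NormedSpace ℝ H]
    [FiniteDimensional ℝ H] (C : ℝ) :
    ∃ K : ℝ, 0 < K ∧ ∀ P : H →L[ℝ] H, (∀ w, ‖P w‖ ≤ C * ‖w‖) → (∀ w, ‖w‖ ≤ C * ‖P w‖) →
      |P.det| ≤ K ∧ 1 ≤ K * |P.det| := by
  obtain ⟨K, hK, h⟩ := exists_abs_det_le H (max C 0)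
  have hm : C ≤ max C 0 := le_max_left _ _
  refine ⟨K, hK, fun P h1 h2 => ⟨h P (P.opNorm_le_bound (le_max_right _ _) fun w =>
    (h1 w).trans (by gcongr)), ?_⟩⟩
  have hinj : Function.Injective (P : H →ₗ[ℝ] H) := by
    rw [injective_iff_map_eq_zero]
    intro w hw
    have := h2 w
    rw [show P w = 0 from hw, norm_zero, mul_zero] at this
    exact norm_le_zero_iff.1 this
  let L := LinearEquiv.ofInjectiveEndo (P : H →ₗ[ℝ] H) hinj
  let R : H →L[ℝ] H := LinearMap.toContinuousLinearMap (L.symm : H →ₗ[ℝ] H)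
  have hPR : ∀ w, P (R w) = w := fun w => L.apply_symm_apply w
  have hR : ‖R‖ ≤ max C 0 := R.opNorm_le_bound (le_max_right _ _) fun w => by
    have := h2 (R w)
    rw [hPR] at this
    exact this.trans (by gcongr)
  have hdet : P.det * R.det = 1 := by
    have e : P.comp R = ContinuousLinearMap.id ℝ H := by
      ext w; exact hPR w
    have := congrArg ContinuousLinearMap.det e
    simpa [ContinuousLinearMap.det] using this
  calc (1 : ℝ) = |R.det| * |P.det| := by rw [← abs_mul, mul_comm, hdet, abs_one]
    _ ≤ _ := by gcongr; exact h R hR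

/-- `φ` is, on `O`, a change of coordinates between a space with the Euclidean structure and a
coordinate space with the scattering structure, with uniform bounds up to the second order. -/
structure ScBounds (φ : HE d → HE d) (O : Set (HE d)) (C : ℝ) : Prop where
  pos : ∀ z ∈ O, 0 < (φ z).1
  upper : ∀ z ∈ O, ∀ w, ‖sig (φ z).1⁻¹ (fderiv ℝ φ z w)‖ ≤ C * ‖w‖
  lower : ∀ z ∈ O, ∀ w, ‖w‖ ≤ C * ‖sig (φ z).1⁻¹ (fderiv ℝ φ z w)‖
  second : ∀ z ∈ O, ∀ w w', ‖sig (φ z).1⁻¹ (fderiv ℝ (fderiv ℝ φ) z w w')‖ ≤ C * ‖w‖ * ‖w'‖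

variable {φ : HE d → HE d} {O : Set (HE d)} {C : ℝ}

/-- After composition with `sig x⁻¹` the derivative of `φ` is uniformly bounded with bounded
inverse, and `sig x` has determinant x^(d+2) = x^(n+1). So Lebesgue measure upstairs corresponds to
the scattering density. -/
theorem ScBounds.exists_det (h : ScBounds φ O C) : ∃ K : ℝ, 0 < K ∧ ∀ z ∈ O,
    |(fderiv ℝ φ z).det| ≤ K * (φ z).1 ^ (d + 2) ∧ (φ z).1 ^ (d + 2) ≤ K * |(fderiv ℝ φ z).det| := by
  obtain ⟨K, hK, hd⟩ := exists_abs_det_bounds (HE d) C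
  refine ⟨K, hK, fun z hz => ?_⟩
  have hx := h.pos z hz
  obtain ⟨h1, h2⟩ := hd ((sig (φ z).1⁻¹).comp (fderiv ℝ φ z)) (h.upper z hz) (h.lower z hz)
  have e : ((sig (φ z).1⁻¹).comp (fderiv ℝ φ z)).det
      = ((φ z).1 ^ (d + 2))⁻¹ * (fderiv ℝ φ z).det := by
    rw [← inv_pow, ← det_sig]
    simp [ContinuousLinearMap.det, LinearMap.det_comp]
  have hp : 0 < (φ z).1 ^ (d + 2) := by positivity
  rw [e, abs_mul, abs_of_pos (inv_pos.2 hp)] at h1 h2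
  constructor
  · rwa [inv_mul_le_iff₀ hp, mul_comm] at h1
  · rw [mul_left_comm, ← div_eq_inv_mul, le_div_iff₀ hp, one_mul] at h2
    exact h2

/-- Comparison of integrals under a change of coordinates with `ScBounds`. -/
theorem ScBounds.exists_lintegral (h : ScBounds φ O C) (hO : IsOpen O)
    (hd : DifferentiableOn ℝ φ O) (hinj : InjOn φ O) :
    ∃ K : NNReal, ∀ (s : Set (HE d)), MeasurableSet s → s ⊆ O → ∀ g : HE d → ℝ≥0∞,
      (∫⁻ q in φ '' s, ENNReal.ofReal (q.1 ^ (d + 2))⁻¹ * g q ≤ K * ∫⁻ z in s, g (φ z)) ∧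
      (∫⁻ z in s, g (φ z) ≤ K * ∫⁻ q in φ '' s, ENNReal.ofReal (q.1 ^ (d + 2))⁻¹ * g q) := by
  obtain ⟨K, hK, hdet⟩ := h.exists_det
  refine ⟨Real.toNNReal K, fun s hs hsO g => ?_⟩
  have key := lintegral_image_eq_lintegral_abs_det_fderiv_mul (volume : Measure (HE d)) hs
    (fun z hz => ((hd.differentiableAt (hO.mem_nhds (hsO hz))).hasFDerivAt).hasFDerivWithinAt)
    (hinj.mono hsO) (fun q => ENNReal.ofReal (q.1 ^ (d + 2))⁻¹ * g q)
  rw [key]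
  have hKe : ((Real.toNNReal K : NNReal) : ℝ≥0∞) = ENNReal.ofReal K := rfl
  rw [hKe, ← lintegral_const_mul' _ _ ENNReal.ofReal_ne_top,
    ← lintegral_const_mul' _ _ ENNReal.ofReal_ne_top]
  constructor
  · refine setLIntegral_mono' hs fun z hz => ?_
    obtain ⟨h1, -⟩ := hdet z (hsO hz)
    have hp : 0 < (φ z).1 ^ (d + 2) := pow_pos (h.pos z (hsO hz)) _
    rw [← mul_assoc, ← ENNReal.ofReal_mul (abs_nonneg _)]
    refine mul_le_mul_left (ENNReal.ofReal_le_ofReal ?_) _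
    rwa [← div_eq_mul_inv, div_le_iff₀ hp]
  · refine setLIntegral_mono' hs fun z hz => ?_
    obtain ⟨-, h1⟩ := hdet z (hsO hz)
    have hp : 0 < (φ z).1 ^ (d + 2) := pow_pos (h.pos z (hsO hz)) _
    rw [← mul_assoc, ← mul_assoc, ← ENNReal.ofReal_mul hK.le, ← ENNReal.ofReal_mul (by positivity)]
    refine le_mul_of_one_le_left' ?_
    rw [ENNReal.one_le_ofReal, ← div_eq_mul_inv, one_le_div hp]
    exact h1

end Scaling

/-! ### Pullbacks of covector fields and their derivatives -/

section Pullback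

variable {d : ℕ}

/-- The pullback under `φ` of the covector field `ψ v`. -/
def pullField (φ : HE d → HE d) (ψ : HE d → ℝ) (v : HE d → HE d →L[ℝ] ℂ) (z : HE d) :
    HE d →L[ℝ] ℂ :=
  ψ (φ z) • (v (φ z)).comp (fderiv ℝ φ z)

variable {φ : HE d → HE d} {ψ : HE d → ℝ} {v : HE d → HE d →L[ℝ] ℂ}

theorem fderiv_comp_covector {z : HE d} (hφ : ContDiffAt ℝ 2 φ z)
    (hv : DifferentiableAt ℝ v (φ z)) (w w' : HE d) :
    HasFDerivAt (fun z => (v (φ z)).comp (fderiv ℝ φ z))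
      (fderiv ℝ (fun z => (v (φ z)).comp (fderiv ℝ φ z)) z) z ∧
    fderiv ℝ (fun z => (v (φ z)).comp (fderiv ℝ φ z)) z w w'
      = fderiv ℝ v (φ z) (fderiv ℝ φ z w) (fderiv ℝ φ z w')
        + v (φ z) (fderiv ℝ (fderiv ℝ φ) z w w') := by
  have h1 : HasFDerivAt φ (fderiv ℝ φ z) z :=
    (hφ.differentiableAt (by norm_num)).hasFDerivAt
  have h2 : HasFDerivAt (fderiv ℝ φ) (fderiv ℝ (fderiv ℝ φ) z) z :=
    ((hφ.fderiv_right (m := 1) (by norm_num)).differentiableAt (by norm_num)).hasFDerivAt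
  have h3 : HasFDerivAt (fun z => v (φ z)) ((fderiv ℝ v (φ z)).comp (fderiv ℝ φ z)) z :=
    hv.hasFDerivAt.comp z h1
  have h4 := h3.clm_comp h2
  refine ⟨h4.differentiableAt.hasFDerivAt, ?_⟩
  rw [h4.fderiv]
  simp [add_comm]

theorem fderiv_pullField {z : HE d} (hφ : ContDiffAt ℝ 2 φ z)
    (hv : DifferentiableAt ℝ v (φ z)) (hψ : DifferentiableAt ℝ ψ (φ z)) (w w' : HE d) :
    fderiv ℝ (pullField φ ψ v) z w w'
      = (fderiv ℝ ψ (φ z) (fderiv ℝ φ z w)) * v (φ z) (fderiv ℝ φ z w')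
        + ψ (φ z) * (fderiv ℝ v (φ z) (fderiv ℝ φ z w) (fderiv ℝ φ z w')
          + v (φ z) (fderiv ℝ (fderiv ℝ φ) z w w')) := by
  have h1 : HasFDerivAt φ (fderiv ℝ φ z) z :=
    (hφ.differentiableAt (by norm_num)).hasFDerivAt
  have h3 : HasFDerivAt (fun z => ψ (φ z)) ((fderiv ℝ ψ (φ z)).comp (fderiv ℝ φ z)) z :=
    hψ.hasFDerivAt.comp z h1
  obtain ⟨h4, h5⟩ := fderiv_comp_covector hφ hv w w'
  have h6 : HasFDerivAt (pullField φ ψ v) _ z := h3.fun_smul h4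
  rw [h6.fderiv]
  simp only [add_apply, smul_apply, h5, ContinuousLinearMap.smulRight_apply,
    ContinuousLinearMap.comp_apply, Complex.real_smul]
  ring

theorem contDiff_indicator_of_isCompact {H F : Type*} [NormedAddCommGroup H] [NormedSpace ℝ H]
    [NormedAddCommGroup F] [NormedSpace ℝ F] {n : ℕ∞ω} {f : H → F} {O K : Set H} (hO : IsOpen O)
    (hf : ContDiffOn ℝ n f O) (hK : IsCompact K) (hKO : K ⊆ O) (h0 : ∀ z ∈ O, z ∉ K → f z = 0) :
    ContDiff ℝ n (O.indicator f) ∧ HasCompactSupport (O.indicator f) := by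
  have hz : ∀ z ∉ K, O.indicator f z = 0 := fun z hzK => by
    by_cases hzO : z ∈ O
    · rw [indicator_of_mem hzO, h0 z hzO hzK]
    · exact indicator_of_notMem hzO _
  refine ⟨contDiff_iff_contDiffAt.2 fun z => ?_, HasCompactSupport.intro hK hz⟩
  by_cases hzO : z ∈ O
  · refine (hf.contDiffAt (hO.mem_nhds hzO)).congr_of_eventuallyEq ?_
    filter_upwards [hO.mem_nhds hzO] with y hy
    exact indicator_of_mem hy _
  · refine (contDiffAt_const (c := (0 : F))).congr_of_eventuallyEq ?_
    filter_upwards [hK.isClosed.isOpen_compl.mem_nhds fun h => hzO (hKO h)] with y hy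
    exact hz y hy

end Pullback

end

/-! ### Adapted coordinates, weights and pointwise bounds -/

section

variable {d : ℕ}

/-- Coordinates adapted to the region `{0 < x, 0 < ρ}` in the open set `Q`: the change of coordinates
`φ` to the scattering structure turns the region into a set `T` (the whole space or a half-space) on
which Korn's inequality holds, and the constant vector fields `V k` span, point into `T` and increase
`x` at the rate at least `c x²`. -/
structure Adapted (ρ : HE d → ℝ) (Q : Set (HE d)) where
  φ : OpenPartialHomeomorph (HE d) (HE d)
  smooth : ContDiffOn ℝ ∞ φ φ.source
  target_eq : φ.target = Q ∩ {q | 0 < q.1}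
  T : Set (HE d)
  measurableSet_T : MeasurableSet T
  korn : KornOn volume T
  mem_T : ∀ z ∈ φ.source, z ∈ T ↔ 0 < ρ (φ z)
  C : ℝ
  C_nonneg : 0 ≤ C
  bounds : ScBounds φ φ.source C
  n : ℕ
  V : Fin n → HE d
  inward : ∀ k, Inward volume T (V k)
  span : ∀ η : HE d →L[ℝ] ℂ, ‖η‖ ^ 2 ≤ C * ∑ k, ‖η (V k)‖ ^ 2
  c : ℝ
  c_pos : 0 < c
  speed : ∀ z ∈ φ.source, ∀ k, c ≤ (fderiv ℝ φ z (V k)).1 / (φ z).1 ^ 2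

/-- The conjugated symmetric gradient of a covector field with respect to a connection `Γ`. -/
def bilinGrad (F : ℝ) (Γ : HE d → HE d →L[ℝ] HE d →L[ℝ] HE d) (v : HE d → HE d →L[ℝ] ℂ) (q : HE d)
    (w w' : HE d) : ℂ :=
  symPart (fderiv ℝ v q) w w' - v q (Γ q w w')
    - F / (2 * q.1 ^ 2) * (w.1 * v q w' + w'.1 * v q w)

/-- The weight functions, comparable to `x⁻ʳ`, whose logarithmic derivatives are bounded by `x⁻²`,
independently of `r` if `|r| ≤ M`. -/
def wt (r M : ℝ) (q : HE d) : ℝ := (q.1⁻¹ + M) ^ r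

theorem wt_pos {r M : ℝ} (hM : 1 ≤ M) {q : HE d} (hq : 0 < q.1) : 0 < wt r M q :=
  Real.rpow_pos_of_pos (by positivity) _

theorem contDiffAt_wt {r M : ℝ} (hM : 1 ≤ M) {q : HE d} (hq : 0 < q.1) {n : ℕ∞ω} :
    ContDiffAt ℝ n (wt r M) q := by
  have h : q.1⁻¹ + M ≠ 0 := by positivity
  exact ((contDiffAt_fst.inv hq.ne').add contDiffAt_const).rpow_const_of_ne h

theorem norm_sig_inv_fst_le (x : ℝ) (h : HE d) : |h.1 / x ^ 2| ≤ ‖sig x⁻¹ h‖ := by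
  refine le_trans (le_of_eq ?_) (norm_fst_le (sig x⁻¹ h))
  rw [sig_apply, Real.norm_eq_abs]
  congr 1
  rw [inv_pow, div_eq_inv_mul]

theorem abs_fderiv_wt_le {r M : ℝ} (hM : 1 ≤ M) (hr : |r| ≤ M) {q : HE d} (hq : 0 < q.1)
    (h : HE d) : |fderiv ℝ (wt r M) q h| ≤ wt r M q * ‖sig q.1⁻¹ h‖ := by
  have hp : 0 < q.1⁻¹ + M := by positivity
  have h1 : HasFDerivAt (fun q : HE d => q.1⁻¹ + M)
      (-(q.1 ^ 2)⁻¹ • ContinuousLinearMap.fst ℝ ℝ (E d)) q :=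
    ((hasDerivAt_inv hq.ne').comp_hasFDerivAt q hasFDerivAt_fst).add_const M
  have h2 := h1.rpow_const (p := r) (Or.inl hp.ne')
  have e : fderiv ℝ (wt r M) q h
      = wt r M q * (r / (q.1⁻¹ + M)) * (-(h.1 / q.1 ^ 2)) := by
    have : HasFDerivAt (wt r M) _ q := h2
    rw [this.fderiv]
    simp only [smul_apply, ContinuousLinearMap.coe_fst', smul_eq_mul, wt, Real.rpow_sub_one hp.ne']
    ring
  rw [e, abs_mul, abs_mul, abs_of_pos (wt_pos hM hq), abs_neg, abs_div, abs_of_pos hp]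
  have h3 : |r| / (q.1⁻¹ + M) ≤ 1 := by
    rw [div_le_one hp]
    have : 0 < q.1⁻¹ := by positivity
    linarith
  have h4 := norm_sig_inv_fst_le q.1 h
  have h5 := (wt_pos (r := r) hM hq).le
  calc _ ≤ wt r M q * 1 * ‖sig q.1⁻¹ h‖ := by gcongr
    _ = _ := by ring

/-- A cutoff function times the weight has a bounded logarithmic scattering derivative. -/
theorem abs_fderiv_mul_wt_le {χ : HE d → ℝ} {X K : ℝ} (hχ : Differentiable ℝ χ)
    (h1 : ∀ q, |χ q| ≤ 1) (hK : ∀ q, ‖fderiv ℝ χ q‖ ≤ K) {r M : ℝ} (hM : 1 ≤ M) (hr : |r| ≤ M)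
    {q : HE d} (hq : 0 < q.1) (hX : q.1 ≤ X) (h : HE d) :
    |fderiv ℝ (fun q => χ q * wt r M q) q h|
      ≤ (K * (X * (1 + X)) + 1) * wt r M q * ‖sig q.1⁻¹ h‖ := by
  have h2 : HasFDerivAt (fun q => χ q * wt r M q) _ q :=
    (hχ q).hasFDerivAt.mul ((contDiffAt_wt (n := 1) hM hq).differentiableAt (by norm_num)).hasFDerivAt
  rw [h2.fderiv]
  simp only [add_apply, smul_apply, smul_eq_mul]
  have h3 := abs_fderiv_wt_le hM hr hq h
  have h4 : |fderiv ℝ χ q h| ≤ K * (X * (1 + X) * ‖sig q.1⁻¹ h‖) := by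
    refine ((fderiv ℝ χ q).le_opNorm h).trans ?_
    have h5 := norm_sig_le hq hX (sig q.1⁻¹ h)
    rw [sig_sig_inv hq.ne'] at h5
    have hX0 : 0 < X := hq.trans_le hX
    have h6 : ‖h‖ ≤ X * (1 + X) * ‖sig q.1⁻¹ h‖ := h5.trans (by gcongr)
    have := hK q
    exact mul_le_mul this h6 (norm_nonneg _) ((norm_nonneg _).trans this)
  have h5 := (wt_pos (r := r) hM hq).le
  refine (abs_add_le _ _).trans ?_
  rw [abs_mul, abs_mul, abs_of_nonneg h5]
  calc _ ≤ 1 * (wt r M q * ‖sig q.1⁻¹ h‖) + wt r M q * (K * (X * (1 + X) * ‖sig q.1⁻¹ h‖)) := by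
        gcongr
        exact h1 q
    _ = _ := by ring

section Pointwise

variable {φ : HE d → HE d} {O : Set (HE d)} {C : ℝ} {ψ : HE d → ℝ} {v : HE d → HE d →L[ℝ] ℂ}

theorem ScBounds.norm_pull_le (h : ScBounds φ O C) {z : HE d} (hz : z ∈ O) (η : HE d →L[ℝ] ℂ)
    (w : HE d) : ‖η (fderiv ℝ φ z w)‖ ≤ scN₁ (φ z).1 η * (C * ‖w‖) := by
  refine (norm_le_scN₁ (h.pos z hz).ne' η _).trans ?_
  exact mul_le_mul_of_nonneg_left (h.upper z hz w) (scN₁_nonneg _ _)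

/-- The symmetric gradient of a pulled back covector field is, up to the effect of the conjugation,
of order zero in terms of the scattering norms. -/
theorem ScBounds.norm_symPart_sub_le (h : ScBounds φ O C) (hC : 0 ≤ C) {z : HE d} (hz : z ∈ O)
    (hφ : ContDiffAt ℝ 2 φ z) (hv : DifferentiableAt ℝ v (φ z)) (hψ : DifferentiableAt ℝ ψ (φ z))
    {X G K m : ℝ} (hX : (φ z).1 ≤ X) {Γ : HE d → HE d →L[ℝ] HE d →L[ℝ] HE d}
    (hΓ : ‖Γ (φ z)‖ ≤ G) (hm : |ψ (φ z)| ≤ m) (hK : 0 ≤ K)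
    (hψ' : ∀ w, |fderiv ℝ ψ (φ z) w| ≤ K * m * ‖sig (φ z).1⁻¹ w‖) {F : ℝ}
    {f : HE d →L[ℝ] HE d →L[ℝ] ℂ} (hf : ∀ w w', f w w' = bilinGrad F Γ v (φ z) w w') (w w' : HE d) :
    ‖symPart (fderiv ℝ (pullField φ ψ v) z) w w'
        - F / 2 * (((fderiv ℝ φ z w).1 / (φ z).1 ^ 2 : ℝ) * pullField φ ψ v z w'
          + ((fderiv ℝ φ z w').1 / (φ z).1 ^ 2 : ℝ) * pullField φ ψ v z w)‖
      ≤ ((K + 1 + G * (1 + X) ^ 3) * C ^ 2 + C) * m *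
        (scN₁ (φ z).1 (v (φ z)) + scN₂ (φ z).1 f) * ‖w‖ * ‖w'‖ := by
  set x := (φ z).1 with hxdef
  have hx : 0 < x := h.pos z hz
  set A := fderiv ℝ φ z with hA
  set n₁ := scN₁ x (v (φ z)) with hn₁
  set n₂ := scN₂ x f with hn₂
  have hn₁0 : 0 ≤ n₁ := scN₁_nonneg _ _
  have hn₂0 : 0 ≤ n₂ := scN₂_nonneg _ _
  have hm0 : 0 ≤ m := (abs_nonneg _).trans hm
  have hG0 : 0 ≤ G := (norm_nonneg _).trans hΓ
  have hX0 : 0 < X := hx.trans_le hX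
  have hAw : ∀ w, ‖sig x⁻¹ (A w)‖ ≤ C * ‖w‖ := h.upper z hz
  -- Solving the definition of `bilinGrad` for the symmetric derivative of `v` leaves `f`, terms in
  -- which `v` is not differentiated, and the conjugation term. The latter is exactly the one
  -- subtracted on the left.
  have e : symPart (fderiv ℝ (pullField φ ψ v) z) w w'
        - F / 2 * (((A w).1 / x ^ 2 : ℝ) * pullField φ ψ v z w'
          + ((A w').1 / x ^ 2 : ℝ) * pullField φ ψ v z w)
      = (1 / 2) * ((fderiv ℝ ψ (φ z) (A w) : ℂ) * v (φ z) (A w')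
          + (fderiv ℝ ψ (φ z) (A w') : ℂ) * v (φ z) (A w))
        + ψ (φ z) * (f (A w) (A w') + v (φ z) (Γ (φ z) (A w) (A w'))
          + (1 / 2) * (v (φ z) (fderiv ℝ (fderiv ℝ φ) z w w')
            + v (φ z) (fderiv ℝ (fderiv ℝ φ) z w' w))) := by
    rw [symPart_apply, fderiv_pullField hφ hv hψ, fderiv_pullField hφ hv hψ, hf, bilinGrad,
      symPart_apply]
    simp only [pullField, smul_apply, ContinuousLinearMap.comp_apply, Complex.real_smul, ← hA,
      ← hxdef]
    push_cast
    have hxc : (x : ℂ) ≠ 0 := by exact_mod_cast hx.ne'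
    field_simp
    ring
  rw [e]
  have b1 : ∀ w w', ‖(fderiv ℝ ψ (φ z) (A w) : ℂ) * v (φ z) (A w')‖
      ≤ K * C ^ 2 * m * n₁ * ‖w‖ * ‖w'‖ := fun w w' => by
    rw [norm_mul, Complex.norm_real, Real.norm_eq_abs]
    calc _ ≤ (K * m * (C * ‖w‖)) * (n₁ * (C * ‖w'‖)) := by
          refine mul_le_mul ((hψ' _).trans ?_) (h.norm_pull_le hz _ _) (norm_nonneg _)
            (by positivity)
          exact mul_le_mul_of_nonneg_left (hAw w) (by positivity)
      _ = _ := by ring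
  have b2 : ‖f (A w) (A w')‖ ≤ C ^ 2 * n₂ * ‖w‖ * ‖w'‖ := by
    calc _ ≤ n₂ * ‖sig x⁻¹ (A w)‖ * ‖sig x⁻¹ (A w')‖ := norm_le_scN₂ hx.ne' _ _ _
      _ ≤ n₂ * (C * ‖w‖) * (C * ‖w'‖) := by gcongr <;> exact hAw _
      _ = _ := by ring
  have b3 : ‖v (φ z) (Γ (φ z) (A w) (A w'))‖ ≤ G * (1 + X) ^ 3 * C ^ 2 * n₁ * ‖w‖ * ‖w'‖ := by
    calc _ ≤ n₁ * ‖sig x⁻¹ (Γ (φ z) (A w) (A w'))‖ := norm_le_scN₁ hx.ne' _ _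
      _ ≤ n₁ * (G * (1 + X) ^ 3 * ‖sig x⁻¹ (A w)‖ * ‖sig x⁻¹ (A w')‖) :=
          mul_le_mul_of_nonneg_left (norm_sig_inv_bilin_le hx hX hΓ _ _) hn₁0
      _ ≤ n₁ * (G * (1 + X) ^ 3 * (C * ‖w‖) * (C * ‖w'‖)) := by gcongr <;> exact hAw _
      _ = _ := by ring
  have b4 : ∀ w w', ‖v (φ z) (fderiv ℝ (fderiv ℝ φ) z w w')‖ ≤ C * n₁ * ‖w‖ * ‖w'‖ := fun w w' => by
    calc _ ≤ n₁ * ‖sig x⁻¹ (fderiv ℝ (fderiv ℝ φ) z w w')‖ := norm_le_scN₁ hx.ne' _ _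
      _ ≤ n₁ * (C * ‖w‖ * ‖w'‖) := mul_le_mul_of_nonneg_left (h.second z hz w w') hn₁0
      _ = _ := by ring
  have b5 : ‖f (A w) (A w') + v (φ z) (Γ (φ z) (A w) (A w'))
          + (1 / 2) * (v (φ z) (fderiv ℝ (fderiv ℝ φ) z w w')
            + v (φ z) (fderiv ℝ (fderiv ℝ φ) z w' w))‖
      ≤ (C ^ 2 * n₂ + G * (1 + X) ^ 3 * C ^ 2 * n₁ + C * n₁) * ‖w‖ * ‖w'‖ := by
    refine (norm_add₃_le).trans ?_
    have h6 : ‖(1 / 2 : ℂ) * (v (φ z) (fderiv ℝ (fderiv ℝ φ) z w w')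
            + v (φ z) (fderiv ℝ (fderiv ℝ φ) z w' w))‖ ≤ C * n₁ * ‖w‖ * ‖w'‖ := by
      rw [norm_mul]
      have h7 := norm_add_le (v (φ z) (fderiv ℝ (fderiv ℝ φ) z w w'))
        (v (φ z) (fderiv ℝ (fderiv ℝ φ) z w' w))
      have h8 := b4 w w'
      have h9 := b4 w' w
      norm_num
      nlinarith
    calc _ ≤ C ^ 2 * n₂ * ‖w‖ * ‖w'‖ + G * (1 + X) ^ 3 * C ^ 2 * n₁ * ‖w‖ * ‖w'‖
          + C * n₁ * ‖w‖ * ‖w'‖ := by gcongr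
      _ = _ := by ring
  have b6 : ‖(1 / 2 : ℂ) * ((fderiv ℝ ψ (φ z) (A w) : ℂ) * v (φ z) (A w')
          + (fderiv ℝ ψ (φ z) (A w') : ℂ) * v (φ z) (A w))‖
      ≤ K * C ^ 2 * m * n₁ * ‖w‖ * ‖w'‖ := by
    rw [norm_mul]
    have h7 := norm_add_le ((fderiv ℝ ψ (φ z) (A w) : ℂ) * v (φ z) (A w'))
      ((fderiv ℝ ψ (φ z) (A w') : ℂ) * v (φ z) (A w))
    have h8 := b1 w w'
    have h9 := b1 w' w
    norm_num at h7 h8 h9 ⊢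
    nlinarith
  refine (norm_add_le _ _).trans ?_
  rw [norm_mul (ψ (φ z) : ℂ), Complex.norm_real, Real.norm_eq_abs]
  calc _ ≤ K * C ^ 2 * m * n₁ * ‖w‖ * ‖w'‖
        + m * ((C ^ 2 * n₂ + G * (1 + X) ^ 3 * C ^ 2 * n₁ + C * n₁) * ‖w‖ * ‖w'‖) := by gcongr
    _ = (K * C ^ 2 * n₁ + (C ^ 2 * n₂ + G * (1 + X) ^ 3 * C ^ 2 * n₁ + C * n₁))
        * m * ‖w‖ * ‖w'‖ := by ring
    _ ≤ (((K + 1 + G * (1 + X) ^ 3) * C ^ 2 + C) * (n₁ + n₂)) * m * ‖w‖ * ‖w'‖ := by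
        gcongr
        have : 0 ≤ (K + G * (1 + X) ^ 3) * C ^ 2 * n₂ + C * n₂ + C ^ 2 * n₁ := by positivity
        linarith
    _ = _ := by ring

/-- The scattering norm of a covector is controlled by its pullback. -/
theorem ScBounds.scN₁_le (h : ScBounds φ O C) (hC : 0 ≤ C) {z : HE d} (hz : z ∈ O)
    (hA : Function.Surjective (fderiv ℝ φ z)) (η : HE d →L[ℝ] ℂ) :
    scN₁ (φ z).1 η ≤ C * ‖η.comp (fderiv ℝ φ z)‖ := by
  refine ContinuousLinearMap.opNorm_le_bound _ (by positivity) fun a => ?_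
  obtain ⟨w, hw⟩ := hA (sig (φ z).1 a)
  have h1 := h.lower z hz w
  rw [hw, sig_inv_sig (h.pos z hz).ne'] at h1
  rw [ContinuousLinearMap.comp_apply, ← hw]
  calc _ ≤ ‖η.comp (fderiv ℝ φ z)‖ * ‖w‖ := (η.comp (fderiv ℝ φ z)).le_opNorm w
    _ ≤ ‖η.comp (fderiv ℝ φ z)‖ * (C * ‖a‖) := by gcongr
    _ = _ := by ring

theorem ScBounds.scN₂_le (h : ScBounds φ O C) (hC : 0 ≤ C) {z : HE d} (hz : z ∈ O)
    (hA : Function.Surjective (fderiv ℝ φ z)) (f : HE d →L[ℝ] HE d →L[ℝ] ℂ) {N : ℝ} (hN : 0 ≤ N)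
    (hf : ∀ w w', ‖f (fderiv ℝ φ z w) (fderiv ℝ φ z w')‖ ≤ N * ‖w‖ * ‖w'‖) :
    scN₂ (φ z).1 f ≤ C ^ 2 * N := by
  refine ContinuousLinearMap.opNorm_le_bound₂ _ (by positivity) fun a a' => ?_
  obtain ⟨w, hw⟩ := hA (sig (φ z).1 a)
  obtain ⟨w', hw'⟩ := hA (sig (φ z).1 a')
  have h1 := h.lower z hz w
  have h2 := h.lower z hz w'
  rw [hw, sig_inv_sig (h.pos z hz).ne'] at h1
  rw [hw', sig_inv_sig (h.pos z hz).ne'] at h2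
  rw [ContinuousLinearMap.bilinearComp_apply, ← hw, ← hw']
  calc _ ≤ N * ‖w‖ * ‖w'‖ := hf w w'
    _ ≤ N * (C * ‖a‖) * (C * ‖a'‖) := by gcongr
    _ = _ := by ring

theorem ScBounds.surjective (h : ScBounds φ O C) {z : HE d} (hz : z ∈ O) :
    Function.Surjective (fderiv ℝ φ z) := by
  have hinj : Function.Injective (fderiv ℝ φ z : HE d →ₗ[ℝ] HE d) := by
    rw [injective_iff_map_eq_zero]
    intro w hw
    have := h.lower z hz w
    rw [show fderiv ℝ φ z w = 0 from hw, map_zero, norm_zero, mul_zero] at this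
    exact norm_le_zero_iff.1 this
  exact LinearMap.injective_iff_surjective.1 hinj

end Pointwise

end

/-! ### Local weighted estimates in adapted coordinates -/

section

variable {d : ℕ}

theorem natCast_le_infty (n : ℕ) : (n : ℕ∞ω) ≤ ((⊤ : ℕ∞) : ℕ∞ω) := by
  exact_mod_cast (le_top : (n : ℕ∞) ≤ ⊤)

/-- `χ` is a cutoff function supported in the open set `L` and equal to `1` on the open set `U`. -/
structure IsCutoff (L U : Set (HE d)) (χ : HE d → ℝ) : Prop where
  isOpen_L : IsOpen L
  isOpen_U : IsOpen U
  smooth : ContDiff ℝ ∞ χ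
  compact : HasCompactSupport χ
  support : tsupport χ ⊆ L
  abs_le : ∀ q, |χ q| ≤ 1
  eq_one : ∀ q ∈ U, χ q = 1

theorem IsCutoff.subset {L U : Set (HE d)} {χ : HE d → ℝ} (h : IsCutoff L U χ) : U ⊆ L :=
  fun q hq => h.support (subset_tsupport _ (by simp [Function.mem_support, h.eq_one q hq]))

/-- `v` is smooth on `Q ∩ {0 < x}`, vanishes near `x = 0` over `L`, and its conjugated symmetric
gradient is `f`. -/
structure FieldOn (Q L : Set (HE d)) (F : ℝ) (Γ : HE d → HE d →L[ℝ] HE d →L[ℝ] HE d)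
    (v : HE d → HE d →L[ℝ] ℂ) (f : HE d → HE d →L[ℝ] HE d →L[ℝ] ℂ) : Prop where
  smooth : ContDiffOn ℝ ∞ v (Q ∩ {q | 0 < q.1})
  compact : ∃ B, IsCompact B ∧ B ⊆ Q ∩ {q | 0 < q.1} ∧ ∀ q ∈ L, 0 < q.1 → q ∉ B → v q = 0
  grad : ∀ q ∈ L, 0 < q.1 → ∀ w w', f q w w' = bilinGrad F Γ v q w w'

namespace Adapted

variable {ρ : HE d → ℝ} {Q L U : Set (HE d)} {χ : HE d → ℝ}
  {Γ : HE d → HE d →L[ℝ] HE d →L[ℝ] HE d} {F : ℝ} {v : HE d → HE d →L[ℝ] ℂ}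
  {f : HE d → HE d →L[ℝ] HE d →L[ℝ] ℂ} {r M : ℝ} (a : Adapted ρ Q)

/-- The weighted and cut off covector field in the adapted coordinates, extended by zero. -/
def field (χ : HE d → ℝ) (r M : ℝ) (v : HE d → HE d →L[ℝ] ℂ) : HE d → HE d →L[ℝ] ℂ :=
  a.φ.source.indicator (pullField a.φ (fun q => χ q * wt r M q) v)

/-- The part of the adapted coordinate space over `L`. -/
def above (L : Set (HE d)) : Set (HE d) := a.φ.source ∩ a.φ ⁻¹' L

theorem isOpen_above (hL : IsOpen L) : IsOpen (a.above L) := a.φ.isOpen_inter_preimage hL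

theorem map_mem {z : HE d} (hz : z ∈ a.φ.source) : a.φ z ∈ Q ∩ {q | 0 < q.1} := by
  rw [← a.target_eq]
  exact a.φ.map_source hz

/-- Over `L` the field vanishes outside a compact subset of {x > 0}, and the cutoff is supported in
`L`. So the pulled back field vanishes off a compact subset of the source and stays smooth when
extended by zero, which makes Korn's inequality and the energy estimate applicable. -/
theorem field_spec (hc : IsCutoff L U χ) (hM : 1 ≤ M) (h : FieldOn Q L F Γ v f) :
    ContDiff ℝ 3 (a.field χ r M v) ∧ HasCompactSupport (a.field χ r M v) ∧
      (∀ z ∉ a.above L, a.field χ r M v z = 0 ∧ fderiv ℝ (a.field χ r M v) z = 0) ∧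
      ∀ z ∈ a.φ.source, a.field χ r M v z = pullField a.φ (fun q => χ q * wt r M q) v z ∧
        fderiv ℝ (a.field χ r M v) z
          = fderiv ℝ (pullField a.φ (fun q => χ q * wt r M q) v) z := by
  obtain ⟨B, hB, hBQ, hB0⟩ := h.compact
  set K := a.φ.symm '' (B ∩ tsupport χ) with hK
  have hBt : B ∩ tsupport χ ⊆ a.φ.target := fun q hq => by rw [a.target_eq]; exact hBQ hq.1
  have hKc : IsCompact K := (hB.inter_right (isClosed_tsupport χ)).image_of_continuousOn
    (a.φ.continuousOn_symm.mono hBt)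
  have hKO : K ⊆ a.above L := by
    rintro _ ⟨q, hq, rfl⟩
    refine ⟨a.φ.map_target (hBt hq), ?_⟩
    rw [mem_preimage, a.φ.right_inv (hBt hq)]
    exact hc.support hq.2
  have h0 : ∀ z ∈ a.φ.source, z ∉ K → pullField a.φ (fun q => χ q * wt r M q) v z = 0 := by
    intro z hz hzK
    by_cases h1 : a.φ z ∈ tsupport χ
    · have h2 : a.φ z ∉ B := fun h2 => hzK ⟨a.φ z, ⟨h2, h1⟩, a.φ.left_inv hz⟩
      have h3 := hB0 _ (hc.support h1) (a.map_mem hz).2 h2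
      simp [pullField, h3]
    · simp [pullField, image_eq_zero_of_notMem_tsupport h1]
  have hsm : ContDiffOn ℝ 3 (pullField a.φ (fun q => χ q * wt r M q) v) a.φ.source := by
    have hφ3 : ContDiffOn ℝ 3 a.φ a.φ.source := a.smooth.of_le (natCast_le_infty 3)
    have hmaps : MapsTo a.φ a.φ.source (Q ∩ {q | 0 < q.1}) := fun z hz => a.map_mem hz
    have hψ : ContDiffOn ℝ 3 (fun q => χ q * wt r M q) (Q ∩ {q | 0 < q.1}) := fun q hq =>
      ((hc.smooth.contDiffAt.of_le (natCast_le_infty 3)).mul (contDiffAt_wt hM hq.2)).contDiffWithinAt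
    have hD : ContDiffOn ℝ 3 (fderiv ℝ a.φ) a.φ.source :=
      a.smooth.fderiv_of_isOpen a.φ.open_source (natCast_le_infty 4)
    exact (hψ.comp hφ3 hmaps).smul
      (((h.smooth.of_le (natCast_le_infty 3)).comp hφ3 hmaps).clm_comp hD)
  obtain ⟨hs, hcs⟩ := contDiff_indicator_of_isCompact a.φ.open_source hsm hKc
    (fun z hz => (hKO hz).1) h0
  refine ⟨hs, hcs, fun z hz => ?_, fun z hz => ⟨indicator_of_mem hz _, ?_⟩⟩
  · have e : a.field χ r M v =ᶠ[𝓝 z] fun _ => 0 := by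
      filter_upwards [hKc.isClosed.isOpen_compl.mem_nhds fun h => hz (hKO h)] with y hy
      by_cases hyO : y ∈ a.φ.source
      · rw [field, indicator_of_mem hyO, h0 y hyO hy]
      · exact indicator_of_notMem hyO _
    refine ⟨e.self_of_nhds, ?_⟩
    rw [e.fderiv_eq]
    simp
  · refine Filter.EventuallyEq.fderiv_eq ?_
    filter_upwards [a.φ.open_source.mem_nhds hz] with y hy
    exact indicator_of_mem hy _

/-- The weighted pointwise squares of the scattering norms of a covector field and its gradient. -/
def dens (r M : ℝ) (v : HE d → HE d →L[ℝ] ℂ) (f : HE d → HE d →L[ℝ] HE d →L[ℝ] ℂ) (q : HE d) : ℝ :=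
  wt r M q ^ 2 * (scN₁ q.1 (v q) ^ 2 + scN₂ q.1 (f q) ^ 2)

/-- The point is the order of quantifiers: `K` and `C₁` are fixed before F, r and M. They depend on
the cutoff, the connection and the coordinates only, because the logarithmic derivative of the
weight is at most 1 as soon as M ≥ |r|. -/
theorem exists_norm_symPart_le (hc : IsCutoff L U χ) (hQ : IsOpen Q) {X G : ℝ}
    (hX : ∀ q ∈ Q, q.1 ≤ X) (hΓ : ∀ q ∈ L, ‖Γ q‖ ≤ G) :
    ∃ K C₁ : ℝ, 0 ≤ K ∧ 0 ≤ C₁ ∧ ∀ (F r M : ℝ) v f, 1 ≤ M → |r| ≤ M → FieldOn Q L F Γ v f →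
      ∀ z ∈ a.above L,
      (∀ w, |fderiv ℝ (fun q => χ q * wt r M q) (a.φ z) w|
        ≤ K * wt r M (a.φ z) * ‖sig (a.φ z).1⁻¹ w‖) ∧
      ∀ w w',
      ‖symPart (fderiv ℝ (a.field χ r M v) z) w w'
        - F / 2 * (((fderiv ℝ a.φ z w).1 / (a.φ z).1 ^ 2 : ℝ) * a.field χ r M v z w'
          + ((fderiv ℝ a.φ z w').1 / (a.φ z).1 ^ 2 : ℝ) * a.field χ r M v z w)‖
      ≤ C₁ * wt r M (a.φ z) *
        (scN₁ (a.φ z).1 (v (a.φ z)) + scN₂ (a.φ z).1 (f (a.φ z))) * ‖w‖ * ‖w'‖ := by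
  obtain ⟨K₀, hK₀⟩ := (hc.compact.fderiv (𝕜 := ℝ)).exists_bound_of_continuous
    (hc.smooth.continuous_fderiv (by simp))
  have hK₀0 : 0 ≤ K₀ := (norm_nonneg _).trans (hK₀ 0)
  set X' := max X 0
  set G' := max G 0
  set K := K₀ * (X' * (1 + X')) + 1 with hKdef
  have hX'0 : 0 ≤ X' := le_max_right _ _
  have hG'0 : 0 ≤ G' := le_max_right _ _
  have hC := a.C_nonneg
  refine ⟨K, (K + 1 + G' * (1 + X') ^ 3) * a.C ^ 2 + a.C, by positivity, by positivity,
    fun F r M v f hM hr h z hz => ?_⟩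
  obtain ⟨-, -, -, hfield⟩ := a.field_spec (r := r) hc hM h
  obtain ⟨e1, e2⟩ := hfield z hz.1
  have hq := a.map_mem hz.1
  have hX' : (a.φ z).1 ≤ X' := (hX _ hq.1).trans (le_max_left _ _)
  have hψ' := abs_fderiv_mul_wt_le (X := X') (hc.smooth.differentiable (by simp)) hc.abs_le hK₀ hM
    hr hq.2 hX'
  refine ⟨hψ', ?_⟩
  rw [e1, e2]
  refine a.bounds.norm_symPart_sub_le hC hz.1
    ((a.smooth.contDiffAt (a.φ.open_source.mem_nhds hz.1)).of_le (natCast_le_infty 2)) ?_ ?_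
    hX' ((hΓ _ hz.2).trans (le_max_left _ _)) ?_ (by positivity) hψ' (h.grad _ hz.2 hq.2)
  · exact (h.smooth.contDiffAt ((hQ.inter (isOpen_lt continuous_const continuous_fst)).mem_nhds
      hq)).differentiableAt (by simp)
  · exact (hc.smooth.differentiable (by simp) _).mul
      ((contDiffAt_wt (n := 1) hM hq.2).differentiableAt (by norm_num))
  · rw [abs_mul, abs_of_pos (wt_pos hM hq.2)]
    exact mul_le_of_le_one_left (wt_pos hM hq.2).le (hc.abs_le _)

/-- The region in coordinates. -/
def pos (ρ : HE d → ℝ) : Set (HE d) := {q | 0 < q.1 ∧ 0 < ρ q}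

theorem image_above (hLQ : L ⊆ Q) : a.φ '' (a.above L ∩ a.T) = L ∩ pos ρ := by
  ext q
  constructor
  · rintro ⟨z, ⟨⟨hz, hzL⟩, hzT⟩, rfl⟩
    exact ⟨hzL, (a.map_mem hz).2, (a.mem_T z hz).1 hzT⟩
  · rintro ⟨hq, hx, hρ⟩
    have ht : q ∈ a.φ.target := by rw [a.target_eq]; exact ⟨hLQ hq, hx⟩
    refine ⟨a.φ.symm q, ⟨⟨a.φ.map_target ht, ?_⟩, ?_⟩, a.φ.right_inv ht⟩
    · rw [mem_preimage, a.φ.right_inv ht]; exact hq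
    · rw [a.mem_T _ (a.φ.map_target ht), a.φ.right_inv ht]; exact hρ

theorem exists_lintegral (a : Adapted ρ Q) :
    ∃ K : NNReal, ∀ L : Set (HE d), IsOpen L → L ⊆ Q → ∀ g : HE d → ℝ≥0∞,
      (∫⁻ q in L ∩ pos ρ, ENNReal.ofReal (q.1 ^ (d + 2))⁻¹ * g q
        ≤ K * ∫⁻ z in a.above L ∩ a.T, g (a.φ z)) ∧
      (∫⁻ z in a.above L ∩ a.T, g (a.φ z)
        ≤ K * ∫⁻ q in L ∩ pos ρ, ENNReal.ofReal (q.1 ^ (d + 2))⁻¹ * g q) := by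
  obtain ⟨K, hK⟩ := a.bounds.exists_lintegral a.φ.open_source
    (a.smooth.differentiableOn (by simp)) a.φ.injOn
  refine ⟨K, fun L hL hLQ g => ?_⟩
  have := hK (a.above L ∩ a.T) ((a.isOpen_above hL).measurableSet.inter a.measurableSet_T)
    (fun z hz => hz.1.1) g
  rwa [a.image_above hLQ] at this

/-- Integrals in adapted coordinates of squares of functions of order zero. -/
theorem exists_lintegral_le (hL : IsOpen L) (hLQ : L ⊆ Q) :
    ∃ K : NNReal, ∀ (r M : ℝ) v f (B : HE d → ℝ) (c : ℝ), (∀ z ∉ a.above L, B z = 0) →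
      (∀ z ∈ a.above L, |B z| ≤ c * wt r M (a.φ z) *
        (scN₁ (a.φ z).1 (v (a.φ z)) + scN₂ (a.φ z).1 (f (a.φ z)))) →
      ∫⁻ z in a.T, ENNReal.ofReal (B z ^ 2) ≤ ENNReal.ofReal (2 * c ^ 2) * (K *
        ∫⁻ q in L ∩ pos ρ, ENNReal.ofReal (q.1 ^ (d + 2))⁻¹ * ENNReal.ofReal (dens r M v f q)) := by
  obtain ⟨K, hK⟩ := a.exists_lintegral
  refine ⟨K, fun r M v f B c h0 h1 => ?_⟩
  have e : ∀ z, ENNReal.ofReal (B z ^ 2)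
      ≤ (a.above L).indicator (fun z => ENNReal.ofReal (2 * c ^ 2) *
        ENNReal.ofReal (dens r M v f (a.φ z))) z := by
    intro z
    by_cases hz : z ∈ a.above L
    · rw [indicator_of_mem hz, ← ENNReal.ofReal_mul (by positivity)]
      refine ENNReal.ofReal_le_ofReal ?_
      rw [← sq_abs]
      refine (pow_le_pow_left₀ (abs_nonneg _) (h1 z hz) 2).trans ?_
      rw [dens]
      have := add_sq_le (a := scN₁ (a.φ z).1 (v (a.φ z))) (b := scN₂ (a.φ z).1 (f (a.φ z)))
      rw [mul_pow, mul_pow]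
      have h2 : 0 ≤ c ^ 2 * wt r M (a.φ z) ^ 2 := by positivity
      nlinarith [mul_le_mul_of_nonneg_left this h2]
    · simp [h0 z hz]
  refine (lintegral_mono e).trans ?_
  rw [setLIntegral_indicator (a.isOpen_above hL).measurableSet,
    lintegral_const_mul' _ _ ENNReal.ofReal_ne_top]
  exact mul_le_mul_right (hK L hL hLQ fun q => ENNReal.ofReal (dens r M v f q)).2 _

theorem inner_re_le {x y : ℂ} {s : ℝ} : s * ‖x‖ ^ 2 - ‖x‖ * ‖y - s * x‖ ≤ inner ℝ x y := by
  have e : y = (s : ℝ) • x + (y - s * x) := by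
    rw [Complex.real_smul]; ring
  have h := abs_real_inner_le_norm x (y - s * x)
  have h2 : inner ℝ x y = s * ‖x‖ ^ 2 + inner ℝ x (y - s * x) := by
    conv_lhs => rw [e]
    rw [inner_add_right, real_inner_smul_right, real_inner_self_eq_norm_sq]
  rw [h2]
  have := neg_abs_le (inner ℝ x (y - s * x))
  linarith

/-- The local weighted `L²` estimate; the constant does not depend on `F` and on the weight. -/
theorem exists_estimate_zero (a : Adapted ρ Q) (hc : IsCutoff L U χ) (hLQ : L ⊆ Q) (hQ : IsOpen Q) {X G : ℝ}
    (hX : ∀ q ∈ Q, q.1 ≤ X) (hΓ : ∀ q ∈ L, ‖Γ q‖ ≤ G) :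
    ∃ N : NNReal, ∀ (F r M : ℝ) v f, 0 < F → 1 ≤ M → |r| ≤ M → FieldOn Q L F Γ v f →
      ENNReal.ofReal (F ^ 2) * ∫⁻ q in U ∩ pos ρ, ENNReal.ofReal (q.1 ^ (d + 2))⁻¹ *
          ENNReal.ofReal (wt r M q ^ 2 * scN₁ q.1 (v q) ^ 2)
        ≤ N * ∫⁻ q in L ∩ pos ρ, ENNReal.ofReal (q.1 ^ (d + 2))⁻¹ *
          ENNReal.ofReal (dens r M v f q) := by
  obtain ⟨K₁, C₁, -, hC₁, hkey⟩ := a.exists_norm_symPart_le hc hQ hX hΓ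
  obtain ⟨K₂, hK₂⟩ := a.exists_lintegral
  obtain ⟨K₃, hK₃⟩ := a.exists_lintegral_le hc.isOpen_L hLQ
  have hC := a.C_nonneg
  have hcp := a.c_pos
  refine ⟨K₂ * (Real.toNNReal (a.C ^ 2 * a.C) *
    ∑ k, Real.toNNReal ((a.c ^ 2)⁻¹ * (2 * (C₁ * ‖a.V k‖ ^ 2) ^ 2)) * K₃),
    fun F r M v f hF hM hr h => ?_⟩
  obtain ⟨hs, hcs, hout, hin⟩ := a.field_spec (r := r) hc hM h
  set u := a.field χ r M v with hu
  set I := ∫⁻ q in L ∩ pos ρ, ENNReal.ofReal (q.1 ^ (d + 2))⁻¹ *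
          ENNReal.ofReal (dens r M v f q) with hI
  have hsk : ∀ k, ContDiff ℝ 1 fun z => u z (a.V k) := fun k =>
    (hs.of_le (by norm_num)).clm_apply contDiff_const
  have hck : ∀ k, HasCompactSupport fun z => u z (a.V k) := fun k =>
    hcs.comp_left (g := fun A : HE d →L[ℝ] ℂ => A (a.V k)) (by simp)
  -- The component of the field along `V k` satisfies a transport equation with growth rate at least
  -- `a.c * F`, and the error `B` is of order zero with a constant free of F. The factor F² on the
  -- left is the gain from conjugation.
  have hE : ∀ k, ENNReal.ofReal (F ^ 2) * ∫⁻ z in a.T, ‖u z (a.V k)‖ₑ ^ 2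
      ≤ ENNReal.ofReal ((a.c ^ 2)⁻¹ * (2 * (C₁ * ‖a.V k‖ ^ 2) ^ 2)) * (K₃ * I) := by
    intro k
    set B : HE d → ℝ := (a.above L).indicator fun z => C₁ * wt r M (a.φ z) *
        (scN₁ (a.φ z).1 (v (a.φ z)) + scN₂ (a.φ z).1 (f (a.φ z))) * ‖a.V k‖ * ‖a.V k‖ with hB
    have hBpos : ∀ z ∈ a.above L, B z = C₁ * wt r M (a.φ z) *
        (scN₁ (a.φ z).1 (v (a.φ z)) + scN₂ (a.φ z).1 (f (a.φ z))) * ‖a.V k‖ * ‖a.V k‖ :=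
      fun z hz => indicator_of_mem hz _
    have henergy := (a.inward k).energy volume a.measurableSet_T (hsk k) (hck k)
      (κ := a.c * F) (by positivity) (B := B) ?_
    · have h4 := hK₃ r M v f B (C₁ * ‖a.V k‖ ^ 2) (fun z hz => indicator_of_notMem hz _) ?_
      · have e1 : ENNReal.ofReal (F ^ 2)
            = ENNReal.ofReal (a.c ^ 2)⁻¹ * ENNReal.ofReal ((a.c * F) ^ 2) := by
          rw [← ENNReal.ofReal_mul (by positivity)]
          congr 1
          field_simp
        rw [e1, mul_assoc]
        refine (mul_le_mul_right (henergy.trans h4) _).trans (le_of_eq ?_)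
        rw [← mul_assoc, ← ENNReal.ofReal_mul (by positivity)]
      · intro z hz
        have hw := (wt_pos (r := r) hM (a.map_mem hz.1).2).le
        have h1 := scN₁_nonneg (a.φ z).1 (v (a.φ z))
        have h2 := scN₂_nonneg (a.φ z).1 (f (a.φ z))
        rw [hBpos z hz, abs_of_nonneg (by positivity)]
        exact le_of_eq (by ring)
    · intro z _
      -- Since `V k` is constant, differentiating u(V) along V sees only the diagonal of the
      -- symmetric part.
      have ed : fderiv ℝ (fun z => u z (a.V k)) z (a.V k) = symPart (fderiv ℝ u z) (a.V k) (a.V k) := by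
        rw [symPart_apply, fderiv_clm_apply (hs.differentiable (by norm_num) z)
          (differentiableAt_const _)]
        simp
        ring
      by_cases hz : z ∈ a.above L
      · have hsp := a.speed z hz.1 k
        set al := (fderiv ℝ a.φ z (a.V k)).1 / (a.φ z).1 ^ 2 with hal
        have h3 := (hkey F r M v f hM hr h z hz).2 (a.V k) (a.V k)
        rw [← hBpos z hz] at h3
        have e2 : symPart (fderiv ℝ u z) (a.V k) (a.V k)
            - F / 2 * ((al : ℝ) * u z (a.V k) + (al : ℝ) * u z (a.V k))
            = symPart (fderiv ℝ u z) (a.V k) (a.V k) - ((F * al : ℝ) : ℂ) * u z (a.V k) := by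
          push_cast; ring
        rw [← hu, ← hal, e2] at h3
        have h4 := inner_re_le (x := u z (a.V k)) (y := symPart (fderiv ℝ u z) (a.V k) (a.V k))
          (s := F * al)
        rw [ed]
        have h5 : a.c * F * ‖u z (a.V k)‖ ^ 2 ≤ F * al * ‖u z (a.V k)‖ ^ 2 := by
          refine mul_le_mul_of_nonneg_right ?_ (by positivity)
          rw [mul_comm]
          exact mul_le_mul_of_nonneg_left hsp hF.le
        have h6 := mul_le_mul_of_nonneg_left h3 (norm_nonneg (u z (a.V k)))
        linarith
      · obtain ⟨e1, -⟩ := hout z hz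
        simp [e1]
  -- Over `U` the cutoff equals 1, so the weighted norm of `v` is recovered from the spanning
  -- components of the field.
  have hP : ∀ z ∈ a.above U ∩ a.T, ENNReal.ofReal (wt r M (a.φ z) ^ 2 *
      scN₁ (a.φ z).1 (v (a.φ z)) ^ 2) ≤ ENNReal.ofReal (a.C ^ 2 * a.C) *
        ∑ k, ‖u z (a.V k)‖ₑ ^ 2 := by
    intro z hz
    have h1 := a.bounds.scN₁_le hC hz.1.1 (a.bounds.surjective hz.1.1) (v (a.φ z))
    have h2 : ‖u z‖ = wt r M (a.φ z) * ‖(v (a.φ z)).comp (fderiv ℝ a.φ z)‖ := by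
      rw [(hin z hz.1.1).1, pullField, hc.eq_one _ hz.1.2, one_mul, norm_smul, Real.norm_eq_abs,
        abs_of_pos (wt_pos hM (a.map_mem hz.1.1).2)]
    have h3 := a.span (u z)
    have hw := (wt_pos (r := r) hM (a.map_mem hz.1.1).2).le
    simp only [enorm_sq_eq_ofReal]
    rw [← ENNReal.ofReal_sum_of_nonneg fun _ _ => by positivity,
      ← ENNReal.ofReal_mul (by positivity)]
    refine ENNReal.ofReal_le_ofReal ?_
    rw [← mul_pow]
    calc (wt r M (a.φ z) * scN₁ (a.φ z).1 (v (a.φ z))) ^ 2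
        ≤ (wt r M (a.φ z) * (a.C * ‖(v (a.φ z)).comp (fderiv ℝ a.φ z)‖)) ^ 2 := by
          have := scN₁_nonneg (a.φ z).1 (v (a.φ z))
          gcongr
      _ = a.C ^ 2 * ‖u z‖ ^ 2 := by rw [h2]; ring
      _ ≤ a.C ^ 2 * (a.C * ∑ k, ‖u z (a.V k)‖ ^ 2) := by gcongr
      _ = _ := by ring
  have hmeas : ∀ k, Measurable fun z => ‖u z (a.V k)‖ₑ ^ 2 := fun k =>
    ((hsk k).continuous.enorm.measurable).pow_const 2
  have hmU : MeasurableSet (a.above U ∩ a.T) :=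
    (a.isOpen_above hc.isOpen_U).measurableSet.inter a.measurableSet_T
  calc _ ≤ ENNReal.ofReal (F ^ 2) * (K₂ * ∫⁻ z in a.above U ∩ a.T, ENNReal.ofReal
          (wt r M (a.φ z) ^ 2 * scN₁ (a.φ z).1 (v (a.φ z)) ^ 2)) :=
        mul_le_mul_right (hK₂ U hc.isOpen_U (hc.subset.trans hLQ) fun q =>
          ENNReal.ofReal (wt r M q ^ 2 * scN₁ q.1 (v q) ^ 2)).1 _
    _ ≤ ENNReal.ofReal (F ^ 2) * (K₂ * (ENNReal.ofReal (a.C ^ 2 * a.C) *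
          ∑ k, ∫⁻ z in a.T, ‖u z (a.V k)‖ₑ ^ 2)) := by
        gcongr
        rw [← lintegral_finsetSum _ fun k _ => hmeas k,
          ← lintegral_const_mul' _ _ ENNReal.ofReal_ne_top]
        exact (setLIntegral_mono' hmU hP).trans (lintegral_mono_set inter_subset_right)
    _ = K₂ * (ENNReal.ofReal (a.C ^ 2 * a.C) *
          ∑ k, ENNReal.ofReal (F ^ 2) * ∫⁻ z in a.T, ‖u z (a.V k)‖ₑ ^ 2) := by
        rw [← Finset.mul_sum]; ring
    _ ≤ K₂ * (ENNReal.ofReal (a.C ^ 2 * a.C) *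
          ∑ k, ENNReal.ofReal ((a.c ^ 2)⁻¹ * (2 * (C₁ * ‖a.V k‖ ^ 2) ^ 2)) * (K₃ * I)) := by
        exact mul_le_mul_right (mul_le_mul_right (Finset.sum_le_sum fun k _ => hE k) _) _
    _ = _ := by
        simp only [← mul_assoc, ← Finset.sum_mul]
        push_cast
        simp only [ENNReal.ofReal, mul_assoc, Finset.sum_mul, Finset.mul_sum]

/-- The local weighted estimate for the first derivatives. -/
theorem exists_estimate_one (a : Adapted ρ Q) (hc : IsCutoff L U χ) (hLQ : L ⊆ Q) (hQ : IsOpen Q)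
    {X G : ℝ} (hX : ∀ q ∈ Q, q.1 ≤ X) (hΓ : ∀ q ∈ L, ‖Γ q‖ ≤ G) (F : ℝ) :
    ∃ N : NNReal, ∀ (r M : ℝ) v f, 1 ≤ M → |r| ≤ M → FieldOn Q L F Γ v f →
      ∫⁻ q in U ∩ pos ρ, ENNReal.ofReal (q.1 ^ (d + 2))⁻¹ *
          ENNReal.ofReal (wt r M q ^ 2 * scN₂ q.1 (fderiv ℝ v q) ^ 2)
        ≤ N * ∫⁻ q in L ∩ pos ρ, ENNReal.ofReal (q.1 ^ (d + 2))⁻¹ *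
          ENNReal.ofReal (dens r M v f q) := by
  obtain ⟨K₁, C₁, hK₁, hC₁, hkey⟩ := a.exists_norm_symPart_le hc hQ hX hΓ
  obtain ⟨K₂, hK₂⟩ := a.exists_lintegral
  obtain ⟨K₃, hK₃⟩ := a.exists_lintegral_le hc.isOpen_L hLQ
  obtain ⟨K₄, hK₄⟩ := a.korn
  have hC := a.C_nonneg
  -- Here the conjugation term is merely bounded, at the price of |F|. The constant may depend on F
  -- because nothing is absorbed in this estimate.
  set c₁ := C₁ + |F| * a.C ^ 2 with hc₁
  set c₂ := K₁ * a.C ^ 2 + a.C with hc₂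
  have hc₁0 : 0 ≤ c₁ := by positivity
  have hc₂0 : 0 ≤ c₂ := by positivity
  refine ⟨K₂ * (Real.toNNReal (2 * a.C ^ 4) * (K₄ * (Real.toNNReal (2 * c₁ ^ 2) * K₃)
    + Real.toNNReal (2 * c₂ ^ 2) * K₃)), fun r M v f hM hr h => ?_⟩
  obtain ⟨hs, hcs, hout, hin⟩ := a.field_spec (r := r) hc hM h
  set u := a.field χ r M v with hu
  set I := ∫⁻ q in L ∩ pos ρ, ENNReal.ofReal (q.1 ^ (d + 2))⁻¹ *
          ENNReal.ofReal (dens r M v f q) with hI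
  set B₂ : HE d → ℝ := (a.above L).indicator fun z => c₂ * (wt r M (a.φ z) *
    scN₁ (a.φ z).1 (v (a.φ z))) with hB₂
  have hub : ∀ z ∈ a.above L, ∀ w, ‖u z w‖
      ≤ wt r M (a.φ z) * (scN₁ (a.φ z).1 (v (a.φ z)) * (a.C * ‖w‖)) := by
    intro z hz w
    have hw := (wt_pos (r := r) hM (a.map_mem hz.1).2).le
    rw [(hin z hz.1).1, pullField, smul_apply, norm_smul, Real.norm_eq_abs, abs_mul,
      abs_of_nonneg hw, ContinuousLinearMap.comp_apply]
    have h1 := a.bounds.norm_pull_le hz.1 (v (a.φ z)) w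
    calc _ ≤ 1 * wt r M (a.φ z) * (scN₁ (a.φ z).1 (v (a.φ z)) * (a.C * ‖w‖)) := by
          gcongr
          exact hc.abs_le _
      _ = _ := by ring
  have hsym : ∀ z ∈ a.above L, ‖symPart (fderiv ℝ u z)‖ ≤ c₁ * wt r M (a.φ z) *
        (scN₁ (a.φ z).1 (v (a.φ z)) + scN₂ (a.φ z).1 (f (a.φ z))) := by
    intro z hz
    have hw := (wt_pos (r := r) hM (a.map_mem hz.1).2).le
    have n1 := scN₁_nonneg (a.φ z).1 (v (a.φ z))
    have n2 := scN₂_nonneg (a.φ z).1 (f (a.φ z))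
    refine ContinuousLinearMap.opNorm_le_bound₂ _ (by positivity) fun w w' => ?_
    have h1 := (hkey F r M v f hM hr h z hz).2 w w'
    rw [← hu] at h1
    have hal : ∀ w, |(fderiv ℝ a.φ z w).1 / (a.φ z).1 ^ 2| ≤ a.C * ‖w‖ := fun w =>
      (norm_sig_inv_fst_le _ _).trans (a.bounds.upper z hz.1 w)
    have h2 : ∀ w w', ‖((((fderiv ℝ a.φ z w).1 / (a.φ z).1 ^ 2 : ℝ) : ℂ)) * u z w'‖
        ≤ a.C ^ 2 * (wt r M (a.φ z) * scN₁ (a.φ z).1 (v (a.φ z))) * ‖w‖ * ‖w'‖ := fun w w' => by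
      rw [norm_mul, Complex.norm_real, Real.norm_eq_abs]
      calc _ ≤ (a.C * ‖w‖) * (wt r M (a.φ z) * (scN₁ (a.φ z).1 (v (a.φ z)) * (a.C * ‖w'‖))) :=
            mul_le_mul (hal w) (hub z hz w') (norm_nonneg _) (by positivity)
        _ = _ := by ring
    have h3 : ‖(F : ℂ) / 2 * (((fderiv ℝ a.φ z w).1 / (a.φ z).1 ^ 2 : ℝ) * u z w'
          + ((fderiv ℝ a.φ z w').1 / (a.φ z).1 ^ 2 : ℝ) * u z w)‖
        ≤ |F| * (a.C ^ 2 * (wt r M (a.φ z) * scN₁ (a.φ z).1 (v (a.φ z))) * ‖w‖ * ‖w'‖) := by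
      have h4 := (norm_add_le _ _).trans (add_le_add (h2 w w') (h2 w' w))
      rw [norm_mul, norm_div, Complex.norm_real, Real.norm_eq_abs]
      norm_num at h4 ⊢
      have := mul_le_mul_of_nonneg_left h4 (show 0 ≤ |F| / 2 by positivity)
      linarith
    have h5 := norm_sub_norm_le (symPart (fderiv ℝ u z) w w')
      ((F : ℂ) / 2 * (((fderiv ℝ a.φ z w).1 / (a.φ z).1 ^ 2 : ℝ) * u z w'
          + ((fderiv ℝ a.φ z w').1 / (a.φ z).1 ^ 2 : ℝ) * u z w))
    have h6 : 0 ≤ |F| * a.C ^ 2 * wt r M (a.φ z) * scN₂ (a.φ z).1 (f (a.φ z)) * ‖w‖ * ‖w'‖ := by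
      positivity
    rw [hc₁]
    linarith
  have hT : ∫⁻ z in a.T, ‖symPart (fderiv ℝ u z)‖ₑ ^ 2 ≤ ENNReal.ofReal (2 * c₁ ^ 2) * (K₃ * I) := by
    simp only [enorm_sq_eq_ofReal]
    refine hK₃ r M v f (fun z => ‖symPart (fderiv ℝ u z)‖) c₁ (fun z hz => ?_) fun z hz => ?_
    · simp only [(hout z hz).2, symPart_zero, norm_zero]
    · rw [abs_of_nonneg (norm_nonneg _)]; exact hsym z hz
  have hT2 : ∫⁻ z in a.T, ENNReal.ofReal (B₂ z ^ 2) ≤ ENNReal.ofReal (2 * c₂ ^ 2) * (K₃ * I) := by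
    refine hK₃ r M v f B₂ c₂ (fun z hz => indicator_of_notMem hz _) fun z hz => ?_
    have hw := (wt_pos (r := r) hM (a.map_mem hz.1).2).le
    have n1 := scN₁_nonneg (a.φ z).1 (v (a.φ z))
    have n2 := scN₂_nonneg (a.φ z).1 (f (a.φ z))
    rw [hB₂, indicator_of_mem hz, abs_of_nonneg (by positivity)]
    have : 0 ≤ c₂ * wt r M (a.φ z) * scN₂ (a.φ z).1 (f (a.φ z)) := by positivity
    linarith
  have hP : ∀ z ∈ a.above U ∩ a.T, ENNReal.ofReal (wt r M (a.φ z) ^ 2 *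
      scN₂ (a.φ z).1 (fderiv ℝ v (a.φ z)) ^ 2) ≤ ENNReal.ofReal (2 * a.C ^ 4) *
        (‖fderiv ℝ u z‖ₑ ^ 2 + ENNReal.ofReal (B₂ z ^ 2)) := by
    intro z hz
    have hzL : z ∈ a.above L := ⟨hz.1.1, hc.subset hz.1.2⟩
    have hq := a.map_mem hz.1.1
    have hwp := wt_pos (r := r) hM hq.2
    have hw := hwp.le
    have n1 := scN₁_nonneg (a.φ z).1 (v (a.φ z))
    have hBz : B₂ z = c₂ * (wt r M (a.φ z) * scN₁ (a.φ z).1 (v (a.φ z))) :=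
      indicator_of_mem hzL _
    have hB0 : 0 ≤ B₂ z := by rw [hBz]; positivity
    have hvd : DifferentiableAt ℝ v (a.φ z) := (h.smooth.contDiffAt
      ((hQ.inter (isOpen_lt continuous_const continuous_fst)).mem_nhds hq)).differentiableAt
        (by simp)
    have hψd : DifferentiableAt ℝ (fun q => χ q * wt r M q) (a.φ z) :=
      (hc.smooth.differentiable (by simp) _).mul
        ((contDiffAt_wt (n := 1) hM hq.2).differentiableAt (by norm_num))
    have hφ2 : ContDiffAt ℝ 2 a.φ z :=
      (a.smooth.contDiffAt (a.φ.open_source.mem_nhds hz.1.1)).of_le (natCast_le_infty 2)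
    have h1 := (hkey F r M v f hM hr h z hzL).1
    have hN : ∀ w w', ‖fderiv ℝ v (a.φ z) (fderiv ℝ a.φ z w) (fderiv ℝ a.φ z w')‖
        ≤ ((wt r M (a.φ z))⁻¹ * (‖fderiv ℝ u z‖ + B₂ z)) * ‖w‖ * ‖w'‖ := by
      intro w w'
      have e := fderiv_pullField hφ2 hvd hψd w w'
      rw [← (hin z hz.1.1).2, hc.eq_one _ hz.1.2, one_mul] at e
      -- The product rule solved for the derivative of `v`: besides the derivative of the field
      -- there remain terms of order zero, from the weight and from the second derivative of `φ`,
      -- all bounded by `B₂`.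
      have e2 : (wt r M (a.φ z) : ℂ) *
          fderiv ℝ v (a.φ z) (fderiv ℝ a.φ z w) (fderiv ℝ a.φ z w')
          = fderiv ℝ u z w w' - (fderiv ℝ (fun q => χ q * wt r M q) (a.φ z) (fderiv ℝ a.φ z w))
              * v (a.φ z) (fderiv ℝ a.φ z w')
            - wt r M (a.φ z) * v (a.φ z) (fderiv ℝ (fderiv ℝ a.φ) z w w') := by
        rw [e]; ring
      have e3 := congrArg norm e2
      rw [norm_mul, Complex.norm_real, Real.norm_eq_abs, abs_of_pos hwp] at e3
      have b1 := (fderiv ℝ u z).le_opNorm₂ w w'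
      have b2 : ‖((fderiv ℝ (fun q => χ q * wt r M q) (a.φ z) (fderiv ℝ a.φ z w) : ℝ) : ℂ)
              * v (a.φ z) (fderiv ℝ a.φ z w')‖ ≤ (K₁ * wt r M (a.φ z) * (a.C * ‖w‖)) *
                (scN₁ (a.φ z).1 (v (a.φ z)) * (a.C * ‖w'‖)) := by
        rw [norm_mul, Complex.norm_real, Real.norm_eq_abs]
        refine mul_le_mul ((h1 _).trans ?_) (a.bounds.norm_pull_le hz.1.1 _ _) (norm_nonneg _)
          (by positivity)
        exact mul_le_mul_of_nonneg_left (a.bounds.upper z hz.1.1 w) (by positivity)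
      have b3 : ‖(wt r M (a.φ z) : ℂ) * v (a.φ z) (fderiv ℝ (fderiv ℝ a.φ) z w w')‖
          ≤ wt r M (a.φ z) * (scN₁ (a.φ z).1 (v (a.φ z)) * (a.C * ‖w‖ * ‖w'‖)) := by
        rw [norm_mul, Complex.norm_real, Real.norm_eq_abs, abs_of_pos hwp]
        refine mul_le_mul_of_nonneg_left ((norm_le_scN₁ hq.2.ne' _ _).trans ?_) hw
        exact mul_le_mul_of_nonneg_left (a.bounds.second z hz.1.1 w w') n1
      have b4 := norm_sub_le (fderiv ℝ u z w w'
        - (fderiv ℝ (fun q => χ q * wt r M q) (a.φ z) (fderiv ℝ a.φ z w))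
              * v (a.φ z) (fderiv ℝ a.φ z w'))
        (wt r M (a.φ z) * v (a.φ z) (fderiv ℝ (fderiv ℝ a.φ) z w w'))
      have b5 := norm_sub_le (fderiv ℝ u z w w')
        ((fderiv ℝ (fun q => χ q * wt r M q) (a.φ z) (fderiv ℝ a.φ z w))
              * v (a.φ z) (fderiv ℝ a.φ z w'))
      have b6 : wt r M (a.φ z) * ‖fderiv ℝ v (a.φ z) (fderiv ℝ a.φ z w) (fderiv ℝ a.φ z w')‖
          ≤ (‖fderiv ℝ u z‖ + B₂ z) * ‖w‖ * ‖w'‖ := by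
        rw [hBz, hc₂]
        linarith
      rw [mul_assoc, mul_assoc, ← div_eq_inv_mul, le_div_iff₀ hwp, ← mul_assoc, mul_comm]
      exact b6
    have h2 := a.bounds.scN₂_le hC hz.1.1 (a.bounds.surjective hz.1.1) (fderiv ℝ v (a.φ z))
      (by positivity) hN
    have n3 := scN₂_nonneg (a.φ z).1 (fderiv ℝ v (a.φ z))
    rw [enorm_sq_eq_ofReal, ← ENNReal.ofReal_add (by positivity) (by positivity),
      ← ENNReal.ofReal_mul (by positivity)]
    refine ENNReal.ofReal_le_ofReal ?_
    have h3 : wt r M (a.φ z) * scN₂ (a.φ z).1 (fderiv ℝ v (a.φ z))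
        ≤ a.C ^ 2 * (‖fderiv ℝ u z‖ + B₂ z) := by
      calc _ ≤ wt r M (a.φ z) * (a.C ^ 2 * ((wt r M (a.φ z))⁻¹ * (‖fderiv ℝ u z‖ + B₂ z))) := by
            gcongr
        _ = _ := by field_simp
    rw [← mul_pow]
    calc _ ≤ (a.C ^ 2 * (‖fderiv ℝ u z‖ + B₂ z)) ^ 2 := by gcongr
      _ = a.C ^ 4 * (‖fderiv ℝ u z‖ + B₂ z) ^ 2 := by ring
      _ ≤ a.C ^ 4 * (2 * (‖fderiv ℝ u z‖ ^ 2 + B₂ z ^ 2)) := by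
          gcongr
          exact add_sq_le
      _ = _ := by ring
  have hmU : MeasurableSet (a.above U ∩ a.T) :=
    (a.isOpen_above hc.isOpen_U).measurableSet.inter a.measurableSet_T
  have hmeas : Measurable fun z => ‖fderiv ℝ u z‖ₑ ^ 2 :=
    ((hs.continuous_fderiv (by norm_num)).enorm.measurable).pow_const 2
  calc _ ≤ K₂ * ∫⁻ z in a.above U ∩ a.T, ENNReal.ofReal
          (wt r M (a.φ z) ^ 2 * scN₂ (a.φ z).1 (fderiv ℝ v (a.φ z)) ^ 2) :=
        (hK₂ U hc.isOpen_U (hc.subset.trans hLQ) fun q =>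
          ENNReal.ofReal (wt r M q ^ 2 * scN₂ q.1 (fderiv ℝ v q) ^ 2)).1
    _ ≤ K₂ * (ENNReal.ofReal (2 * a.C ^ 4) *
          ((∫⁻ z in a.T, ‖fderiv ℝ u z‖ₑ ^ 2) + ∫⁻ z in a.T, ENNReal.ofReal (B₂ z ^ 2))) := by
        rw [← lintegral_add_left hmeas, ← lintegral_const_mul' _ _ ENNReal.ofReal_ne_top]
        exact mul_le_mul_right ((setLIntegral_mono' hmU hP).trans
          (lintegral_mono_set inter_subset_right)) _
    _ ≤ K₂ * (ENNReal.ofReal (2 * a.C ^ 4) *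
          (K₄ * (ENNReal.ofReal (2 * c₁ ^ 2) * (K₃ * I))
            + ENNReal.ofReal (2 * c₂ ^ 2) * (K₃ * I))) :=
        mul_le_mul_right (mul_le_mul_right (add_le_add
          ((hK₄ u hs hcs).trans (mul_le_mul_right hT _)) hT2) _) _
    _ = _ := by
        push_cast
        simp only [ENNReal.ofReal]
        ring

end Adapted

end

/-! ### Local inverses with uniform bounds, and the cone map -/

section

section LocalInverse

variable {H : Type*} [NormedAddCommGroup H] [NormedSpace ℝ H] [FiniteDimensional ℝ H]

/-- The inverse function theorem with uniform bounds up to the second order. -/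
theorem exists_localInverse {Ψ : H → H} {s : Set H} (hs : IsOpen s) (hΨ : ContDiffOn ℝ ∞ Ψ s)
    {q₀ : H} (hq₀ : q₀ ∈ s) (A : H ≃L[ℝ] H) (hA : HasFDerivAt Ψ (A : H →L[ℝ] H) q₀)
    {ε : ℝ} (hε : 0 < ε) :
    ∃ (θ : OpenPartialHomeomorph H H) (C : ℝ), 0 ≤ C ∧ q₀ ∈ θ.target ∧ θ.target ⊆ s ∧
      (∀ q ∈ θ.target, θ.symm q = Ψ q) ∧ ContDiffOn ℝ ∞ θ θ.source ∧
      ∀ z ∈ θ.source, ‖fderiv ℝ θ z‖ ≤ C ∧ (∀ w, ‖w‖ ≤ C * ‖fderiv ℝ θ z w‖) ∧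
        ‖fderiv ℝ (fderiv ℝ θ) z‖ ≤ C ∧ ‖fderiv ℝ θ z - (A.symm : H →L[ℝ] H)‖ ≤ ε := by
  have : CompleteSpace H := FiniteDimensional.complete ℝ H
  have hat : ∀ q ∈ s, ContDiffAt ℝ ∞ Ψ q := fun q hq => hΨ.contDiffAt (hs.mem_nhds hq)
  set e := (hat q₀ hq₀).toOpenPartialHomeomorph Ψ hA (by simp) with he
  have hcoe : ∀ q, e q = Ψ q := fun q => rfl
  have hsrc : q₀ ∈ e.source := (hat q₀ hq₀).mem_toOpenPartialHomeomorph_source hA (by simp)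
  -- points where the derivative is invertible
  have hD : ContinuousOn (fderiv ℝ Ψ) s := hΨ.continuousOn_fderiv_of_isOpen hs (by simp)
  have hinv : ∀ᶠ q in 𝓝 q₀, ∃ B : H ≃L[ℝ] H, (B : H →L[ℝ] H) = fderiv ℝ Ψ q := by
    have h1 := A.nhds
    rw [← hA.fderiv] at h1
    exact (hD.continuousAt (hs.mem_nhds hq₀)) h1
  obtain ⟨O₁, hO₁, hO₁o, hqO₁⟩ := eventually_nhds_iff.1 hinv
  set e₁ := e.restrOpen (s ∩ O₁) (hs.inter hO₁o) with he₁
  have hs₁ : e₁.source = e.source ∩ (s ∩ O₁) := e.restrOpen_source _ _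
  have hsm : ContDiffOn ℝ ∞ e₁.symm e₁.target := by
    intro z hz
    have hq := e₁.map_target hz
    rw [hs₁] at hq
    obtain ⟨B, hB⟩ := hO₁ _ hq.2.2
    refine (e₁.contDiffAt_symm (f₀' := B) hz ?_ (hat _ hq.2.1)).contDiffWithinAt
    rw [hB]
    exact ((hat _ hq.2.1).differentiableAt (by simp)).hasFDerivAt
  have hq₁ : q₀ ∈ e₁.source := by rw [hs₁]; exact ⟨hsrc, hq₀, hqO₁⟩
  have hz₁ : Ψ q₀ ∈ e₁.target := e₁.map_source hq₁
  have hsymm0 : e₁.symm (Ψ q₀) = q₀ := e₁.left_inv hq₁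
  have hd0 : fderiv ℝ e₁.symm (Ψ q₀) = (A.symm : H →L[ℝ] H) := by
    refine HasFDerivAt.fderiv ?_
    refine e₁.hasFDerivAt_symm (f' := A) hz₁ ?_
    rw [hsymm0]
    exact hA
  have hc1 : ContinuousAt (fderiv ℝ e₁.symm) (Ψ q₀) :=
    (hsm.continuousOn_fderiv_of_isOpen e₁.open_target (by simp)).continuousAt
      (e₁.open_target.mem_nhds hz₁)
  have hc2 : ContinuousAt (fderiv ℝ (fderiv ℝ e₁.symm)) (Ψ q₀) :=
    ((hsm.fderiv_of_isOpen (m := 1) e₁.open_target (natCast_le_infty 2)).continuousOn_fderiv_of_isOpen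
      e₁.open_target le_rfl).continuousAt (e₁.open_target.mem_nhds hz₁)
  have hc3 : ContinuousAt (fderiv ℝ Ψ) q₀ := hD.continuousAt (hs.mem_nhds hq₀)
  set C₁ := ‖fderiv ℝ e₁.symm (Ψ q₀)‖ + 1
  set C₂ := ‖fderiv ℝ (fderiv ℝ e₁.symm) (Ψ q₀)‖ + 1
  set C₃ := ‖fderiv ℝ Ψ q₀‖ + 1
  have v1 : ∀ᶠ z in 𝓝 (Ψ q₀), ‖fderiv ℝ e₁.symm z‖ < C₁ :=
    hc1.norm.eventually (gt_mem_nhds (lt_add_one _))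
  have v2 : ∀ᶠ z in 𝓝 (Ψ q₀), ‖fderiv ℝ (fderiv ℝ e₁.symm) z‖ < C₂ :=
    hc2.norm.eventually (gt_mem_nhds (lt_add_one _))
  have v3 : ∀ᶠ q in 𝓝 q₀, ‖fderiv ℝ Ψ q‖ < C₃ :=
    hc3.norm.eventually (gt_mem_nhds (lt_add_one _))
  -- Closeness of the derivative to its value at the base point will keep dx(V) bounded below for
  -- vector fields chosen at that point.
  have v4 : ∀ᶠ z in 𝓝 (Ψ q₀), ‖fderiv ℝ e₁.symm z - (A.symm : H →L[ℝ] H)‖ < ε := by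
    refine (hc1.sub continuousAt_const).norm.eventually (gt_mem_nhds ?_)
    change ‖fderiv ℝ e₁.symm (Ψ q₀) - (A.symm : H →L[ℝ] H)‖ < ε
    rw [hd0, sub_self, norm_zero]
    exact hε
  have hcΨ : ContinuousAt Ψ q₀ := (hat q₀ hq₀).continuousAt
  obtain ⟨O₂, hO₂, hO₂o, hqO₂⟩ := eventually_nhds_iff.1
    (((hcΨ.eventually v1).and (hcΨ.eventually v2)).and (v3.and (hcΨ.eventually v4)))
  set e₂ := e₁.restrOpen O₂ hO₂o with he₂
  have hs₂ : e₂.source = e₁.source ∩ O₂ := e₁.restrOpen_source _ _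
  have htgt : e₂.target ⊆ e₁.target := fun z hz => by
    have hq := e₂.map_target hz
    rw [hs₂] at hq
    have h := e₁.map_source hq.1
    have h' : e₁ (e₂.symm z) = z := e₂.right_inv hz
    rwa [h'] at h
  refine ⟨e₂.symm, max C₁ (max C₂ C₃), ?_, ?_, ?_, fun q _ => rfl, ?_, ?_⟩
  · exact le_max_of_le_left (by positivity)
  · change q₀ ∈ e₂.source
    rw [hs₂]; exact ⟨hq₁, hqO₂⟩
  · change e₂.source ⊆ s
    rw [hs₂, hs₁]; exact fun q hq => hq.1.2.1
  · exact hsm.mono htgt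
  · intro z hz
    have hz2 : z ∈ e₂.target := hz
    have hq := e₂.map_target hz2
    rw [hs₂] at hq
    have hz1 : z ∈ e₁.target := htgt hz2
    have hqz : Ψ (e₁.symm z) = z := e₁.right_inv hz1
    obtain ⟨⟨b1, b2⟩, b3, b4⟩ := hO₂ _ hq.2
    change ‖fderiv ℝ e₁.symm (Ψ (e₁.symm z))‖ < C₁ at b1
    change ‖fderiv ℝ (fderiv ℝ e₁.symm) (Ψ (e₁.symm z))‖ < C₂ at b2
    change ‖fderiv ℝ Ψ (e₁.symm z)‖ < C₃ at b3
    change ‖fderiv ℝ e₁.symm (Ψ (e₁.symm z)) - (A.symm : H →L[ℝ] H)‖ < ε at b4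
    rw [hqz] at b1 b2 b4
    refine ⟨b1.le.trans (le_max_left _ _), fun w => ?_,
      b2.le.trans ((le_max_left _ _).trans (le_max_right _ _)), b4.le⟩
    have hq1 := hq.1
    rw [hs₁] at hq1
    have hd1 : HasFDerivAt Ψ (fderiv ℝ Ψ (e₁.symm z)) (e₁.symm z) :=
      ((hat _ hq1.2.1).differentiableAt (by simp)).hasFDerivAt
    have hd2 : HasFDerivAt e₁.symm (fderiv ℝ e₁.symm z) z :=
      ((hsm.contDiffAt (e₁.open_target.mem_nhds hz1)).differentiableAt (by simp)).hasFDerivAt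
    have hcomp : (fderiv ℝ Ψ (e₁.symm z)).comp (fderiv ℝ e₁.symm z) = ContinuousLinearMap.id ℝ H := by
      refine (hd1.comp z hd2).unique ?_
      refine (hasFDerivAt_id z).congr_of_eventuallyEq ?_
      filter_upwards [e₁.open_target.mem_nhds hz1] with y hy
      exact e₁.right_inv hy
    have hw : fderiv ℝ Ψ (e₁.symm z) (fderiv ℝ e₁.symm z w) = w := DFunLike.congr_fun hcomp w
    calc ‖w‖ = ‖fderiv ℝ Ψ (e₁.symm z) (fderiv ℝ e₁.symm z w)‖ := by rw [hw]
      _ ≤ ‖fderiv ℝ Ψ (e₁.symm z)‖ * ‖fderiv ℝ e₁.symm z w‖ := ContinuousLinearMap.le_opNorm _ _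
      _ ≤ _ := mul_le_mul_of_nonneg_right
        (b3.le.trans ((le_max_right _ _).trans (le_max_right _ _))) (norm_nonneg _)

/-- A family of vectors which separates covectors bounds the norm of covectors. -/
theorem exists_norm_sq_le_of_span {n : ℕ} (V : Fin n → H)
    (hV : ∀ η : H →L[ℝ] ℂ, (∀ k, η (V k) = 0) → η = 0) :
    ∃ C : ℝ, 0 ≤ C ∧ ∀ η : H →L[ℝ] ℂ, ‖η‖ ^ 2 ≤ C * ∑ k, ‖η (V k)‖ ^ 2 := by
  let T : (H →L[ℝ] ℂ) →ₗ[ℝ] EuclideanSpace ℂ (Fin n) :=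
    { toFun := fun η => WithLp.toLp 2 fun k => η (V k)
      map_add' := fun η η' => by ext k; simp
      map_smul' := fun c η => by ext k; simp }
  have hT : LinearMap.ker T = ⊥ := by
    rw [LinearMap.ker_eq_bot']
    intro η h
    refine hV η fun k => ?_
    have := congrArg (fun u : EuclideanSpace ℂ (Fin n) => u k) h
    simpa [T] using this
  obtain ⟨K, -, hK⟩ := T.exists_antilipschitzWith hT
  refine ⟨(K : ℝ) ^ 2, by positivity, fun η => ?_⟩
  have h1 := hK.le_mul_norm_sub η 0
  simp only [map_zero, add_zero, norm_neg] at h1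
  have h2 : ‖T η‖ ^ 2 = ∑ k, ‖η (V k)‖ ^ 2 := by
    rw [EuclideanSpace.norm_sq_eq]
    rfl
  calc ‖η‖ ^ 2 ≤ (K * ‖T η‖) ^ 2 := pow_le_pow_left₀ (norm_nonneg _) h1 2
    _ = _ := by rw [mul_pow, h2]

end LocalInverse

section Cone

variable {d : ℕ}

/-- The map `(s, Θ) ↦ (1 / s, Θ / s)`, which turns Euclidean into scattering geometry. -/
def cone : OpenPartialHomeomorph (HE d) (HE d) where
  toFun z := (z.1⁻¹, z.1⁻¹ • z.2)
  invFun z := (z.1⁻¹, z.1⁻¹ • z.2)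
  source := {z | 0 < z.1}
  target := {z | 0 < z.1}
  map_source' z hz := inv_pos.2 (show 0 < z.1 from hz)
  map_target' z hz := inv_pos.2 (show 0 < z.1 from hz)
  left_inv' z hz := by
    have h : z.1 ≠ 0 := ne_of_gt hz
    simp [smul_smul, h]
  right_inv' z hz := by
    have h : z.1 ≠ 0 := ne_of_gt hz
    simp [smul_smul, h]
  open_source := isOpen_lt continuous_const continuous_fst
  open_target := isOpen_lt continuous_const continuous_fst
  continuousOn_toFun z hz := by
    have h : z.1 ≠ 0 := ne_of_gt hz
    have h1 : ContinuousAt (fun z : HE d => z.1⁻¹) z := continuousAt_fst.inv₀ h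
    exact (h1.prodMk (h1.smul continuousAt_snd)).continuousWithinAt
  continuousOn_invFun z hz := by
    have h : z.1 ≠ 0 := ne_of_gt hz
    have h1 : ContinuousAt (fun z : HE d => z.1⁻¹) z := continuousAt_fst.inv₀ h
    exact (h1.prodMk (h1.smul continuousAt_snd)).continuousWithinAt

theorem cone_apply (z : HE d) : cone z = (z.1⁻¹, z.1⁻¹ • z.2) := rfl

theorem contDiffAt_cone {z : HE d} (hz : 0 < z.1) : ContDiffAt ℝ ∞ (cone : HE d → HE d) z := by
  have h1 : ContDiffAt ℝ ∞ (fun z : HE d => z.1⁻¹) z := contDiffAt_fst.inv hz.ne'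
  exact h1.prodMk (h1.smul contDiffAt_snd)

theorem fderiv_cone {z : HE d} (hz : 0 < z.1) (w : HE d) :
    fderiv ℝ (cone : HE d → HE d) z w
      = (-(z.1⁻¹ ^ 2 * w.1), z.1⁻¹ • w.2 - (z.1⁻¹ ^ 2 * w.1) • z.2) := by
  have h1 : HasFDerivAt (fun z : HE d => z.1⁻¹)
      (-(z.1 ^ 2)⁻¹ • ContinuousLinearMap.fst ℝ ℝ (E d)) z :=
    (hasDerivAt_inv hz.ne').comp_hasFDerivAt z hasFDerivAt_fst
  have h2 : HasFDerivAt (cone : HE d → HE d) _ z := h1.prodMk (h1.smul hasFDerivAt_snd)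
  rw [h2.fderiv]
  ext1
  · simp
  · simp only [ContinuousLinearMap.prod_apply, add_apply, smul_apply,
      ContinuousLinearMap.coe_snd', ContinuousLinearMap.smulRight_apply,
      ContinuousLinearMap.coe_fst', smul_eq_mul, inv_pow]
    rw [neg_mul, neg_smul, sub_eq_add_neg]

theorem fderiv_fderiv_cone {z : HE d} (hz : 0 < z.1) (w w' : HE d) :
    fderiv ℝ (fderiv ℝ (cone : HE d → HE d)) z w w'
      = (2 * z.1⁻¹ ^ 3 * w.1 * w'.1, -((z.1⁻¹ ^ 2 * w.1) • w'.2)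
          - (z.1⁻¹ ^ 2 * w'.1) • w.2 + (2 * z.1⁻¹ ^ 3 * w.1 * w'.1) • z.2) := by
  have h1 : HasFDerivAt (fun z : HE d => z.1⁻¹)
      (-(z.1 ^ 2)⁻¹ • ContinuousLinearMap.fst ℝ ℝ (E d)) z :=
    (hasDerivAt_inv hz.ne').comp_hasFDerivAt z hasFDerivAt_fst
  have h2 : HasFDerivAt (fun z : HE d => z.1⁻¹ ^ 2 * w'.1) _ z := (h1.pow 2).mul_const w'.1
  have h3 : HasFDerivAt (fun z : HE d =>
    ((-(z.1⁻¹ ^ 2 * w'.1), z.1⁻¹ • w'.2 - (z.1⁻¹ ^ 2 * w'.1) • z.2) : HE d)) _ z :=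
    h2.neg.prodMk ((h1.smul_const w'.2).sub (h2.smul hasFDerivAt_snd))
  have e : (fun z : HE d => fderiv ℝ (cone : HE d → HE d) z w') =ᶠ[𝓝 z] fun z =>
      ((-(z.1⁻¹ ^ 2 * w'.1), z.1⁻¹ • w'.2 - (z.1⁻¹ ^ 2 * w'.1) • z.2) : HE d) := by
    filter_upwards [(isOpen_lt continuous_const continuous_fst).mem_nhds hz] with y hy
    exact fderiv_cone hy w'
  have h4 : DifferentiableAt ℝ (fderiv ℝ (cone : HE d → HE d)) z :=
    ((contDiffAt_cone hz).fderiv_right (m := 1) (natCast_le_infty 2)).differentiableAt (by simp)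
  have h5 : fderiv ℝ (fderiv ℝ (cone : HE d → HE d)) z w w'
      = fderiv ℝ (fun z : HE d => fderiv ℝ (cone : HE d → HE d) z w') z w := by
    rw [fderiv_clm_apply h4 (differentiableAt_const _)]
    simp
  rw [h5, e.fderiv_eq, h3.fderiv]
  ext1
  · simp
    field_simp
  · simp
    module

end Cone

end

/-! ### Scattering bounds for the cone map -/

section

variable {d : ℕ}

theorem fderiv_fderiv_comp {H : Type*} [NormedAddCommGroup H] [NormedSpace ℝ H] {f g : H → H} {z : H}
    (hf : ContDiffAt ℝ 2 f z) (hg : ContDiffAt ℝ 2 g (f z)) (w w' : H) :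
    fderiv ℝ (fderiv ℝ (g ∘ f)) z w w'
      = fderiv ℝ (fderiv ℝ g) (f z) (fderiv ℝ f z w) (fderiv ℝ f z w')
        + fderiv ℝ g (f z) (fderiv ℝ (fderiv ℝ f) z w w') := by
  have e : fderiv ℝ (g ∘ f) =ᶠ[𝓝 z] fun y => (fderiv ℝ g (f y)).comp (fderiv ℝ f y) := by
    filter_upwards [hf.eventually (by simp),
      hf.continuousAt.eventually (hg.eventually (by simp))] with y h1 h2
    exact fderiv_comp y (h2.differentiableAt (by simp)) (h1.differentiableAt (by simp))
  have h1 : HasFDerivAt f (fderiv ℝ f z) z := (hf.differentiableAt (by simp)).hasFDerivAt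
  have h2 : HasFDerivAt (fderiv ℝ f) (fderiv ℝ (fderiv ℝ f) z) z :=
    ((hf.fderiv_right (m := 1) (by norm_num)).differentiableAt (by simp)).hasFDerivAt
  have h3 : HasFDerivAt (fderiv ℝ g) (fderiv ℝ (fderiv ℝ g) (f z)) (f z) :=
    ((hg.fderiv_right (m := 1) (by norm_num)).differentiableAt (by simp)).hasFDerivAt
  have h4 : HasFDerivAt (fun y => (fderiv ℝ g (f y)).comp (fderiv ℝ f y)) _ z :=
    (h3.comp z h1).clm_comp h2
  rw [e.fderiv_eq, h4.fderiv]
  simp [add_comm]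

theorem eq_zero_of_coordVec {η : HE d →L[ℝ] ℂ} (h0 : η (1, 0) = 0)
    (hi : ∀ i, η (0, EuclideanSpace.single i 1) = 0) : η = 0 := by
  have h1 : (η : HE d →ₗ[ℝ] ℂ).comp (LinearMap.inr ℝ ℝ (E d)) = 0 := by
    refine (EuclideanSpace.basisFun (Fin d) ℝ).toBasis.ext fun i => ?_
    simpa using hi i
  ext w
  · simpa using h0
  · exact DFunLike.congr_fun h1 w

/-- A linear map preserving dx does not touch the component that is scaled by x⁻². The other
components are scaled by x⁻¹ only, and this is compensated by ‖u‖ ≤ x (1 + X) ‖sig x⁻¹ u‖. Thus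
coordinate changes that preserve x are bounded in scattering frames. -/
theorem norm_sig_inv_le_of_fst_eq {x X C : ℝ} (hx : 0 < x) (hX : x ≤ X) (hC : 0 ≤ C) {u u' : HE d}
    (h1 : u'.1 = u.1) (h2 : ‖u'‖ ≤ C * ‖u‖) :
    ‖sig x⁻¹ u'‖ ≤ (1 + C * (1 + X)) * ‖sig x⁻¹ u‖ := by
  have hX0 : 0 < X := hx.trans_le hX
  have h3 := norm_sig_le hx hX (sig x⁻¹ u)
  rw [sig_sig_inv hx.ne'] at h3
  have h4 := norm_nonneg (sig x⁻¹ u)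
  rw [sig_apply x⁻¹ u', Prod.norm_def, max_le_iff]
  constructor
  · rw [h1]
    have h5 : ‖x⁻¹ ^ 2 * u.1‖ ≤ ‖sig x⁻¹ u‖ := norm_fst_le (sig x⁻¹ u)
    have : 0 ≤ C * (1 + X) * ‖sig x⁻¹ u‖ := by positivity
    linarith
  · rw [norm_smul, norm_inv, Real.norm_eq_abs, abs_of_pos hx]
    have h5 : ‖u'.2‖ ≤ C * (x * (1 + X) * ‖sig x⁻¹ u‖) :=
      (norm_snd_le u').trans (h2.trans (by gcongr))
    calc x⁻¹ * ‖u'.2‖ ≤ x⁻¹ * (C * (x * (1 + X) * ‖sig x⁻¹ u‖)) := by gcongr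
      _ = C * (1 + X) * ‖sig x⁻¹ u‖ := by field_simp
      _ ≤ _ := by linarith

/-- Here x = 1/s, so `sig z.1` is the inverse scattering scaling at the image point. In the
scattering frame the derivative depends only on y = Θ/s, which is bounded: it is a shear with a
sign, so both it and its inverse are bounded. -/
theorem sig_inv_fderiv_cone {z : HE d} (hz : 0 < z.1) (w : HE d) :
    sig z.1 (fderiv ℝ (cone : HE d → HE d) z w) = (-w.1, w.2 - w.1 • (z.1⁻¹ • z.2)) := by
  rw [fderiv_cone hz, sig_apply]
  have := hz.ne'
  ext1
  · simp only []
    field_simp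
  · simp only [smul_sub, smul_smul]
    congr 2
    · field_simp; simp
    · field_simp

theorem sig_inv_fderiv_fderiv_cone {z : HE d} (hz : 0 < z.1) (w w' : HE d) :
    sig z.1 (fderiv ℝ (fderiv ℝ (cone : HE d → HE d)) z w w')
      = (2 * z.1⁻¹ * w.1 * w'.1, -((z.1⁻¹ * w.1) • w'.2) - (z.1⁻¹ * w'.1) • w.2
        + (2 * z.1⁻¹ * w.1 * w'.1) • (z.1⁻¹ • z.2)) := by
  rw [fderiv_fderiv_cone hz, sig_apply]
  have := hz.ne'
  ext1
  · simp only []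
    field_simp
  · simp only [smul_add, smul_sub, smul_neg, smul_smul]
    have e1 : ∀ a : ℝ, z.1 * (z.1⁻¹ ^ 2 * a) = z.1⁻¹ * a := fun a => by field_simp
    have e2 : z.1 * (2 * z.1⁻¹ ^ 3 * w.1 * w'.1) = 2 * z.1⁻¹ * w.1 * w'.1 * z.1⁻¹ := by field_simp
    rw [e1, e1, e2]

theorem norm_sig_inv_fderiv_cone_le {z : HE d} (hz : 0 < z.1) {Y : ℝ} (hY : ‖z.1⁻¹ • z.2‖ ≤ Y)
    (w : HE d) :
    ‖sig z.1 (fderiv ℝ (cone : HE d → HE d) z w)‖ ≤ (1 + Y) * ‖w‖ ∧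
      ‖w‖ ≤ (1 + Y) * ‖sig z.1 (fderiv ℝ (cone : HE d → HE d) z w)‖ := by
  have hY0 : 0 ≤ Y := (norm_nonneg _).trans hY
  rw [sig_inv_fderiv_cone hz]
  set y := z.1⁻¹ • z.2
  have a1 := norm_fst_le w
  have a2 := norm_snd_le w
  have a0 := norm_nonneg w
  constructor
  · rw [Prod.norm_def, max_le_iff]
    constructor
    · rw [norm_neg]; nlinarith
    · refine (norm_sub_le _ _).trans ?_
      rw [norm_smul]
      have : ‖w.1‖ * ‖y‖ ≤ ‖w‖ * Y := by gcongr
      linarith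
  · set m : HE d := (-w.1, w.2 - w.1 • y)
    have b1 : ‖w.1‖ ≤ ‖m‖ := by
      have := norm_fst_le m
      rwa [show m.1 = -w.1 from rfl, norm_neg] at this
    have b2 : ‖w.2 - w.1 • y‖ ≤ ‖m‖ := norm_snd_le m
    have b0 := norm_nonneg m
    rw [Prod.norm_def, max_le_iff]
    constructor
    · nlinarith
    · have e : w.2 = (w.2 - w.1 • y) + w.1 • y := by abel
      rw [e]
      refine (norm_add_le _ _).trans ?_
      rw [norm_smul]
      have : ‖w.1‖ * ‖y‖ ≤ ‖m‖ * Y := by gcongr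
      linarith

theorem norm_sig_inv_fderiv_fderiv_cone_le {z : HE d} (hz : 0 < z.1) {X Y : ℝ} (hX : z.1⁻¹ ≤ X)
    (hY : ‖z.1⁻¹ • z.2‖ ≤ Y) (w w' : HE d) :
    ‖sig z.1 (fderiv ℝ (fderiv ℝ (cone : HE d → HE d)) z w w')‖
      ≤ 2 * X * (1 + Y) * ‖w‖ * ‖w'‖ := by
  have hY0 : 0 ≤ Y := (norm_nonneg _).trans hY
  have hx : 0 < z.1⁻¹ := inv_pos.2 hz
  have hX0 : 0 < X := hx.trans_le hX
  rw [sig_inv_fderiv_fderiv_cone hz]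
  set y := z.1⁻¹ • z.2
  set x := z.1⁻¹
  have a1 := norm_fst_le w
  have a2 := norm_snd_le w
  have b1 := norm_fst_le w'
  have b2 := norm_snd_le w'
  have a0 := norm_nonneg w
  have b0 := norm_nonneg w'
  have k1 : ‖2 * x * w.1 * w'.1‖ ≤ 2 * X * ‖w‖ * ‖w'‖ := by
    rw [norm_mul, norm_mul, norm_mul, Real.norm_eq_abs x, abs_of_pos hx]
    norm_num
    gcongr <;> assumption
  rw [Prod.norm_def, max_le_iff]
  constructor
  · refine k1.trans ?_
    have : 0 ≤ 2 * X * Y * ‖w‖ * ‖w'‖ := by positivity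
    linarith
  · have k2 : ‖(x * w.1) • w'.2‖ ≤ X * ‖w‖ * ‖w'‖ := by
      rw [norm_smul, norm_mul, Real.norm_eq_abs x, abs_of_pos hx]; gcongr
    have k3 : ‖(x * w'.1) • w.2‖ ≤ X * ‖w'‖ * ‖w‖ := by
      rw [norm_smul, norm_mul, Real.norm_eq_abs x, abs_of_pos hx]; gcongr
    have k4 : ‖(2 * x * w.1 * w'.1) • y‖ ≤ 2 * X * ‖w‖ * ‖w'‖ * Y := by
      rw [norm_smul]; gcongr
    refine (norm_add_le _ _).trans ?_
    refine (add_le_add (norm_sub_le _ _) k4).trans ?_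
    rw [norm_neg]
    linarith

section ConeTrans

variable {θ : OpenPartialHomeomorph (HE d) (HE d)} {C X Y : ℝ}

/-- The scattering bounds for a diffeomorphism preserving `x`, composed with the cone map. -/
theorem scBounds_cone_trans (hC : 0 ≤ C) (hX : 0 ≤ X) (hY : 0 ≤ Y)
    (hθ : ContDiffOn ℝ ∞ θ θ.source) (hfst : ∀ z ∈ θ.source, (θ z).1 = z.1)
    (hb : ∀ z ∈ θ.source, z.1 ≤ X ∧ ‖z.2‖ ≤ Y)
    (h1 : ∀ z ∈ θ.source, ‖fderiv ℝ θ z‖ ≤ C) (h2 : ∀ z ∈ θ.source, ∀ w, ‖w‖ ≤ C * ‖fderiv ℝ θ z w‖)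
    (h3 : ∀ z ∈ θ.source, ‖fderiv ℝ (fderiv ℝ θ) z‖ ≤ C) :
    ∃ C' : ℝ, 0 ≤ C' ∧ ScBounds (cone.trans θ) (cone.trans θ).source C' := by
  set C₁ := 1 + C * (1 + X) with hC₁
  have hC₁0 : 0 ≤ C₁ := by positivity
  have hsrc : ∀ z ∈ (cone.trans θ).source, 0 < z.1 ∧ cone z ∈ θ.source := fun z hz => by
    rw [OpenPartialHomeomorph.trans_source] at hz
    exact hz
  have hcoe : ((cone.trans θ : OpenPartialHomeomorph (HE d) (HE d)) : HE d → HE d) = θ ∘ cone := rfl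
  have hcd : ∀ p ∈ θ.source, ContDiffAt ℝ ∞ θ p := fun p hp => hθ.contDiffAt (θ.open_source.mem_nhds hp)
  have hD1 : ∀ p ∈ θ.source, ∀ u, (fderiv ℝ θ p u).1 = u.1 := by
    intro p hp u
    have e : (fun y => (θ y).1) =ᶠ[𝓝 p] fun y => y.1 := by
      filter_upwards [θ.open_source.mem_nhds hp] with y hy using hfst y hy
    have k1 := (((hcd p hp).differentiableAt (by simp)).hasFDerivAt).fst
    have k2 := (hasFDerivAt_fst (𝕜 := ℝ) (p := p)).congr_of_eventuallyEq e
    exact DFunLike.congr_fun (k1.unique k2) u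
  -- Since θ preserves x, its second derivative has no x-component. Only the scaling x⁻¹ of the
  -- other components then has to be compensated.
  have hD2 : ∀ p ∈ θ.source, ∀ u u', (fderiv ℝ (fderiv ℝ θ) p u u').1 = 0 := by
    intro p hp u u'
    have k1 : DifferentiableAt ℝ (fderiv ℝ θ) p :=
      (((hcd p hp).fderiv_right (m := 1) (natCast_le_infty 2)).differentiableAt (by simp))
    have k2 := ((k1.hasFDerivAt).clm_apply (hasFDerivAt_const u' p)).fst
    have e : (fun y => (fderiv ℝ θ y u').1) =ᶠ[𝓝 p] fun _ => u'.1 := by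
      filter_upwards [θ.open_source.mem_nhds hp] with y hy using hD1 y hy u'
    have k3 := (hasFDerivAt_const (𝕜 := ℝ) u'.1 p).congr_of_eventuallyEq e
    have := DFunLike.congr_fun (k2.unique k3) u
    simpa using this
  have hxz : ∀ z ∈ (cone.trans θ).source, ((cone.trans θ) z).1 = z.1⁻¹ := fun z hz =>
    hfst _ (hsrc z hz).2
  have hfd : ∀ z ∈ (cone.trans θ).source, ∀ w, fderiv ℝ (cone.trans θ) z w
      = fderiv ℝ θ (cone z) (fderiv ℝ (cone : HE d → HE d) z w) := fun z hz w => by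
    rw [hcoe, fderiv_comp z ((hcd _ (hsrc z hz).2).differentiableAt (by simp))
      ((contDiffAt_cone (hsrc z hz).1).differentiableAt (by simp))]
    rfl
  refine ⟨C₁ * (1 + Y) + (C * X * (1 + X) ^ 2 * (1 + Y) ^ 2 + C₁ * (2 * X * (1 + Y))), by positivity,
    ?_, ?_, ?_, ?_⟩
  · intro z hz
    rw [hxz z hz]
    exact inv_pos.2 (hsrc z hz).1
  · intro z hz w
    obtain ⟨hz0, hp⟩ := hsrc z hz
    obtain ⟨hpX, hpY⟩ := hb _ hp
    have hx : 0 < z.1⁻¹ := inv_pos.2 hz0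
    have k1 := (norm_sig_inv_fderiv_cone_le hz0 hpY w).1
    have k2 := norm_sig_inv_le_of_fst_eq hx hpX hC (hD1 _ hp (fderiv ℝ (cone : HE d → HE d) z w))
      (((fderiv ℝ θ (cone z)).le_opNorm _).trans (by gcongr; exact h1 _ hp))
    rw [hxz z hz, hfd z hz]
    simp only [inv_inv] at k2 ⊢
    refine k2.trans ((mul_le_mul_of_nonneg_left k1 hC₁0).trans ?_)
    rw [← mul_assoc]
    refine mul_le_mul_of_nonneg_right (le_add_of_nonneg_right (by positivity)) (norm_nonneg _)
  · intro z hz w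
    obtain ⟨hz0, hp⟩ := hsrc z hz
    obtain ⟨hpX, hpY⟩ := hb _ hp
    have hx : 0 < z.1⁻¹ := inv_pos.2 hz0
    have k1 := (norm_sig_inv_fderiv_cone_le hz0 hpY w).2
    have k2 := norm_sig_inv_le_of_fst_eq hx hpX hC
      (hD1 _ hp (fderiv ℝ (cone : HE d → HE d) z w)).symm (h2 _ hp _)
    rw [hxz z hz, hfd z hz]
    simp only [inv_inv] at k2 ⊢
    refine k1.trans ((mul_le_mul_of_nonneg_left k2 (by positivity)).trans ?_)
    rw [← mul_assoc]
    refine mul_le_mul_of_nonneg_right ?_ (norm_nonneg _)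
    rw [mul_comm]
    exact le_add_of_nonneg_right (by positivity)
  · intro z hz w w'
    obtain ⟨hz0, hp⟩ := hsrc z hz
    obtain ⟨hpX, hpY⟩ := hb _ hp
    have hx : 0 < z.1⁻¹ := inv_pos.2 hz0
    rw [hxz z hz, hcoe, fderiv_fderiv_comp ((contDiffAt_cone hz0).of_le (natCast_le_infty 2))
      ((hcd _ hp).of_le (natCast_le_infty 2)), map_add]
    have k1 := (norm_sig_inv_fderiv_cone_le hz0 hpY w).1
    have k1' := (norm_sig_inv_fderiv_cone_le hz0 hpY w').1
    have k3 := norm_sig_inv_fderiv_fderiv_cone_le hz0 hpX hpY w w'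
    have k2 := norm_sig_inv_le_of_fst_eq hx hpX hC
      (hD1 _ hp (fderiv ℝ (fderiv ℝ (cone : HE d → HE d)) z w w'))
      (((fderiv ℝ θ (cone z)).le_opNorm _).trans (by gcongr; exact h1 _ hp))
    set u := fderiv ℝ (cone : HE d → HE d) z w
    set u' := fderiv ℝ (cone : HE d → HE d) z w'
    set m := fderiv ℝ (fderiv ℝ θ) (cone z) u u' with hm
    have k4 := norm_sig_le hx hpX (sig z.1⁻¹⁻¹ u)
    have k4' := norm_sig_le hx hpX (sig z.1⁻¹⁻¹ u')
    rw [sig_sig_inv hx.ne', inv_inv] at k4 k4'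
    have k5 : ‖m‖ ≤ C * ‖u‖ * ‖u'‖ :=
      ((fderiv ℝ (fderiv ℝ θ) (cone z)).le_opNorm₂ u u').trans (by gcongr; exact h3 _ hp)
    -- The vectors `u` and `u'` are each O(x), so one factor x⁻¹ leaves a bound of order x, hence at
    -- most X.
    have k6 : ‖sig z.1 m‖ ≤ C * X * (1 + X) ^ 2 * (1 + Y) ^ 2 * ‖w‖ * ‖w'‖ := by
      have e : sig z.1 m = (0, z.1 • m.2) := by
        rw [sig_apply, hm, hD2 _ hp, mul_zero]
      rw [e, Prod.norm_def, norm_zero, max_eq_right (norm_nonneg _), norm_smul, Real.norm_eq_abs,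
        abs_of_pos hz0]
      have hpX' : z.1⁻¹ ≤ X := hpX
      calc z.1 * ‖m.2‖ ≤ z.1 * (C * (z.1⁻¹ * (1 + X) * ((1 + Y) * ‖w‖))
            * (z.1⁻¹ * (1 + X) * ((1 + Y) * ‖w'‖))) := by
            refine mul_le_mul_of_nonneg_left ((norm_snd_le m).trans (k5.trans ?_)) hz0.le
            refine mul_le_mul (mul_le_mul_of_nonneg_left (k4.trans ?_) hC) (k4'.trans ?_)
              (norm_nonneg _) (by positivity) <;> gcongr
        _ = C * z.1⁻¹ * (1 + X) ^ 2 * (1 + Y) ^ 2 * ‖w‖ * ‖w'‖ := by field_simp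
        _ ≤ _ := by gcongr
    rw [inv_inv] at k2 ⊢
    refine (norm_add_le _ _).trans ?_
    have k7 : C₁ * ‖sig z.1 (fderiv ℝ (fderiv ℝ (cone : HE d → HE d)) z w w')‖
        ≤ C₁ * (2 * X * (1 + Y)) * ‖w‖ * ‖w'‖ := by
      refine (mul_le_mul_of_nonneg_left k3 hC₁0).trans (le_of_eq (by ring))
    have k8 : 0 ≤ C₁ * (1 + Y) * ‖w‖ * ‖w'‖ := by positivity
    linarith

/-- The vector fields `V` in the case of the cone map. -/
def coneVec (ε : Fin d → ℝ) : Fin (d + 1) → HE d :=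
  Fin.cons (-1, 0) fun i => (-1, ε i • EuclideanSpace.single i 1)

theorem eq_zero_of_coneVec {ε : Fin d → ℝ} (hε : ∀ i, ε i ≠ 0) (η : HE d →L[ℝ] ℂ)
    (h : ∀ k, η (coneVec ε k) = 0) : η = 0 := by
  have h0 : η (-1, 0) = 0 := h 0
  refine eq_zero_of_coordVec ?_ fun i => ?_
  · have e : ((1, 0) : HE d) = -(-1, 0) := by simp
    rw [e, map_neg, h0, neg_zero]
  · have h1 : η (-1, ε i • EuclideanSpace.single i 1) = 0 := h i.succ
    have e : ((0, EuclideanSpace.single i 1) : HE d)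
        = (ε i)⁻¹ • ((-1, ε i • EuclideanSpace.single i 1) - (-1, 0)) := by
      simp [smul_smul, hε i]
    rw [e, map_smul, map_sub, h1, h0, sub_zero, smul_zero]

/-- All vectors of `coneVec` have s-component -1, and x = 1/s, so the derivative of x along them is
exactly x² and the speed constant is 1. The free choice of `ε` is used to make them point into `T`.
-/
theorem nonempty_adapted_cone (hC : 0 ≤ C) (hX : 0 ≤ X) (hY : 0 ≤ Y)
    (hθ : ContDiffOn ℝ ∞ θ θ.source) (hfst : ∀ z ∈ θ.source, (θ z).1 = z.1)
    (hb : ∀ z ∈ θ.source, z.1 ≤ X ∧ ‖z.2‖ ≤ Y)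
    (h1 : ∀ z ∈ θ.source, ‖fderiv ℝ θ z‖ ≤ C) (h2 : ∀ z ∈ θ.source, ∀ w, ‖w‖ ≤ C * ‖fderiv ℝ θ z w‖)
    (h3 : ∀ z ∈ θ.source, ‖fderiv ℝ (fderiv ℝ θ) z‖ ≤ C) {ρ : HE d → ℝ} {T : Set (HE d)}
    (hTm : MeasurableSet T) (hT : KornOn volume T)
    (hTρ : ∀ z, 0 < z.1 → cone z ∈ θ.source → (z ∈ T ↔ 0 < ρ (θ (cone z))))
    {ε : Fin d → ℝ} (hε : ∀ i, ε i ≠ 0) (hin : ∀ k, Inward volume T (coneVec ε k)) :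
    Nonempty (Adapted ρ θ.target) := by
  obtain ⟨C₁, hC₁, hB⟩ := scBounds_cone_trans hC hX hY hθ hfst hb h1 h2 h3
  obtain ⟨C₂, hC₂, hS⟩ := exists_norm_sq_le_of_span (coneVec ε) (eq_zero_of_coneVec hε)
  have hsrc : ∀ z ∈ (cone.trans θ).source, 0 < z.1 ∧ cone z ∈ θ.source := fun z hz => by
    rw [OpenPartialHomeomorph.trans_source] at hz
    exact hz
  have hm1 : C₁ ≤ max C₁ C₂ := le_max_left _ _
  have hsm : ContDiffOn ℝ ∞ (cone.trans θ) (cone.trans θ).source := fun z hz =>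
    ((hθ.contDiffAt (θ.open_source.mem_nhds (hsrc z hz).2)).comp z
      (contDiffAt_cone (hsrc z hz).1)).contDiffWithinAt
  refine ⟨⟨cone.trans θ, hsm, ?_, T, hTm, hT, fun z hz => hTρ z (hsrc z hz).1 (hsrc z hz).2,
    max C₁ C₂, le_max_of_le_left hC₁, ?_, d + 1, coneVec ε, hin,
    fun η => (hS η).trans (mul_le_mul_of_nonneg_right (le_max_right _ _)
      (Finset.sum_nonneg fun _ _ => by positivity)), 1, one_pos, ?_⟩⟩
  · rw [OpenPartialHomeomorph.trans_target]
    ext q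
    have hq : q ∈ θ.target → (θ.symm q).1 = q.1 := fun hq => by
      rw [← hfst _ (θ.map_target hq), θ.right_inv hq]
    constructor
    · rintro ⟨a1, a2⟩
      have a3 : 0 < (θ.symm q).1 := a2
      exact ⟨a1, by rwa [hq a1] at a3⟩
    · rintro ⟨a1, a2⟩
      have a3 : 0 < q.1 := a2
      rw [← hq a1] at a3
      exact ⟨a1, a3⟩
  · refine ⟨hB.pos, fun z hz w => (hB.upper z hz w).trans (by gcongr),
      fun z hz w => (hB.lower z hz w).trans (by gcongr),
      fun z hz w w' => (hB.second z hz w w').trans (by gcongr)⟩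
  · intro z hz k
    obtain ⟨hz0, hp⟩ := hsrc z hz
    have e : (fun y => ((cone.trans θ) y).1) =ᶠ[𝓝 z] fun y => y.1⁻¹ := by
      filter_upwards [(cone.trans θ).open_source.mem_nhds hz] with y hy
      exact hfst _ (hsrc y hy).2
    have k1 : HasFDerivAt (fun y : HE d => y.1⁻¹) (-(z.1 ^ 2)⁻¹ • ContinuousLinearMap.fst ℝ ℝ (E d)) z :=
      (hasDerivAt_inv hz0.ne').comp_hasFDerivAt z hasFDerivAt_fst
    have k2 := ((((hsm.contDiffAt ((cone.trans θ).open_source.mem_nhds hz)).differentiableAt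
      (by simp)).hasFDerivAt).fst).unique (k1.congr_of_eventuallyEq e)
    have k3 : (fderiv ℝ (cone.trans θ) z (coneVec ε k)).1 = -(z.1 ^ 2)⁻¹ * (coneVec ε k).1 :=
      DFunLike.congr_fun k2 (coneVec ε k)
    have k4 : (coneVec ε k).1 = -1 := by
      refine Fin.cases ?_ (fun i => ?_) k <;> rfl
    have k5 : ((cone.trans θ) z).1 = z.1⁻¹ := e.self_of_nhds
    rw [k3, k4, k5]
    have := hz0.ne'
    refine le_of_eq ?_
    field_simp

end ConeTrans

end

/-! ### Existence of adapted coordinates -/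

section

variable {d : ℕ} {ρ : HE d → ℝ} {s : Set (HE d)} {q₀ : HE d}

theorem exists_isOpen_norm_lt {Ψ : HE d → HE d} (hs : IsOpen s) (hΨ : ContinuousOn Ψ s)
    (hq₀ : q₀ ∈ s) : ∃ s' ⊆ s, IsOpen s' ∧ q₀ ∈ s' ∧ ∃ M : ℝ, 0 ≤ M ∧ ∀ q ∈ s', ‖q‖ ≤ M ∧ ‖Ψ q‖ ≤ M := by
  set N := ‖q₀‖ + ‖Ψ q₀‖ + 1
  refine ⟨s ∩ Ψ ⁻¹' Metric.ball 0 N ∩ Metric.ball 0 N, fun q hq => hq.1.1,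
    (hΨ.isOpen_inter_preimage hs Metric.isOpen_ball).inter Metric.isOpen_ball, ⟨⟨hq₀, ?_⟩, ?_⟩, N,
    by positivity, fun q hq => ⟨?_, ?_⟩⟩
  · have := norm_nonneg q₀
    simp only [mem_preimage, Metric.mem_ball, dist_zero_right, N]; linarith
  · have := norm_nonneg (Ψ q₀)
    simp only [Metric.mem_ball, dist_zero_right, N]; linarith
  · exact (mem_ball_zero_iff.1 hq.2).le
  · exact (mem_ball_zero_iff.1 hq.1.2).le

/-- Away from ∂_int Ω the region fills a whole neighbourhood intersected with {x > 0}, so `T` is the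
whole space, every constant field is inward, and θ is just a restriction of the identity. -/
theorem exists_adapted_of_pos (hs : IsOpen s) (hq₀ : q₀ ∈ s) (hpos : ∀ q ∈ s, 0 < ρ q) :
    ∃ Q : Set (HE d), IsOpen Q ∧ q₀ ∈ Q ∧ Q ⊆ s ∧ (∃ X : ℝ, ∀ q ∈ Q, q.1 ≤ X) ∧
      Nonempty (Adapted ρ Q) := by
  obtain ⟨s', hs's, hs', hq', M, hM, hb⟩ := exists_isOpen_norm_lt hs continuousOn_id hq₀
  obtain ⟨θ, C, hC, hqθ, hθs, hsymm, hθ, hbd⟩ := exists_localInverse (Ψ := id) hs' contDiffOn_id hq'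
    (ContinuousLinearEquiv.refl ℝ (HE d)) (hasFDerivAt_id q₀) one_pos
  have hid : ∀ z ∈ θ.source, θ z = z := fun z hz => by
    have := hsymm _ (θ.map_source hz)
    rw [θ.left_inv hz] at this
    exact this.symm
  have hsrc : ∀ z ∈ θ.source, z ∈ s' := fun z hz => by
    have := hθs (θ.map_source hz)
    rwa [hid z hz] at this
  have hθX : ∀ q ∈ θ.target, q.1 ≤ M := fun q hq =>
    (le_abs_self _).trans ((norm_fst_le q).trans (hb q (hθs hq)).1)
  refine ⟨θ.target, θ.open_target, hqθ, hθs.trans hs's, ⟨M, hθX⟩, ?_⟩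
  refine nonempty_adapted_cone hC hM hM hθ (fun z hz => by rw [hid z hz])
    (fun z hz => ⟨?_, (norm_snd_le z).trans (hb z (hsrc z hz)).1⟩) (fun z hz => (hbd z hz).1)
    (fun z hz => (hbd z hz).2.1) (fun z hz => (hbd z hz).2.2.1) MeasurableSet.univ (kornOn_univ volume)
    (fun z _ hz => ⟨fun _ => hpos _ (hs's (hθs (θ.map_source hz))), fun _ => mem_univ _⟩)
    (ε := fun _ => 1) (fun _ => one_ne_zero) (fun k => inward_univ volume _)
  exact (le_abs_self _).trans ((norm_fst_le z).trans (hb z (hsrc z hz)).1)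

/-- Adapted coordinates at a boundary point at infinity. -/
theorem exists_adapted_of_fderiv_snd (hs : IsOpen s) (hρ : ContDiffOn ℝ ∞ ρ s) (hq₀ : q₀ ∈ s) {e : E d}
    (he : fderiv ℝ ρ q₀ (0, e) ≠ 0) :
    ∃ Q : Set (HE d), IsOpen Q ∧ q₀ ∈ Q ∧ Q ⊆ s ∧ (∃ X : ℝ, ∀ q ∈ Q, q.1 ≤ X) ∧
      Nonempty (Adapted ρ Q) := by
  set D := fderiv ℝ ρ q₀ with hD
  set l : E d →L[ℝ] ℝ := D.comp (ContinuousLinearMap.inr ℝ ℝ (E d)) with hl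
  set n : E d := (D (0, e))⁻¹ • e with hn
  have hln : l n = 1 := by
    rw [hn, map_smul, smul_eq_mul]
    exact inv_mul_cancel₀ he
  -- This map keeps x and moves y along `n` until `l` of the new y equals ρ, because `l n` is 1.
  -- Thus ρ becomes linear in y without changing x.
  set Ψ : HE d → HE d := fun q => (q.1, q.2 + (ρ q - l q.2) • n) with hΨdef
  have hΨ : ContDiffOn ℝ ∞ Ψ s := contDiff_fst.contDiffOn.prodMk
    (contDiff_snd.contDiffOn.add ((hρ.sub (l.contDiff.comp contDiff_snd).contDiffOn).smul contDiffOn_const))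
  obtain ⟨s', hs's, hs', hq', M, hM, hb⟩ := exists_isOpen_norm_lt hs hΨ.continuousOn hq₀
  have hDab : ∀ a b, D (a, b) = D (a, 0) + l b := fun a b => by
    rw [hl, ContinuousLinearMap.comp_apply, ContinuousLinearMap.inr_apply, ← map_add]
    simp
  let j : ℝ →L[ℝ] HE d := ContinuousLinearMap.inl ℝ ℝ (E d)
  let P : HE d →L[ℝ] HE d := (ContinuousLinearMap.fst ℝ ℝ (E d)).prod
    (ContinuousLinearMap.snd ℝ ℝ (E d)
      + ((D.comp j).comp (ContinuousLinearMap.fst ℝ ℝ (E d))).smulRight n)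
  let P' : HE d →L[ℝ] HE d := (ContinuousLinearMap.fst ℝ ℝ (E d)).prod
    (ContinuousLinearMap.snd ℝ ℝ (E d)
      - ((D.comp j).comp (ContinuousLinearMap.fst ℝ ℝ (E d))).smulRight n)
  let A : HE d ≃L[ℝ] HE d := ContinuousLinearEquiv.equivOfInverse P P'
    (fun w => by ext1 <;> simp [P, P']) (fun w => by ext1 <;> simp [P, P'])
  have hA : HasFDerivAt Ψ (A : HE d →L[ℝ] HE d) q₀ := by
    have h1 : HasFDerivAt ρ D q₀ :=
      ((hρ.contDiffAt (hs.mem_nhds hq₀)).differentiableAt (by simp)).hasFDerivAt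
    have h2 : HasFDerivAt (fun q : HE d => l q.2) (l.comp (ContinuousLinearMap.snd ℝ ℝ (E d))) q₀ :=
      l.hasFDerivAt.comp q₀ hasFDerivAt_snd
    have h3 : HasFDerivAt Ψ _ q₀ :=
      hasFDerivAt_fst.prodMk (hasFDerivAt_snd.add ((h1.sub h2).smul_const n))
    refine h3.congr_fderiv ?_
    refine ContinuousLinearMap.ext fun w => ?_
    change _ = P w
    have := hDab w.1 w.2
    ext1
    · simp [P]
    · simp [P, j, this]
  obtain ⟨θ, C, hC, hqθ, hθs, hsymm, hθ, hbd⟩ := exists_localInverse hs' (hΨ.mono hs's) hq' A hA one_pos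
  have hinv : ∀ z ∈ θ.source, Ψ (θ z) = z := fun z hz => by
    rw [← hsymm _ (θ.map_source hz), θ.left_inv hz]
  have hz : ∀ z ∈ θ.source, ‖z‖ ≤ M := fun z hz => by
    have := (hb _ (hθs (θ.map_source hz))).2
    rwa [hinv z hz] at this
  have hθX : ∀ q ∈ θ.target, q.1 ≤ M := fun q hq =>
    (le_abs_self _).trans ((norm_fst_le q).trans (hb q (hθs hq)).1)
  refine ⟨θ.target, θ.open_target, hqθ, hθs.trans hs's, ⟨M, hθX⟩, ?_⟩
  let l' : HE d →L[ℝ] ℝ := l.comp (ContinuousLinearMap.snd ℝ ℝ (E d))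
  have hl'n : l' (0, n) = 1 := hln
  -- The signs make every vector (-1, ε_i e_i) point into {l > 0} or along its boundary. No
  -- information on ∂_xρ is needed, since l does not involve s.
  let ε : Fin d → ℝ := fun i => if 0 ≤ l (EuclideanSpace.single i 1) then 1 else -1
  refine nonempty_adapted_cone hC hM hM hθ (fun z hz => ?_)
    (fun z hzs => ⟨(le_abs_self _).trans ((norm_fst_le z).trans (hz z hzs)),
      (norm_snd_le z).trans (hz z hzs)⟩) (fun z hz => (hbd z hz).1)
    (fun z hz => (hbd z hz).2.1) (fun z hz => (hbd z hz).2.2.1) (T := {z | 0 < l' z})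
    (isOpen_lt continuous_const l'.continuous).measurableSet (kornOn_halfSpace volume hl'n)
    (fun z hz0 hzs => ?_) (ε := ε) (fun i => ?_) (fun k => inward_halfSpace volume ?_)
  · change (Ψ (θ z)).1 = z.1
    rw [hinv z hz]
  · have h1 := congrArg (fun w : HE d => l w.2) (hinv _ hzs)
    simp only [hΨdef, map_add, map_smul, hln, smul_eq_mul, mul_one, cone_apply] at h1
    -- Being linear in y, the defining function becomes l(Θ)/s under the cone map, so its positivity
    -- set is the half-space l > 0.
    have h2 : ρ (θ (cone z)) = z.1⁻¹ * l z.2 := by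
      rw [cone_apply]; linarith
    rw [h2]
    change 0 < l z.2 ↔ _
    exact (mul_pos_iff_of_pos_left (inv_pos.2 hz0)).symm
  · dsimp only [ε]; split_ifs <;> norm_num
  · refine Fin.cases ?_ (fun i => ?_) k
    · change 0 ≤ l 0
      simp
    · change 0 ≤ l (ε i • EuclideanSpace.single i 1)
      rw [map_smul, smul_eq_mul]
      dsimp only [ε]
      split_ifs with h
      · linarith
      · linarith [not_le.1 h]

/-- Adapted coordinates at a boundary point in the interior. -/
theorem exists_adapted_of_fderiv_fst (hs : IsOpen s) (hρ : ContDiffOn ℝ ∞ ρ s) (hq₀ : q₀ ∈ s)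
    (hx : 0 < q₀.1) (hα : 0 < fderiv ℝ ρ q₀ (1, 0)) :
    ∃ Q : Set (HE d), IsOpen Q ∧ q₀ ∈ Q ∧ Q ⊆ s ∧ (∃ X : ℝ, ∀ q ∈ Q, q.1 ≤ X) ∧
      Nonempty (Adapted ρ Q) := by
  set D := fderiv ℝ ρ q₀ with hD
  set α := D (1, 0) with hαdef
  set l : E d →L[ℝ] ℝ := D.comp (ContinuousLinearMap.inr ℝ ℝ (E d)) with hl
  -- At positive x no scaling is needed: ρ itself replaces x as a coordinate, possible because ∂_xρ
  -- ≠ 0, and the region is the half-space of positive first coordinate.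
  set Ψ : HE d → HE d := fun q => (ρ q, q.2) with hΨdef
  have hΨ : ContDiffOn ℝ ∞ Ψ s := hρ.prodMk contDiff_snd.contDiffOn
  have hs1 : IsOpen (s ∩ {q | q₀.1 / 2 < q.1}) := hs.inter (isOpen_lt continuous_const continuous_fst)
  have hq1 : q₀ ∈ s ∩ {q | q₀.1 / 2 < q.1} := ⟨hq₀, by change q₀.1 / 2 < q₀.1; linarith⟩
  obtain ⟨s', hs's, hs', hq', M, hM, hb⟩ := exists_isOpen_norm_lt hs1
    (hΨ.continuousOn.mono inter_subset_left) hq1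
  have hDab : ∀ w : HE d, D w = α * w.1 + l w.2 := fun w => by
    have e : w = w.1 • ((1, 0) : HE d) + (0, w.2) := by ext1 <;> simp
    conv_lhs => rw [e]
    rw [map_add, map_smul, smul_eq_mul, mul_comm]
    rfl
  have hα0 : α ≠ 0 := hα.ne'
  let P : HE d →L[ℝ] HE d := D.prod (ContinuousLinearMap.snd ℝ ℝ (E d))
  let P' : HE d →L[ℝ] HE d := (α⁻¹ • (ContinuousLinearMap.fst ℝ ℝ (E d)
    - l.comp (ContinuousLinearMap.snd ℝ ℝ (E d)))).prod (ContinuousLinearMap.snd ℝ ℝ (E d))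
  let A : HE d ≃L[ℝ] HE d := ContinuousLinearEquiv.equivOfInverse P P'
    (fun w => by
      ext1
      · simp only [P, P', ContinuousLinearMap.prod_apply, smul_apply, sub_apply,
          ContinuousLinearMap.coe_fst', ContinuousLinearMap.comp_apply,
          ContinuousLinearMap.coe_snd', hDab, smul_eq_mul]
        field_simp
        ring
      · rfl)
    (fun w => by
      ext1
      · simp only [P, P', ContinuousLinearMap.prod_apply, smul_apply, sub_apply,
          ContinuousLinearMap.coe_fst', ContinuousLinearMap.comp_apply,
          ContinuousLinearMap.coe_snd', hDab, smul_eq_mul]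
        field_simp
        ring
      · rfl)
  have hA : HasFDerivAt Ψ (A : HE d →L[ℝ] HE d) q₀ :=
    ((hρ.contDiffAt (hs.mem_nhds hq₀)).differentiableAt (by simp)).hasFDerivAt.prodMk hasFDerivAt_snd
  let ε : Fin d → ℝ := fun i => if 0 ≤ l (EuclideanSpace.single i 1) then 1 else -1
  -- In the original coordinates these fields all have x-component 1 at the base point. The
  -- derivative of ρ along them is α + ε_i l(e_i) with ε_i l(e_i) ≥ 0, so the positive sign of α =
  -- ∂_xρ makes them inward. This is the decisive use of the convexity hypothesis in the estimates.
  let V₀ : Fin (d + 1) → HE d := Fin.cons (1, 0) fun i => (1, ε i • EuclideanSpace.single i 1)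
  let V : Fin (d + 1) → HE d := fun k => A (V₀ k)
  have hε : ∀ i, ε i ≠ 0 := fun i => by dsimp only [ε]; split_ifs <;> norm_num
  have hV : ∀ η : HE d →L[ℝ] ℂ, (∀ k, η (V k) = 0) → η = 0 := by
    intro η h
    have h' : η.comp (A : HE d →L[ℝ] HE d) = 0 := by
      have h0 : η.comp (A : HE d →L[ℝ] HE d) (1, 0) = 0 := h 0
      refine eq_zero_of_coordVec h0 fun i => ?_
      have h1 : η.comp (A : HE d →L[ℝ] HE d) (1, ε i • EuclideanSpace.single i 1) = 0 := h i.succ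
      have e : ((0, EuclideanSpace.single i 1) : HE d)
          = (ε i)⁻¹ • ((1, ε i • EuclideanSpace.single i 1) - (1, 0)) := by
        simp [smul_smul, hε i]
      rw [e, map_smul, map_sub, h1, h0, sub_zero, smul_zero]
    refine ContinuousLinearMap.ext fun w => ?_
    have := DFunLike.congr_fun h' (A.symm w)
    simpa using this
  -- Chosen so that δ‖V k‖ ≤ 1/2: then dx(V k) ≥ 1/2 throughout the neighbourhood, and with x ≤ M
  -- the speed is at least 1/(2M²).
  set δ := (2 * (1 + ∑ k, ‖V k‖))⁻¹ with hδ
  have hsum : 0 ≤ ∑ k, ‖V k‖ := Finset.sum_nonneg fun _ _ => norm_nonneg _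
  have hδ0 : 0 < δ := by positivity
  obtain ⟨θ, C, hC, hqθ, hθs, hsymm, hθ, hbd⟩ := exists_localInverse hs'
    (hΨ.mono (hs's.trans inter_subset_left)) hq' A hA hδ0
  have hinv : ∀ z ∈ θ.source, Ψ (θ z) = z := fun z hz => by
    rw [← hsymm _ (θ.map_source hz), θ.left_inv hz]
  have hθX : ∀ q ∈ θ.target, q.1 ≤ M := fun q hq =>
    (le_abs_self _).trans ((norm_fst_le q).trans (hb q (hθs hq)).1)
  have hlow : ∀ q ∈ θ.target, q₀.1 / 2 < q.1 := fun q hq => (hs's (hθs hq)).2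
  refine ⟨θ.target, θ.open_target, hqθ, fun q hq => (hs's (hθs hq)).1, ⟨M, hθX⟩, ?_⟩
  obtain ⟨C₂, hC₂, hS⟩ := exists_norm_sq_le_of_span V hV
  have hM0 : 0 < M := (half_pos hx).trans ((hlow _ hqθ).trans_le (hθX _ hqθ))
  -- Since q₀.1/2 < x ≤ M on the neighbourhood, the scattering and Euclidean norms are uniformly
  -- equivalent, and the bounds for θ carry over.
  set C₁ := (1 + M) / (q₀.1 / 2) ^ 2 * C + C * (M * (1 + M)) with hC₁
  have hC₁0 : 0 ≤ C₁ := by positivity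
  let l' : HE d →L[ℝ] ℝ := ContinuousLinearMap.fst ℝ ℝ (E d)
  have hl'n : l' (1, 0) = 1 := rfl
  have hup : ∀ z ∈ θ.source, ∀ w : HE d, ‖sig (θ z).1⁻¹ w‖ ≤ (1 + M) / (q₀.1 / 2) ^ 2 * ‖w‖ := fun z hz w => by
    have h1 := hlow _ (θ.map_source hz)
    have h0 : 0 < (θ z).1 := (half_pos hx).trans h1
    refine (norm_sig_inv_le h0 (hθX _ (θ.map_source hz)) w).trans ?_
    have := half_pos hx
    gcongr
  refine ⟨⟨θ, hθ, ?_, {z | 0 < l' z}, (isOpen_lt continuous_const l'.continuous).measurableSet,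
    kornOn_halfSpace volume hl'n, fun z hz => ?_, max C₁ C₂, le_max_of_le_left hC₁0,
    ⟨fun z hz => ?_, fun z hz w => ?_, fun z hz w => ?_, fun z hz w w' => ?_⟩, d + 1, V,
    fun k => inward_halfSpace volume ?_,
    fun η => (hS η).trans (mul_le_mul_of_nonneg_right (le_max_right _ _)
      (Finset.sum_nonneg fun _ _ => by positivity)), (2 * M ^ 2)⁻¹, by positivity, fun z hz k => ?_⟩⟩
  · refine (inter_eq_left.2 fun q hq => ?_).symm
    exact (half_pos hx).trans (hlow q hq)
  · have h1 : ρ (θ z) = z.1 := congrArg Prod.fst (hinv z hz)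
    rw [h1]
    rfl
  · exact (half_pos hx).trans (hlow _ (θ.map_source hz))
  · refine (hup z hz _).trans ?_
    have h2 : ‖fderiv ℝ θ z w‖ ≤ C * ‖w‖ := ((fderiv ℝ θ z).le_opNorm w).trans
      (mul_le_mul_of_nonneg_right (hbd z hz).1 (norm_nonneg _))
    calc _ ≤ (1 + M) / (q₀.1 / 2) ^ 2 * (C * ‖w‖) := by gcongr
      _ = (1 + M) / (q₀.1 / 2) ^ 2 * C * ‖w‖ := by ring
      _ ≤ _ := mul_le_mul_of_nonneg_right ((le_add_of_nonneg_right (by positivity)).trans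
        (le_max_left _ _)) (norm_nonneg _)
  · have h0 : 0 < (θ z).1 := (half_pos hx).trans (hlow _ (θ.map_source hz))
    have h1 := norm_sig_le h0 (hθX _ (θ.map_source hz)) (sig (θ z).1⁻¹ (fderiv ℝ θ z w))
    rw [sig_sig_inv h0.ne'] at h1
    have h3 := hθX _ (θ.map_source hz)
    calc ‖w‖ ≤ C * ‖fderiv ℝ θ z w‖ := (hbd z hz).2.1 w
      _ ≤ C * (M * (1 + M) * ‖sig (θ z).1⁻¹ (fderiv ℝ θ z w)‖) := by
        refine mul_le_mul_of_nonneg_left (h1.trans ?_) hC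
        gcongr
      _ = C * (M * (1 + M)) * ‖sig (θ z).1⁻¹ (fderiv ℝ θ z w)‖ := by ring
      _ ≤ _ := mul_le_mul_of_nonneg_right ((le_add_of_nonneg_left (by positivity)).trans
        (le_max_left _ _)) (norm_nonneg _)
  · refine (hup z hz _).trans ?_
    have h2 : ‖fderiv ℝ (fderiv ℝ θ) z w w'‖ ≤ C * ‖w‖ * ‖w'‖ :=
      ((fderiv ℝ (fderiv ℝ θ) z).le_opNorm₂ w w').trans (by gcongr; exact (hbd z hz).2.2.1)
    calc _ ≤ (1 + M) / (q₀.1 / 2) ^ 2 * (C * ‖w‖ * ‖w'‖) := by gcongr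
      _ = (1 + M) / (q₀.1 / 2) ^ 2 * C * (‖w‖ * ‖w'‖) := by ring
      _ ≤ max C₁ C₂ * (‖w‖ * ‖w'‖) := mul_le_mul_of_nonneg_right
        ((le_add_of_nonneg_right (by positivity)).trans (le_max_left _ _)) (by positivity)
      _ = _ := by ring
  · have e : l' (V k) = α * (V₀ k).1 + l (V₀ k).2 := hDab (V₀ k)
    rw [e]
    refine Fin.cases ?_ (fun i => ?_) k
    · change 0 ≤ α * 1 + l 0
      simp [hα.le]
    · change 0 ≤ α * 1 + l (ε i • EuclideanSpace.single i 1)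
      rw [map_smul, smul_eq_mul]
      dsimp only [ε]
      split_ifs with h
      · linarith
      · linarith [not_le.1 h]
  · have h0 : 0 < (θ z).1 := (half_pos hx).trans (hlow _ (θ.map_source hz))
    have h1 : ‖(fderiv ℝ θ z - (A.symm : HE d →L[ℝ] HE d)) (V k)‖ ≤ δ * ‖V k‖ :=
      (ContinuousLinearMap.le_opNorm _ _).trans
        (mul_le_mul_of_nonneg_right (hbd z hz).2.2.2 (norm_nonneg _))
    have h2 : (A.symm : HE d →L[ℝ] HE d) (V k) = V₀ k := A.symm_apply_apply _
    have h3 : (V₀ k).1 = 1 := by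
      refine Fin.cases ?_ (fun i => ?_) k <;> rfl
    have h4 : ‖V k‖ ≤ ∑ k, ‖V k‖ := Finset.single_le_sum (f := fun k => ‖V k‖)
      (fun _ _ => norm_nonneg _) (Finset.mem_univ k)
    have h5 : δ * ‖V k‖ ≤ 1 / 2 := by
      rw [hδ, inv_mul_le_iff₀ (by positivity)]
      linarith
    have h6 := (norm_fst_le _).trans h1
    rw [sub_apply, h2, Prod.fst_sub, h3, Real.norm_eq_abs] at h6
    have h7 : 1 / 2 ≤ (fderiv ℝ θ z (V k)).1 := by
      have := neg_abs_le ((fderiv ℝ θ z (V k)).1 - 1)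
      linarith
    have h8 := hθX _ (θ.map_source hz)
    rw [le_div_iff₀ (by positivity)]
    refine le_trans ?_ h7
    rw [inv_mul_le_iff₀ (by positivity)]
    have : (θ z).1 ^ 2 ≤ M ^ 2 := by gcongr
    linarith

/-- Three kinds of points: corners, where only d_yρ ≠ 0 is used; boundary points with x > 0, where
∂_xρ > 0 is used; and points with ρ > 0, whether or not x vanishes. -/
theorem exists_adapted (hs : IsOpen s) (hρ : ContDiffOn ℝ ∞ ρ s) (hq₀ : q₀ ∈ s) (hx : 0 ≤ q₀.1)
    (h0 : 0 ≤ ρ q₀) (h1 : ρ q₀ = 0 → 0 < fderiv ℝ ρ q₀ (1, 0))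
    (h2 : ρ q₀ = 0 → q₀.1 = 0 → ∃ e, fderiv ℝ ρ q₀ (0, e) ≠ 0) :
    ∃ Q : Set (HE d), IsOpen Q ∧ q₀ ∈ Q ∧ Q ⊆ s ∧ (∃ X : ℝ, ∀ q ∈ Q, q.1 ≤ X) ∧
      Nonempty (Adapted ρ Q) := by
  rcases h0.eq_or_lt with h | h
  · rcases hx.eq_or_lt with hx | hx
    · obtain ⟨e, he⟩ := h2 h.symm hx.symm
      exact exists_adapted_of_fderiv_snd hs hρ hq₀ he
    · exact exists_adapted_of_fderiv_fst hs hρ hq₀ hx (h1 h.symm)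
  · obtain ⟨Q, hQ, hqQ, hQs, hX, ha⟩ := exists_adapted_of_pos
      (hρ.continuousOn.isOpen_inter_preimage hs isOpen_Ioi) (q₀ := q₀) ⟨hq₀, h⟩ (fun q hq => hq.2)
    exact ⟨Q, hQ, hqQ, hQs.trans inter_subset_left, hX, ha⟩

end

/-! ### Coordinates on ℝ × Y and coordinate expressions of tensors -/

section

variable {d : ℕ} {Y : Type*} [TopologicalSpace Y] [ChartedSpace (E d) Y] [IsManifold (𝓡 d) ∞ Y]

/-- The domain of the coordinates `(x, e)`. -/
def dom (e : OpenPartialHomeomorph Y (E d)) : Set (HE d) := {q | q.2 ∈ e.target}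

theorem isOpen_dom (e : OpenPartialHomeomorph Y (E d)) : IsOpen (dom e) :=
  e.open_target.preimage continuous_snd

variable {e e' : OpenPartialHomeomorph Y (E d)}

theorem contMDiffOn_param (he : e ∈ IsManifold.maximalAtlas (𝓡 d) ∞ Y) :
    ContMDiffOn 𝓘(ℝ, HE d) (IZ d) ∞ (param e) (dom e) := by
  have h1 : ContMDiffOn (𝓡 d) (𝓡 d) ∞ e.symm e.target := contMDiffOn_symm_of_mem_maximalAtlas he
  have h2 : ContMDiffOn 𝓘(ℝ, HE d) (𝓡 d) ∞ (fun q : HE d => e.symm q.2) (dom e) :=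
    h1.comp (contDiff_snd.contMDiff.contMDiffOn) fun q hq => hq
  exact ContMDiffOn.prodMk (contDiff_fst.contMDiff.contMDiffOn) h2

theorem contMDiff_constSection (w : HE d) :
    ContMDiff 𝓘(ℝ, HE d) (𝓘(ℝ, HE d).prod 𝓘(ℝ, HE d)) ∞
      (fun q => (⟨q, w⟩ : TangentBundle 𝓘(ℝ, HE d) (HE d))) := by
  intro q
  rw [Bundle.contMDiffAt_totalSpace]
  refine ⟨contMDiffAt_id, ?_⟩
  simp
  exact contMDiffAt_const

/-- The coordinate vector fields are images of constant sections under the tangent map of the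
parametrization, hence smooth. Evaluating bundle sections on them turns invariant smoothness into
smoothness of components. -/
theorem contMDiffOn_mfderiv_param (he : e ∈ IsManifold.maximalAtlas (𝓡 d) ∞ Y) (w : HE d) :
    ContMDiffOn 𝓘(ℝ, HE d) ((IZ d).prod 𝓘(ℝ, HE d)) ∞
      (fun q => (⟨param e q, mfderiv 𝓘(ℝ, HE d) (IZ d) (param e) q w⟩ :
        TangentBundle (IZ d) (ℝ × Y))) (dom e) := by
  have h1 := (contMDiffOn_param he).contMDiffOn_tangentMapWithin (m := ∞) (by simp)
    (isOpen_dom e).uniqueMDiffOn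
  have h2 := h1.comp ((contMDiff_constSection w).contMDiffOn (s := dom e)) fun q hq => hq
  refine h2.congr fun q hq => ?_
  simp only [Function.comp, tangentMapWithin]
  rw [mfderivWithin_of_isOpen (isOpen_dom e) hq]

/-- The derivative of the parametrization, as a map between model spaces. -/
def dparam (e : OpenPartialHomeomorph Y (E d)) (q : HE d) : HE d →L[ℝ] HE d :=
  mfderiv 𝓘(ℝ, HE d) (IZ d) (param e) q

/-- The value of a one-form at a point. -/
def formAt (u : OneForm d Y) (p : ℝ × Y) : HE d →L[ℝ] ℂ := u p

/-- The value of a bilinear form at a point. -/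
def bilinAt {F : Type*} [NormedAddCommGroup F] [NormedSpace ℝ F]
    (T : ∀ p : ℝ × Y, TangentSpace (IZ d) p →L[ℝ] TangentSpace (IZ d) p →L[ℝ] F) (p : ℝ × Y) :
    HE d →L[ℝ] HE d →L[ℝ] F := T p

/-- The coordinate expression of a one-form. -/
def pull (e : OpenPartialHomeomorph Y (E d)) (u : OneForm d Y) (q : HE d) : HE d →L[ℝ] ℂ :=
  (formAt u (param e q)).comp (dparam e q)

theorem comp₁_eq (u : OneForm d Y) (a : Fin (d + 1)) (q : HE d) :
    comp₁ e u a q = pull e u q (coordVec a) := rfl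

/-- The coordinate expression of a bilinear form. -/
def pull₂ (e : OpenPartialHomeomorph Y (E d)) {F : Type*} [NormedAddCommGroup F] [NormedSpace ℝ F]
    (T : ∀ p : ℝ × Y, TangentSpace (IZ d) p →L[ℝ] TangentSpace (IZ d) p →L[ℝ] F) (q : HE d) :
    HE d →L[ℝ] HE d →L[ℝ] F :=
  (bilinAt T (param e q)).bilinearComp (dparam e q) (dparam e q)

theorem comp₂_eq (T : TwoTensor d Y) (a b : Fin (d + 1)) (q : HE d) :
    comp₂ e T a b q = pull₂ e T q (coordVec a) (coordVec b) := rfl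

theorem contDiffOn_pull (he : e ∈ IsManifold.maximalAtlas (𝓡 d) ∞ Y) {u : OneForm d Y} (hu : u.Smooth) :
    ContDiffOn ℝ ∞ (pull e u) (dom e) := by
  rw [contDiffOn_clm_apply]
  intro w
  have h0 := hu.comp_contMDiffOn (contMDiffOn_param he)
  have h := ContMDiffOn.clm_bundle_apply (F₁ := HE d) (F₂ := ℂ) (E₂ := fun _ : ℝ × Y => ℂ) (n := ∞)
    (b := param e) h0 (contMDiffOn_mfderiv_param he w)
  rw [← contMDiffOn_iff_contDiffOn]
  intro q hq
  have h1 := (Bundle.contMDiffWithinAt_totalSpace.1 (h q hq)).2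
  exact h1

theorem contDiffOn_pull₂ (he : e ∈ IsManifold.maximalAtlas (𝓡 d) ∞ Y) {W : Set (ℝ × Y)} (g : MetricOn d W) :
    ContDiffOn ℝ ∞ (pull₂ e g.inner) (dom e ∩ param e ⁻¹' W) := by
  rw [contDiffOn_clm_apply]
  intro w
  rw [contDiffOn_clm_apply]
  intro w'
  have h0 := g.smooth.comp ((contMDiffOn_param he).mono inter_subset_left) (inter_subset_right)
  have h := ContMDiffOn.clm_bundle_apply₂ (F₁ := HE d) (F₂ := HE d) (F₃ := ℝ)
    (E₃ := fun _ : ℝ × Y => ℝ) (n := ∞) (b := param e) h0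
    ((contMDiffOn_mfderiv_param he w).mono inter_subset_left)
    ((contMDiffOn_mfderiv_param he w').mono inter_subset_left)
  rw [← contMDiffOn_iff_contDiffOn]
  intro q hq
  have h1 := (Bundle.contMDiffWithinAt_totalSpace.1 (h q hq)).2
  exact h1

/-- The coordinates `(x, e)`. -/
def coord (e : OpenPartialHomeomorph Y (E d)) (p : ℝ × Y) : HE d := (p.1, e p.2)

theorem coord_param {q : HE d} (hq : q ∈ dom e) : coord e (param e q) = q :=
  Prod.ext rfl (e.right_inv hq)

theorem param_coord {p : ℝ × Y} (hp : p.2 ∈ e.source) : param e (coord e p) = p :=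
  Prod.ext rfl (e.left_inv hp)

theorem coord_mem_dom {p : ℝ × Y} (hp : p.2 ∈ e.source) : coord e p ∈ dom e := e.map_source hp

theorem param_snd_mem {q : HE d} (hq : q ∈ dom e) : (param e q).2 ∈ e.source := e.map_target hq

theorem contMDiffOn_coord (he : e ∈ IsManifold.maximalAtlas (𝓡 d) ∞ Y) :
    ContMDiffOn (IZ d) 𝓘(ℝ, HE d) ∞ (coord e) {p | p.2 ∈ e.source} := by
  have h1 : ContMDiffOn (𝓡 d) (𝓡 d) ∞ e e.source := contMDiffOn_of_mem_maximalAtlas he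
  have h2 : ContMDiffOn (IZ d) (𝓡 d) ∞ (fun p : ℝ × Y => e p.2) {p | p.2 ∈ e.source} :=
    h1.comp contMDiff_snd.contMDiffOn fun p hp => hp
  exact ContMDiffOn.prodMk_space (contMDiff_fst.contMDiffOn) h2

theorem isOpen_source (e : OpenPartialHomeomorph Y (E d)) : IsOpen {p : ℝ × Y | p.2 ∈ e.source} :=
  e.open_source.preimage continuous_snd

theorem mdifferentiableAt_coord (he : e ∈ IsManifold.maximalAtlas (𝓡 d) ∞ Y) {p : ℝ × Y}
    (hp : p.2 ∈ e.source) : MDifferentiableAt (IZ d) 𝓘(ℝ, HE d) (coord e) p :=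
  ((contMDiffOn_coord he).contMDiffAt ((isOpen_source e).mem_nhds hp)).mdifferentiableAt (by simp)

theorem mdifferentiableAt_param (he : e ∈ IsManifold.maximalAtlas (𝓡 d) ∞ Y) {q : HE d}
    (hq : q ∈ dom e) : MDifferentiableAt 𝓘(ℝ, HE d) (IZ d) (param e) q :=
  ((contMDiffOn_param he).contMDiffAt ((isOpen_dom e).mem_nhds hq)).mdifferentiableAt (by simp)

/-- The part of the domain of the coordinates `(x, e)` where also `e'` is defined. -/
def overlap (e e' : OpenPartialHomeomorph Y (E d)) : Set (HE d) := {q | q.2 ∈ (e.symm.trans e').source}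

/-- The change of coordinates. -/
def trans (e e' : OpenPartialHomeomorph Y (E d)) (q : HE d) : HE d := (q.1, e' (e.symm q.2))

theorem isOpen_overlap : IsOpen (overlap e e') :=
  (e.symm.trans e').open_source.preimage continuous_snd

theorem mem_overlap {q : HE d} : q ∈ overlap e e' ↔ q ∈ dom e ∧ (param e q).2 ∈ e'.source := by
  rw [overlap, mem_ofPred_eq, OpenPartialHomeomorph.trans_source]
  rfl

theorem trans_eq (q : HE d) : trans e e' q = coord e' (param e q) := rfl

theorem trans_mem {q : HE d} (hq : q ∈ overlap e e') : trans e e' q ∈ dom e' :=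
  e'.map_source (mem_overlap.1 hq).2

theorem param_trans {q : HE d} (hq : q ∈ overlap e e') : param e' (trans e e' q) = param e q :=
  param_coord (mem_overlap.1 hq).2

theorem trans_trans {q : HE d} (hq : q ∈ overlap e e') : trans e' e (trans e e' q) = q := by
  rw [trans_eq, param_trans hq, coord_param (mem_overlap.1 hq).1]

theorem trans_mem_overlap {q : HE d} (hq : q ∈ overlap e e') : trans e e' q ∈ overlap e' e := by
  rw [mem_overlap, param_trans hq]
  exact ⟨trans_mem hq, param_snd_mem (mem_overlap.1 hq).1⟩

theorem injOn_trans : InjOn (trans e e') (overlap e e') := fun q hq q' hq' h => by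
  rw [← trans_trans hq, h, trans_trans hq']

theorem contDiffOn_trans (he : e ∈ IsManifold.maximalAtlas (𝓡 d) ∞ Y)
    (he' : e' ∈ IsManifold.maximalAtlas (𝓡 d) ∞ Y) : ContDiffOn ℝ ∞ (trans e e') (overlap e e') := by
  rw [← contMDiffOn_iff_contDiffOn]
  exact (contMDiffOn_coord he').comp ((contMDiffOn_param he).mono fun q hq => (mem_overlap.1 hq).1)
    fun q hq => (mem_overlap.1 hq).2

/-- A change of chart acts on Y only, so its Jacobian is block diagonal with entry 1 in the
x-direction. It therefore commutes with `sig`, and scattering norms in different charts are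
comparable up to x = 0. -/
theorem fderiv_trans_apply (he : e ∈ IsManifold.maximalAtlas (𝓡 d) ∞ Y)
    (he' : e' ∈ IsManifold.maximalAtlas (𝓡 d) ∞ Y) {q : HE d} (hq : q ∈ overlap e e') (w : HE d) :
    fderiv ℝ (trans e e') q w = (w.1, (fderiv ℝ (trans e e') q (0, w.2)).2) := by
  have hd : HasFDerivAt (trans e e') (fderiv ℝ (trans e e') q) q :=
    (((contDiffOn_trans he he').contDiffAt (isOpen_overlap.mem_nhds hq)).differentiableAt
      (by simp)).hasFDerivAt
  have h1 : ∀ w, (fderiv ℝ (trans e e') q w).1 = w.1 := fun w =>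
    DFunLike.congr_fun (hd.fst.unique hasFDerivAt_fst) w
  have h2 : ∀ a : ℝ, (fderiv ℝ (trans e e') q (a, 0)).2 = 0 := by
    intro a
    have h3 : HasDerivAt (fun t : ℝ => (t, q.2)) ((1, 0) : HE d) q.1 :=
      (hasDerivAt_id _).prodMk (hasDerivAt_const _ _)
    have h4 := HasFDerivAt.comp_hasDerivAt q.1 (f := fun t : ℝ => (t, q.2)) hd.snd h3
    have h5 := h4.unique (hasDerivAt_const q.1 (e' (e.symm q.2)))
    have h6 : (fderiv ℝ (trans e e') q (1, 0)).2 = 0 := h5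
    have h7 : ((a, 0) : HE d) = a • (1, 0) := by simp
    rw [h7, map_smul, Prod.smul_snd, h6, smul_zero]
  have e1 : w = (w.1, 0) + (0, w.2) := by simp
  refine Prod.ext (h1 w) ?_
  conv_lhs => rw [e1]
  rw [map_add, Prod.snd_add, h2, zero_add]

theorem dparam_trans (he : e ∈ IsManifold.maximalAtlas (𝓡 d) ∞ Y)
    (he' : e' ∈ IsManifold.maximalAtlas (𝓡 d) ∞ Y) {q : HE d} (hq : q ∈ overlap e e') :
    dparam e q = (dparam e' (trans e e' q)).comp (fderiv ℝ (trans e e') q) := by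
  have e1 : param e =ᶠ[𝓝 q] param e' ∘ trans e e' := by
    filter_upwards [isOpen_overlap.mem_nhds hq] with y hy using (param_trans hy).symm
  have hd : DifferentiableAt ℝ (trans e e') q :=
    (((contDiffOn_trans he he').contDiffAt (isOpen_overlap.mem_nhds hq)).differentiableAt (by simp))
  rw [dparam, e1.mfderiv_eq, mfderiv_comp q (mdifferentiableAt_param he' (trans_mem hq))
    hd.mdifferentiableAt, mfderiv_eq_fderiv]
  rfl

theorem mfderiv_coord_mfderiv_param (he : e ∈ IsManifold.maximalAtlas (𝓡 d) ∞ Y)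
    (he' : e' ∈ IsManifold.maximalAtlas (𝓡 d) ∞ Y) {q : HE d} (hq : q ∈ overlap e e') (w : HE d) :
    mfderiv (IZ d) 𝓘(ℝ, HE d) (coord e') (param e q) (mfderiv 𝓘(ℝ, HE d) (IZ d) (param e) q w)
      = fderiv ℝ (trans e e') q w := by
  have hm := mem_overlap.1 hq
  have e1 : trans e e' = coord e' ∘ param e := rfl
  rw [← mfderiv_eq_fderiv, e1,
    mfderiv_comp q (mdifferentiableAt_coord he' hm.2) (mdifferentiableAt_param he hm.1)]
  rfl

theorem mem_overlap_self {q : HE d} (hq : q ∈ dom e) : q ∈ overlap e e :=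
  mem_overlap.2 ⟨hq, param_snd_mem hq⟩

theorem fderiv_trans_self {q : HE d} (hq : q ∈ dom e) (w : HE d) : fderiv ℝ (trans e e) q w = w := by
  have e1 : trans e e =ᶠ[𝓝 q] id := by
    filter_upwards [(isOpen_dom e).mem_nhds hq] with y hy using coord_param hy
  rw [e1.fderiv_eq, fderiv_id]
  rfl

theorem mfderiv_param_injective (he : e ∈ IsManifold.maximalAtlas (𝓡 d) ∞ Y) {q : HE d}
    (hq : q ∈ dom e) {w : HE d} (hw : mfderiv 𝓘(ℝ, HE d) (IZ d) (param e) q w = 0) : w = 0 := by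
  have h := mfderiv_coord_mfderiv_param he he (mem_overlap_self hq) w
  rw [fderiv_trans_self hq, hw, map_zero] at h
  exact h.symm

theorem mfderiv_param_mfderiv_coord (he : e ∈ IsManifold.maximalAtlas (𝓡 d) ∞ Y) {p : ℝ × Y}
    (hp : p.2 ∈ e.source) (v : TangentSpace (IZ d) p) :
    (mfderiv 𝓘(ℝ, HE d) (IZ d) (param e) (coord e p) (mfderiv (IZ d) 𝓘(ℝ, HE d) (coord e) p v) : HE d)
      = v := by
  have e1 : param e ∘ coord e =ᶠ[𝓝 p] id := by
    filter_upwards [(isOpen_source e).mem_nhds hp] with y hy using param_coord hy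
  have h := mfderiv_comp p (mdifferentiableAt_param he (coord_mem_dom hp)) (mdifferentiableAt_coord he hp)
  rw [e1.mfderiv_eq, mfderiv_id] at h
  exact (DFunLike.congr_fun h v).symm

theorem pull_trans (he : e ∈ IsManifold.maximalAtlas (𝓡 d) ∞ Y)
    (he' : e' ∈ IsManifold.maximalAtlas (𝓡 d) ∞ Y) (u : OneForm d Y) {q : HE d} (hq : q ∈ overlap e e') :
    pull e u q = (pull e' u (trans e e' q)).comp (fderiv ℝ (trans e e') q) := by
  rw [pull, pull, dparam_trans he he' hq, param_trans hq]
  rfl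

theorem pull₂_trans (he : e ∈ IsManifold.maximalAtlas (𝓡 d) ∞ Y)
    (he' : e' ∈ IsManifold.maximalAtlas (𝓡 d) ∞ Y) {F : Type*} [NormedAddCommGroup F] [NormedSpace ℝ F]
    (T : ∀ p : ℝ × Y, TangentSpace (IZ d) p →L[ℝ] TangentSpace (IZ d) p →L[ℝ] F) {q : HE d}
    (hq : q ∈ overlap e e') :
    pull₂ e T q = (pull₂ e' T (trans e e' q)).bilinearComp (fderiv ℝ (trans e e') q)
      (fderiv ℝ (trans e e') q) := by
  rw [pull₂, pull₂, dparam_trans he he' hq, param_trans hq]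
  rfl

end

/-! ### The Levi-Civita connection and invariance of the symmetric gradient -/

section

section CoordVec

variable {d : ℕ}

/-- The coordinate functionals dual to `coordVec`. -/
def coordFun : Fin (d + 1) → HE d →L[ℝ] ℝ :=
  Fin.cons (ContinuousLinearMap.fst ℝ ℝ (E d))
    fun i => (EuclideanSpace.proj i).comp (ContinuousLinearMap.snd ℝ ℝ (E d))

theorem sum_coordFun_smul (w : HE d) : ∑ a, coordFun a w • (coordVec a : HE d) = w := by
  rw [Fin.sum_univ_succ]
  ext1
  · simp [coordFun, coordVec, Prod.fst_sum]
  · simp only [coordFun, coordVec, Fin.cons_zero, Fin.cons_succ, Prod.snd_add, Prod.smul_snd, smul_zero,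
      zero_add, Prod.snd_sum]
    ext i
    simp [Finset.sum_apply, Pi.single_apply]

theorem coordFun_coordVec (a b : Fin (d + 1)) :
    coordFun a (coordVec b : HE d) = if a = b then 1 else 0 := by
  refine Fin.cases ?_ (fun i => ?_) a <;> refine Fin.cases ?_ (fun j => ?_) b
  · simp [coordFun, coordVec]
  · simp [coordFun, coordVec, (Fin.succ_ne_zero j).symm]
  · simp [coordFun, coordVec]
  · simp [coordFun, coordVec, PiLp.single_apply]

theorem ext_coordVec {M : Type*} [AddCommGroup M] [Module ℝ M] {f f' : HE d → M}
    (hf : IsLinearMap ℝ f) (hf' : IsLinearMap ℝ f')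
    (h : ∀ a, f (coordVec a : HE d) = f' (coordVec a : HE d)) (w : HE d) : f w = f' w := by
  have e : ∀ g : HE d → M, IsLinearMap ℝ g → g w = ∑ a, coordFun a w • g (coordVec a) := fun g hg => by
    conv_lhs => rw [← sum_coordFun_smul w]
    exact (map_sum (hg.mk' g) _ _).trans (Finset.sum_congr rfl fun a _ => (hg.mk' g).map_smul _ _)
  rw [e f hf, e f' hf']
  simp only [h]

end CoordVec

variable {d : ℕ} {Y : Type*} [TopologicalSpace Y] [ChartedSpace (E d) Y] [IsManifold (𝓡 d) ∞ Y]
  {e e' : OpenPartialHomeomorph Y (E d)} {W : Set (ℝ × Y)} {g : MetricOn d W}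

theorem gMat_apply (a b : Fin (d + 1)) (q : HE d) :
    gMat g e q a b = pull₂ e g.inner q (coordVec a) (coordVec b) := rfl

theorem pull₂_apply {F : Type*} [NormedAddCommGroup F] [NormedSpace ℝ F]
    (T : ∀ p : ℝ × Y, TangentSpace (IZ d) p →L[ℝ] TangentSpace (IZ d) p →L[ℝ] F) (q w w' : HE d) :
    pull₂ e T q w w' = bilinAt T (param e q) (dparam e q w) (dparam e q w') := rfl

theorem pull₂_symm {q : HE d} (hq : param e q ∈ W) (w w' : HE d) :
    pull₂ e g.inner q w w' = pull₂ e g.inner q w' w := by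
  rw [pull₂_apply, pull₂_apply, bilinAt]
  exact g.symm (param e q) hq (dparam e q w) (dparam e q w')

theorem pull₂_pos (he : e ∈ IsManifold.maximalAtlas (𝓡 d) ∞ Y) {q : HE d} (hd : q ∈ dom e)
    (hq : param e q ∈ W) {w : HE d} (hw : w ≠ 0) : 0 < pull₂ e g.inner q w w := by
  rw [pull₂_apply, bilinAt]
  exact g.pos (param e q) hq (dparam e q w) fun h => hw (mfderiv_param_injective he hd h)

theorem eq_of_pull₂_eq (he : e ∈ IsManifold.maximalAtlas (𝓡 d) ∞ Y) {q : HE d} (hd : q ∈ dom e)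
    (hq : param e q ∈ W) {w w' : HE d} (h : ∀ z, pull₂ e g.inner q w z = pull₂ e g.inner q w' z) :
    w = w' := by
  by_contra hne
  have h1 := pull₂_pos (g := g) he hd hq (sub_ne_zero.2 hne)
  have h2 := congrArg (fun φ : HE d →L[ℝ] ℝ => φ (w - w')) (map_sub (pull₂ e g.inner q) w w')
  simp only [sub_apply, h, sub_self] at h2
  rw [h2] at h1
  exact lt_irrefl _ h1

theorem isUnit_det_gMat (he : e ∈ IsManifold.maximalAtlas (𝓡 d) ∞ Y) {q : HE d} (hd : q ∈ dom e)
    (hq : param e q ∈ W) : IsUnit (gMat g e q).det := by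
  rw [isUnit_iff_ne_zero]
  intro h0
  obtain ⟨v, hv, hv0⟩ := Matrix.exists_mulVec_eq_zero_iff.2 h0
  set w : HE d := ∑ b, v b • (coordVec b : HE d) with hw
  have h1 : ∀ z, pull₂ e g.inner q z w = 0 := by
    refine fun z => ext_coordVec (f := fun z => pull₂ e g.inner q z w) (f' := fun _ => (0 : ℝ)) ⟨fun x y => by simp, fun c x => by simp⟩
      ⟨fun x y => by simp, fun c x => by simp⟩ (fun a => ?_) z
    have h2 := congrFun hv0 a
    simp only [Matrix.mulVec, dotProduct, gMat_apply, Pi.zero_apply] at h2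
    simp only [hw, map_sum, map_smul, smul_eq_mul]
    rw [← h2]
    exact Finset.sum_congr rfl fun b _ => mul_comm _ _
  have hw0 : w = 0 := by
    by_contra hne
    exact (pull₂_pos (g := g) he hd hq hne).ne' (h1 w)
  refine hv (funext fun a => ?_)
  have h3 := congrArg (coordFun a) hw0
  simpa [hw, map_sum, coordFun_coordVec] using h3

/-- The Christoffel symbols as a bilinear map. -/
def chr (g : MetricOn d W) (e : OpenPartialHomeomorph Y (E d)) (q : HE d) : HE d →L[ℝ] HE d →L[ℝ] HE d :=
  ∑ a, ∑ b, ∑ c, christoffel g e c a b q •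
    (coordFun a).smulRight ((coordFun b).smulRight (coordVec c : HE d))

theorem chr_coordVec (q : HE d) (a b : Fin (d + 1)) :
    chr g e q (coordVec a) (coordVec b) = ∑ c, christoffel g e c a b q • (coordVec c : HE d) := by
  simp only [chr, sum_apply, smul_apply, ContinuousLinearMap.smulRight_apply, coordFun_coordVec]
  rw [Finset.sum_eq_single a (fun b' _ hb => by simp [hb]) (by simp),
    Finset.sum_eq_single b (fun b' _ hb => by simp [hb]) (by simp)]
  simp

/-- Lowering the upper index of the Christoffel symbols with the metric cancels the inverse matrix
in their definition; that the matrix is invertible comes from positivity of the metric. -/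
theorem koszul_coordVec (he : e ∈ IsManifold.maximalAtlas (𝓡 d) ∞ Y) {q : HE d} (hd : q ∈ dom e)
    (hq : param e q ∈ W) (a b k : Fin (d + 1)) :
    pull₂ e g.inner q (chr g e q (coordVec a) (coordVec b)) (coordVec k)
      = (1 / 2) * (pd a (fun q' => gMat g e q' b k) q + pd b (fun q' => gMat g e q' a k) q
      - pd k (fun q' => gMat g e q' a b) q) := by
  rw [chr_coordVec]
  set X : Fin (d + 1) → ℝ := fun l => pd a (fun q' => gMat g e q' b l) q
    + pd b (fun q' => gMat g e q' a l) q - pd l (fun q' => gMat g e q' a b) q with hX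
  have h1 : ∀ c, christoffel g e c a b q = (1 / 2) * ((gMat g e q)⁻¹.mulVec X) c := fun c => rfl
  have h2 : (gMat g e q).mulVec ((gMat g e q)⁻¹.mulVec X) = X := by
    rw [Matrix.mulVec_mulVec, Matrix.mul_nonsing_inv _ (isUnit_det_gMat he hd hq), Matrix.one_mulVec]
  have h3 := congrFun h2 k
  simp only [map_sum, sum_apply, map_smul, smul_apply, smul_eq_mul, h1]
  change _ = 1 / 2 * X k
  rw [← h3]
  rw [Matrix.mulVec, dotProduct, Finset.mul_sum]
  refine Finset.sum_congr rfl fun c _ => ?_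
  rw [gMat_apply, pull₂_symm hq (coordVec k)]
  ring

theorem differentiableAt_pull₂ (he : e ∈ IsManifold.maximalAtlas (𝓡 d) ∞ Y) (hW : IsOpen W) {q : HE d}
    (hd : q ∈ dom e) (hq : param e q ∈ W) : ContDiffAt ℝ ∞ (pull₂ e g.inner) q := by
  have ho : IsOpen (dom e ∩ param e ⁻¹' W) :=
    (contMDiffOn_param he).continuousOn.isOpen_inter_preimage (isOpen_dom e) hW
  exact (contDiffOn_pull₂ he g).contDiffAt (ho.mem_nhds ⟨hd, hq⟩)

theorem fderiv_apply₂ {F : Type*} [NormedAddCommGroup F] [NormedSpace ℝ F]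
    {T : HE d → HE d →L[ℝ] HE d →L[ℝ] F} {q : HE d} (hT : DifferentiableAt ℝ T q) (w w' z : HE d) :
    fderiv ℝ (fun q' => T q' w w') q z = fderiv ℝ T q z w w' := by
  have h1 : HasFDerivAt (fun q' => T q' w w') _ q :=
    (hT.hasFDerivAt.clm_apply (hasFDerivAt_const w q)).clm_apply (hasFDerivAt_const w' q)
  rw [h1.fderiv]
  simp

/-- The Koszul formula. -/
theorem koszul (he : e ∈ IsManifold.maximalAtlas (𝓡 d) ∞ Y) (hW : IsOpen W) {q : HE d} (hd : q ∈ dom e)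
    (hq : param e q ∈ W) (w w' z : HE d) :
    pull₂ e g.inner q (chr g e q w w') z
      = (1 / 2) * (fderiv ℝ (pull₂ e g.inner) q w w' z + fderiv ℝ (pull₂ e g.inner) q w' w z
        - fderiv ℝ (pull₂ e g.inner) q z w w') := by
  have hT := (differentiableAt_pull₂ (g := g) he hW hd hq).differentiableAt (by simp)
  refine ext_coordVec (f := fun w => pull₂ e g.inner q (chr g e q w w') z)
    (f' := fun w => (1 / 2) * (fderiv ℝ (pull₂ e g.inner) q w w' z + fderiv ℝ (pull₂ e g.inner) q w' w z
        - fderiv ℝ (pull₂ e g.inner) q z w w'))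
    ⟨fun x y => by simp, fun c x => by simp⟩ ⟨fun x y => by simp; ring, fun c x => by simp; ring⟩
    (fun a => ?_) w
  refine ext_coordVec (f := fun w' => pull₂ e g.inner q (chr g e q (coordVec a) w') z)
    (f' := fun w' => (1 / 2) * (fderiv ℝ (pull₂ e g.inner) q (coordVec a) w' z
      + fderiv ℝ (pull₂ e g.inner) q w' (coordVec a) z
        - fderiv ℝ (pull₂ e g.inner) q z (coordVec a) w'))
    ⟨fun x y => by simp, fun c x => by simp⟩ ⟨fun x y => by simp; ring, fun c x => by simp; ring⟩
    (fun b => ?_) w'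
  refine ext_coordVec (f := fun z => pull₂ e g.inner q (chr g e q (coordVec a) (coordVec b)) z)
    (f' := fun z => (1 / 2) * (fderiv ℝ (pull₂ e g.inner) q (coordVec a) (coordVec b) z
      + fderiv ℝ (pull₂ e g.inner) q (coordVec b) (coordVec a) z
        - fderiv ℝ (pull₂ e g.inner) q z (coordVec a) (coordVec b)))
    ⟨fun x y => by simp, fun c x => by simp⟩ ⟨fun x y => by simp; ring, fun c x => by simp; ring⟩
    (fun k => ?_) z
  simp only [koszul_coordVec he hd hq, pd, gMat_apply, fderiv_apply₂ hT]

/-- Both connections are determined by their metrics through the Koszul formula. Differentiating the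
identity expressing one metric as the pullback of the other produces second derivatives of the
transition map; by symmetry all of them cancel except the one in the stated inhomogeneous term.
Nondegeneracy of the metric removes the test vector. -/
theorem chr_trans (he : e ∈ IsManifold.maximalAtlas (𝓡 d) ∞ Y)
    (he' : e' ∈ IsManifold.maximalAtlas (𝓡 d) ∞ Y) (hW : IsOpen W) {q : HE d} (ho : q ∈ overlap e e')
    (hq : param e q ∈ W) (w w' : HE d) :
    fderiv ℝ (trans e e') q (chr g e q w w')
      = chr g e' (trans e e' q) (fderiv ℝ (trans e e') q w) (fderiv ℝ (trans e e') q w')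
        + fderiv ℝ (fderiv ℝ (trans e e')) q w w' := by
  have hd := (mem_overlap.1 ho).1
  have hd' := trans_mem ho
  have hq' : param e' (trans e e' q) ∈ W := by rwa [param_trans ho]
  set τ := trans e e' with hτ
  have hτd : ContDiffAt ℝ ∞ τ q := (contDiffOn_trans he he').contDiffAt (isOpen_overlap.mem_nhds ho)
  have hsurj : ∀ z', ∃ z, fderiv ℝ τ q z = z' := by
    intro z'
    have e1 : τ ∘ trans e' e =ᶠ[𝓝 (τ q)] id := by
      filter_upwards [isOpen_overlap.mem_nhds (trans_mem_overlap ho)] with y hy using trans_trans hy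
    have h1 : HasFDerivAt (trans e' e) (fderiv ℝ (trans e' e) (τ q)) (τ q) :=
      (((contDiffOn_trans he' he).contDiffAt (isOpen_overlap.mem_nhds
        (trans_mem_overlap ho))).differentiableAt (by simp)).hasFDerivAt
    have h2 : HasFDerivAt τ (fderiv ℝ τ q) (trans e' e (τ q)) := by
      rw [trans_trans ho]; exact (hτd.differentiableAt (by simp)).hasFDerivAt
    have h3 := (h2.comp (τ q) h1).unique ((hasFDerivAt_id (τ q)).congr_of_eventuallyEq e1)
    exact ⟨_, DFunLike.congr_fun h3 z'⟩
  have hT' := (differentiableAt_pull₂ (g := g) he' hW hd' hq').differentiableAt (by simp)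
  set G := pull₂ e g.inner with hG
  set G' := pull₂ e' g.inner with hG'
  have hDG : ∀ w a b, fderiv ℝ G q w a b
      = fderiv ℝ G' (τ q) (fderiv ℝ τ q w) (fderiv ℝ τ q a) (fderiv ℝ τ q b)
        + G' (τ q) (fderiv ℝ (fderiv ℝ τ) q w a) (fderiv ℝ τ q b)
        + G' (τ q) (fderiv ℝ τ q a) (fderiv ℝ (fderiv ℝ τ) q w b) := by
    intro w a b
    have hT := (differentiableAt_pull₂ (g := g) he hW hd hq).differentiableAt (by simp)
    rw [← fderiv_apply₂ hT]
    have e1 : (fun q' => G q' a b) =ᶠ[𝓝 q] fun q' => G' (τ q') (fderiv ℝ τ q' a) (fderiv ℝ τ q' b) := by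
      filter_upwards [isOpen_overlap.mem_nhds ho] with y hy
      rw [hG, pull₂_trans he he' _ hy]
      rfl
    have h1 : HasFDerivAt τ (fderiv ℝ τ q) q := (hτd.differentiableAt (by simp)).hasFDerivAt
    have h2 : HasFDerivAt (fderiv ℝ τ) (fderiv ℝ (fderiv ℝ τ) q) q :=
      ((hτd.fderiv_right (m := 1) (natCast_le_infty 2)).differentiableAt (by simp)).hasFDerivAt
    have h3 : HasFDerivAt (fun q' => G' (τ q')) ((fderiv ℝ G' (τ q)).comp (fderiv ℝ τ q)) q :=
      hT'.hasFDerivAt.comp q h1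
    have h4 : HasFDerivAt (fun q' => G' (τ q') (fderiv ℝ τ q' a) (fderiv ℝ τ q' b)) _ q :=
      (h3.clm_apply (h2.clm_apply (hasFDerivAt_const a q))).clm_apply
        (h2.clm_apply (hasFDerivAt_const b q))
    rw [e1.fderiv_eq, h4.fderiv]
    simp
    ring
  have hsymm : ∀ a b, fderiv ℝ (fderiv ℝ τ) q a b = fderiv ℝ (fderiv ℝ τ) q b a := fun a b =>
    (hτd.isSymmSndFDerivAt (by simpa using natCast_le_infty 2)) a b
  refine eq_of_pull₂_eq (g := g) he' hd' hq' fun z' => ?_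
  obtain ⟨z, rfl⟩ := hsurj z'
  rw [map_add, add_apply, koszul he' hW hd' hq']
  have h1 : G' (τ q) (fderiv ℝ τ q (chr g e q w w')) (fderiv ℝ τ q z) = G q (chr g e q w w') z := by
    rw [hG, pull₂_trans he he' _ ho]
    rfl
  rw [← hG', h1, hG, koszul he hW hd hq, ← hG, hDG, hDG, hDG]
  have hs' := fun a b => pull₂_symm (g := g) (e := e') hq' a b
  rw [← hG'] at hs'
  rw [hsymm w' w, hsymm z w, hsymm z w', hs' (fderiv ℝ τ q w') (fderiv ℝ (fderiv ℝ τ) q w z),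
    hs' (fderiv ℝ τ q w) (fderiv ℝ (fderiv ℝ τ) q w' z)]
  ring

theorem contDiffAt_pull {u : OneForm d Y}
    (hu : ContDiffOn ℝ ∞ (pull e u) (dom e)) {q : HE d} (hd : q ∈ dom e) :
    ContDiffAt ℝ ∞ (pull e u) q :=
  hu.contDiffAt ((isOpen_dom e).mem_nhds hd)

/-- The classical formula for the conjugated symmetric gradient in invariant form. -/
theorem symGradConj_eq {F : ℝ} {u : OneForm d Y} {q : HE d} (hu : DifferentiableAt ℝ (pull e u) q)
    (hx : 0 < q.1) (a b : Fin (d + 1)) :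
    symGradConj g e F (fun a => comp₁ e u a) a b q
      = bilinGrad F (chr g e) (pull e u) q (coordVec a) (coordVec b) := by
  have hpd : ∀ a b, pd a (fun q' : HE d => (Real.exp (F / q'.1) : ℂ) * comp₁ e u b q') q
      = (Real.exp (F / q.1) : ℂ) * (fderiv ℝ (pull e u) q (coordVec a) (coordVec b)
        - F / q.1 ^ 2 * (coordVec a : HE d).1 * pull e u q (coordVec b)) := by
    intro a b
    have h1 : HasFDerivAt (fun q' : HE d => F / q'.1)
        (F • (-(q.1 ^ 2)⁻¹ • ContinuousLinearMap.fst ℝ ℝ (E d))) q := by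
      have h0 : HasFDerivAt (fun z : HE d => z.1⁻¹)
          (-(q.1 ^ 2)⁻¹ • ContinuousLinearMap.fst ℝ ℝ (E d)) q :=
        (hasDerivAt_inv hx.ne').comp_hasFDerivAt q hasFDerivAt_fst
      exact h0.const_mul F
    have h2 : HasFDerivAt (fun q' : HE d => ((Real.exp (F / q'.1) : ℝ) : ℂ))
        (Complex.ofRealCLM.comp (Real.exp (F / q.1) • (F • (-(q.1 ^ 2)⁻¹ •
          ContinuousLinearMap.fst ℝ ℝ (E d))))) q :=
      Complex.ofRealCLM.hasFDerivAt.comp q h1.exp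
    have h3 : HasFDerivAt (fun q' => comp₁ e u b q') _ q :=
      hu.hasFDerivAt.clm_apply (hasFDerivAt_const (coordVec b : HE d) q)
    have h4 : HasFDerivAt (fun q' : HE d => (Real.exp (F / q'.1) : ℂ) * comp₁ e u b q') _ q := h2.mul h3
    rw [pd, h4.fderiv]
    simp [comp₁_eq]
    ring
  have he : (Real.exp (-F / q.1) : ℂ) * (Real.exp (F / q.1) : ℂ) = 1 := by
    rw [← Complex.ofReal_mul, ← Real.exp_add, neg_div, neg_add_cancel, Real.exp_zero, Complex.ofReal_one]
  have hs : ∑ c, (christoffel g e c a b q : ℂ) * ((Real.exp (F / q.1) : ℂ) * comp₁ e u c q)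
      = (Real.exp (F / q.1) : ℂ) * pull e u q (chr g e q (coordVec a) (coordVec b)) := by
    rw [chr_coordVec, map_sum, Finset.mul_sum]
    refine Finset.sum_congr rfl fun c _ => ?_
    rw [map_smul, Complex.real_smul, comp₁_eq]
    ring
  rw [symGradConj, symGrad, hpd, hpd, hs, bilinGrad, symPart_apply]
  linear_combination ((1 / 2) * ((fderiv ℝ (pull e u) q (coordVec a) (coordVec b)
        - F / q.1 ^ 2 * (coordVec a : HE d).1 * pull e u q (coordVec b))
      + (fderiv ℝ (pull e u) q (coordVec b) (coordVec a)
        - F / q.1 ^ 2 * (coordVec b : HE d).1 * pull e u q (coordVec a)))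
      - pull e u q (chr g e q (coordVec a) (coordVec b))) * he

/-- The conjugated symmetric gradient is a tensor. -/
theorem bilinGrad_trans (he : e ∈ IsManifold.maximalAtlas (𝓡 d) ∞ Y)
    (he' : e' ∈ IsManifold.maximalAtlas (𝓡 d) ∞ Y) (hW : IsOpen W) {q : HE d} (ho : q ∈ overlap e e')
    (hq : param e q ∈ W) {u : OneForm d Y} (hu : DifferentiableAt ℝ (pull e' u) (trans e e' q)) (F : ℝ)
    (w w' : HE d) :
    bilinGrad F (chr g e) (pull e u) q w w'
      = bilinGrad F (chr g e') (pull e' u) (trans e e' q) (fderiv ℝ (trans e e') q w)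
        (fderiv ℝ (trans e e') q w') := by
  set τ := trans e e' with hτ
  have hτd : ContDiffAt ℝ ∞ τ q := (contDiffOn_trans he he').contDiffAt (isOpen_overlap.mem_nhds ho)
  have hsymm : ∀ a b, fderiv ℝ (fderiv ℝ τ) q a b = fderiv ℝ (fderiv ℝ τ) q b a := fun a b =>
    (hτd.isSymmSndFDerivAt (by simpa using natCast_le_infty 2)) a b
  have e1 : pull e u =ᶠ[𝓝 q] fun y => (pull e' u (τ y)).comp (fderiv ℝ τ y) := by
    filter_upwards [isOpen_overlap.mem_nhds ho] with y hy using pull_trans he he' u hy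
  have h1 : ∀ w w', fderiv ℝ (pull e u) q w w' = fderiv ℝ (pull e' u) (τ q) (fderiv ℝ τ q w) (fderiv ℝ τ q w')
      + pull e' u (τ q) (fderiv ℝ (fderiv ℝ τ) q w w') := fun w w' => by
    rw [e1.fderiv_eq]
    exact (fderiv_comp_covector (hτd.of_le (natCast_le_infty 2)) hu w w').2
  have h2 : ∀ w, pull e u q w = pull e' u (τ q) (fderiv ℝ τ q w) := fun w => by
    rw [pull_trans he he' u ho]; rfl
  have h3 : ∀ w, (fderiv ℝ τ q w).1 = w.1 := fun w => by
    rw [hτ, fderiv_trans_apply he he' ho]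
  have h4 : (τ q).1 = q.1 := rfl
  -- The second derivative of τ in the symmetrized derivative of the pulled back form cancels the
  -- inhomogeneous term of `chr_trans`. The conjugation term is invariant because τ preserves x and
  -- dx.
  rw [bilinGrad, bilinGrad, symPart_apply, symPart_apply, h1, h1, h2, h2, h2, chr_trans he he' hW ho hq,
    h3, h3, h4, map_add, hsymm w' w]
  ring

/-- `bilinGrad` as a continuous bilinear form. -/
def gradForm (F : ℝ) (Γ : HE d → HE d →L[ℝ] HE d →L[ℝ] HE d) (v : HE d → HE d →L[ℝ] ℂ)
    (q : HE d) : HE d →L[ℝ] HE d →L[ℝ] ℂ :=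
  symPart (fderiv ℝ v q) - ((ContinuousLinearMap.compL ℝ (HE d) (HE d) ℂ (v q)).comp (Γ q))
    - (F / (2 * q.1 ^ 2) : ℝ) • ((ContinuousLinearMap.fst ℝ ℝ (E d)).smulRight (v q)
      + ((ContinuousLinearMap.fst ℝ ℝ (E d)).smulRight (v q)).flip)

theorem gradForm_apply (F : ℝ) (Γ : HE d → HE d →L[ℝ] HE d →L[ℝ] HE d) (v : HE d → HE d →L[ℝ] ℂ)
    (q w w' : HE d) : gradForm F Γ v q w w' = bilinGrad F Γ v q w w' := by
  simp [bilinGrad, gradForm]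
  ring

theorem gradForm_congr {F : ℝ} {Γ : HE d → HE d →L[ℝ] HE d →L[ℝ] HE d} {v v' : HE d → HE d →L[ℝ] ℂ}
    {q : HE d} (h : v =ᶠ[𝓝 q] v') : gradForm F Γ v q = gradForm F Γ v' q := by
  rw [gradForm, gradForm, h.fderiv_eq, h.eq_of_nhds]

theorem gradForm_trans (he : e ∈ IsManifold.maximalAtlas (𝓡 d) ∞ Y)
    (he' : e' ∈ IsManifold.maximalAtlas (𝓡 d) ∞ Y) (hW : IsOpen W) {q : HE d} (ho : q ∈ overlap e e')
    (hq : param e q ∈ W) {u : OneForm d Y} (hu : DifferentiableAt ℝ (pull e' u) (trans e e' q)) (F : ℝ) :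
    gradForm F (chr g e) (pull e u) q
      = (gradForm F (chr g e') (pull e' u) (trans e e' q)).bilinearComp (fderiv ℝ (trans e e') q)
        (fderiv ℝ (trans e e') q) := by
  refine ContinuousLinearMap.ext fun w => ContinuousLinearMap.ext fun w' => ?_
  rw [ContinuousLinearMap.bilinearComp_apply, gradForm_apply, gradForm_apply,
    bilinGrad_trans he he' hW ho hq hu]

/-- Continuity across x = 0 is what matters: it bounds the connection on compact sets that reach the
boundary. The inverse metric is handled as adjugate over determinant. -/
theorem continuousOn_chr (he : e ∈ IsManifold.maximalAtlas (𝓡 d) ∞ Y) (hW : IsOpen W) :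
    ContinuousOn (chr g e) (dom e ∩ param e ⁻¹' W) := by
  have ho : IsOpen (dom e ∩ param e ⁻¹' W) :=
    (contMDiffOn_param he).continuousOn.isOpen_inter_preimage (isOpen_dom e) hW
  have hG : ∀ a b, ContDiffOn ℝ ∞ (fun q => gMat g e q a b) (dom e ∩ param e ⁻¹' W) := by
    intro a b
    have h := ((contDiffOn_pull₂ he g).clm_apply (contDiffOn_const (c := (coordVec a : HE d)))).clm_apply
      (contDiffOn_const (c := (coordVec b : HE d)))
    exact h.congr fun q _ => gMat_apply a b q
  have hpd : ∀ k a b, ContinuousOn (fun q => pd k (fun q' => gMat g e q' a b) q) (dom e ∩ param e ⁻¹' W) :=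
    fun k a b => ((hG a b).continuousOn_fderiv_of_isOpen ho (by simp)).clm_apply continuousOn_const
  have hM : ContinuousOn (fun q => gMat g e q) (dom e ∩ param e ⁻¹' W) :=
    continuousOn_pi.2 fun a => continuousOn_pi.2 fun b => (hG a b).continuousOn
  have hI : ∀ a b, ContinuousOn (fun q => (gMat g e q)⁻¹ a b) (dom e ∩ param e ⁻¹' W) := by
    intro a b q hq
    have hdet : (gMat g e q).det ≠ 0 := (isUnit_det_gMat he hq.1 hq.2).ne_zero
    have h1 : ContinuousWithinAt (fun q => (gMat g e q).det⁻¹ * (gMat g e q).adjugate a b)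
        (dom e ∩ param e ⁻¹' W) q := by
      have hd : Continuous fun M : Matrix (Fin (d + 1)) (Fin (d + 1)) ℝ => M.det := by fun_prop
      have ha : Continuous fun M : Matrix (Fin (d + 1)) (Fin (d + 1)) ℝ => M.adjugate a b := by
        have : Continuous fun M : Matrix (Fin (d + 1)) (Fin (d + 1)) ℝ => M.adjugate :=
          continuous_id.matrix_adjugate
        exact (continuous_apply b).comp ((continuous_apply a).comp this)
      exact ((hd.continuousAt.comp_continuousWithinAt (hM q hq)).inv₀ hdet).mul
        (ha.continuousAt.comp_continuousWithinAt (hM q hq))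
    refine h1.congr (fun y _ => ?_) ?_ <;> simp [Matrix.inv_def]
  refine continuousOn_finsetSum _ fun a _ => continuousOn_finsetSum _ fun b _ =>
    continuousOn_finsetSum _ fun c _ => ContinuousOn.fun_smul ?_ continuousOn_const
  exact continuousOn_const.mul (continuousOn_finsetSum _ fun k _ => (hI c k).mul
    (((hpd a b k).add (hpd b a k)).sub (hpd k a b)))

end

/-! ### Comparison of norms in different charts -/

section

variable {d : ℕ} {Y : Type*} [TopologicalSpace Y] [ChartedSpace (E d) Y] [IsManifold (𝓡 d) ∞ Y]
  {e e' : OpenPartialHomeomorph Y (E d)}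

theorem measurableSet_dom_inter_isOpen (he : e ∈ IsManifold.maximalAtlas (𝓡 d) ∞ Y) {O : Set (ℝ × Y)}
    (hO : IsOpen O) : MeasurableSet (dom e ∩ param e ⁻¹' O) :=
  ((contMDiffOn_param he).continuousOn.isOpen_inter_preimage (isOpen_dom e) hO).measurableSet

theorem measurableSet_dom_inter_isClosed (he : e ∈ IsManifold.maximalAtlas (𝓡 d) ∞ Y) {O : Set (ℝ × Y)}
    (hO : IsClosed O) : MeasurableSet (dom e ∩ param e ⁻¹' O) := by
  have h : dom e ∩ param e ⁻¹' O = dom e \ (dom e ∩ param e ⁻¹' Oᶜ) := by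
    ext q
    simp only [mem_inter_iff, mem_preimage, Set.mem_sdiff, mem_compl_iff]
    tauto
  rw [h]
  exact (isOpen_dom e).measurableSet.diff (measurableSet_dom_inter_isOpen he hO.isOpen_compl)

/-- One-forms which are smooth in all coordinates of the form `(x, e)`. -/
def CoordSmooth (u : OneForm d Y) : Prop :=
  ∀ e ∈ IsManifold.maximalAtlas (𝓡 d) ∞ Y, ContDiffOn ℝ ∞ (pull e u) (dom e)

theorem CoordSmooth.contDiffAt {u : OneForm d Y} (hu : CoordSmooth u)
    (he : e ∈ IsManifold.maximalAtlas (𝓡 d) ∞ Y) {q : HE d} (hq : q ∈ dom e) :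
    ContDiffAt ℝ ∞ (pull e u) q := contDiffAt_pull (hu e he) hq

theorem CoordSmooth.add {u u' : OneForm d Y} (hu : CoordSmooth u) (hu' : CoordSmooth u') :
    CoordSmooth fun p => u p + u' p := fun e he => (hu e he).add (hu' e he)

theorem CoordSmooth.smul {u : OneForm d Y} (hu : CoordSmooth u) (c : ℂ) :
    CoordSmooth fun p => c • u p := fun e he => (hu e he).const_smul c

theorem CoordSmooth.smul_fun {u : OneForm d Y} (hu : CoordSmooth u) {θ : ℝ × Y → ℝ}
    (hθ : ContMDiff (IZ d) 𝓘(ℝ, ℝ) ∞ θ) : CoordSmooth fun p => θ p • u p := fun e he => by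
  have h1 : ContDiffOn ℝ ∞ (fun q => θ (param e q)) (dom e) := by
    rw [← contMDiffOn_iff_contDiffOn]
    exact hθ.comp_contMDiffOn (contMDiffOn_param he)
  exact h1.smul (hu e he)

theorem scN₁_comp_le {x C : ℝ} {η : HE d →L[ℝ] ℂ} {A : HE d →L[ℝ] HE d}
    (hA : ∀ w, A (sig x w) = sig x (A w)) (hC : ‖A‖ ≤ C) : scN₁ x (η.comp A) ≤ C * scN₁ x η := by
  have e1 : (η.comp A).comp (sig x) = (η.comp (sig x)).comp A := by
    refine ContinuousLinearMap.ext fun w => ?_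
    simp [hA]
  rw [scN₁, e1, mul_comm]
  exact (ContinuousLinearMap.opNorm_comp_le _ _).trans
    (mul_le_mul_of_nonneg_left hC (norm_nonneg _))

theorem scN₂_comp_le {x C : ℝ} {f : HE d →L[ℝ] HE d →L[ℝ] ℂ} {A : HE d →L[ℝ] HE d}
    (hA : ∀ w, A (sig x w) = sig x (A w)) (hC : ‖A‖ ≤ C) :
    scN₂ x (f.bilinearComp A A) ≤ C ^ 2 * scN₂ x f := by
  have hC0 : 0 ≤ C := (norm_nonneg _).trans hC
  have h0 := scN₂_nonneg x f
  refine ContinuousLinearMap.opNorm_le_bound₂ _ (by positivity) fun w w' => ?_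
  have e1 : (f.bilinearComp A A).bilinearComp (sig x) (sig x) w w'
      = f.bilinearComp (sig x) (sig x) (A w) (A w') := by
    simp [hA]
  have hw : ∀ w, ‖A w‖ ≤ C * ‖w‖ := fun w => (A.le_opNorm w).trans (by gcongr)
  rw [e1]
  refine ((f.bilinearComp (sig x) (sig x)).le_opNorm₂ (A w) (A w')).trans ?_
  change scN₂ x f * _ * _ ≤ _
  calc _ ≤ scN₂ x f * (C * ‖w‖) * (C * ‖w'‖) := by
        gcongr
        · exact hw w
        · exact hw w'
    _ = _ := by ring

theorem fderiv_trans_sig (he : e ∈ IsManifold.maximalAtlas (𝓡 d) ∞ Y)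
    (he' : e' ∈ IsManifold.maximalAtlas (𝓡 d) ∞ Y) {q : HE d} (hq : q ∈ overlap e e') (x : ℝ) (w : HE d) :
    fderiv ℝ (trans e e') q (sig x w) = sig x (fderiv ℝ (trans e e') q w) := by
  rw [fderiv_trans_apply he he' hq (sig x w), fderiv_trans_apply he he' hq w, sig_apply, sig_apply]
  have : ((0, x • w.2) : HE d) = x • (0, w.2) := by simp
  simp only [this, map_smul, Prod.smul_snd]

theorem det_fderiv_trans_ne_zero (he : e ∈ IsManifold.maximalAtlas (𝓡 d) ∞ Y)
    (he' : e' ∈ IsManifold.maximalAtlas (𝓡 d) ∞ Y) {q : HE d} (hq : q ∈ overlap e e') :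
    (fderiv ℝ (trans e e') q).det ≠ 0 := by
  have e1 : trans e' e ∘ trans e e' =ᶠ[𝓝 q] id := by
    filter_upwards [isOpen_overlap.mem_nhds hq] with y hy using trans_trans hy
  have h1 : HasFDerivAt (trans e' e) (fderiv ℝ (trans e' e) (trans e e' q)) (trans e e' q) :=
    (((contDiffOn_trans he' he).contDiffAt (isOpen_overlap.mem_nhds
      (trans_mem_overlap hq))).differentiableAt (by simp)).hasFDerivAt
  have h2 : HasFDerivAt (trans e e') (fderiv ℝ (trans e e') q) q :=
    (((contDiffOn_trans he he').contDiffAt (isOpen_overlap.mem_nhds hq)).differentiableAt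
      (by simp)).hasFDerivAt
  have h3 := (h1.comp q h2).unique ((hasFDerivAt_id q).congr_of_eventuallyEq e1)
  have h4 := congrArg ContinuousLinearMap.det h3
  intro h0
  have h5 : (fderiv ℝ (trans e' e) (trans e e' q)).det * (fderiv ℝ (trans e e') q).det = 1 := by
    simpa [ContinuousLinearMap.det, LinearMap.det_comp] using h4
  rw [h0, mul_zero] at h5
  exact zero_ne_one h5

/-- Weighted integrals of nonnegative functions with respect to the scattering density. -/
def scInt (s : Set (HE d)) (h : HE d → ℝ) : ℝ≥0∞ :=
  ∫⁻ q in s, ENNReal.ofReal (q.1 ^ (d + 2))⁻¹ * ENNReal.ofReal (h q)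

/-- Comparison of integrals in different coordinates. -/
theorem exists_scInt_trans_le (he : e ∈ IsManifold.maximalAtlas (𝓡 d) ∞ Y)
    (he' : e' ∈ IsManifold.maximalAtlas (𝓡 d) ∞ Y) {B : Set (HE d)} (hB : IsCompact B)
    (hBo : B ⊆ overlap e e') :
    ∃ (K : NNReal) (C : ℝ), (∀ q ∈ B, ‖fderiv ℝ (trans e e') q‖ ≤ C) ∧ ∀ s ⊆ B, MeasurableSet s →
      ∀ h : HE d → ℝ, scInt s (fun q => h (trans e e' q)) ≤ K * scInt (trans e e' '' s) h := by
  have hτ := contDiffOn_trans he he'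
  have hc : ContinuousOn (fderiv ℝ (trans e e')) B :=
    (hτ.continuousOn_fderiv_of_isOpen isOpen_overlap (by simp)).mono hBo
  obtain ⟨C, hC⟩ := hB.exists_bound_of_continuousOn hc
  have hdet : ContinuousOn (fun q => (fderiv ℝ (trans e e') q).det⁻¹) B :=
    (ContinuousLinearMap.continuous_det.comp_continuousOn hc).inv₀
      fun q hq => det_fderiv_trans_ne_zero he he' (hBo hq)
  obtain ⟨K, hK⟩ := hB.exists_bound_of_continuousOn hdet
  refine ⟨Real.toNNReal K, C, hC, fun s hs hsm h => ?_⟩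
  have key := lintegral_image_eq_lintegral_abs_det_fderiv_mul (volume : Measure (HE d)) hsm
    (fun z hz => (((hτ.contDiffAt (isOpen_overlap.mem_nhds (hBo (hs hz)))).differentiableAt
      (by simp)).hasFDerivAt).hasFDerivWithinAt)
    (injOn_trans.mono (hs.trans hBo))
    (fun q => ENNReal.ofReal (q.1 ^ (d + 2))⁻¹ * ENNReal.ofReal (h q))
  rw [scInt, scInt, key]
  have hKe : ((Real.toNNReal K : NNReal) : ℝ≥0∞) = ENNReal.ofReal K := rfl
  rw [hKe, ← lintegral_const_mul' _ _ ENNReal.ofReal_ne_top]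
  refine setLIntegral_mono' hsm fun q hq => ?_
  have h0 := abs_pos.2 (det_fderiv_trans_ne_zero he he' (hBo (hs hq)))
  have h1 := hK q (hs hq)
  have hK0 : 0 ≤ K := (norm_nonneg _).trans h1
  rw [norm_inv, Real.norm_eq_abs, inv_le_iff_one_le_mul₀ h0] at h1
  rw [← mul_assoc (ENNReal.ofReal K), ← ENNReal.ofReal_mul hK0]
  exact le_mul_of_one_le_left' (ENNReal.one_le_ofReal.2 h1)

theorem scInt_mono_set {s t : Set (HE d)} (h : s ⊆ t) (f : HE d → ℝ) : scInt s f ≤ scInt t f :=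
  lintegral_mono_set h

theorem scInt_mono {s : Set (HE d)} (hs : MeasurableSet s) {f f' : HE d → ℝ} {C : ℝ} (hC : 0 ≤ C)
    (h : ∀ q ∈ s, f q ≤ C * f' q) : scInt s f ≤ ENNReal.ofReal C * scInt s f' := by
  rw [scInt, scInt, ← lintegral_const_mul' _ _ ENNReal.ofReal_ne_top]
  refine setLIntegral_mono' hs fun q hq => ?_
  rw [mul_left_comm, ← ENNReal.ofReal_mul hC]
  exact mul_le_mul_right (ENNReal.ofReal_le_ofReal (h q hq)) _

theorem scInt_iUnion_le {ι : Type*} [Fintype ι] (s : ι → Set (HE d)) (f : HE d → ℝ) :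
    scInt (⋃ i, s i) f ≤ ∑ i, scInt (s i) f := by
  simpa [scInt] using lintegral_iUnion_le s (fun q => ENNReal.ofReal (q.1 ^ (d + 2))⁻¹ * ENNReal.ofReal (f q))

theorem scInt_union_le (s t : Set (HE d)) (f : HE d → ℝ) :
    scInt (s ∪ t) f ≤ scInt s f + scInt t f := lintegral_union_le _ _ _

section Global

variable [T2Space Y] {R : Region d Y} {g : MetricOn d R.W} (A : Cover R)

theorem Region.isOpen_D (R : Region d Y) : IsOpen R.D := by
  have h1 : IsOpen (R.W ∩ R.rho ⁻¹' Ioi 0) := R.smooth_rho.continuousOn.isOpen_inter_preimage R.isOpen_W isOpen_Ioi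
  have h2 : IsOpen (R.W ∩ R.rho₁ ⁻¹' Ioi 0) :=
    R.smooth_rho₁.continuousOn.isOpen_inter_preimage R.isOpen_W isOpen_Ioi
  have h3 : IsOpen {p : ℝ × Y | 0 < p.1} := isOpen_lt continuous_const continuous_fst
  convert (h1.inter h2).inter h3 using 1
  ext p
  simp only [Region.D, mem_ofPred_eq, mem_inter_iff, mem_preimage, mem_Ioi]
  tauto

theorem Region.D_subset (R : Region d Y) : R.D ⊆ R.K := fun _ h => ⟨h.1, h.2.1.le, h.2.2.1.le, h.2.2.2.le⟩

theorem Region.isCompact_K (R : Region d Y) : IsCompact R.K := R.isCompact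

theorem measurableSet_over (he : e ∈ IsManifold.maximalAtlas (𝓡 d) ∞ Y) {C : Set Y} (hC : IsCompact C) :
    MeasurableSet {q : HE d | q ∈ dom e ∧ e.symm q.2 ∈ C ∧ param e q ∈ R.D} := by
  have h1 := measurableSet_dom_inter_isClosed he (O := {p : ℝ × Y | p.2 ∈ C})
    (hC.isClosed.preimage continuous_snd)
  have h2 := measurableSet_dom_inter_isOpen he R.isOpen_D
  convert h1.inter h2 using 1
  ext q
  simp only [mem_ofPred_eq, mem_inter_iff, mem_preimage, param]
  tauto

theorem Cover.measurableSet_piece (j : Fin A.N) : MeasurableSet (A.piece j) :=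
  measurableSet_over (A.e_mem j) (A.isCompact_C j)

/-- The closure of a piece. -/
def Cover.cpiece (j : Fin A.N) : Set (HE d) :=
  {q | q ∈ dom (A.e j) ∧ (A.e j).symm q.2 ∈ A.C j ∧ param (A.e j) q ∈ R.K}

theorem Cover.piece_subset (j : Fin A.N) : A.piece j ⊆ A.cpiece j :=
  fun _ h => ⟨h.1, h.2.1, R.D_subset h.2.2⟩

theorem Cover.isCompact_cpiece (j : Fin A.N) : IsCompact (A.cpiece j) := by
  have h1 : IsCompact (R.K ∩ {p : ℝ × Y | p.2 ∈ A.C j}) :=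
    R.isCompact_K.inter_right ((A.isCompact_C j).isClosed.preimage continuous_snd)
  have h2 : A.cpiece j = coord (A.e j) '' (R.K ∩ {p : ℝ × Y | p.2 ∈ A.C j}) := by
    ext q
    constructor
    · rintro ⟨h1, h2, h3⟩
      exact ⟨param (A.e j) q, ⟨h3, h2⟩, coord_param h1⟩
    · rintro ⟨p, ⟨h3, h2⟩, rfl⟩
      have hs : p.2 ∈ (A.e j).source := A.C_subset j h2
      refine ⟨coord_mem_dom hs, ?_, ?_⟩
      · change (param (A.e j) (coord (A.e j) p)).2 ∈ A.C j
        rw [param_coord hs]; exact h2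
      · rw [param_coord hs]; exact h3
  rw [h2]
  exact h1.image_of_continuousOn ((contMDiffOn_coord (A.e_mem j)).continuousOn.mono
    fun p hp => A.C_subset j hp.2)

/-- The contribution of the points over the `k`-th piece to an integral in the `j`-th coordinates. -/
theorem exists_scInt_over_le (g : MetricOn d R.W) (j k : Fin A.N) {B : Set (HE d)} (hB : IsCompact B)
    (hBd : B ⊆ dom (A.e j)) :
    ∃ K : NNReal, ∀ (F r M : ℝ) (u : OneForm d Y), CoordSmooth u → ∀ L ⊆ B, MeasurableSet L →
      scInt (L ∩ {q | q ∈ dom (A.e j) ∧ (A.e j).symm q.2 ∈ A.C k ∧ param (A.e j) q ∈ R.D})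
        (Adapted.dens r M (pull (A.e j) u) (gradForm F (chr g (A.e j)) (pull (A.e j) u)))
      ≤ K * scInt (A.piece k)
        (Adapted.dens r M (pull (A.e k) u) (gradForm F (chr g (A.e k)) (pull (A.e k) u))) := by
  have hj := A.e_mem j
  have hk := A.e_mem k
  set B' := B ∩ {q | (A.e j).symm q.2 ∈ A.C k} with hB'
  have hB'c : IsCompact B' := by
    have h1 : ContinuousOn (fun q : HE d => (A.e j).symm q.2) B :=
      (A.e j).symm.continuousOn.comp continuousOn_snd fun q hq => hBd hq
    exact hB.of_isClosed_subset (h1.preimage_isClosed_of_isClosed hB.isClosed (A.isCompact_C k).isClosed)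
      inter_subset_left
  have hB'o : B' ⊆ overlap (A.e j) (A.e k) := fun q hq =>
    mem_overlap.2 ⟨hBd hq.1, A.C_subset k hq.2⟩
  obtain ⟨K, C, hC, hK⟩ := exists_scInt_trans_le hj hk hB'c hB'o
  refine ⟨Real.toNNReal (C ^ 2 + C ^ 4) * K, fun F r M u hu L hL hLm => ?_⟩
  set s := L ∩ {q | q ∈ dom (A.e j) ∧ (A.e j).symm q.2 ∈ A.C k ∧ param (A.e j) q ∈ R.D} with hs
  have hsm : MeasurableSet s := hLm.inter (measurableSet_over hj (A.isCompact_C k))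
  have hsB : s ⊆ B' := fun q hq => ⟨hL hq.1, hq.2.2.1⟩
  set dk := Adapted.dens r M (pull (A.e k) u) (gradForm F (chr g (A.e k)) (pull (A.e k) u)) with hdk
  have h1 : scInt s (Adapted.dens r M (pull (A.e j) u) (gradForm F (chr g (A.e j)) (pull (A.e j) u)))
      ≤ ENNReal.ofReal (C ^ 2 + C ^ 4) * scInt s (fun q => dk (trans (A.e j) (A.e k) q)) := by
    refine scInt_mono hsm (by positivity) fun q hq => ?_
    have ho := hB'o (hsB hq)
    have hW : param (A.e j) q ∈ R.W := hq.2.2.2.1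
    have hA := fderiv_trans_sig hj hk ho q.1
    have hCq := hC q (hsB hq)
    have hC0 : 0 ≤ C := (norm_nonneg _).trans hCq
    have hdiff : DifferentiableAt ℝ (pull (A.e k) u) (trans (A.e j) (A.e k) q) :=
      (hu.contDiffAt hk (trans_mem ho)).differentiableAt (by simp)
    have n1 := scN₁_comp_le (η := pull (A.e k) u (trans (A.e j) (A.e k) q)) hA hCq
    have n2 := scN₂_comp_le (f := gradForm F (chr g (A.e k)) (pull (A.e k) u) (trans (A.e j) (A.e k) q))
      hA hCq
    rw [← pull_trans hj hk u ho] at n1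
    rw [← gradForm_trans hj hk R.isOpen_W ho hW hdiff] at n2
    have hx : (trans (A.e j) (A.e k) q).1 = q.1 := rfl
    have hw : wt r M (trans (A.e j) (A.e k) q) = wt r M q := rfl
    rw [hdk, Adapted.dens, Adapted.dens, hx, hw, mul_left_comm]
    refine mul_le_mul_of_nonneg_left ?_ (by positivity)
    have m1 := pow_le_pow_left₀ (scN₁_nonneg _ _) n1 2
    have m2 := pow_le_pow_left₀ (scN₂_nonneg _ _) n2 2
    have p1 : 0 ≤ C ^ 4 * scN₁ q.1 (pull (A.e k) u (trans (A.e j) (A.e k) q)) ^ 2 := by positivity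
    have p2 : 0 ≤ C ^ 2 * scN₂ q.1 (gradForm F (chr g (A.e k)) (pull (A.e k) u)
      (trans (A.e j) (A.e k) q)) ^ 2 := by positivity
    nlinarith
  have h2 : trans (A.e j) (A.e k) '' s ⊆ A.piece k := by
    rintro _ ⟨q, hq, rfl⟩
    have ho := hB'o (hsB hq)
    refine ⟨trans_mem ho, ?_, ?_⟩
    · change (param (A.e k) (trans (A.e j) (A.e k) q)).2 ∈ A.C k
      rw [param_trans ho]; exact hq.2.2.1
    · rw [param_trans ho]; exact hq.2.2.2
  refine h1.trans ?_
  rw [ENNReal.coe_mul, mul_assoc]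
  exact mul_le_mul_right ((hK s hsB hsm dk).trans (mul_le_mul_right (scInt_mono_set h2 _) _)) _

end Global

end

/-! ### From local estimates to estimates on the coordinate pieces -/

section

variable {d : ℕ} {Y : Type*} [TopologicalSpace Y] [ChartedSpace (E d) Y] [IsManifold (𝓡 d) ∞ Y]
  {e e' : OpenPartialHomeomorph Y (E d)}

section Functions

variable {W : Set (ℝ × Y)} {f : ℝ × Y → ℝ}

theorem contDiffOn_comp_param (he : e ∈ IsManifold.maximalAtlas (𝓡 d) ∞ Y)
    (hf : ContMDiffOn (IZ d) 𝓘(ℝ, ℝ) ∞ f W) :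
    ContDiffOn ℝ ∞ (f ∘ param e) (dom e ∩ param e ⁻¹' W) := by
  rw [← contMDiffOn_iff_contDiffOn]
  exact hf.comp ((contMDiffOn_param he).mono inter_subset_left) fun q hq => hq.2

theorem isOpen_dom_inter (he : e ∈ IsManifold.maximalAtlas (𝓡 d) ∞ Y) (hW : IsOpen W) :
    IsOpen (dom e ∩ param e ⁻¹' W) :=
  (contMDiffOn_param he).continuousOn.isOpen_inter_preimage (isOpen_dom e) hW

theorem differentiableAt_comp_param (he : e ∈ IsManifold.maximalAtlas (𝓡 d) ∞ Y) (hW : IsOpen W)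
    (hf : ContMDiffOn (IZ d) 𝓘(ℝ, ℝ) ∞ f W) {q : HE d} (hd : q ∈ dom e) (hq : param e q ∈ W) :
    DifferentiableAt ℝ (f ∘ param e) q :=
  ((contDiffOn_comp_param he hf).contDiffAt ((isOpen_dom_inter he hW).mem_nhds ⟨hd, hq⟩)).differentiableAt
    (by simp)

theorem dx_param (he : e ∈ IsManifold.maximalAtlas (𝓡 d) ∞ Y) (hW : IsOpen W)
    (hf : ContMDiffOn (IZ d) 𝓘(ℝ, ℝ) ∞ f W) {q : HE d} (hd : q ∈ dom e) (hq : param e q ∈ W) :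
    dx f (param e q) = fderiv ℝ (f ∘ param e) q (1, 0) := by
  have h1 : HasDerivAt (fun t : ℝ => ((t, q.2) : HE d)) (1, 0) q.1 :=
    (hasDerivAt_id q.1).prodMk (hasDerivAt_const q.1 q.2)
  exact ((differentiableAt_comp_param he hW hf hd hq).hasFDerivAt.comp_hasDerivAt q.1 h1).deriv

theorem exists_fderiv_snd_ne_zero (he : e ∈ IsManifold.maximalAtlas (𝓡 d) ∞ Y) (hW : IsOpen W)
    (hf : ContMDiffOn (IZ d) 𝓘(ℝ, ℝ) ∞ f W) {q : HE d} (hd : q ∈ dom e) (hq : param e q ∈ W)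
    (h : dy (d := d) f (param e q) ≠ 0) : ∃ w, fderiv ℝ (f ∘ param e) q (0, w) ≠ 0 := by
  by_contra! h0
  apply h
  have hs : (param e q).2 ∈ e.source := param_snd_mem hd
  have h1 : (fun y => f ((param e q).1, y)) =ᶠ[𝓝 (param e q).2]
      (fun w => (f ∘ param e) (q.1, w)) ∘ e := by
    filter_upwards [e.open_source.mem_nhds hs] with y hy
    simp [param, e.left_inv hy]
  have h2 : e (param e q).2 = q.2 := e.right_inv hd
  have h3 : MDifferentiableAt (𝓡 d) (𝓡 d) e (param e q).2 :=
    ((contMDiffOn_of_mem_maximalAtlas he).contMDiffAt (e.open_source.mem_nhds hs)).mdifferentiableAt (by simp)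
  have h5 : HasFDerivAt (fun w : E d => ((q.1, w) : HE d)) (ContinuousLinearMap.inr ℝ ℝ (E d)) q.2 :=
    (hasFDerivAt_const q.1 q.2).prodMk (hasFDerivAt_id q.2)
  have h6 : HasFDerivAt (fun w : E d => (f ∘ param e) (q.1, w)) (0 : E d →L[ℝ] ℝ) q.2 := by
    have h8 : (fderiv ℝ (f ∘ param e) q).comp (ContinuousLinearMap.inr ℝ ℝ (E d)) = 0 :=
      ContinuousLinearMap.ext fun w : E d => h0 w
    rw [← h8]
    exact (differentiableAt_comp_param he hW hf hd hq).hasFDerivAt.comp q.2 h5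
  rw [← h2] at h6
  have h7 := h6.hasMFDerivAt.comp (param e q).2 h3.hasMFDerivAt
  rw [dy]
  refine ((h7.congr_of_eventuallyEq h1).mfderiv).trans ?_
  exact ContinuousLinearMap.zero_comp _

end Functions

section Estimates

variable [T2Space Y] {R : Region d Y} {g : MetricOn d R.W} (A : Cover R)

variable (R) in
/-- One-forms which are smooth in coordinates and vanish outside of a compact set which meets neither the
boundary `x = 0` nor `∂_int Ω₁`. -/
def Localized (u : OneForm d Y) : Prop :=
  CoordSmooth u ∧ ∃ Z, IsCompact Z ∧ Z ⊆ R.W ∧ (∀ p ∈ Z, 0 < p.1 ∧ 0 < R.rho₁ p) ∧ ∀ p ∉ Z, u p = 0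

/-- The squared graph norm of a one-form in scattering frames. -/
def Cover.graphNormSq (g : MetricOn d R.W) (F r M : ℝ) (u : OneForm d Y) : ℝ≥0∞ :=
  ∑ k, scInt (A.piece k) (Adapted.dens r M (pull (A.e k) u) (gradForm F (chr g (A.e k)) (pull (A.e k) u)))

/-- A neighbourhood in the j-th chart may leave `C j` and may also cross ρ₁ = 0. A localized form
vanishes near the points that do not lie in `R.D`, and the other points lie over some `C k`, where
the integral is compared with that over the k-th piece. -/
theorem exists_scInt_inter_pos_le (g : MetricOn d R.W) (j : Fin A.N) {B : Set (HE d)} (hB : IsCompact B)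
    (hBs : B ⊆ dom (A.e j) ∩ param (A.e j) ⁻¹' R.W) :
    ∃ K : NNReal, ∀ (F r M : ℝ) (u : OneForm d Y), Localized R u → ∀ L ⊆ B, MeasurableSet L →
      scInt (L ∩ Adapted.pos (R.rho ∘ param (A.e j)))
        (Adapted.dens r M (pull (A.e j) u) (gradForm F (chr g (A.e j)) (pull (A.e j) u)))
      ≤ K * A.graphNormSq g F r M u := by
  have hBd : B ⊆ dom (A.e j) := hBs.trans inter_subset_left
  choose K hK using fun k => exists_scInt_over_le A g j k hB hBd
  refine ⟨∑ k, K k, fun F r M u hu L hL hLm => ?_⟩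
  obtain ⟨hus, Z, hZ, hZW, hZpos, hZ0⟩ := hu
  have hj := A.e_mem j
  set D := Adapted.dens r M (pull (A.e j) u) (gradForm F (chr g (A.e j)) (pull (A.e j) u)) with hD
  set s : Fin A.N → Set (HE d) := fun k =>
    L ∩ {q | q ∈ dom (A.e j) ∧ (A.e j).symm q.2 ∈ A.C k ∧ param (A.e j) q ∈ R.D} with hs
  have hsm : MeasurableSet (⋃ k, s k) := MeasurableSet.iUnion fun k =>
    hLm.inter (measurableSet_over hj (A.isCompact_C k))
  have h0 : ∀ q ∈ L, 0 < q.1 → 0 < R.rho (param (A.e j) q) → q ∉ ⋃ k, s k → D q = 0 := by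
    intro q hq hq1 hq2 hq3
    have hqd := hBd (hL hq)
    have hqZ : param (A.e j) q ∉ Z := by
      intro h
      have hDm : param (A.e j) q ∈ R.D := ⟨hZW h, hq1, hq2, (hZpos _ h).2⟩
      obtain ⟨k, hk⟩ := A.covers _ (R.D_subset hDm)
      exact hq3 (mem_iUnion.2 ⟨k, hq, hqd, hk, hDm⟩)
    have h1 : pull (A.e j) u =ᶠ[𝓝 q] 0 := by
      filter_upwards [(isOpen_dom_inter hj hZ.isClosed.isOpen_compl).mem_nhds ⟨hqd, hqZ⟩] with y hy
      change (formAt u (param (A.e j) y)).comp (dparam (A.e j) y) = 0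
      have : formAt u (param (A.e j) y) = 0 := hZ0 _ hy.2
      rw [this, ContinuousLinearMap.zero_comp]
    have h2 : gradForm F (chr g (A.e j)) (pull (A.e j) u) q = 0 := by
      rw [gradForm_congr h1]
      refine ContinuousLinearMap.ext fun w => ContinuousLinearMap.ext fun w' => ?_
      rw [gradForm_apply]
      simp [bilinGrad, symPart]
    rw [hD, Adapted.dens, h1.eq_of_nhds, h2]
    simp [scN₁, scN₂]
  have h1 : scInt (L ∩ Adapted.pos (R.rho ∘ param (A.e j))) D ≤ scInt (⋃ k, s k) D := by
    refine (lintegral_mono_set (subset_union_left (t := ⋃ k, s k))).trans ?_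
    rw [scInt, ← lintegral_indicator hsm]
    refine le_trans ?_ (setLIntegral_le_lintegral (L ∩ Adapted.pos (R.rho ∘ param (A.e j)) ∪ ⋃ k, s k) _)
    have hm : MeasurableSet (L ∩ Adapted.pos (R.rho ∘ param (A.e j)) ∪ ⋃ k, s k) := by
      refine MeasurableSet.union ?_ hsm
      have e1 : L ∩ Adapted.pos (R.rho ∘ param (A.e j)) = (L ∩ {q : HE d | 0 < q.1}) ∩
          (dom (A.e j) ∩ param (A.e j) ⁻¹' (R.W ∩ R.rho ⁻¹' Ioi 0)) := by
        ext q
        constructor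
        · exact fun h => ⟨⟨h.1, h.2.1⟩, (hBs (hL h.1)).1, (hBs (hL h.1)).2, h.2.2⟩
        · exact fun h => ⟨h.1.1, h.1.2, h.2.2.2⟩
      rw [e1]
      exact (hLm.inter (measurableSet_lt measurable_const measurable_fst)).inter
        (measurableSet_dom_inter_isOpen hj
          (R.smooth_rho.continuousOn.isOpen_inter_preimage R.isOpen_W isOpen_Ioi))
    refine setLIntegral_mono' hm fun q hq => ?_
    by_cases hqs : q ∈ ⋃ k, s k
    · rw [indicator_of_mem hqs]
    · obtain ⟨hqL, hq1, hq2⟩ := hq.resolve_right hqs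
      rw [h0 q hqL hq1 hq2 hqs]
      simp
  refine h1.trans ((scInt_iUnion_le s D).trans ?_)
  rw [Cover.graphNormSq, Finset.mul_sum]
  refine Finset.sum_le_sum fun k _ => (hK k F r M u hus L hL hLm).trans ?_
  gcongr
  exact_mod_cast Finset.single_le_sum (f := K) (fun i _ => zero_le) (Finset.mem_univ k)

/-- Adapted coordinates around q₀ and a bump function equal to 1 near q₀ reduce to the estimates for
`Adapted`. Points of ∂_int Ω₁ need no special treatment, because localized forms extend by zero
across it. In the first estimate `N` is fixed before F and r. -/
theorem exists_local_estimate (g : MetricOn d R.W) (hx : ∀ p ∈ R.bdryInt, 0 < dx R.rho p) (j : Fin A.N) {q₀ : HE d}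
    (hq₀ : q₀ ∈ A.cpiece j) :
    ∃ U, IsOpen U ∧ q₀ ∈ U ∧ (∃ N : NNReal, ∀ (F r M : ℝ) (u : OneForm d Y), 0 < F → 1 ≤ M → |r| ≤ M →
      Localized R u → ENNReal.ofReal (F ^ 2) *
        scInt (U ∩ A.piece j) (fun q => wt r M q ^ 2 * scN₁ q.1 (pull (A.e j) u q) ^ 2)
          ≤ N * A.graphNormSq g F r M u) ∧
      ∀ F : ℝ, ∃ N : NNReal, ∀ (r M : ℝ) (u : OneForm d Y), 1 ≤ M → |r| ≤ M → Localized R u →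
        scInt (U ∩ A.piece j) (fun q => wt r M q ^ 2 * scN₂ q.1 (fderiv ℝ (pull (A.e j) u) q) ^ 2)
          ≤ N * A.graphNormSq g F r M u := by
  have hj := A.e_mem j
  obtain ⟨hd, -, hK⟩ := hq₀
  set ρ := R.rho ∘ param (A.e j) with hρ
  set s := dom (A.e j) ∩ param (A.e j) ⁻¹' R.W with hs
  have hso : IsOpen s := isOpen_dom_inter hj R.isOpen_W
  obtain ⟨Q, hQ, hqQ, hQs, ⟨X, hX⟩, ⟨a⟩⟩ := exists_adapted (ρ := ρ) hso
    (contDiffOn_comp_param hj R.smooth_rho) (q₀ := q₀) ⟨hd, hK.1⟩ hK.2.1 hK.2.2.1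
    (fun h => by rw [← dx_param hj R.isOpen_W R.smooth_rho hd hK.1]; exact hx _ ⟨hK, h⟩)
    (fun h h' => exists_fderiv_snd_ne_zero hj R.isOpen_W R.smooth_rho hd hK.1 ((R.regular _ hK h).2 h'))
  obtain ⟨ε, hε, hball⟩ := Metric.nhds_basis_closedBall.mem_iff.1 (hQ.mem_nhds hqQ)
  set L := Metric.ball q₀ ε with hL
  set U := Metric.ball q₀ (ε / 3) with hU
  have hLB : L ⊆ Metric.closedBall q₀ ε := Metric.ball_subset_closedBall
  have hLQ : L ⊆ Q := hLB.trans hball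
  have hBc : IsCompact (Metric.closedBall q₀ ε) := isCompact_closedBall _ _
  have hBs : Metric.closedBall q₀ ε ⊆ s := hball.trans hQs
  obtain ⟨G, hG⟩ := hBc.exists_bound_of_continuousOn ((continuousOn_chr (g := g) hj R.isOpen_W).mono hBs)
  obtain ⟨χ, hc⟩ : ∃ χ : HE d → ℝ, IsCutoff L U χ := by
    let β : ContDiffBump q₀ := ⟨ε / 3, ε / 2, by positivity, by linarith⟩
    refine ⟨β, ⟨Metric.isOpen_ball, Metric.isOpen_ball, β.contDiff, β.hasCompactSupport, ?_, fun q => ?_,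
      fun q hq => β.one_of_mem_closedBall (Metric.ball_subset_closedBall hq)⟩⟩
    · rw [β.tsupport_eq]
      exact Metric.closedBall_subset_ball (by change ε / 2 < ε; linarith)
    · rw [abs_of_nonneg β.nonneg]
      exact β.le_one
  have hΓ : ∀ q ∈ L, ‖chr g (A.e j) q‖ ≤ G := fun q hq => hG q (hLB hq)
  have hfield : ∀ (F : ℝ) (u : OneForm d Y), Localized R u → FieldOn Q L F (chr g (A.e j)) (pull (A.e j) u)
      (gradForm F (chr g (A.e j)) (pull (A.e j) u)) := by
    rintro F u ⟨hus, Z, hZ, -, hZpos, hZ0⟩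
    refine ⟨(hus _ hj).mono fun q hq => (hQs hq.1).1, ⟨Metric.closedBall q₀ ε ∩ param (A.e j) ⁻¹' Z, ?_, ?_, ?_⟩,
      fun q _ _ w w' => gradForm_apply _ _ _ _ _ _⟩
    · exact hBc.of_isClosed_subset (((contMDiffOn_param hj).continuousOn.mono fun q hq =>
        (hBs hq).1).preimage_isClosed_of_isClosed hBc.isClosed hZ.isClosed) inter_subset_left
    · exact fun q hq => ⟨hball hq.1, (hZpos _ hq.2).1⟩
    · intro q hq _ hqB
      have : formAt u (param (A.e j) q) = 0 := hZ0 _ fun h => hqB ⟨hLB hq, h⟩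
      change (formAt u (param (A.e j) q)).comp (dparam (A.e j) q) = 0
      rw [this, ContinuousLinearMap.zero_comp]
  obtain ⟨K, hK'⟩ := exists_scInt_inter_pos_le A g j hBc hBs
  have hpos : U ∩ A.piece j ⊆ U ∩ Adapted.pos ρ := fun q hq => ⟨hq.1, hq.2.2.2.2.1, hq.2.2.2.2.2.1⟩
  obtain ⟨N, hN⟩ := a.exists_estimate_zero hc hLQ hQ hX hΓ
  refine ⟨U, Metric.isOpen_ball, Metric.mem_ball_self (by positivity), ⟨N * K, fun F r M u hF hM hr hu => ?_⟩,
    fun F => ?_⟩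
  · refine (mul_le_mul_right (scInt_mono_set hpos _) _).trans ((hN F r M _ _ hF hM hr (hfield F u hu)).trans ?_)
    rw [ENNReal.coe_mul, mul_assoc]
    exact mul_le_mul_right (hK' F r M u hu L hLB Metric.isOpen_ball.measurableSet) _
  · obtain ⟨N, hN⟩ := a.exists_estimate_one hc hLQ hQ hX hΓ F
    refine ⟨N * K, fun r M u hM hr hu => ?_⟩
    refine (scInt_mono_set hpos _).trans ((hN r M _ _ hM hr (hfield F u hu)).trans ?_)
    rw [ENNReal.coe_mul, mul_assoc]
    exact mul_le_mul_right (hK' F r M u hu L hLB Metric.isOpen_ball.measurableSet) _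

/-- Sets on which such estimates hold are stable under subsets and finite unions, so the local
estimates and compactness of the closed piece suffice. The closed piece includes the boundary x = 0.
-/
theorem exists_piece_estimate (g : MetricOn d R.W) (hx : ∀ p ∈ R.bdryInt, 0 < dx R.rho p) (j : Fin A.N) :
    (∃ N : NNReal, ∀ (F r M : ℝ) (u : OneForm d Y), 0 < F → 1 ≤ M → |r| ≤ M →
      Localized R u → ENNReal.ofReal (F ^ 2) *
        scInt (A.piece j) (fun q => wt r M q ^ 2 * scN₁ q.1 (pull (A.e j) u q) ^ 2)
          ≤ N * A.graphNormSq g F r M u) ∧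
      ∀ F : ℝ, ∃ N : NNReal, ∀ (r M : ℝ) (u : OneForm d Y), 1 ≤ M → |r| ≤ M → Localized R u →
        scInt (A.piece j) (fun q => wt r M q ^ 2 * scN₂ q.1 (fderiv ℝ (pull (A.e j) u) q) ^ 2)
          ≤ N * A.graphNormSq g F r M u := by
  have key := (A.isCompact_cpiece j).induction_on (p := fun U =>
    (∃ N : NNReal, ∀ (F r M : ℝ) (u : OneForm d Y), 0 < F → 1 ≤ M → |r| ≤ M →
      Localized R u → ENNReal.ofReal (F ^ 2) *
        scInt (U ∩ A.piece j) (fun q => wt r M q ^ 2 * scN₁ q.1 (pull (A.e j) u q) ^ 2)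
          ≤ N * A.graphNormSq g F r M u) ∧
      ∀ F : ℝ, ∃ N : NNReal, ∀ (r M : ℝ) (u : OneForm d Y), 1 ≤ M → |r| ≤ M → Localized R u →
        scInt (U ∩ A.piece j) (fun q => wt r M q ^ 2 * scN₂ q.1 (fderiv ℝ (pull (A.e j) u) q) ^ 2)
          ≤ N * A.graphNormSq g F r M u) ?_ ?_ ?_ ?_
  · rwa [inter_eq_right.2 (A.piece_subset j)] at key
  · exact ⟨⟨0, fun F r M u _ _ _ _ => by simp [scInt]⟩, fun F => ⟨0, fun r M u _ _ _ => by simp [scInt]⟩⟩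
  · rintro s t hst ⟨⟨N, h1⟩, h2⟩
    have hst' := inter_subset_inter_left (A.piece j) hst
    refine ⟨⟨N, fun F r M u hF hM hr hu => (mul_le_mul_right (scInt_mono_set hst' _) _).trans
      (h1 F r M u hF hM hr hu)⟩, fun F => ?_⟩
    obtain ⟨N, h2⟩ := h2 F
    exact ⟨N, fun r M u hM hr hu => (scInt_mono_set hst' _).trans (h2 r M u hM hr hu)⟩
  · rintro s t ⟨⟨N, h1⟩, h2⟩ ⟨⟨N', h1'⟩, h2'⟩
    refine ⟨⟨N + N', fun F r M u hF hM hr hu => ?_⟩, fun F => ?_⟩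
    · rw [union_inter_distrib_right, ENNReal.coe_add, add_mul]
      refine (mul_le_mul_right (scInt_union_le _ _ _) _).trans ?_
      rw [mul_add]
      exact add_le_add (h1 F r M u hF hM hr hu) (h1' F r M u hF hM hr hu)
    · obtain ⟨N, h2⟩ := h2 F
      obtain ⟨N', h2'⟩ := h2' F
      refine ⟨N + N', fun r M u hM hr hu => ?_⟩
      rw [union_inter_distrib_right, ENNReal.coe_add, add_mul]
      exact (scInt_union_le _ _ _).trans (add_le_add (h2 r M u hM hr hu) (h2' r M u hM hr hu))
  · intro q hq
    obtain ⟨U, hU, hqU, h⟩ := exists_local_estimate A g hx j hq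
    exact ⟨U, mem_nhdsWithin_of_mem_nhds (hU.mem_nhds hqU), h⟩

end Estimates

end

/-! ### Absorption for large F -/

section

variable {d : ℕ} {Y : Type*} [TopologicalSpace Y] [ChartedSpace (E d) Y] [IsManifold (𝓡 d) ∞ Y]
  {e e' : OpenPartialHomeomorph Y (E d)}

section Absorb

variable [T2Space Y] {R : Region d Y} (A : Cover R)

/-- The squared weighted norm of a one-form in scattering frames. -/
def Cover.normSq₀ (r M : ℝ) (u : OneForm d Y) : ℝ≥0∞ :=
  ∑ k, scInt (A.piece k) fun q => wt r M q ^ 2 * scN₁ q.1 (pull (A.e k) u q) ^ 2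

/-- The squared weighted norm of the derivatives of a one-form in scattering frames. -/
def Cover.normSq₁ (r M : ℝ) (u : OneForm d Y) : ℝ≥0∞ :=
  ∑ k, scInt (A.piece k) fun q => wt r M q ^ 2 * scN₂ q.1 (fderiv ℝ (pull (A.e k) u) q) ^ 2

/-- The squared weighted norm of the conjugated symmetric gradient in scattering frames. -/
def Cover.normSq₂ (g : MetricOn d R.W) (F r M : ℝ) (u : OneForm d Y) : ℝ≥0∞ :=
  ∑ k, scInt (A.piece k) fun q =>
    wt r M q ^ 2 * scN₂ q.1 (gradForm F (chr g (A.e k)) (pull (A.e k) u) q) ^ 2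

theorem continuous_sig : Continuous fun q : HE d => (sig q.1 : HE d →L[ℝ] HE d) := by
  have h : (fun q : HE d => (sig q.1 : HE d →L[ℝ] HE d)) = fun q =>
      q.1 ^ 2 • (ContinuousLinearMap.inl ℝ ℝ (E d)).comp (ContinuousLinearMap.fst ℝ ℝ (E d))
      + q.1 • (ContinuousLinearMap.inr ℝ ℝ (E d)).comp (ContinuousLinearMap.snd ℝ ℝ (E d)) := by
    funext q
    refine ContinuousLinearMap.ext fun w : HE d => ?_
    rw [sig_apply]
    ext1 <;> simp
  rw [h]
  fun_prop

theorem Cover.continuousOn_normSq₀ {u : OneForm d Y} (hu : CoordSmooth u) (j : Fin A.N) {r M : ℝ} (hM : 1 ≤ M) :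
    ContinuousOn (fun q => ENNReal.ofReal (q.1 ^ (d + 2))⁻¹ *
      ENNReal.ofReal (wt r M q ^ 2 * scN₁ q.1 (pull (A.e j) u q) ^ 2)) (A.piece j) := by
  have hpos : ∀ q ∈ A.piece j, 0 < q.1 := fun q hq => hq.2.2.2.1
  have h1 : ContinuousOn (pull (A.e j) u) (A.piece j) := (hu _ (A.e_mem j)).continuousOn.mono fun q hq => hq.1
  have h2 : ContinuousOn (fun q => scN₁ q.1 (pull (A.e j) u q)) (A.piece j) :=
    (h1.clm_comp continuous_sig.continuousOn).norm
  have h3 : ContinuousOn (wt r M) (A.piece j) := fun q hq =>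
    (contDiffAt_wt (n := 0) hM (hpos q hq)).continuousAt.continuousWithinAt
  have h4 : ContinuousOn (fun q : HE d => (q.1 ^ (d + 2))⁻¹) (A.piece j) :=
    (continuous_fst.pow _).continuousOn.inv₀ fun q hq => (pow_pos (hpos q hq) _).ne'
  have h5 := ENNReal.continuous_ofReal.comp_continuousOn (h4.mul ((h3.pow 2).mul (h2.pow 2)))
  refine h5.congr fun q hq => ?_
  have := hpos q hq
  exact (ENNReal.ofReal_mul (by positivity)).symm

theorem Cover.graphNormSq_le {g : MetricOn d R.W} {u : OneForm d Y} (hu : CoordSmooth u) {F r M : ℝ} (hM : 1 ≤ M) :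
    A.graphNormSq g F r M u ≤ A.normSq₀ r M u + A.normSq₂ g F r M u := by
  rw [Cover.graphNormSq, Cover.normSq₀, Cover.normSq₂, ← Finset.sum_add_distrib]
  refine Finset.sum_le_sum fun j _ => ?_
  have hm : AEMeasurable (fun q => ENNReal.ofReal (q.1 ^ (d + 2))⁻¹ *
      ENNReal.ofReal (wt r M q ^ 2 * scN₁ q.1 (pull (A.e j) u q) ^ 2)) (volume.restrict (A.piece j)) :=
    (A.continuousOn_normSq₀ hu j hM).aemeasurable (A.measurableSet_piece j)
  rw [scInt, scInt, scInt, ← lintegral_add_left' hm]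
  refine lintegral_mono fun q => ?_
  rw [Adapted.dens, mul_add, ENNReal.ofReal_add (by positivity) (by positivity), mul_add]

/-- Since F ≥ N + 1 ≥ 1 one has F² ≥ N + 1, which leaves one copy of `a` after cancelling `N * a`.
Finiteness of `a` is essential for the cancellation. -/
theorem ENNReal_absorb {N : NNReal} {a b : ℝ≥0∞} {F : ℝ} (hF : (N : ℝ) + 1 ≤ F) (ha : a ≠ ⊤)
    (h : ENNReal.ofReal (F ^ 2) * a ≤ N * (a + b)) : a ≤ N * b := by
  have h1 : (N : ℝ≥0∞) + 1 ≤ ENNReal.ofReal (F ^ 2) := by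
    have h0 : (0 : ℝ) ≤ N := N.2
    have h2 : (N : ℝ≥0∞) + 1 = ENNReal.ofReal ((N : ℝ) + 1) := by
      rw [ENNReal.ofReal_add h0 zero_le_one, ENNReal.ofReal_coe_nnreal, ENNReal.ofReal_one]
    rw [h2]
    exact ENNReal.ofReal_le_ofReal (by nlinarith)
  have h3 : (N : ℝ≥0∞) * a + a ≤ N * a + N * b := by
    calc (N : ℝ≥0∞) * a + a = (N + 1) * a := by ring
      _ ≤ ENNReal.ofReal (F ^ 2) * a := by gcongr
      _ ≤ _ := h.trans_eq (mul_add _ _ _)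
  exact (ENNReal.add_le_add_iff_left (ENNReal.mul_ne_top ENNReal.coe_ne_top ha)).1 h3

/-- The main estimate. -/
theorem exists_estimate (g : MetricOn d R.W) (hx : ∀ p ∈ R.bdryInt, 0 < dx R.rho p) :
    ∃ F₀ : ℝ, 0 < F₀ ∧ ∀ F, F₀ ≤ F → ∃ N : NNReal, ∀ (r M : ℝ) (u : OneForm d Y), 1 ≤ M → |r| ≤ M →
      Localized R u → A.normSq₀ r M u ≠ ⊤ →
        A.normSq₀ r M u + A.normSq₁ r M u ≤ N * A.normSq₂ g F r M u := by
  choose N hN using fun j => (exists_piece_estimate A g hx j).1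
  choose N' hN' using fun j => (exists_piece_estimate A g hx j).2
  -- The threshold involves only the constants of the zeroth order estimates, which depend neither
  -- on F nor on the weight. The constants N' of the first order estimates do depend on F and enter
  -- after absorption.
  refine ⟨(∑ j, N j : NNReal) + 1, by positivity, fun F hF => ⟨(∑ j, N j) + (∑ j, N' j F) * ((∑ j, N j) + 1),
    fun r M u hM hr hu hfin => ?_⟩⟩
  have hF0 : 0 < F := lt_of_lt_of_le (by positivity) hF
  have h0 : ENNReal.ofReal (F ^ 2) * A.normSq₀ r M u ≤ ((∑ j, N j : NNReal) : ℝ≥0∞) *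
      (A.normSq₀ r M u + A.normSq₂ g F r M u) := by
    refine le_trans ?_ (mul_le_mul_right (A.graphNormSq_le (g := g) (F := F) hu.1 hM) _)
    rw [Cover.normSq₀, Finset.mul_sum, ENNReal.ofNNReal_finsetSum, Finset.sum_mul]
    exact Finset.sum_le_sum fun j _ => hN j F r M u hF0 hM hr hu
  have h1 := ENNReal_absorb hF hfin h0
  have h2 : A.normSq₁ r M u ≤ ((∑ j, N' j F : NNReal) : ℝ≥0∞) * (A.normSq₀ r M u + A.normSq₂ g F r M u) := by
    refine le_trans ?_ (mul_le_mul_right (A.graphNormSq_le (g := g) (F := F) hu.1 hM) _)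
    rw [Cover.normSq₁, ENNReal.ofNNReal_finsetSum, Finset.sum_mul]
    exact Finset.sum_le_sum fun j _ => hN' j F r M u hM hr hu
  have h3 := h2.trans (mul_le_mul_right (add_le_add_left h1 _) _)
  refine (add_le_add h1 h3).trans_eq ?_
  push_cast
  ring

end Absorb

/-! ### Cutting off near ∂_int Ω₁ and x = 0 -/

section Cutoff

variable [T2Space Y] {R : Region d Y}

variable (R) in
/-- One-forms which are smooth in coordinates and vanish near `∂_int Ω₁` and near `x = 0`. -/
def Admissible (u : OneForm d Y) : Prop :=
  CoordSmooth u ∧ ∀ p ∈ R.K, p.1 = 0 ∨ p ∈ R.bdryInt₁ → ∀ᶠ p' in 𝓝 p, u p' = 0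

theorem TestForm.admissible {u : OneForm d Y} (hu : TestForm R u) : Admissible R u :=
  ⟨fun _ he => contDiffOn_pull he hu.1, hu.2⟩

theorem Admissible.add {u u' : OneForm d Y} (hu : Admissible R u) (hu' : Admissible R u') :
    Admissible R fun p => u p + u' p := by
  refine ⟨hu.1.add hu'.1, fun p hp h => ?_⟩
  filter_upwards [hu.2 p hp h, hu'.2 p hp h] with y h1 h2
  rw [h1, h2, add_zero]

theorem Admissible.smul {u : OneForm d Y} (hu : Admissible R u) (c : ℂ) :
    Admissible R fun p => c • u p := by
  refine ⟨hu.1.smul c, fun p hp h => ?_⟩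
  filter_upwards [hu.2 p hp h] with y h1
  rw [h1, smul_zero]

/-- The points of `R.K` near which u does not vanish identically form a compact set inside {x > 0,
ρ₁ > 0}, possibly reaching ∂_int Ω. Multiplying by a smooth function equal to 1 near that set and
zero off a slightly larger compact set does not change u near points of `R.D`. -/
theorem Admissible.exists_localized [SigmaCompactSpace Y] {u : OneForm d Y} (hu : Admissible R u) :
    ∃ u' : OneForm d Y, Localized R u' ∧ ∀ p ∈ R.D, ∀ᶠ p' in 𝓝 p, u' p' = u p' := by
  have : LocallyCompactSpace Y := ChartedSpace.locallyCompactSpace (E d) Y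
  set Z₀ := R.K ∩ {p | ¬ ∀ᶠ p' in 𝓝 p, u p' = 0} with hZ₀
  have hZ₀c : IsCompact Z₀ := by
    refine R.isCompact_K.inter_right ?_
    have : IsOpen {p | ∀ᶠ p' in 𝓝 p, u p' = 0} := isOpen_setOfPred_eventually_nhds
    exact this.isClosed_compl
  set O : Set (ℝ × Y) := {p | 0 < p.1} ∩ (R.W ∩ R.rho₁ ⁻¹' Ioi 0) with hO
  have hOo : IsOpen O := (isOpen_lt continuous_const continuous_fst).inter
    (R.smooth_rho₁.continuousOn.isOpen_inter_preimage R.isOpen_W isOpen_Ioi)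
  have hZO : Z₀ ⊆ O := by
    rintro p ⟨hp, hp'⟩
    refine ⟨hp.2.1.lt_of_ne fun h => hp' (hu.2 p hp (Or.inl h.symm)), hp.1, ?_⟩
    exact hp.2.2.2.lt_of_ne fun h => hp' (hu.2 p hp (Or.inr ⟨hp, h.symm⟩))
  obtain ⟨Z, hZ, hZ₀Z, hZsub⟩ := exists_compact_between hZ₀c hOo hZO
  obtain ⟨θ, hθ1, hθ0, -⟩ := exists_contMDiffMap_one_nhds_of_subset_interior (IZ d) (n := ⊤) hZ₀c.isClosed hZ₀Z
  refine ⟨fun p => θ p • u p, ⟨hu.1.smul_fun θ.contMDiff, Z, hZ, fun p hp => (hZsub hp).2.1,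
    fun p hp => ⟨(hZsub hp).1, (hZsub hp).2.2⟩, fun p hp => by
      change θ p • u p = 0
      rw [hθ0 p hp, zero_smul]⟩, fun p hp => ?_⟩
  by_cases h : ∀ᶠ p' in 𝓝 p, u p' = 0
  · filter_upwards [h] with y hy
    rw [hy, smul_zero]
  · have hpZ : p ∈ Z₀ := ⟨R.D_subset hp, h⟩
    filter_upwards [mem_nhdsSet_iff_forall.1 hθ1 p hpZ] with y hy
    rw [hy, one_smul]

theorem pull_congr (he : e ∈ IsManifold.maximalAtlas (𝓡 d) ∞ Y) {u u' : OneForm d Y} {q : HE d} (hq : q ∈ dom e)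
    (h : ∀ᶠ p' in 𝓝 (param e q), u' p' = u p') : pull e u' =ᶠ[𝓝 q] pull e u := by
  have h1 : ContinuousAt (param e) q :=
    (contMDiffOn_param he).continuousOn.continuousAt ((isOpen_dom e).mem_nhds hq)
  filter_upwards [h1.eventually h] with y hy
  have : formAt u' (param e y) = formAt u (param e y) := hy
  rw [pull, pull, this]

/-- The main estimate for admissible forms. -/
theorem exists_estimate_admissible [SigmaCompactSpace Y] (A : Cover R) (g : MetricOn d R.W)
    (hx : ∀ p ∈ R.bdryInt, 0 < dx R.rho p) :
    ∃ F₀ : ℝ, 0 < F₀ ∧ ∀ F, F₀ ≤ F → ∃ N : NNReal, ∀ (r M : ℝ) (u : OneForm d Y), 1 ≤ M → |r| ≤ M →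
      Admissible R u → A.normSq₀ r M u ≠ ⊤ →
        A.normSq₀ r M u + A.normSq₁ r M u ≤ N * A.normSq₂ g F r M u := by
  obtain ⟨F₀, hF₀, h⟩ := exists_estimate A g hx
  refine ⟨F₀, hF₀, fun F hF => ?_⟩
  obtain ⟨N, hN⟩ := h F hF
  refine ⟨N, fun r M u hM hr hu hfin => ?_⟩
  obtain ⟨u', hu', heq⟩ := hu.exists_localized
  have hc : ∀ j, ∀ q ∈ A.piece j, pull (A.e j) u' =ᶠ[𝓝 q] pull (A.e j) u := fun j q hq =>
    pull_congr (A.e_mem j) hq.1 (heq _ hq.2.2)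
  have hI : ∀ j (h h' : HE d → ℝ), (∀ q ∈ A.piece j, h q = h' q) → scInt (A.piece j) h = scInt (A.piece j) h' :=
    fun j h h' H => setLIntegral_congr_fun (A.measurableSet_piece j) fun q hq => by simp only [H q hq]
  have e0 : A.normSq₀ r M u' = A.normSq₀ r M u := Finset.sum_congr rfl fun j _ =>
    hI j _ _ fun q hq => by rw [(hc j q hq).eq_of_nhds]
  have e1 : A.normSq₁ r M u' = A.normSq₁ r M u := Finset.sum_congr rfl fun j _ =>
    hI j _ _ fun q hq => by rw [(hc j q hq).fderiv_eq]
  have e2 : A.normSq₂ g F r M u' = A.normSq₂ g F r M u := Finset.sum_congr rfl fun j _ =>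
    hI j _ _ fun q hq => by rw [gradForm_congr (hc j q hq)]
  have := hN r M u' hM hr hu' (by rwa [e0])
  rwa [e0, e1, e2] at this

end Cutoff

end

/-! ### Norms of components and scattering jets -/

section

variable {d : ℕ}

section Components

theorem sig_coordVec (x : ℝ) (a : Fin (d + 1)) :
    sig x (coordVec a : HE d) = scFactor (d := d) x a • (coordVec a : HE d) := by
  refine Fin.cases ?_ (fun i => ?_) a
  · rw [sig_apply]; simp [coordVec, scFactor]
  · rw [sig_apply]; simp [coordVec, scFactor]

theorem norm_coordVec_le (a : Fin (d + 1)) : ‖(coordVec a : HE d)‖ ≤ 1 := by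
  refine Fin.cases ?_ (fun i => ?_) a
  · simp [coordVec, Prod.norm_def]
  · simp [coordVec, Prod.norm_def]

theorem abs_coordFun_le (a : Fin (d + 1)) (w : HE d) : |coordFun a w| ≤ ‖w‖ := by
  refine Fin.cases ?_ (fun i => ?_) a
  · exact norm_fst_le w
  · exact (PiLp.norm_apply_le w.2 i).trans (norm_snd_le w)

theorem opNorm_le_sum {G : Type*} [NormedAddCommGroup G] [NormedSpace ℝ G] (η : HE d →L[ℝ] G) :
    ‖η‖ ≤ ∑ a, ‖η (coordVec a : HE d)‖ := by
  refine η.opNorm_le_bound (Finset.sum_nonneg fun a _ => norm_nonneg _) fun w => ?_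
  conv_lhs => rw [← sum_coordFun_smul w, map_sum]
  rw [Finset.sum_mul]
  refine (norm_sum_le _ _).trans (Finset.sum_le_sum fun a _ => ?_)
  rw [map_smul, norm_smul, mul_comm]
  exact mul_le_mul_of_nonneg_left (abs_coordFun_le a w) (norm_nonneg _)

theorem scN₁_le_sum (x : ℝ) (η : HE d →L[ℝ] ℂ) :
    scN₁ x η ≤ ∑ a, ‖η (sig x (coordVec a : HE d))‖ := opNorm_le_sum _

theorem scN₂_le_sum (x : ℝ) (f : HE d →L[ℝ] HE d →L[ℝ] ℂ) :
    scN₂ x f ≤ ∑ a, ∑ b, ‖f (sig x (coordVec a : HE d)) (sig x (coordVec b : HE d))‖ :=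
  (opNorm_le_sum _).trans (Finset.sum_le_sum fun _ _ => opNorm_le_sum _)

theorem norm_apply_sig_le (x : ℝ) (η : HE d →L[ℝ] ℂ) (a : Fin (d + 1)) :
    ‖η (sig x (coordVec a : HE d))‖ ≤ scN₁ x η := by
  refine ((η.comp (sig x)).le_opNorm (coordVec a : HE d)).trans ?_
  exact mul_le_of_le_one_right (norm_nonneg _) (norm_coordVec_le a)

theorem norm_apply_sig_sig_le (x : ℝ) (f : HE d →L[ℝ] HE d →L[ℝ] ℂ) (a b : Fin (d + 1)) :
    ‖f (sig x (coordVec a : HE d)) (sig x (coordVec b : HE d))‖ ≤ scN₂ x f := by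
  refine ((f.bilinearComp (sig x) (sig x)).le_opNorm₂ (coordVec a : HE d) (coordVec b : HE d)).trans ?_
  have h0 := scN₂_nonneg x f
  change scN₂ x f * _ * _ ≤ _
  calc _ ≤ scN₂ x f * 1 * 1 := by
        gcongr
        · exact norm_coordVec_le a
        · exact norm_coordVec_le b
    _ = _ := by ring

/-- The coefficients in the formula for derivatives of scattering components. -/
def kap (x : ℝ) (b a : Fin (d + 1)) : ℝ := if b = 0 then (if a = 0 then 2 * x else x) else 0

theorem abs_kap_le {x X : ℝ} (hx : 0 < x) (hX : x ≤ X) (b a : Fin (d + 1)) : |kap x b a| ≤ 2 * X := by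
  unfold kap
  split_ifs
  · rw [abs_of_pos (by positivity)]; linarith
  · rw [abs_of_pos hx]; linarith
  · rw [abs_zero]; linarith

/-- The scattering factors depend on x only, so differentiating them contributes only in the
direction x²∂_x, where x²∂_x(x²) = 2x · x² and x²∂_x(x) = x · x. These coefficients are recorded in
`kap` and stay bounded. -/
theorem scFactor_mul_pd {v : HE d → HE d →L[ℝ] ℂ} {q : HE d} (hv : DifferentiableAt ℝ v q) (b a : Fin (d + 1)) :
    (scFactor (d := d) q.1 b : ℂ) * pd b (fun q' => (scFactor (d := d) q'.1 a : ℂ) * v q' (coordVec a)) q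
      = fderiv ℝ v q (sig q.1 (coordVec b)) (sig q.1 (coordVec a))
        + kap q.1 b a * v q (sig q.1 (coordVec a)) := by
  set σ : ℝ := if a = 0 then 2 * q.1 else 1 with hσ
  have h1 : HasFDerivAt (fun q' : HE d => scFactor (d := d) q'.1 a) (σ • ContinuousLinearMap.fst ℝ ℝ (E d)) q := by
    have h2 : HasDerivAt (fun x : ℝ => scFactor (d := d) x a) σ q.1 := by
      rw [hσ]
      refine Fin.cases ?_ (fun i => ?_) a
      · simpa [scFactor] using hasDerivAt_pow 2 q.1
      · simpa [scFactor, Fin.succ_ne_zero] using hasDerivAt_id' q.1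
    exact h2.comp_hasFDerivAt q hasFDerivAt_fst
  have h3 : HasFDerivAt (fun q' : HE d => v q' (coordVec a))
      ((ContinuousLinearMap.apply ℝ ℂ (coordVec a : HE d)).comp (fderiv ℝ v q)) q :=
    (ContinuousLinearMap.apply ℝ ℂ (coordVec a : HE d)).hasFDerivAt.comp q hv.hasFDerivAt
  have h4 : HasFDerivAt (fun q' : HE d => (scFactor (d := d) q'.1 a : ℂ) * v q' (coordVec a)) _ q :=
    (h1.fun_smul h3).congr_of_eventuallyEq (Eventually.of_forall fun q' => by simp)
  rw [pd, h4.fderiv, sig_coordVec, sig_coordVec]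
  have h5 : scFactor (d := d) q.1 b * (σ * (coordVec b : HE d).1) = kap q.1 b a * scFactor (d := d) q.1 a := by
    rw [hσ, kap]
    refine Fin.cases ?_ (fun i => ?_) b
    · refine Fin.cases ?_ (fun i => ?_) a
      · simp [scFactor, coordVec]; ring
      · simp [scFactor, coordVec, Fin.succ_ne_zero]; ring
    · simp [coordVec, Fin.succ_ne_zero]
  have h5' := congrArg (fun t : ℝ => (t : ℂ)) h5
  push_cast at h5'
  simp only [add_apply, smul_apply, ContinuousLinearMap.comp_apply, ContinuousLinearMap.apply_apply,
    ContinuousLinearMap.smulRight_apply, ContinuousLinearMap.coe_fst', map_smul, Complex.real_smul, smul_eq_mul]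
  push_cast
  linear_combination (v q (coordVec a)) * h5'

end Components

section Weights

/-- The weight is x^{-r} (1 + Mx)^r, and 1 ≤ 1 + Mx ≤ 1 + MX. The comparison constant depends on r;
this is harmless, since it is used only after absorption. -/
theorem exists_weight_bounds (r M : ℝ) {X : ℝ} (hM : 1 ≤ M) (hX0 : 0 ≤ X) : ∃ c : ℝ, 0 ≤ c ∧ ∀ q : HE d, 0 < q.1 → q.1 ≤ X →
    q.1 ^ (-r) ≤ c * wt r M q ∧ wt r M q ≤ c * q.1 ^ (-r) := by
  refine ⟨(1 + M * X) ^ |r|, by positivity, fun q hq hqX => ?_⟩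
  set t := 1 + M * q.1 with ht
  have ht1 : 1 ≤ t := by nlinarith
  have htX : t ≤ 1 + M * X := by rw [ht]; gcongr
  have e1 : wt r M q = q.1 ^ (-r) * t ^ r := by
    rw [wt, Real.rpow_neg hq.le, ← Real.inv_rpow hq.le, ← Real.mul_rpow (by positivity) (by positivity)]
    congr 1
    rw [ht]; field_simp
  have hb : ∀ s, |s| = |r| → t ^ s ≤ (1 + M * X) ^ |r| := fun s hs => by
    refine (Real.rpow_le_rpow_of_exponent_le ht1 (le_abs_self s)).trans ?_
    rw [hs]
    exact Real.rpow_le_rpow (by positivity) htX (abs_nonneg _)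
  have hx0 : 0 ≤ q.1 ^ (-r) := by positivity
  constructor
  · have h1 := hb (-r) (abs_neg r)
    have h2 : t ^ (-r) * t ^ r = 1 := by
      rw [← Real.rpow_add (by positivity)]; simp
    rw [e1]
    calc q.1 ^ (-r) = t ^ (-r) * (q.1 ^ (-r) * t ^ r) := by rw [mul_left_comm, h2, mul_one]
      _ ≤ _ := by gcongr
  · rw [e1, mul_comm]
    gcongr
    exact hb r rfl

end Weights

variable {Y : Type*} [TopologicalSpace Y] [ChartedSpace (E d) Y] [IsManifold (𝓡 d) ∞ Y]
  [T2Space Y] {R : Region d Y} (A : Cover R) (r : ℝ)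

theorem Region.exists_bound (R : Region d Y) : ∃ X : ℝ, 0 ≤ X ∧ ∀ p ∈ R.K, p.1 ≤ X := by
  obtain ⟨X, hX⟩ := (R.isCompact_K.image continuous_fst).bddAbove
  exact ⟨max X 0, le_max_right _ _, fun p hp => (hX (mem_image_of_mem _ hp)).trans (le_max_left _ _)⟩

namespace Cover

theorem ae_mem_piece (j : Fin A.N) : ∀ᵐ q ∂(A.mu r j), q ∈ A.piece j :=
  (withDensity_absolutelyContinuous _ _).ae_le (ae_restrict_mem (A.measurableSet_piece j))

/-- Translates the abstract `L²` norm into weighted integrals: the exponent of the measure splits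
into the scattering density x^{-(d+2)} and the square of x^{-r}. -/
theorem ofReal_norm_sq {κ : Type} [Fintype κ] {f : A.L2 r κ} {T : Fin A.N → κ → HE d → ℂ}
    (h : A.Represents r f T) :
    ENNReal.ofReal (‖f‖ ^ 2) = ∑ j, scInt (A.piece j) fun q => (q.1 ^ (-r)) ^ 2 * ∑ k, ‖T j k q‖ ^ 2 := by
  rw [PiLp.norm_sq_eq_of_L2, ENNReal.ofReal_sum_of_nonneg fun _ _ => by positivity]
  refine Finset.sum_congr rfl fun j _ => ?_
  have h1 : ENNReal.ofReal (‖f j‖ ^ 2) = ∫⁻ q, ‖(f j : HE d → EuclideanSpace ℂ κ) q‖ₑ ^ 2 ∂(A.mu r j) := by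
    rw [ENNReal.ofReal_pow (norm_nonneg _), ofReal_norm, Lp.enorm_def]
    have := eLpNorm_nnreal_pow_eq_lintegral (f := (f j : HE d → EuclideanSpace ℂ κ)) (μ := A.mu r j)
      (p := 2) two_ne_zero
    simpa using this
  have h2 : ∫⁻ q, ‖(f j : HE d → EuclideanSpace ℂ κ) q‖ₑ ^ 2 ∂(A.mu r j)
      = ∫⁻ q, ENNReal.ofReal (∑ k, ‖T j k q‖ ^ 2) ∂(A.mu r j) := by
    refine lintegral_congr_ae ?_
    filter_upwards [h j] with q hq
    rw [← ofReal_norm, ← ENNReal.ofReal_pow (norm_nonneg _), EuclideanSpace.norm_sq_eq]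
    simp only [hq]
  have h3 : AEMeasurable (fun q : HE d => ENNReal.ofReal (q.1 ^ (-(d + 2 : ℝ) - 2 * r)))
      (volume.restrict (A.piece j)) := by fun_prop
  rw [h1, h2, mu, lintegral_withDensity_eq_lintegral_mul_non_measurable₀ _ h3
    (Eventually.of_forall fun _ => ENNReal.ofReal_lt_top), scInt]
  refine setLIntegral_congr_fun (A.measurableSet_piece j) fun q hq => ?_
  have hq0 : 0 < q.1 := hq.2.2.2.1
  simp only [Pi.mul_apply]
  have e : (q.1 ^ (d + 2))⁻¹ * (q.1 ^ (-r)) ^ 2 = q.1 ^ (-(d + 2 : ℝ) - 2 * r) := by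
    rw [← Real.rpow_natCast q.1, ← Real.rpow_natCast (q.1 ^ (-r)), ← Real.rpow_mul hq0.le, ← Real.rpow_neg hq0.le,
      ← Real.rpow_add hq0]
    congr 1
    push_cast
    ring
  rw [← e, ENNReal.ofReal_mul (by positivity), ENNReal.ofReal_mul (by positivity), mul_assoc]

theorem pull_sig_eq {u : OneForm d Y} (e : OpenPartialHomeomorph Y (E d)) (q : HE d) (a : Fin (d + 1)) :
    scComp₁ e u a q = pull e u q (sig q.1 (coordVec a)) := by
  rw [sig_coordVec, map_smul, Complex.real_smul, scComp₁, comp₁_eq]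

theorem jet_inr {u : OneForm d Y} {j : Fin A.N} {q : HE d} (hu : DifferentiableAt ℝ (pull (A.e j) u) q)
    (b a : Fin (d + 1)) : A.jet u j (.inr (b, a)) q
      = fderiv ℝ (pull (A.e j) u) q (sig q.1 (coordVec b)) (sig q.1 (coordVec a))
        + kap q.1 b a * pull (A.e j) u q (sig q.1 (coordVec a)) :=
  scFactor_mul_pd hu b a

/-- Provides the finiteness required by the absorption argument: the jet of u is represented by an
element of `L²`. -/
theorem normSq₀_le {f : A.L2 r (JetIdx d)} {u : OneForm d Y} (h : A.Represents r f (A.jet u)) {M : ℝ} (hM : 1 ≤ M) :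
    A.normSq₀ r M u ≠ ⊤ := by
  obtain ⟨X, hX0, hX⟩ := R.exists_bound
  obtain ⟨c, hc, hcb⟩ := exists_weight_bounds (d := d) r M hM hX0
  refine ne_top_of_le_ne_top (ENNReal.mul_ne_top (a := ENNReal.ofReal (c ^ 2 * (d + 1 : ℕ)))
    ENNReal.ofReal_ne_top (ENNReal.ofReal_ne_top (r := ‖f‖ ^ 2))) ?_
  rw [A.ofReal_norm_sq r h, normSq₀, Finset.mul_sum]
  refine Finset.sum_le_sum fun j _ => scInt_mono (A.measurableSet_piece j) (by positivity) fun q hq => ?_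
  have hq0 : 0 < q.1 := hq.2.2.2.1
  have h1 := (hcb q hq0 (hX _ (R.D_subset hq.2.2))).2
  have h2 : scN₁ q.1 (pull (A.e j) u q) ^ 2 ≤ (d + 1 : ℕ) * ∑ k, ‖A.jet u j k q‖ ^ 2 := by
    have h3 := pow_le_pow_left₀ (scN₁_nonneg _ _) (scN₁_le_sum q.1 (pull (A.e j) u q)) 2
    refine h3.trans ((sq_sum_le_card_mul_sum_sq).trans ?_)
    rw [Finset.card_univ, Fintype.card_fin, Fintype.sum_sum_type]
    refine mul_le_mul_of_nonneg_left ?_ (by positivity)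
    refine le_add_of_le_of_nonneg (le_of_eq ?_) (by positivity)
    exact Finset.sum_congr rfl fun a _ => by rw [← pull_sig_eq]; rfl
  have hw := (wt_pos (r := r) hM hq0).le
  calc _ ≤ (c * q.1 ^ (-r)) ^ 2 * ((d + 1 : ℕ) * ∑ k, ‖A.jet u j k q‖ ^ 2) := by gcongr
    _ = _ := by ring

theorem exists_norm_jet_le {M : ℝ} (hM : 1 ≤ M) : ∃ C : ℝ, ∀ (u : OneForm d Y) (f : A.L2 r (JetIdx d)),
    CoordSmooth u → A.Represents r f (A.jet u) →
      ENNReal.ofReal (‖f‖ ^ 2) ≤ ENNReal.ofReal C * (A.normSq₀ r M u + A.normSq₁ r M u) := by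
  obtain ⟨X, hX0, hX⟩ := R.exists_bound
  obtain ⟨c, hc, hcb⟩ := exists_weight_bounds (d := d) r M hM hX0
  set n := Fintype.card (JetIdx d) with hn
  set c' := c ^ 2 * (n * (2 * ((2 * X + 1) ^ 2))) with hc'
  refine ⟨c', fun u f hu h => ?_⟩
  rw [A.ofReal_norm_sq r h, normSq₀, normSq₁, ← Finset.sum_add_distrib, Finset.mul_sum]
  refine Finset.sum_le_sum fun j _ => ?_
  have hm := (A.continuousOn_normSq₀ hu j (r := r) hM).aemeasurable (A.measurableSet_piece j) (μ := volume)
  have h4 : scInt (A.piece j) (fun q => wt r M q ^ 2 * (scN₁ q.1 (pull (A.e j) u q) ^ 2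
      + scN₂ q.1 (fderiv ℝ (pull (A.e j) u) q) ^ 2))
      ≤ scInt (A.piece j) (fun q => wt r M q ^ 2 * scN₁ q.1 (pull (A.e j) u q) ^ 2)
      + scInt (A.piece j) (fun q => wt r M q ^ 2 * scN₂ q.1 (fderiv ℝ (pull (A.e j) u) q) ^ 2) := by
    rw [scInt, scInt, scInt, ← lintegral_add_left' hm]
    refine lintegral_mono fun q => ?_
    rw [mul_add, ENNReal.ofReal_add (by positivity) (by positivity), mul_add]
  refine le_trans ?_ (mul_le_mul_right h4 _)
  refine scInt_mono (A.measurableSet_piece j) (by positivity) fun q hq => ?_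
  have hq0 : 0 < q.1 := hq.2.2.2.1
  have hqX := hX _ (R.D_subset hq.2.2)
  have h1 := (hcb q hq0 hqX).1
  have hd : DifferentiableAt ℝ (pull (A.e j) u) q := (hu.contDiffAt (A.e_mem j) hq.1).differentiableAt (by simp)
  set s₁ := scN₁ q.1 (pull (A.e j) u q) with hs₁
  set s₂ := scN₂ q.1 (fderiv ℝ (pull (A.e j) u) q) with hs₂
  have hs1 : 0 ≤ s₁ := scN₁_nonneg _ _
  have hs2 : 0 ≤ s₂ := scN₂_nonneg _ _
  have hk : ∀ k, ‖A.jet u j k q‖ ^ 2 ≤ 2 * ((2 * X + 1) ^ 2) * (s₁ ^ 2 + s₂ ^ 2) := by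
    intro k
    have hb : ‖A.jet u j k q‖ ≤ (2 * X + 1) * s₁ + s₂ := by
      rcases k with a | ⟨b, a⟩
      · have e1 : A.jet u j (.inl a) q = pull (A.e j) u q (sig q.1 (coordVec a)) := pull_sig_eq _ _ _
        rw [e1]
        have := norm_apply_sig_le q.1 (pull (A.e j) u q) a
        nlinarith
      · rw [A.jet_inr hd]
        refine (norm_add_le _ _).trans ?_
        rw [norm_mul, Complex.norm_real, Real.norm_eq_abs]
        have h5 := norm_apply_sig_le q.1 (pull (A.e j) u q) a
        have h6 := norm_apply_sig_sig_le q.1 (fderiv ℝ (pull (A.e j) u) q) b a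
        have h7 := mul_le_mul (abs_kap_le hq0 hqX b a) h5 (norm_nonneg _) (by positivity)
        have : 2 * X * s₁ ≤ (2 * X + 1) * s₁ := by nlinarith
        linarith
    refine (pow_le_pow_left₀ (norm_nonneg _) hb 2).trans ?_
    have h8 : s₂ ≤ (2 * X + 1) * s₂ := by nlinarith
    refine (pow_le_pow_left₀ (by positivity) (add_le_add_right h8 _) 2).trans ?_
    have : 0 ≤ (2 * X + 1) ^ 2 * (s₁ - s₂) ^ 2 := by positivity
    nlinarith
  have h9 : ∑ k, ‖A.jet u j k q‖ ^ 2 ≤ n * (2 * ((2 * X + 1) ^ 2) * (s₁ ^ 2 + s₂ ^ 2)) := by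
    refine (Finset.sum_le_card_nsmul _ _ _ fun k _ => hk k).trans_eq ?_
    rw [Finset.card_univ, nsmul_eq_mul]
  calc _ ≤ (c * wt r M q) ^ 2 * (n * (2 * ((2 * X + 1) ^ 2) * (s₁ ^ 2 + s₂ ^ 2))) := by gcongr
    _ = _ := by rw [hc']; ring

/-- The components of the conjugated symmetric gradient. -/
def symRepr (g : MetricOn d R.W) (F : ℝ) (u : OneForm d Y) (j : Fin A.N) (k : Fin (d + 1) × Fin (d + 1)) (q : HE d) : ℂ :=
  scFactor (d := d) q.1 k.1 * scFactor (d := d) q.1 k.2 * symGradConj g (A.e j) F (fun a => comp₁ (A.e j) u a) k.1 k.2 q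

theorem symRepr_eq {g : MetricOn d R.W} {F : ℝ} {u : OneForm d Y} {j : Fin A.N} {q : HE d}
    (hu : DifferentiableAt ℝ (pull (A.e j) u) q) (hq : 0 < q.1) (k : Fin (d + 1) × Fin (d + 1)) :
    A.symRepr g F u j k q = gradForm F (chr g (A.e j)) (pull (A.e j) u) q (sig q.1 (coordVec k.1))
      (sig q.1 (coordVec k.2)) := by
  rw [symRepr, symGradConj_eq hu hq, ← gradForm_apply, sig_coordVec, sig_coordVec]
  simp only [map_smul, smul_apply, Complex.real_smul]
  ring

theorem exists_normSq₂_le {M : ℝ} (hM : 1 ≤ M) : ∃ C : ℝ, ∀ (g : MetricOn d R.W) (F : ℝ) (u : OneForm d Y)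
    (f : A.L2 r (Fin (d + 1) × Fin (d + 1))), CoordSmooth u → A.Represents r f (A.symRepr g F u) →
      A.normSq₂ g F r M u ≤ ENNReal.ofReal C * ENNReal.ofReal (‖f‖ ^ 2) := by
  obtain ⟨X, hX0, hX⟩ := R.exists_bound
  obtain ⟨c, hc, hcb⟩ := exists_weight_bounds (d := d) r M hM hX0
  set n := Fintype.card (Fin (d + 1) × Fin (d + 1)) with hn
  refine ⟨c ^ 2 * n, fun g F u f hu h => ?_⟩
  rw [A.ofReal_norm_sq r h, normSq₂, Finset.mul_sum]
  refine Finset.sum_le_sum fun j _ => scInt_mono (A.measurableSet_piece j) (by positivity) fun q hq => ?_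
  have hq0 : 0 < q.1 := hq.2.2.2.1
  have h1 := (hcb q hq0 (hX _ (R.D_subset hq.2.2))).2
  have hd : DifferentiableAt ℝ (pull (A.e j) u) q := (hu.contDiffAt (A.e_mem j) hq.1).differentiableAt (by simp)
  have h2 : scN₂ q.1 (gradForm F (chr g (A.e j)) (pull (A.e j) u) q) ^ 2 ≤ n * ∑ k, ‖A.symRepr g F u j k q‖ ^ 2 := by
    have h3 := pow_le_pow_left₀ (scN₂_nonneg _ _)
      (scN₂_le_sum q.1 (gradForm F (chr g (A.e j)) (pull (A.e j) u) q)) 2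
    rw [← Fintype.sum_prod_type'] at h3
    refine h3.trans ((sq_sum_le_card_mul_sum_sq).trans ?_)
    rw [Finset.card_univ]
    refine mul_le_mul_of_nonneg_left (le_of_eq ?_) (by positivity)
    exact Finset.sum_congr rfl fun k _ => by rw [A.symRepr_eq hd hq0]
  have hw := (wt_pos (r := r) hM hq0).le
  calc _ ≤ (c * q.1 ^ (-r)) ^ 2 * (n * ∑ k, ‖A.symRepr g F u j k q‖ ^ 2) := by gcongr
    _ = _ := by ring

end Cover

/-- The conjugated symmetric gradient is bounded from below. -/
theorem exists_norm_le [SigmaCompactSpace Y] (g : MetricOn d R.W) (hx : ∀ p ∈ R.bdryInt, 0 < dx R.rho p) :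
    ∃ F₀ : ℝ, 0 < F₀ ∧ ∀ F, F₀ ≤ F → ∀ r, ∃ C : NNReal, ∀ (u : OneForm d Y) (f : A.L2 r (Cover.JetIdx d))
      (f' : A.L2 r (Fin (d + 1) × Fin (d + 1))), Admissible R u → A.Represents r f (A.jet u) →
      A.Represents r f' (A.symRepr g F u) → ‖f‖ ≤ C * ‖f'‖ := by
  obtain ⟨F₀, hF₀, h⟩ := exists_estimate_admissible A g hx
  refine ⟨F₀, hF₀, fun F hF r => ?_⟩
  obtain ⟨N, hN⟩ := h F hF
  -- The weight parameter M = |r| + 1 meets both requirements 1 ≤ M and |r| ≤ M. Although M depends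
  -- on r, `F₀` and `N` were fixed beforehand.
  have hM : 1 ≤ |r| + 1 := by have := abs_nonneg r; linarith
  obtain ⟨C₁, hC₁⟩ := A.exists_norm_jet_le r hM
  obtain ⟨C₂, hC₂⟩ := A.exists_normSq₂_le r hM
  set c : NNReal := Real.toNNReal C₁ * (N * Real.toNNReal C₂) with hc
  refine ⟨NNReal.sqrt c, fun u f f' hu hf hf' => ?_⟩
  have h1 : ENNReal.ofReal (‖f‖ ^ 2) ≤ ENNReal.ofReal (c * ‖f'‖ ^ 2) := by
    refine (hC₁ u f hu.1 hf).trans ?_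
    rw [ENNReal.ofReal_mul c.coe_nonneg, ENNReal.ofReal_coe_nnreal, hc, ENNReal.coe_mul, ENNReal.coe_mul, mul_assoc, mul_assoc]
    refine mul_le_mul_right ((hN r _ u hM (by linarith) hu (A.normSq₀_le r hf hM)).trans ?_) _
    exact mul_le_mul_right (hC₂ g F u f' hu.1 hf') _
  rw [ENNReal.ofReal_le_ofReal_iff (by positivity)] at h1
  refine (pow_le_pow_iff_left₀ (norm_nonneg _) (by positivity) two_ne_zero).1 ?_
  rw [mul_pow]
  have : ((NNReal.sqrt c : NNReal) : ℝ) ^ 2 = c := by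
    rw [← NNReal.coe_pow, NNReal.sq_sqrt]
  rwa [this]

end

/-! ### The symmetric gradient as a bounded operator on jets -/

section

/-- Multiplication by a bounded matrix-valued function on `L²`. -/
theorem exists_mulOperator {α : Type*} [MeasurableSpace α] {μ : Measure α} {V V' : Type*}
    [NormedAddCommGroup V] [NormedSpace ℂ V] [NormedAddCommGroup V'] [NormedSpace ℂ V']
    {m : α → V →L[ℂ] V'} (hm : AEStronglyMeasurable m μ) {C : ℝ} (hC : ∀ᵐ x ∂μ, ‖m x‖ ≤ C) :
    ∃ T : Lp V 2 μ →L[ℂ] Lp V' 2 μ, ∀ f : Lp V 2 μ, ∀ᵐ x ∂μ, (T f : α → V') x = m x ((f : α → V) x) := by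
  have hp : MemLp m ⊤ μ := memLp_top_of_bound hm C hC
  set B : (V →L[ℂ] V') →L[ℂ] V →L[ℂ] V' := ContinuousLinearMap.id ℂ _
  refine ⟨B.holderL μ ⊤ 2 2 (hp.toLp m), fun f => ?_⟩
  have h1 := B.coeFn_holder (r := 2) (hp.toLp m) f
  filter_upwards [h1, hp.coeFn_toLp] with x hx hx'
  rw [ContinuousLinearMap.holderL_apply_apply, hx, hx']
  rfl

/-- Bounded operators with closed range between Hilbert spaces have left inverses. -/
theorem exists_leftInverse {H₁ H₂ : Type*} [NormedAddCommGroup H₁] [NormedSpace ℂ H₁] [CompleteSpace H₁]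
    [NormedAddCommGroup H₂] [InnerProductSpace ℂ H₂] [CompleteSpace H₂] (f : H₁ →L[ℂ] H₂) {C : NNReal}
    (h : ∀ x, ‖x‖ ≤ C * ‖f x‖) :
    Function.Injective f ∧ ∃ P : H₂ →L[ℂ] H₁, P ∘L f = ContinuousLinearMap.id ℂ H₁ := by
  have ha := f.antilipschitz_of_bound h
  have hr := ha.isClosed_range f.uniformContinuous
  refine ⟨ha.injective, ?_⟩
  set e := f.equivRange ha.injective hr
  have : CompleteSpace f.range := by
    have h2 : IsClosed (f.range : Set H₂) := hr
    exact h2.completeSpace_coe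
  -- The range is closed by the lower bound, so one may project onto it orthogonally and then
  -- invert.
  refine ⟨(e.symm : f.range →L[ℂ] H₁) ∘L f.range.orthogonalProjectionOnto, ?_⟩
  refine ContinuousLinearMap.ext fun x => ?_
  have h1 : f.range.orthogonalProjectionOnto (f x) = e x :=
    f.range.orthogonalProjectionOnto_mem_subspace_eq_self (e x)
  simp [h1]

variable {d : ℕ}

section Coefficients

/-- The smooth quotients of scattering factors. -/
def scRatio (x : ℝ) (a b c : Fin (d + 1)) : ℝ :=
  if a = 0 then (if c = 0 then scFactor (d := d) x b else x * scFactor (d := d) x b)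
  else (if c = 0 then (if b = 0 then x else 1) else scFactor (d := d) x b)

/-- In scattering components Γ^c_ab carries the factors of a and b divided by that of c. In every
case the quotient is a monomial in x, even for c = 0 and tangential a, b, where it is 1; so there is
no singularity at x = 0. -/
theorem scRatio_mul (x : ℝ) (a b c : Fin (d + 1)) :
    scRatio x a b c * scFactor (d := d) x c = scFactor (d := d) x a * scFactor (d := d) x b := by
  unfold scRatio
  refine Fin.cases ?_ (fun i => ?_) a <;> refine Fin.cases ?_ (fun j => ?_) b <;> refine Fin.cases ?_ (fun k => ?_) c <;>
    simp only [scFactor, Fin.cons_zero, Fin.cons_succ, Fin.succ_ne_zero, reduceIte] <;> ring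

theorem continuous_scFactor (a : Fin (d + 1)) : Continuous fun x : ℝ => scFactor (d := d) x a := by
  refine Fin.cases ?_ (fun i => ?_) a
  · simpa [scFactor] using continuous_pow 2
  · simpa [scFactor] using continuous_id'

theorem continuous_scRatio (a b c : Fin (d + 1)) : Continuous fun x : ℝ => scRatio x a b c := by
  have h := continuous_scFactor b
  unfold scRatio
  split_ifs <;> fun_prop

theorem continuous_kap (b a : Fin (d + 1)) : Continuous fun x : ℝ => kap x b a := by
  unfold kap
  split_ifs <;> fun_prop

variable (d) in
abbrev JetSpace : Type := EuclideanSpace ℂ (Cover.JetIdx d)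

variable (d) in
abbrev PairSpace : Type := EuclideanSpace ℂ (Fin (d + 1) × Fin (d + 1))

/-- The value of a component of a jet. -/
def jetProj (k : Cover.JetIdx d) : JetSpace d →L[ℂ] ℂ := EuclideanSpace.proj k

theorem jetProj_apply (k : Cover.JetIdx d) (ξ : JetSpace d) : jetProj k ξ = ξ k := rfl

/-- The components of the conjugated symmetric gradient as functionals on jets. -/
def coeffRow (F : ℝ) (Γ : HE d → HE d →L[ℝ] HE d →L[ℝ] HE d) (a b : Fin (d + 1)) (q : HE d) : JetSpace d →L[ℂ] ℂ :=
  (2⁻¹ : ℝ) • (jetProj (.inr (a, b)) + jetProj (.inr (b, a)))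
    - (2⁻¹ : ℝ) • (kap q.1 a b • jetProj (.inl b) + kap q.1 b a • jetProj (.inl a))
    - ∑ c, (scRatio q.1 a b c * coordFun c (Γ q (coordVec a) (coordVec b))) • jetProj (.inl c)
    - (F / 2) • ((coordVec a : HE d).1 • jetProj (.inl b) + (coordVec b : HE d).1 • jetProj (.inl a))

theorem continuousOn_coeffRow {F : ℝ} {Γ : HE d → HE d →L[ℝ] HE d →L[ℝ] HE d} {s : Set (HE d)}
    (hΓ : ContinuousOn Γ s) (a b : Fin (d + 1)) : ContinuousOn (coeffRow F Γ a b) s := by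
  have h1 : ∀ a b : Fin (d + 1), ContinuousOn (fun q : HE d => kap q.1 a b) s := fun a b =>
    ((continuous_kap a b).comp continuous_fst).continuousOn
  have h2 : ∀ c, ContinuousOn (fun q : HE d => scRatio q.1 a b c * coordFun c (Γ q (coordVec a) (coordVec b))) s :=
    fun c => ((continuous_scRatio a b c).comp continuous_fst).continuousOn.mul
      ((coordFun c).continuous.comp_continuousOn
        ((hΓ.clm_apply continuousOn_const).clm_apply continuousOn_const))
  have h3 : ContinuousOn (fun q : HE d => (2⁻¹ : ℝ) • (kap q.1 a b • jetProj (.inl b) + kap q.1 b a • jetProj (.inl a))) s :=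
    (((h1 a b).fun_smul continuousOn_const).fun_add ((h1 b a).fun_smul continuousOn_const)).fun_const_smul _
  have h4 : ContinuousOn (fun q : HE d => ∑ c, (scRatio q.1 a b c * coordFun c (Γ q (coordVec a) (coordVec b))) •
      jetProj (.inl c)) s :=
    continuousOn_finsetSum _ fun c _ => (h2 c).fun_smul continuousOn_const
  unfold coeffRow
  exact ((continuousOn_const.fun_sub h3).fun_sub h4).fun_sub continuousOn_const

/-- The conjugated symmetric gradient as a linear map on jets. -/
def coeffMap (F : ℝ) (Γ : HE d → HE d →L[ℝ] HE d →L[ℝ] HE d) (q : HE d) : JetSpace d →L[ℂ] PairSpace d :=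
  ∑ k : Fin (d + 1) × Fin (d + 1), ContinuousLinearMap.smulRightL ℂ (JetSpace d) (PairSpace d) (coeffRow F Γ k.1 k.2 q)
    (EuclideanSpace.single k 1)

theorem continuousOn_coeffMap {F : ℝ} {Γ : HE d → HE d →L[ℝ] HE d →L[ℝ] HE d} {s : Set (HE d)}
    (hΓ : ContinuousOn Γ s) : ContinuousOn (coeffMap F Γ) s :=
  continuousOn_finsetSum _ fun k _ =>
    ((ContinuousLinearMap.smulRightL ℂ (JetSpace d) (PairSpace d)).continuous.comp_continuousOn
      (continuousOn_coeffRow hΓ k.1 k.2)).clm_apply continuousOn_const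

theorem coeffMap_apply (F : ℝ) (Γ : HE d → HE d →L[ℝ] HE d →L[ℝ] HE d) (q : HE d) (ξ : JetSpace d)
    (k : Fin (d + 1) × Fin (d + 1)) : coeffMap F Γ q ξ k = coeffRow F Γ k.1 k.2 q ξ := by
  rw [coeffMap, sum_apply, WithLp.ofLp_sum, Finset.sum_apply, Finset.sum_eq_single k]
  · simp
  · intro b _ hb
    simp [hb.symm]
  · simp

end Coefficients

variable {Y : Type*} [TopologicalSpace Y] [ChartedSpace (E d) Y] [IsManifold (𝓡 d) ∞ Y]
  [T2Space Y] {R : Region d Y} (A : Cover R) (r : ℝ)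

namespace Cover

/-- The `kap` terms remove what differentiating the scattering factors has added to the jet. In the
conjugation term the factor x⁻² cancels against x²∂_x, leaving the constant coefficient F/2. -/
theorem symRepr_eq_coeffRow {g : MetricOn d R.W} {F : ℝ} {u : OneForm d Y} {j : Fin A.N} {q : HE d}
    (hu : DifferentiableAt ℝ (pull (A.e j) u) q) (hq : 0 < q.1) {ξ : JetSpace d} (hξ : ∀ k, ξ k = A.jet u j k q)
    (a b : Fin (d + 1)) : A.symRepr g F u j (a, b) q = coeffRow F (chr g (A.e j)) a b q ξ := by
  rw [A.symRepr_eq hu hq, gradForm_apply, bilinGrad]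
  have hl : ∀ a, ξ (.inl a) = pull (A.e j) u q (sig q.1 (coordVec a)) := fun a => by
    rw [hξ]; exact pull_sig_eq _ _ _
  have hr : ∀ b a, ξ (.inr (b, a)) = fderiv ℝ (pull (A.e j) u) q (sig q.1 (coordVec b)) (sig q.1 (coordVec a))
      + kap q.1 b a * pull (A.e j) u q (sig q.1 (coordVec a)) := fun b a => by
    rw [hξ, A.jet_inr hu]
  set v := pull (A.e j) u q with hv
  have h1 : v (chr g (A.e j) q (sig q.1 (coordVec a)) (sig q.1 (coordVec b)))
      = ∑ c, ((scRatio q.1 a b c * coordFun c (chr g (A.e j) q (coordVec a) (coordVec b)) : ℝ) : ℂ) * ξ (.inl c) := by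
    have e1 : chr g (A.e j) q (sig q.1 (coordVec a)) (sig q.1 (coordVec b))
        = (scFactor (d := d) q.1 a * scFactor (d := d) q.1 b) • chr g (A.e j) q (coordVec a) (coordVec b) := by
      rw [sig_coordVec, sig_coordVec, map_smul, map_smul, smul_apply, smul_smul, mul_comm]
    rw [e1]
    set w := chr g (A.e j) q (coordVec a) (coordVec b) with hw
    conv_lhs => rw [← sum_coordFun_smul w]
    rw [map_smul, map_sum, Finset.smul_sum]
    refine Finset.sum_congr rfl fun c _ => ?_
    rw [hl c, sig_coordVec q.1 c, map_smul, map_smul, Complex.real_smul, Complex.real_smul, Complex.real_smul,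
      ← scRatio_mul q.1 a b c]
    push_cast
    ring
  have h2 : ∀ a, ((sig q.1 (coordVec a : HE d)).1 : ℝ) = q.1 ^ 2 * (coordVec a : HE d).1 := fun a => rfl
  have hx : (q.1 : ℂ) ≠ 0 := by exact_mod_cast hq.ne'
  simp only [h1, h2, coeffRow, sub_apply, add_apply, smul_apply, sum_apply, jetProj_apply,
    symPart, ContinuousLinearMap.flip_apply, Complex.real_smul]
  rw [hr a b, hr b a, hl a, hl b]
  push_cast
  field_simp
  ring

/-- The conjugated symmetric gradient as a bounded operator on jets. -/
theorem exists_operator (g : MetricOn d R.W) (F : ℝ) :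
    ∃ S : A.L2 r (JetIdx d) →L[ℂ] A.L2 r (Fin (d + 1) × Fin (d + 1)), ∀ (u : OneForm d Y) (f : A.L2 r (JetIdx d)),
      CoordSmooth u → A.Represents r f (A.jet u) → A.Represents r (S f) (A.symRepr g F u) := by
  have hT : ∀ j, ∃ T : Lp (JetSpace d) 2 (A.mu r j) →L[ℂ] Lp (PairSpace d) 2 (A.mu r j), ∀ f : Lp (JetSpace d) 2 (A.mu r j),
      ∀ᵐ q ∂(A.mu r j), (T f : HE d → PairSpace d) q = coeffMap F (chr g (A.e j)) q ((f : HE d → JetSpace d) q) := by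
    intro j
    -- The coefficients are continuous up to x = 0 and the closed piece is compact, hence they are
    -- bounded.
    have hc : ContinuousOn (coeffMap F (chr g (A.e j))) (A.cpiece j) :=
      continuousOn_coeffMap ((continuousOn_chr (A.e_mem j) R.isOpen_W).mono fun q hq => ⟨hq.1, hq.2.2.1⟩)
    obtain ⟨C, hC⟩ := (A.isCompact_cpiece j).exists_bound_of_continuousOn hc
    refine exists_mulOperator ?_ (C := C) ?_
    · exact ((hc.mono (A.piece_subset j)).aestronglyMeasurable (A.measurableSet_piece j)).mono_ac
        (withDensity_absolutelyContinuous _ _)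
    · filter_upwards [A.ae_mem_piece r j] with q hq using hC q (A.piece_subset j hq)
  choose T hT using hT
  refine ⟨(PiLp.continuousLinearEquiv 2 ℂ fun j => Lp (PairSpace d) 2 (A.mu r j)).symm.toContinuousLinearMap ∘L
    ContinuousLinearMap.pi fun j => T j ∘L PiLp.proj 2 _ j, fun u f hu hf j => ?_⟩
  filter_upwards [hT j (f j), hf j, A.ae_mem_piece r j] with q h1 h2 hq k
  have hd : DifferentiableAt ℝ (pull (A.e j) u) q := (hu.contDiffAt (A.e_mem j) hq.1).differentiableAt (by simp)
  have hq0 : 0 < q.1 := hq.2.2.2.1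
  have e1 := A.symRepr_eq_coeffRow (g := g) (F := F) hd hq0 h2 k.1 k.2
  rw [← coeffMap_apply, ← h1] at e1
  exact e1.symm

end Cover

end

/-! ### Symmetric tensors, closedness of the target space, and the left inverse -/

section

variable {d : ℕ} {Y : Type*} [TopologicalSpace Y] [ChartedSpace (E d) Y] [IsManifold (𝓡 d) ∞ Y]
  {e e' : OpenPartialHomeomorph Y (E d)}

/-- The derivative of the coordinate map. -/
def dcoord (e : OpenPartialHomeomorph Y (E d)) (p : ℝ × Y) : HE d →L[ℝ] HE d :=
  mfderiv (IZ d) 𝓘(ℝ, HE d) (coord e) p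

theorem dcoord_dparam (he : e ∈ IsManifold.maximalAtlas (𝓡 d) ∞ Y) (he' : e' ∈ IsManifold.maximalAtlas (𝓡 d) ∞ Y)
    {q : HE d} (hq : q ∈ overlap e e') (w : HE d) :
    dcoord e' (param e q) (dparam e q w) = fderiv ℝ (trans e e') q w :=
  mfderiv_coord_mfderiv_param he he' hq w

theorem dparam_dcoord (he : e ∈ IsManifold.maximalAtlas (𝓡 d) ∞ Y) {q : HE d} (hq : q ∈ dom e) (w : HE d) :
    dparam e q (dcoord e (param e q) w) = w := by
  have h := mfderiv_param_mfderiv_coord he (p := param e q) (param_snd_mem hq) w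
  rw [coord_param hq] at h
  exact h

section Symmetry

variable {W : Set (ℝ × Y)} {g : MetricOn d W}

theorem chr_symm (he : e ∈ IsManifold.maximalAtlas (𝓡 d) ∞ Y) (hW : IsOpen W) {q : HE d}
    (hd : q ∈ dom e) (hq : param e q ∈ W) (w w' : HE d) : chr g e q w w' = chr g e q w' w := by
  have hT := (differentiableAt_pull₂ (g := g) he hW hd hq).differentiableAt (by simp)
  have hs : ∀ z w w', fderiv ℝ (pull₂ e g.inner) q z w w' = fderiv ℝ (pull₂ e g.inner) q z w' w := by
    intro z w w'
    rw [← fderiv_apply₂ hT, ← fderiv_apply₂ hT]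
    congr 1
    refine Filter.EventuallyEq.fderiv_eq ?_
    filter_upwards [(isOpen_dom_inter he hW).mem_nhds ⟨hd, hq⟩] with y hy using pull₂_symm hy.2 _ _
  refine eq_of_pull₂_eq he hd hq (g := g) fun z => ?_
  rw [koszul he hW hd hq, koszul he hW hd hq, hs z w w']
  ring

theorem gradForm_symm (he : e ∈ IsManifold.maximalAtlas (𝓡 d) ∞ Y) (hW : IsOpen W) {q : HE d}
    (hd : q ∈ dom e) (hq : param e q ∈ W) (F : ℝ) (v : HE d → HE d →L[ℝ] ℂ) (w w' : HE d) :
    gradForm F (chr g e) v q w w' = gradForm F (chr g e) v q w' w := by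
  rw [gradForm_apply, gradForm_apply, bilinGrad, bilinGrad, chr_symm he hW hd hq w w']
  simp only [symPart, smul_apply, add_apply, ContinuousLinearMap.flip_apply]
  ring_nf

end Symmetry

/-- Convergence in `L²` gives almost everywhere convergence of a subsequence on one piece; finitely
many extractions serve all pieces simultaneously. -/
theorem exists_subseq_ae {ι : Type*} [Fintype ι] {α : Type*} [MeasurableSpace α] {μ : ι → Measure α}
    {V : Type*} [NormedAddCommGroup V] {f : ℕ → ∀ i, Lp V 2 (μ i)} {f₀ : ∀ i, Lp V 2 (μ i)}
    (h : ∀ i, Tendsto (fun n => f n i) atTop (𝓝 (f₀ i))) :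
    ∃ φ : ℕ → ℕ, StrictMono φ ∧ ∀ i, ∀ᵐ x ∂(μ i),
      Tendsto (fun n => (f (φ n) i : α → V) x) atTop (𝓝 ((f₀ i : α → V) x)) := by
  classical
  have key : ∀ s : Finset ι, ∃ φ : ℕ → ℕ, StrictMono φ ∧ ∀ i ∈ s, ∀ᵐ x ∂(μ i),
      Tendsto (fun n => (f (φ n) i : α → V) x) atTop (𝓝 ((f₀ i : α → V) x)) := by
    intro s
    induction s using Finset.induction_on with
    | empty => exact ⟨id, strictMono_id, fun i hi => absurd hi (Finset.notMem_empty i)⟩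
    | insert a s ha ih =>
      obtain ⟨φ, hφ, hφs⟩ := ih
      obtain ⟨ψ, hψ, hψa⟩ := (tendstoInMeasure_of_tendsto_Lp
        ((h a).comp hφ.tendsto_atTop)).exists_seq_tendsto_ae
      refine ⟨φ ∘ ψ, hφ.comp hψ, fun i hi => ?_⟩
      rcases Finset.mem_insert.1 hi with rfl | hi
      · exact hψa
      · filter_upwards [hφs i hi] with x hx using hx.comp hψ.tendsto_atTop
  obtain ⟨φ, hφ, h⟩ := key Finset.univ
  exact ⟨φ, hφ, fun i => h i (Finset.mem_univ i)⟩

theorem bilin_eq_sum (B : HE d →L[ℝ] HE d →L[ℝ] ℂ) (A : HE d →L[ℝ] HE d) : B.bilinearComp A A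
    = ∑ a, ∑ b, B (coordVec a) (coordVec b) • ((coordFun a).comp A).smulRight (((coordFun b).comp A).smulRight (1 : ℂ)) := by
  refine ContinuousLinearMap.ext fun w => ContinuousLinearMap.ext fun w' => ?_
  have e1 : B.bilinearComp A A w w' = B (A w) (A w') := rfl
  rw [e1]
  conv_lhs => rw [← sum_coordFun_smul (A w), ← sum_coordFun_smul (A w')]
  simp only [map_sum, map_smul, sum_apply, smul_apply, ContinuousLinearMap.smulRight_apply,
    ContinuousLinearMap.comp_apply, Complex.real_smul, smul_eq_mul, mul_one]
  rw [Finset.sum_comm]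
  refine Finset.sum_congr rfl fun a _ => ?_
  rw [Finset.mul_sum]
  exact Finset.sum_congr rfl fun b _ => by ring

variable [T2Space Y] {R : Region d Y} (A : Cover R) (r : ℝ)

open Classical in
/-- The value at a point of the conjugated symmetric gradient of a one-form. -/
def gradFormAt (g : MetricOn d R.W) (F : ℝ) (u : OneForm d Y) (p : ℝ × Y) : HE d →L[ℝ] HE d →L[ℝ] ℂ :=
  if p ∈ R.D then (gradForm F (chr g (chartAt (E d) p.2)) (pull (chartAt (E d) p.2) u)
    (coord (chartAt (E d) p.2) p)).bilinearComp (dcoord (chartAt (E d) p.2) p) (dcoord (chartAt (E d) p.2) p)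
  else 0

/-- The conjugated symmetric gradient of a one-form as a tensor. -/
def gradTensor (g : MetricOn d R.W) (F : ℝ) (u : OneForm d Y) : TwoTensor d Y := fun p => gradFormAt g F u p

theorem chartAt_mem (y : Y) : chartAt (E d) y ∈ IsManifold.maximalAtlas (𝓡 d) ∞ Y :=
  IsManifold.chart_mem_maximalAtlas y

theorem gradFormAt_symm (g : MetricOn d R.W) (F : ℝ) (u : OneForm d Y) (p : ℝ × Y) (v w : HE d) :
    gradFormAt g F u p v w = gradFormAt g F u p w v := by
  by_cases h : p ∈ R.D
  · have hs : p.2 ∈ (chartAt (E d) p.2).source := mem_chart_source _ _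
    have hm := chartAt_mem (d := d) p.2
    rw [gradFormAt, if_pos h]
    generalize chartAt (E d) p.2 = e at hs hm ⊢
    have hq : param e (coord e p) ∈ R.W := by rw [param_coord hs]; exact h.1
    have h1 := gradForm_symm (g := g) hm R.isOpen_W (coord_mem_dom hs) hq F (pull e u) (dcoord e p v) (dcoord e p w)
    rw [ContinuousLinearMap.bilinearComp_apply, ContinuousLinearMap.bilinearComp_apply, h1]
  · rw [gradFormAt, if_neg h]
    rfl

/-- The tensor was defined at each point through a preferred chart there; tensoriality shows that
every other chart sees the same object. -/
theorem pull₂_gradTensor (he : e ∈ IsManifold.maximalAtlas (𝓡 d) ∞ Y) (g : MetricOn d R.W) (F : ℝ) {u : OneForm d Y}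
    (hu : CoordSmooth u) {q : HE d} (hq : q ∈ dom e) (hD : param e q ∈ R.D) :
    pull₂ e (gradTensor g F u) q = gradForm F (chr g e) (pull e u) q := by
  set e' := chartAt (E d) (param e q).2 with he'
  have hm : e' ∈ IsManifold.maximalAtlas (𝓡 d) ∞ Y := chartAt_mem _
  have ho : q ∈ overlap e e' := mem_overlap.2 ⟨hq, mem_chart_source _ _⟩
  have hdiff : DifferentiableAt ℝ (pull e' u) (trans e e' q) :=
    (hu.contDiffAt hm (trans_mem ho)).differentiableAt (by simp)
  rw [gradForm_trans he hm R.isOpen_W ho hD.1 hdiff]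
  have h1 : bilinAt (gradTensor g F u) (param e q) = (gradForm F (chr g e') (pull e' u)
      (trans e e' q)).bilinearComp (dcoord e' (param e q)) (dcoord e' (param e q)) := if_pos hD
  rw [pull₂, h1]
  refine ContinuousLinearMap.ext fun w => ContinuousLinearMap.ext fun w' => ?_
  change gradForm F (chr g e') (pull e' u) (trans e e' q) (dcoord e' (param e q) (dparam e q w))
    (dcoord e' (param e q) (dparam e q w')) = _
  rw [dcoord_dparam he hm ho, dcoord_dparam he hm ho]
  rfl

namespace Cover

theorem repr₂_gradTensor (g : MetricOn d R.W) (F : ℝ) {u : OneForm d Y} (hu : CoordSmooth u) {j : Fin A.N} {q : HE d}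
    (hq : q ∈ A.piece j) (k : Fin (d + 1) × Fin (d + 1)) :
    A.repr₂ (gradTensor g F u) j k q = A.symRepr g F u j k q := by
  have hd : DifferentiableAt ℝ (pull (A.e j) u) q := (hu.contDiffAt (A.e_mem j) hq.1).differentiableAt (by simp)
  rw [repr₂, symRepr, comp₂_eq, pull₂_gradTensor (A.e_mem j) g F hu hq.1 hq.2.2, gradForm_apply,
    symGradConj_eq hd hq.2.2.2.1]

theorem mem_H0_of_represents {g : MetricOn d R.W} {F : ℝ} {u : OneForm d Y} (hu : CoordSmooth u)
    {f : A.L2 r (Fin (d + 1) × Fin (d + 1))} (hf : A.Represents r f (A.symRepr g F u)) : f ∈ A.H0 r := by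
  refine ⟨gradTensor g F u, fun p v w => gradFormAt_symm g F u p v w, fun j => ?_⟩
  filter_upwards [hf j, A.ae_mem_piece r j] with q h hq k
  rw [h k, A.repr₂_gradTensor g F hu hq]

-- An element of `H0` comes from one tensor common to all pieces, so the limit has to be realized by
-- a single tensor too. A subsequence converges almost everywhere on each piece, and the tensor is
-- defined at a point p as the limit of the values at p whenever it exists. The definition does not
-- refer to a piece, so no compatibility has to be checked. Closedness is needed because the
-- operator is extended to a closure.
open Classical in
theorem isClosed_H0 : IsClosed (A.H0 r : Set (A.L2 r (Fin (d + 1) × Fin (d + 1)))) := by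
  refine IsSeqClosed.isClosed fun f f₀ hf hlim => ?_
  choose T hTs hT using hf
  have hproj : ∀ j, Tendsto (fun n => f n j) atTop (𝓝 (f₀ j)) := fun j =>
    ((PiLp.proj 2 (𝕜 := ℂ) (fun j => Lp (PairSpace d) 2 (A.mu r j)) j).continuous.tendsto f₀).comp hlim
  obtain ⟨φ, -, hφ⟩ := exists_subseq_ae (f := fun n j => f n j) (f₀ := fun j => f₀ j) hproj
  set L : ∀ p : ℝ × Y, HE d →L[ℝ] HE d →L[ℝ] ℂ := fun p =>
    if h : ∃ B, Tendsto (fun n => bilinAt (T (φ n)) p) atTop (𝓝 B) then h.choose else 0 with hL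
  have happ : ∀ {B : ℕ → HE d →L[ℝ] HE d →L[ℝ] ℂ} {B₀}, Tendsto B atTop (𝓝 B₀) → ∀ w w',
      Tendsto (fun n => B n w w') atTop (𝓝 (B₀ w w')) := fun hB w w' =>
    (((ContinuousLinearMap.apply ℝ ℂ w').continuous.comp
      (ContinuousLinearMap.apply ℝ (HE d →L[ℝ] ℂ) w).continuous).tendsto _).comp hB
  have hLsymm : ∀ p w w', L p w w' = L p w' w := by
    intro p w w'
    by_cases h : ∃ B, Tendsto (fun n => bilinAt (T (φ n)) p) atTop (𝓝 B)
    · have e1 : L p = h.choose := dif_pos h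
      rw [e1]
      refine tendsto_nhds_unique (happ h.choose_spec w w') ?_
      refine (happ h.choose_spec w' w).congr fun n => ?_
      exact hTs (φ n) p w' w
    · have e1 : L p = 0 := dif_neg h
      rw [e1]
      rfl
  refine ⟨fun p => L p, hLsymm, fun j => ?_⟩
  have hall : ∀ᵐ q ∂(A.mu r j), ∀ n, ∀ k, (f (φ n) j : HE d → PairSpace d) q k = A.repr₂ (T (φ n)) j k q :=
    ae_all_iff.2 fun n => hT (φ n) j
  filter_upwards [hφ j, hall, A.ae_mem_piece r j] with q h1 h2 hq
  have hx : 0 < q.1 := hq.2.2.2.1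
  have hj := A.e_mem j
  have hsc : ∀ a, (scFactor (d := d) q.1 a : ℂ) ≠ 0 := fun a => by
    refine Fin.cases ?_ (fun i => ?_) a <;> simp [scFactor, hx.ne']
  have hk : ∀ k, Tendsto (fun n => A.repr₂ (T (φ n)) j k q) atTop (𝓝 ((f₀ j : HE d → PairSpace d) q k)) := fun k => by
    refine (((EuclideanSpace.proj (𝕜 := ℂ) k).continuous.tendsto _).comp h1).congr fun n => ?_
    exact h2 n k
  have hc : ∀ a b, Tendsto (fun n => pull₂ (A.e j) (T (φ n)) q (coordVec a) (coordVec b)) atTop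
      (𝓝 ((scFactor (d := d) q.1 a * scFactor (d := d) q.1 b : ℂ)⁻¹ * (f₀ j : HE d → PairSpace d) q (a, b))) := by
    intro a b
    refine ((hk (a, b)).const_mul _).congr fun n => ?_
    rw [repr₂, comp₂_eq, inv_mul_cancel_left₀ (mul_ne_zero (hsc a) (hsc b))]
  set p := param (A.e j) q with hp
  -- The derivative of the parametrization is invertible, so convergence of all components in one
  -- chart forces convergence of the bilinear forms at p.
  have hconv : ∃ B, Tendsto (fun n => bilinAt (T (φ n)) p) atTop (𝓝 B) := by
    refine ⟨_, (tendsto_finsetSum Finset.univ fun a _ => tendsto_finsetSum Finset.univ fun b _ =>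
      (hc a b).smul_const (((coordFun a).comp (dcoord (A.e j) p)).smulRight
        (((coordFun b).comp (dcoord (A.e j) p)).smulRight (1 : ℂ)))).congr fun n => ?_⟩
    rw [← bilin_eq_sum]
    refine ContinuousLinearMap.ext fun w => ContinuousLinearMap.ext fun w' => ?_
    change bilinAt (T (φ n)) p (dparam (A.e j) q (dcoord (A.e j) p w)) (dparam (A.e j) q (dcoord (A.e j) p w')) = _
    rw [dparam_dcoord hj hq.1, dparam_dcoord hj hq.1]
  have e1 : L p = hconv.choose := dif_pos hconv
  intro k
  refine tendsto_nhds_unique (hk k) ?_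
  have h3 := happ hconv.choose_spec (dparam (A.e j) q (coordVec k.1)) (dparam (A.e j) q (coordVec k.2))
  rw [← e1] at h3
  exact h3.const_mul (scFactor (d := d) q.1 k.1 * scFactor (d := d) q.1 k.2 : ℂ)

theorem jet_zero (j : Fin A.N) (k : JetIdx d) (q : HE d) : A.jet (fun _ => 0) j k q = 0 := by
  rcases k with a | ⟨b, a⟩
  · simp [jet, scComp₁, comp₁]
  · rw [A.jet_inr (differentiableAt_const (0 : HE d →L[ℝ] ℂ))]
    have e1 : pull (A.e j) (fun _ => 0 : OneForm d Y) = fun _ => 0 := rfl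
    rw [e1]
    simp

theorem jet_add {u u' : OneForm d Y} {j : Fin A.N} {q : HE d} (hd : DifferentiableAt ℝ (pull (A.e j) u) q)
    (hd' : DifferentiableAt ℝ (pull (A.e j) u') q) (k : JetIdx d) :
    A.jet (fun p => u p + u' p) j k q = A.jet u j k q + A.jet u' j k q := by
  have e0 : (pull (A.e j) fun p => u p + u' p) = pull (A.e j) u + pull (A.e j) u' := rfl
  have e1 : fderiv ℝ (pull (A.e j) u + pull (A.e j) u') q = _ := fderiv_add hd hd'
  rcases k with a | ⟨b, a⟩
  · exact mul_add _ _ _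
  · rw [A.jet_inr hd, A.jet_inr hd', A.jet_inr (by rw [e0]; exact hd.add hd'), e0, e1]
    simp only [add_apply, Pi.add_apply]
    ring

theorem jet_smul {u : OneForm d Y} {j : Fin A.N} {q : HE d} (hd : DifferentiableAt ℝ (pull (A.e j) u) q)
    (c : ℂ) (k : JetIdx d) : A.jet (fun p => c • u p) j k q = c * A.jet u j k q := by
  have e0 : (pull (A.e j) fun p => c • u p) = c • pull (A.e j) u := rfl
  have e1 : fderiv ℝ (c • pull (A.e j) u) q = _ := fderiv_const_smul hd c
  rcases k with a | ⟨b, a⟩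
  · exact mul_left_comm _ _ _
  · rw [A.jet_inr hd, A.jet_inr (by rw [e0]; exact hd.const_smul c), e0, e1]
    simp only [smul_apply, Pi.smul_apply, smul_eq_mul]
    ring

/-- The classes of admissible forms with finite norm. -/
def admissible : Submodule ℂ (A.L2 r (JetIdx d)) where
  carrier := {f | ∃ u : OneForm d Y, Admissible R u ∧ A.Represents r f (A.jet u)}
  zero_mem' := by
    refine ⟨fun _ => 0, ⟨fun e _ => ?_, fun _ _ _ => Eventually.of_forall fun _ => rfl⟩, fun j => ?_⟩
    · exact contDiffOn_const (c := (0 : HE d →L[ℝ] ℂ))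
    · filter_upwards [Lp.coeFn_zero (JetSpace d) 2 (A.mu r j)] with q hq k
      have h0 : ((0 : A.L2 r (JetIdx d)) j) = 0 := rfl
      rw [h0, hq, A.jet_zero]
      rfl
  add_mem' := by
    rintro f f' ⟨u, hu, h⟩ ⟨u', hu', h'⟩
    refine ⟨_, hu.add hu', fun j => ?_⟩
    filter_upwards [h j, h' j, Lp.coeFn_add (f j) (f' j), A.ae_mem_piece r j] with q h1 h2 h3 hq k
    have h0 : (f + f') j = f j + f' j := rfl
    rw [h0, h3, Pi.add_apply, PiLp.add_apply, h1 k, h2 k,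
      A.jet_add ((hu.1.contDiffAt (A.e_mem j) hq.1).differentiableAt (by simp))
        ((hu'.1.contDiffAt (A.e_mem j) hq.1).differentiableAt (by simp))]
  smul_mem' := by
    rintro c f ⟨u, hu, h⟩
    refine ⟨_, hu.smul c, fun j => ?_⟩
    filter_upwards [h j, Lp.coeFn_smul c (f j), A.ae_mem_piece r j] with q h1 h3 hq k
    have h0 : (c • f) j = c • f j := rfl
    rw [h0, h3, Pi.smul_apply, PiLp.smul_apply, h1 k,
      A.jet_smul ((hu.1.contDiffAt (A.e_mem j) hq.1).differentiableAt (by simp)), smul_eq_mul]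

/-- Admissible forms already constitute a linear space, so the span in the definition of `HDot1`
produces only jets of single admissible forms, to which the estimate applies. -/
theorem HDot1_le : A.HDot1 r ≤ (A.admissible r).topologicalClosure := by
  refine Submodule.topologicalClosure_mono (Submodule.span_le.2 ?_)
  rintro f ⟨u, hu, hf⟩
  exact ⟨u, hu.admissible, hf⟩

end Cover

/-- Restriction of an operator which is bounded from below on a closed subspace. -/
theorem exists_restrict_leftInverse {V V' : Type*} [NormedAddCommGroup V] [NormedSpace ℂ V] [CompleteSpace V]
    [NormedAddCommGroup V'] [InnerProductSpace ℂ V'] [CompleteSpace V'] (S₀ : V →L[ℂ] V') {D : Submodule ℂ V}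
    {H : Submodule ℂ V'} (hD : IsClosed (D : Set V)) {C : NNReal} (h : ∀ f ∈ D, S₀ f ∈ H ∧ ‖f‖ ≤ C * ‖S₀ f‖) :
    ∃ S : D →L[ℂ] H, (∀ f, (S f : V') = S₀ f) ∧ Function.Injective S ∧
      ∃ P : H →L[ℂ] D, P ∘L S = ContinuousLinearMap.id ℂ D := by
  have : CompleteSpace D := hD.completeSpace_coe
  obtain ⟨hinj, P, hP⟩ := exists_leftInverse (S₀ ∘L D.subtypeL) (C := C) fun f => (h f f.2).2
  refine ⟨(S₀ ∘L D.subtypeL).codRestrict H fun f => (h f f.2).1, fun f => rfl,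
    fun f f' hff => hinj (congrArg Subtype.val hff), P ∘L H.subtypeL, ?_⟩
  exact ContinuousLinearMap.ext fun f => DFunLike.congr_fun hP f

/-- The conjugated symmetric gradient is injective with a bounded left inverse. -/
theorem exists_leftInverse_symGradConj [SigmaCompactSpace Y] (g : MetricOn d R.W)
    (hx : ∀ p ∈ R.bdryInt, 0 < dx R.rho p) :
    ∃ F₀ : ℝ, 0 < F₀ ∧ ∀ F : ℝ, F₀ ≤ F → ∀ r : ℝ,
      ∃ S : A.HDot1 r →L[ℂ] A.H0 r, A.IsSymGradConj r g F S ∧ Function.Injective S ∧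
        ∃ P : A.H0 r →L[ℂ] A.HDot1 r, P ∘L S = ContinuousLinearMap.id ℂ (A.HDot1 r) := by
  obtain ⟨F₀, hF₀, h⟩ := exists_norm_le A g hx
  refine ⟨F₀, hF₀, fun F hF r => ?_⟩
  obtain ⟨C, hC⟩ := h F hF r
  obtain ⟨S₀, hS₀⟩ := A.exists_operator r g F
  -- Both the membership in `H0` and the lower bound are closed conditions on f, so they extend from
  -- admissible forms to their closure.
  have hcl : IsClosed {f : A.L2 r (Cover.JetIdx d) | S₀ f ∈ A.H0 r ∧ ‖f‖ ≤ C * ‖S₀ f‖} :=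
    ((A.isClosed_H0 r).preimage S₀.continuous).inter
      (isClosed_le continuous_norm (continuous_const.mul S₀.continuous.norm))
  have hsub : (A.admissible r : Set (A.L2 r (Cover.JetIdx d))) ⊆ {f | S₀ f ∈ A.H0 r ∧ ‖f‖ ≤ C * ‖S₀ f‖} := by
    rintro f ⟨u, hu, hf⟩
    have h1 := hS₀ u f hu.1 hf
    exact ⟨A.mem_H0_of_represents r hu.1 h1, hC u f _ hu hf h1⟩
  have hall : ∀ f ∈ A.HDot1 r, S₀ f ∈ A.H0 r ∧ ‖f‖ ≤ C * ‖S₀ f‖ := fun f hf =>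
    closure_minimal hsub hcl (A.HDot1_le r hf)
  have hD : IsClosed (A.HDot1 r : Set (A.L2 r (Cover.JetIdx d))) := Submodule.isClosed_topologicalClosure _
  obtain ⟨S, hS, hinv⟩ := exists_restrict_leftInverse S₀ (D := A.HDot1 r) (H := A.H0 r) hD hall
  refine ⟨S, fun u f hu hf => ?_, hinv⟩
  rw [hS]
  exact hS₀ u f hu.admissible.1 hf

end

/-! ### Independence of the defining function -/

section

variable {d : ℕ} {Y : Type*} [TopologicalSpace Y] [ChartedSpace (E d) Y] [IsManifold (𝓡 d) ∞ Y]
  {e : OpenPartialHomeomorph Y (E d)}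

theorem fderiv_comp_param_ne_zero {W : Set (ℝ × Y)} {f : ℝ × Y → ℝ} (he : e ∈ IsManifold.maximalAtlas (𝓡 d) ∞ Y)
    (hW : IsOpen W) (hf : ContMDiffOn (IZ d) 𝓘(ℝ, ℝ) ∞ f W) {p : ℝ × Y} (hs : p.2 ∈ e.source) (hp : p ∈ W)
    (h : mfderiv (IZ d) 𝓘(ℝ, ℝ) f p ≠ 0) : fderiv ℝ (f ∘ param e) (coord e p) ≠ 0 := by
  intro h0
  have hfd : MDifferentiableAt (IZ d) 𝓘(ℝ, ℝ) f (param e (coord e p)) := by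
    rw [param_coord hs]
    exact (hf.contMDiffAt (hW.mem_nhds hp)).mdifferentiableAt (by simp)
  have hc : mfderiv 𝓘(ℝ, HE d) 𝓘(ℝ, ℝ) (f ∘ param e) (coord e p) = _ :=
    mfderiv_comp (coord e p) hfd (mdifferentiableAt_param he (coord_mem_dom hs))
  rw [mfderiv_eq_fderiv, h0, param_coord hs] at hc
  refine h (ContinuousLinearMap.ext fun v => ?_)
  have h1 := mfderiv_param_mfderiv_coord he hs v
  have h2 := DFunLike.congr_fun hc (mfderiv (IZ d) 𝓘(ℝ, HE d) (coord e) p v)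
  have h3 : mfderiv (IZ d) 𝓘(ℝ, ℝ) f p (mfderiv 𝓘(ℝ, HE d) (IZ d) (param e) (coord e p)
      (mfderiv (IZ d) 𝓘(ℝ, HE d) (coord e) p v)) = (0 : ℝ) := h2.symm
  rw [h1] at h3
  exact h3

theorem tendsto_slope_line {φ : HE d → ℝ} {q : HE d} (hφ : DifferentiableAt ℝ φ q) (h0 : φ q = 0) (v : HE d) :
    Tendsto (fun t : ℝ => t⁻¹ * φ (q + t • v)) (𝓝[>] 0) (𝓝 (fderiv ℝ φ q v)) := by
  have h1 : HasDerivAt (fun t : ℝ => q + t • v) v 0 := by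
    simpa using ((hasDerivAt_id (0 : ℝ)).smul_const v).const_add q
  have h2 : HasFDerivAt φ (fderiv ℝ φ q) (q + (0 : ℝ) • v) := by simpa using hφ.hasFDerivAt
  have h3 := (h2.comp_hasDerivAt (0 : ℝ) h1).tendsto_slope_zero_right
  simpa [h0] using h3

/-- A function which is nonnegative on `{x ≥ 0, ρ > 0}` and has a nonvanishing differential at a boundary point
increases in all directions in the interior of the tangent cone. -/
theorem fderiv_pos_of_nonneg {ρ φ : HE d → ℝ} {q v : HE d} (hρ : DifferentiableAt ℝ ρ q) (hφ : DifferentiableAt ℝ φ q)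
    (hρ0 : ρ q = 0) (hφ0 : φ q = 0) (hx : 0 ≤ q.1) (hv : 0 < v.1) (hρv : 0 < fderiv ℝ ρ q v)
    (hne : fderiv ℝ φ q ≠ 0) (h : ∀ᶠ q' in 𝓝 q, 0 ≤ q'.1 → 0 < ρ q' → 0 ≤ φ q') : 0 < fderiv ℝ φ q v := by
  have key : ∀ w : HE d, 0 < w.1 → 0 < fderiv ℝ ρ q w → 0 ≤ fderiv ℝ φ q w := by
    intro w hw1 hw2
    have hc : Tendsto (fun t : ℝ => q + t • w) (𝓝[>] 0) (𝓝 q) := by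
      have : Continuous fun t : ℝ => q + t • w := by fun_prop
      simpa using (this.tendsto 0).mono_left nhdsWithin_le_nhds
    refine ge_of_tendsto (tendsto_slope_line hφ hφ0 w) ?_
    filter_upwards [hc.eventually h, (tendsto_slope_line hρ hρ0 w).eventually (lt_mem_nhds hw2),
      self_mem_nhdsWithin] with t h1 h2 ht
    have ht0 : (0 : ℝ) < t := ht
    refine mul_nonneg (inv_pos.2 ht0).le (h1 ?_ ?_)
    · change 0 ≤ q.1 + t * w.1
      positivity
    · exact pos_of_mul_pos_right h2 (inv_pos.2 ht0).le
  -- If the derivative along v vanished, then v + s w would still lie in the open cone for small s >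
  -- 0, forcing a nonnegative derivative along every w, hence a zero differential.
  refine (key v hv hρv).lt_of_ne fun h0 => hne ?_
  have hall : ∀ w : HE d, 0 ≤ fderiv ℝ φ q w := by
    intro w
    have c1 : Continuous fun s : ℝ => (v + s • w : HE d) := by fun_prop
    have e1 : ∀ᶠ s : ℝ in 𝓝[>] 0, 0 < (v + s • w).1 := nhdsWithin_le_nhds
      ((continuous_fst.comp c1).continuousAt.eventually (lt_mem_nhds (by simpa using hv)))
    have e2 : ∀ᶠ s : ℝ in 𝓝[>] 0, 0 < fderiv ℝ ρ q (v + s • w) := nhdsWithin_le_nhds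
      (((fderiv ℝ ρ q).continuous.comp c1).continuousAt.eventually (lt_mem_nhds (by simpa using hρv)))
    obtain ⟨s, ⟨h1, h2⟩, hs⟩ := ((e1.and e2).and self_mem_nhdsWithin).exists
    have hs0 : (0 : ℝ) < s := hs
    have h3 := key _ h1 h2
    rw [map_add, map_smul, ← h0, zero_add, smul_eq_mul] at h3
    exact nonneg_of_mul_nonneg_right h3 hs0
  refine ContinuousLinearMap.ext fun w : HE d => le_antisymm ?_ (hall w)
  have := hall (-w)
  rw [map_neg] at this
  exact neg_nonneg.1 this

/-- The vector ∂_x lies in the open cone dx > 0, dρ > 0 precisely because ∂_xρ > 0. The argument is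
uniform in p: at corners the condition x ≥ 0 enters through dx > 0. -/
theorem Region.dx_pos_of_isDefiningFunction {R : Region d Y} (hx : ∀ p ∈ R.bdryInt, 0 < dx R.rho p)
    {f : ℝ × Y → ℝ} (hf : R.IsDefiningFunction f) {p : ℝ × Y} (hp : p ∈ R.bdryInt) : 0 < dx f p := by
  obtain ⟨hfs, hf0, hfpos⟩ := hf
  have hs : p.2 ∈ (chartAt (E d) p.2).source := mem_chart_source _ _
  have hm : chartAt (E d) p.2 ∈ IsManifold.maximalAtlas (𝓡 d) ∞ Y := IsManifold.chart_mem_maximalAtlas _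
  generalize chartAt (E d) p.2 = e at hs hm
  have hpp : param e (coord e p) = p := param_coord hs
  have hd : coord e p ∈ dom e := coord_mem_dom hs
  have hpW : param e (coord e p) ∈ R.W := by rw [hpp]; exact hp.1.1
  have hxp := hx p hp
  have hne := fderiv_comp_param_ne_zero hm R.isOpen_W hfs hs hp.1.1 (hf0 p hp).2
  have e1 := dx_param hm R.isOpen_W R.smooth_rho hd hpW
  have e2 := dx_param hm R.isOpen_W hfs hd hpW
  rw [hpp] at e1 e2
  rw [e1] at hxp
  rw [e2]
  refine fderiv_pos_of_nonneg (ρ := R.rho ∘ param e) (differentiableAt_comp_param hm R.isOpen_W R.smooth_rho hd hpW)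
    (differentiableAt_comp_param hm R.isOpen_W hfs hd hpW) ?_ ?_ hp.1.2.1 zero_lt_one hxp hne ?_
  · rw [Function.comp_apply, hpp]; exact hp.2
  · rw [Function.comp_apply, hpp]; exact (hf0 p hp).1
  -- Disjointness of the internal boundaries keeps ρ₁ positive near p, so every nearby point with x
  -- ≥ 0 and ρ > 0 belongs to `R.K`, where f is nonnegative.
  have hρ₁ : 0 < R.rho₁ p := hp.1.2.2.2.lt_of_ne fun h => R.disjoint p hp.1 ⟨hp.2, h.symm⟩
  have hO : IsOpen (R.W ∩ R.rho₁ ⁻¹' Ioi 0) :=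
    R.smooth_rho₁.continuousOn.isOpen_inter_preimage R.isOpen_W isOpen_Ioi
  have hpO : param e (coord e p) ∈ R.W ∩ R.rho₁ ⁻¹' Ioi 0 := by
    rw [hpp]
    exact ⟨hp.1.1, hρ₁⟩
  filter_upwards [(isOpen_dom_inter hm hO).mem_nhds ⟨hd, hpO⟩] with q hq hq1 hq2
  have hK : param e q ∈ R.K := ⟨hq.2.1, hq1, hq2.le, (show 0 < R.rho₁ (param e q) from hq.2.2).le⟩
  exact (hfpos _ hK fun h => hq2.ne h.2.symm).le

end

end ScGrad

end

theorem lemmaA2 {d : ℕ} {Y : Type*} [TopologicalSpace Y] [T2Space Y] [SigmaCompactSpace Y]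
    [ChartedSpace (ScGrad.E d) Y] [IsManifold (𝓡 d) ∞ Y]
    (R : ScGrad.Region d Y) (g : ScGrad.MetricOn d R.W) (A : ScGrad.Cover R)
    (hx : ∀ p ∈ R.bdryInt, 0 < ScGrad.dx R.rho p) :
    (∀ f : ℝ × Y → ℝ, R.IsDefiningFunction f → ∀ p ∈ R.bdryInt, 0 < ScGrad.dx f p) ∧
    ∃ F₀ : ℝ, 0 < F₀ ∧ ∀ F : ℝ, F₀ ≤ F → ∀ r : ℝ,
      ∃ S : A.HDot1 r →L[ℂ] A.H0 r, A.IsSymGradConj r g F S ∧ Function.Injective S ∧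
        ∃ P : A.H0 r →L[ℂ] A.HDot1 r, P ∘L S = ContinuousLinearMap.id ℂ (A.HDot1 r) := by
  obtain ⟨F₀, hF₀, h⟩ := ScGrad.exists_leftInverse_symGradConj A g hx
  exact ⟨fun f hf p hp => ScGrad.Region.dx_pos_of_isDefiningFunction hx hf hp, F₀, hF₀, h⟩
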